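/- **Theorem (L² error estimate).** Let $d\ge 2$, $k\ge 1$, $J\ge 1$ be integers, let $\rho>0$ and $C_{reg}$ be real numbers. There is a constant $C>0$, depending only on $d,k,J,\rho,C_{reg}$, such that the following holds. *Mesh.* Let $\Omega\subset\mathbb R^d$ be open and let $\mathcal T_h$ be a face-to-face partition of $\overline\Omega$ into finitely many convex polytopes with pairwise disjoint interiors contained in $\Omega$: each facet $e$ of an element either lies in $\partial\Omega$, or has its relative interior in $\Omega$ and is also a facet of another element. Write $h_T,h_e$ for the diameters of an element $T$ and a face $e$, $|T|,|e|$ for their $d$- and $(d-1)$-dimensional measures, ${\bf n}_e$ for the outward unit normal of $T$ on $e$, $n_T$ for the number of faces of $T$, and $h=\max_T h_T$. Assume shape regularity: for every $T$ and every face $e$ of $T$, $|T|\ge\rho h_T^d$, $|e|\ge\rho h_e^{d-1}$, $h_e\ge\rho h_T$, and ${\bf n}_e\cdot{\bf n}_{e'}\le 1-\rho$ for any two distinct faces $e,e'$ of $T$. *Method.* Let $V_h$ be the space of pairs $v=\{v_0,v_b\}$ with $v_0|_T\in P_k(T)$ for each element $T$ and $v_b|_e\in P_k(e)$, single-valued,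 for each face $e$, and $V_h^0=\{v\in V_h: v_b=0\text{ on }\partial\Omega\}$. Let integers $j_T$ with $n_T+k-1\le j_T\le J$ be given (for instance $j_T=n_T+k-1$). For $v\in V_h$ the weak gradient $\nabla_w v|_T\in[P_{j_T}(T)]^d$ is the unique polynomial with $$(\nabla_w v,{\bf q})_T=-(v_0,\nabla\cdot{\bf q})_T+\langle v_b,{\bf q}\cdot{\bf n}\rangle_{\partial T}\qquad\forall\,{\bf q}\in[P_{j_T}(T)]^d .$$ Let $f\in L^2(\Omega)$, let $u\in H_0^1(\Omega)$ be the weak solution of $-\Delta u=f$, i.e. $(\nabla u,\nabla v)=(f,v)$ for all $v\in H_0^1(\Omega)$, and let $u_h=\{u_0,u_b\}\in V_h^0$ be a weak Galerkin solution: $$\sum_{T}(\nabla_w u_h,\nabla_w v)_T=(f,v_0)\qquad\forall\, v=\{v_0,v_b\}\in V_h^0 .$$ *Claim.* Assume $u\in H^{k+1}(\Omega)$. Let $Q_0u$ be the element-wise $L^2$ projection of $u$ onto $P_k(T)$ and $\epsilon_0=Q_0u-u_0$. Assume $H^2$-regularity of the dual problem: the weak solution $\Phi\in H_0^1(\Omega)$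 of $-\Delta\Phi=\epsilon_0$ lies in $H^2(\Omega)$ and satisfies $\|\Phi\|_2\le C_{reg}\|\epsilon_0\|$. Then $$\|u-u_0\|\le C\,h^{k+1}\,|u|_{k+1},$$ where $\|\cdot\|$ is the $L^2(\Omega)$ norm, and $\|\cdot\|_m$ and $|\cdot|_m$ are the norm and the seminorm (all derivatives of order exactly $m$) of $H^m(\Omega)$. -/

import Mathlib

open MeasureTheory Filter Topology
open scoped ContDiff

noncomputable section

namespace WG

/-- Euclidean space `ℝ^d`. -/
abbrev Pt (d : ℕ) : Type := EuclideanSpace ℝ (Fin d)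

/-! ### Lebesgue and Sobolev spaces -/

/-- The `L²(S)` norm of a function. -/
def l2Norm {d : ℕ} (S : Set (Pt d)) (u : Pt d → ℝ) : ℝ :=
  Real.sqrt (∫ x in S, u x ^ 2)

/-- Test functions: smooth functions with compact support contained in `Ω`. -/
def IsTestFunction {d : ℕ} (Ω : Set (Pt d)) (φ : Pt d → ℝ) : Prop :=
  ContDiff ℝ ∞ φ ∧ HasCompactSupport φ ∧ tsupport φ ⊆ Ω

/-- The classical partial derivative `∂_{I 0} ∂_{I 1} ⋯ ∂_{I (m-1)} φ`. -/
def partialDeriv {d m : ℕ} (I : Fin m → Fin d) (φ : Pt d → ℝ) (x : Pt d) : ℝ :=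
  iteratedFDeriv ℝ m φ x (fun t => EuclideanSpace.single (I t) (1 : ℝ))

/-- `g ∈ L²(Ω)` is the weak partial derivative `∂_{I 0} ⋯ ∂_{I (m-1)} u` of `u` in `Ω`. -/
def HasWeakDeriv {d m : ℕ} (Ω : Set (Pt d)) (I : Fin m → Fin d) (u g : Pt d → ℝ) : Prop :=
  MemLp g 2 (volume.restrict Ω) ∧
    ∀ φ : Pt d → ℝ, IsTestFunction Ω φ →
      ∫ x in Ω, u x * partialDeriv I φ x = (-1) ^ m * ∫ x in Ω, g x * φ x

open Classical in
/-- The weak partial derivative (unique up to null sets); `0` if there is none in `L²(Ω)`. -/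
def weakDeriv {d m : ℕ} (Ω : Set (Pt d)) (I : Fin m → Fin d) (u : Pt d → ℝ) : Pt d → ℝ :=
  if h : ∃ g, HasWeakDeriv Ω I u g then h.choose else 0

/-- `u ∈ H^m(Ω)`: `u` and all its weak partial derivatives up to order `m` lie in `L²(Ω)`. -/
def MemSobolev {d : ℕ} (Ω : Set (Pt d)) (m : ℕ) (u : Pt d → ℝ) : Prop :=
  MemLp u 2 (volume.restrict Ω) ∧
    ∀ l : ℕ, l ≤ m → ∀ I : Fin l → Fin d, ∃ g, HasWeakDeriv Ω I u g

/-- The seminorm `|u|_m`, the `L²(Ω)` norm of the tensor of all partial derivatives of order `m`. -/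
def sobolevSeminorm {d : ℕ} (Ω : Set (Pt d)) (m : ℕ) (u : Pt d → ℝ) : ℝ :=
  Real.sqrt (∑ I : Fin m → Fin d, l2Norm Ω (weakDeriv Ω I u) ^ 2)

/-- The norm `‖u‖_m` of `H^m(Ω)`. -/
def sobolevNorm {d : ℕ} (Ω : Set (Pt d)) (m : ℕ) (u : Pt d → ℝ) : ℝ :=
  Real.sqrt (∑ l ∈ Finset.range (m + 1), sobolevSeminorm Ω l u ^ 2)

/-- `u ∈ H_0^1(Ω)`, the closure of the test functions in `H^1(Ω)`. -/
def MemH10 {d : ℕ} (Ω : Set (Pt d)) (u : Pt d → ℝ) : Prop :=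
  MemSobolev Ω 1 u ∧
    ∃ φ : ℕ → Pt d → ℝ, (∀ n, IsTestFunction Ω (φ n)) ∧
      Tendsto (fun n => sobolevNorm Ω 1 (fun x => u x - φ n x)) atTop (𝓝 0)

/-- `u ∈ H_0^1(Ω)` is the weak solution of `-Δu = f` in `Ω`, `u = 0` on `∂Ω`:
`(∇u, ∇v) = (f, v)` for all `v ∈ H_0^1(Ω)`. -/
def IsPoissonSolution {d : ℕ} (Ω : Set (Pt d)) (f u : Pt d → ℝ) : Prop :=
  MemH10 Ω u ∧ ∀ v : Pt d → ℝ, MemH10 Ω v →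
    ∑ i : Fin d, ∫ x in Ω, weakDeriv Ω ![i] u x * weakDeriv Ω ![i] v x = ∫ x in Ω, f x * v x

/-- `H²`-regularity, with constant `C`, of the Dirichlet problem `-ΔΦ = g`, `Φ ∈ H_0^1(Ω)`. -/
def H2Regularity {d : ℕ} (Ω : Set (Pt d)) (g : Pt d → ℝ) (C : ℝ) : Prop :=
  ∀ Φ : Pt d → ℝ, IsPoissonSolution Ω g Φ →
    MemSobolev Ω 2 Φ ∧ sobolevNorm Ω 2 Φ ≤ C * l2Norm Ω g

/-! ### Polynomials -/

/-- Real polynomials in `d` variables. -/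
abbrev Poly (d : ℕ) : Type := MvPolynomial (Fin d) ℝ

/-- The value of a polynomial at a point. -/
def peval {d : ℕ} (p : Poly d) (x : Pt d) : ℝ := MvPolynomial.eval (fun i => x i) p

/-- Polynomials of total degree at most `k`. -/
abbrev PolyDeg (d k : ℕ) : Submodule ℝ (Poly d) := MvPolynomial.restrictTotalDegree (Fin d) ℝ k

/-! ### Polytopes and meshes -/

/-- A convex polytope with non-empty interior, given by the outward unit normals of its facets:
`{x | ⟪ν, x⟫ ≤ offset ν for all normals ν}`. No inequality is redundant, so the normals are in
bijection with the facets. -/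
structure ConvexPolytope (d : ℕ) where
  normals : Finset (Pt d)
  offset : Pt d → ℝ
  norm_normal : ∀ ν ∈ normals, ‖ν‖ = 1
  bounded : Bornology.IsBounded {x : Pt d | ∀ ν ∈ normals, inner ℝ ν x ≤ offset ν}
  exists_interior : ∃ x : Pt d, ∀ ν ∈ normals, inner ℝ ν x < offset ν
  irredundant : ∀ ν ∈ normals, ∃ x : Pt d, inner ℝ ν x = offset ν ∧
    ∀ μ ∈ normals, μ ≠ ν → inner ℝ μ x < offset μ

namespace ConvexPolytope

variable {d : ℕ}

/-- The (closed) polytope as a set. -/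
def carrier (T : ConvexPolytope d) : Set (Pt d) :=
  {x | ∀ ν ∈ T.normals, inner ℝ ν x ≤ T.offset ν}

/-- The (closed) facet with outward normal `ν`. -/
def facet (T : ConvexPolytope d) (ν : Pt d) : Set (Pt d) :=
  {x | x ∈ T.carrier ∧ inner ℝ ν x = T.offset ν}

/-- The relative interior of the facet with outward normal `ν`. -/
def openFacet (T : ConvexPolytope d) (ν : Pt d) : Set (Pt d) :=
  {x | inner ℝ ν x = T.offset ν ∧ ∀ μ ∈ T.normals, μ ≠ ν → inner ℝ μ x < T.offset μ}

/-- The diameter `h_T`. -/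
def diam (T : ConvexPolytope d) : ℝ := Metric.diam T.carrier

/-- The number of facets (edges or flat faces) of `T`. -/
def numFacets (T : ConvexPolytope d) : ℕ := T.normals.card

/-- `p ∈ P_k(T)` is the `L²(T)` projection of `u`. -/
def IsProj (T : ConvexPolytope d) (k : ℕ) (u : Pt d → ℝ) (p : Poly d) : Prop :=
  p ∈ PolyDeg d k ∧ ∀ q ∈ PolyDeg d k,
    ∫ x in T.carrier, peval p x * peval q x = ∫ x in T.carrier, u x * peval q x

/-- `G ∈ [P_j(T)]^d` is the weak gradient of `{v₀, v_b}` on `T`: for all `q ∈ [P_j(T)]^d`,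
`(G, q)_T = -(v₀, ∇·q)_T + ⟨v_b, q·n⟩_{∂T}`. Here `v_b` assigns to each facet a polynomial, and
`μHE[d - 1]` is the surface measure. -/
def IsWeakGradient (T : ConvexPolytope d) (j : ℕ) (v₀ : Poly d) (vb : Set (Pt d) → Poly d)
    (G : Fin d → Poly d) : Prop :=
  (∀ i, G i ∈ PolyDeg d j) ∧ ∀ q : Fin d → Poly d, (∀ i, q i ∈ PolyDeg d j) →
    ∫ x in T.carrier, ∑ i, peval (G i) x * peval (q i) x =
      -(∫ x in T.carrier, peval v₀ x * peval (∑ i, MvPolynomial.pderiv i (q i)) x) +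
        ∑ ν ∈ T.normals, ∫ x in T.facet ν,
          peval (vb (T.facet ν)) x * ∑ i, peval (q i) x * ν i ∂μHE[d - 1]

/-- The `L²(T)` projection of `u ∈ L²(T)` onto `P_k(T)`. -/
def proj (T : ConvexPolytope d) (k : ℕ) (u : Pt d → ℝ) : Poly d :=
  Classical.epsilon (T.IsProj k u)

/-- The weak gradient of `{v₀, v_b}` on `T` in `[P_j(T)]^d`. -/
def weakGradient (T : ConvexPolytope d) (j : ℕ) (v₀ : Poly d) (vb : Set (Pt d) → Poly d) :
    Fin d → Poly d :=
  Classical.epsilon (T.IsWeakGradient j v₀ vb)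

end ConvexPolytope

/-- A conforming (face-to-face) partition of `Ω` into finitely many convex polytopes: every facet
of an element lies in `∂Ω`, or is interior to `Ω` and is also a facet of another element. -/
structure PolytopalMesh {d : ℕ} (Ω : Set (Pt d)) where
  numElem : ℕ
  elem : Fin numElem → ConvexPolytope d
  iUnion_carrier : ⋃ T, (elem T).carrier = closure Ω
  interior_subset : ∀ T, interior (elem T).carrier ⊆ Ω
  disjoint_interior : ∀ T T', T ≠ T' →
    Disjoint (interior (elem T).carrier) (interior (elem T').carrier)
  conforming : ∀ T, ∀ ν ∈ (elem T).normals,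
    (elem T).facet ν ⊆ frontier Ω ∨
      ((elem T).openFacet ν ⊆ Ω ∧
        ∃ T', T' ≠ T ∧ ∃ ν' ∈ (elem T').normals, (elem T').facet ν' = (elem T).facet ν)

/-- A weak function `{v₀, v_b}` with polynomial components: `v₀` gives a polynomial on each
element, `v_b` a polynomial on each edge/face (only its values on the face matter, and they are
shared by the adjacent elements). -/
structure WeakFun (d N : ℕ) where
  v0 : Fin N → Poly d
  vb : Set (Pt d) → Poly d

namespace PolytopalMesh

variable {d : ℕ} {Ω : Set (Pt d)}

/-- The mesh size `h = max_T h_T`. -/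
def meshSize (M : PolytopalMesh Ω) : ℝ := ⨆ T, (M.elem T).diam

/-- Shape regularity with parameter `ρ`: for each element `T` and each face `e` of `T`,
`|T| ≥ ρ h_T^d`, `|e| ≥ ρ h_e^{d-1}`, `h_e ≥ ρ h_T`, and no two distinct faces of an element are
nearly coplanar. -/
structure ShapeRegular (M : PolytopalMesh Ω) (ρ : ℝ) : Prop where
  volume_ge : ∀ T, ρ * (M.elem T).diam ^ d ≤ (volume (M.elem T).carrier).toReal
  area_ge : ∀ T, ∀ ν ∈ (M.elem T).normals,
    ρ * Metric.diam ((M.elem T).facet ν) ^ (d - 1) ≤ (μHE[d - 1] ((M.elem T).facet ν)).toReal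
  diam_ge : ∀ T, ∀ ν ∈ (M.elem T).normals,
    ρ * (M.elem T).diam ≤ Metric.diam ((M.elem T).facet ν)
  inner_le : ∀ T, ∀ ν ∈ (M.elem T).normals, ∀ μ ∈ (M.elem T).normals, ν ≠ μ →
    inner ℝ ν μ ≤ 1 - ρ

/-- The space `V_h`: `v₀ ∈ P_k(T)` on every element, `v_b ∈ P_k(e)` on every face. -/
def MemV (M : PolytopalMesh Ω) (k : ℕ) (v : WeakFun d M.numElem) : Prop :=
  (∀ T, v.v0 T ∈ PolyDeg d k) ∧
    ∀ T, ∀ ν ∈ (M.elem T).normals, v.vb ((M.elem T).facet ν) ∈ PolyDeg d k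

/-- The subspace `V_h^0` of the `v ∈ V_h` with `v_b = 0` on `∂Ω`. -/
def MemV0 (M : PolytopalMesh Ω) (k : ℕ) (v : WeakFun d M.numElem) : Prop :=
  M.MemV k v ∧ ∀ T, ∀ ν ∈ (M.elem T).normals, (M.elem T).facet ν ⊆ frontier Ω →
    ∀ x ∈ (M.elem T).facet ν, peval (v.vb ((M.elem T).facet ν)) x = 0

/-- The weak gradient `∇_w v` on the element `T`, of degree `j T`. -/
def weakGradient (M : PolytopalMesh Ω) (j : Fin M.numElem → ℕ) (v : WeakFun d M.numElem)
    (T : Fin M.numElem) : Fin d → Poly d :=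
  (M.elem T).weakGradient (j T) (v.v0 T) v.vb

/-- `u_h ∈ V_h^0` solves the weak Galerkin scheme
`(∇_w u_h, ∇_w v)_{𝒯_h} = (f, v₀)` for all `v ∈ V_h^0`. -/
def IsWGSolution (M : PolytopalMesh Ω) (k : ℕ) (j : Fin M.numElem → ℕ) (f : Pt d → ℝ)
    (uh : WeakFun d M.numElem) : Prop :=
  M.MemV0 k uh ∧ ∀ v : WeakFun d M.numElem, M.MemV0 k v →
    ∑ T, ∫ x in (M.elem T).carrier,
        ∑ i, peval (M.weakGradient j uh T i) x * peval (M.weakGradient j v T i) x =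
      ∑ T, ∫ x in (M.elem T).carrier, f x * peval (v.v0 T) x

/-- The piecewise polynomial function on `Ω` equal to `p T` in the interior of `T`. -/
def piecewise (M : PolytopalMesh Ω) (p : Fin M.numElem → Poly d) (x : Pt d) : ℝ :=
  ∑ T, (interior (M.elem T).carrier).indicator (peval (p T)) x

/-- The element-wise `L²` projection `Q₀ u` onto polynomials of degree at most `k`. -/
def Q0 (M : PolytopalMesh Ω) (k : ℕ) (u : Pt d → ℝ) (T : Fin M.numElem) : Poly d :=
  (M.elem T).proj k u

end PolytopalMesh

/-! ### Well-definedness of the projection and of the weak gradient -/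

variable {d : ℕ}

theorem peval_continuous (p : Poly d) : Continuous (peval p) := by
  unfold peval
  have : Continuous fun x : Pt d => (fun i => x i) := by fun_prop
  exact (MvPolynomial.continuous_eval p).comp this

theorem ConvexPolytope.isCompact_carrier (T : ConvexPolytope d) : IsCompact T.carrier := by
  refine Metric.isCompact_of_isClosed_isBounded ?_ T.bounded
  have : T.carrier = ⋂ ν ∈ T.normals, {x | inner ℝ ν x ≤ T.offset ν} := by
    ext x; simp [ConvexPolytope.carrier]
  rw [this]
  exact isClosed_biInter fun ν _ => isClosed_le (by fun_prop) continuous_const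

theorem ConvexPolytope.isCompact_facet (T : ConvexPolytope d) (ν : Pt d) :
    IsCompact (T.facet ν) := by
  have : T.facet ν = T.carrier ∩ {x | inner ℝ ν x = T.offset ν} := rfl
  rw [this]
  exact T.isCompact_carrier.inter_right (isClosed_eq (by fun_prop) continuous_const)

theorem ConvexPolytope.facet_lt_top (T : ConvexPolytope d) {ν : Pt d} (hν : ν ∈ T.normals) :
    μHE[d - 1] (T.facet ν) < ⊤ := by
  have h1 := T.norm_normal ν hν
  have hne : ν ≠ 0 := by rintro rfl; simp at h1
  obtain ⟨m, rfl⟩ : ∃ m, d = m + 1 := by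
    rcases d with _ | m
    · exact absurd (Subsingleton.elim ν 0) hne
    · exact ⟨m, rfl⟩
  have : Fact (Module.finrank ℝ (Pt (m + 1)) = m + 1) := ⟨by simp⟩
  let b := OrthonormalBasis.fromOrthogonalSpanSingleton (𝕜 := ℝ) m hne
  let f : Pt m → Pt (m + 1) := fun y => T.offset ν • ν + (b.repr.symm y : Pt (m + 1))
  have hf : Isometry f := by
    have : Isometry fun y : Pt m => (b.repr.symm y : Pt (m + 1)) :=
      isometry_subtype_coe.comp b.repr.symm.isometry
    exact (IsometryEquiv.addLeft (T.offset ν • ν)).isometry.comp this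
  have hsub : T.facet ν ⊆ Set.range f := by
    intro x hx
    have hx2 : inner ℝ ν x = T.offset ν := hx.2
    have hm : x - T.offset ν • ν ∈ (ℝ ∙ ν)ᗮ := by
      rw [Submodule.mem_orthogonal_singleton_iff_inner_right, inner_sub_right, inner_smul_right,
        real_inner_self_eq_norm_sq, h1, hx2]; simp
    exact ⟨b.repr ⟨_, hm⟩, by simp [f]⟩
  have himg : f '' (f ⁻¹' T.facet ν) = T.facet ν := Set.image_preimage_eq_of_subset hsub
  rw [← himg, Nat.add_sub_cancel, hf.euclideanHausdorffMeasure_image,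
    EuclideanSpace.euclideanHausdorffMeasure_eq_volume]
  exact (hf.isClosedEmbedding.isCompact_preimage (T.isCompact_facet ν)).measure_lt_top

theorem ConvexPolytope.interior_nonempty (T : ConvexPolytope d) :
    (interior T.carrier).Nonempty := by
  obtain ⟨x, hx⟩ := T.exists_interior
  refine ⟨x, mem_interior.2 ⟨⋂ ν ∈ T.normals, {x | inner ℝ ν x < T.offset ν}, ?_, ?_, ?_⟩⟩
  · intro y hy ν hν
    simp only [Set.mem_iInter] at hy
    exact (hy ν hν).le
  · exact isOpen_biInter_finset fun ν _ => isOpen_lt (by fun_prop) continuous_const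
  · simpa using hx

theorem ConvexPolytope.eq_zero_of_integral (T : ConvexPolytope d) (p : Poly d)
    (h : ∫ x in T.carrier, peval p x * peval p x = 0) : p = 0 := by
  have hc : Continuous fun x : Pt d => peval p x * peval p x :=
    (peval_continuous p).mul (peval_continuous p)
  have h0 : ∀ x ∈ interior T.carrier, peval p x = 0 := by
    have hi : IntegrableOn (fun x : Pt d => peval p x * peval p x) T.carrier :=
      hc.continuousOn.integrableOn_compact T.isCompact_carrier
    have h2 : ∫ x in interior T.carrier, peval p x * peval p x = 0 := by
      apply le_antisymm
      · rw [← h]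
        exact setIntegral_mono_set hi (ae_of_all _ fun x => mul_self_nonneg _)
          (LE.le.eventuallyLE interior_subset)
      · exact integral_nonneg fun x => mul_self_nonneg _
    rw [setIntegral_eq_zero_iff_of_nonneg_ae (ae_of_all _ fun x => mul_self_nonneg _)
      (hi.mono_set interior_subset)] at h2
    have h3 := Measure.eqOn_open_of_ae_eq (μ := volume) h2 isOpen_interior hc.continuousOn
      continuousOn_const
    intro x hx
    simpa using h3 hx
  obtain ⟨x, hx⟩ := T.interior_nonempty
  have hopen : IsOpen ((fun y : Fin d → ℝ => (WithLp.toLp 2 y : Pt d)) ⁻¹' interior T.carrier) :=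
    isOpen_interior.preimage (PiLp.continuous_toLp 2 _)
  obtain ⟨ε, hε, hb⟩ := Metric.isOpen_iff.1 hopen (fun i => x i) (by simpa using hx)
  refine MvPolynomial.funext_set (fun i => Metric.ball (x i) ε) (fun i => ?_) fun y hy => ?_
  · rw [Real.ball_eq_Ioo]; exact Set.Ioo_infinite (by linarith)
  · have : y ∈ Metric.ball (fun i => x i) ε := by
      rw [ball_pi _ hε]; exact hy
    simpa [peval] using h0 _ (hb this)

theorem peval_integrableOn (T : ConvexPolytope d) (p q : Poly d) :
    IntegrableOn (fun x => peval p x * peval q x) T.carrier :=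
  ((peval_continuous p).mul (peval_continuous q)).continuousOn.integrableOn_compact
    T.isCompact_carrier

theorem peval_add (p q : Poly d) (x : Pt d) : peval (p + q) x = peval p x + peval q x := by
  simp [peval]

theorem peval_sub (p q : Poly d) (x : Pt d) : peval (p - q) x = peval p x - peval q x := by
  simp [peval]

theorem peval_smul (c : ℝ) (p : Poly d) (x : Pt d) : peval (c • p) x = c * peval p x := by
  simp [peval, MvPolynomial.smul_eval]

theorem ConvexPolytope.exists_rep (T : ConvexPolytope d) (j : ℕ) (L : Poly d →ₗ[ℝ] ℝ) :
    ∃ p ∈ PolyDeg d j, ∀ q ∈ PolyDeg d j,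
      ∫ x in T.carrier, peval p x * peval q x = L q := by
  let B : PolyDeg d j →ₗ[ℝ] PolyDeg d j →ₗ[ℝ] ℝ := LinearMap.mk₂ ℝ
    (fun p q => ∫ x in T.carrier, peval p.1 x * peval q.1 x)
    (fun p p' q => by
      simp only [Submodule.coe_add, peval_add, add_mul]
      exact integral_add (peval_integrableOn T _ _) (peval_integrableOn T _ _))
    (fun c p q => by
      simp only [Submodule.coe_smul, peval_smul, mul_assoc, integral_const_mul, smul_eq_mul])
    (fun p q q' => by
      simp only [Submodule.coe_add, peval_add, mul_add]
      exact integral_add (peval_integrableOn T _ _) (peval_integrableOn T _ _))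
    (fun c p q => by
      simp only [Submodule.coe_smul, peval_smul, mul_left_comm _ c, integral_const_mul,
        smul_eq_mul])
  have hinj : Function.Injective B := by
    rw [← LinearMap.ker_eq_bot, LinearMap.ker_eq_bot']
    intro p hp
    have := LinearMap.congr_fun hp p
    exact Subtype.ext (T.eq_zero_of_integral p.1 this)
  have hsurj : Function.Surjective B :=
    (LinearMap.injective_iff_surjective_of_finrank_eq_finrank
      (Subspace.dual_finrank_eq (K := ℝ) (V := PolyDeg d j)).symm).1 hinj
  obtain ⟨p, hp⟩ := hsurj (L.comp (PolyDeg d j).subtype)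
  exact ⟨p.1, p.2, fun q hq => LinearMap.congr_fun hp ⟨q, hq⟩⟩

theorem ConvexPolytope.isProj_proj (T : ConvexPolytope d) (k : ℕ) {u : Pt d → ℝ}
    (hu : IntegrableOn u T.carrier) : T.IsProj k u (T.proj k u) := by
  have hi : ∀ q : Poly d, IntegrableOn (fun x => u x * peval q x) T.carrier := fun q =>
    hu.mul_continuousOn (peval_continuous q).continuousOn T.isCompact_carrier
  let L : Poly d →ₗ[ℝ] ℝ :=
    { toFun := fun q => ∫ x in T.carrier, u x * peval q x
      map_add' := fun p q => by
        simp only [peval_add, mul_add]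
        exact integral_add (hi p) (hi q)
      map_smul' := fun c q => by
        simp only [peval_smul, mul_left_comm _ c, integral_const_mul, smul_eq_mul,
          RingHom.id_apply] }
  obtain ⟨p, hp, h⟩ := T.exists_rep k L
  exact Classical.epsilon_spec (p := T.IsProj k u) ⟨p, hp, h⟩

theorem ConvexPolytope.isWeakGradient_weakGradient (T : ConvexPolytope d) (j : ℕ) (v₀ : Poly d)
    (vb : Set (Pt d) → Poly d) :
    T.IsWeakGradient j v₀ vb (T.weakGradient j v₀ vb) := by
  have hf : ∀ ν ∈ T.normals, ∀ (q : Poly d) (i : Fin d), IntegrableOn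
      (fun x => peval (vb (T.facet ν)) x * (peval q x * ν i)) (T.facet ν) μHE[d - 1] := by
    intro ν hν q i
    refine ContinuousOn.integrableOn_of_subset_isCompact ?_ (T.isCompact_facet ν)
      (T.isCompact_facet ν).measurableSet subset_rfl (T.facet_lt_top hν).ne
    exact ((peval_continuous _).mul ((peval_continuous q).mul continuous_const)).continuousOn
  let L : Fin d → Poly d →ₗ[ℝ] ℝ := fun i =>
    { toFun := fun q => -(∫ x in T.carrier, peval v₀ x * peval (MvPolynomial.pderiv i q) x) +
        ∑ ν ∈ T.normals, ∫ x in T.facet ν,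
          peval (vb (T.facet ν)) x * (peval q x * ν i) ∂μHE[d - 1]
      map_add' := fun p q => by
        simp only [map_add, peval_add, mul_add, add_mul]
        rw [integral_add (peval_integrableOn T _ _) (peval_integrableOn T _ _),
          Finset.sum_congr rfl fun ν hν => integral_add (hf ν hν p i) (hf ν hν q i),
          Finset.sum_add_distrib]
        ring
      map_smul' := fun c q => by
        simp only [Derivation.map_smul, peval_smul, mul_left_comm _ c, mul_assoc c, integral_const_mul,
          smul_eq_mul, RingHom.id_apply, ← Finset.mul_sum]
        ring }
  choose G hG hGq using fun i => T.exists_rep j (L i)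
  refine Classical.epsilon_spec (p := T.IsWeakGradient j v₀ vb) ⟨G, hG, fun q hq => ?_⟩
  have hsum : ∀ x, peval (∑ i, MvPolynomial.pderiv i (q i)) x =
      ∑ i, peval (MvPolynomial.pderiv i (q i)) x := fun x => by simp [peval]
  simp only [hsum, Finset.mul_sum]
  rw [integral_finsetSum _ fun i _ => peval_integrableOn T _ _,
    integral_finsetSum _ fun i _ => peval_integrableOn T _ _,
    Finset.sum_congr rfl fun ν hν => integral_finsetSum _ fun i _ => hf ν hν (q i) i,
    Finset.sum_comm, ← Finset.sum_neg_distrib, ← Finset.sum_add_distrib]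
  exact Finset.sum_congr rfl fun i _ => hGq i (q i) (hq i)

theorem ConvexPolytope.IsProj.unique {T : ConvexPolytope d} {k : ℕ} {u : Pt d → ℝ} {p p' : Poly d}
    (h : T.IsProj k u p) (h' : T.IsProj k u p') : p = p' := by
  have hs := Submodule.sub_mem _ h.1 h'.1
  refine sub_eq_zero.1 (T.eq_zero_of_integral _ ?_)
  have := (h.2 _ hs).trans (h'.2 _ hs).symm
  simp only [peval_sub _ _, sub_mul (peval p _)] at this ⊢
  rw [integral_sub, this, sub_self]
  all_goals simpa only [peval_sub, IntegrableOn] using peval_integrableOn T _ (p - p')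

theorem ConvexPolytope.IsWeakGradient.unique {T : ConvexPolytope d} {j : ℕ} {v₀ : Poly d}
    {vb : Set (Pt d) → Poly d} {G G' : Fin d → Poly d}
    (h : T.IsWeakGradient j v₀ vb G) (h' : T.IsWeakGradient j v₀ vb G') : G = G' := by
  classical
  funext i
  have hs := Submodule.sub_mem _ (h.1 i) (h'.1 i)
  have hq : ∀ i', (Pi.single i (G i - G' i) : Fin d → Poly d) i' ∈ PolyDeg d j := by
    intro i'
    rcases eq_or_ne i' i with rfl | hne
    · simpa using hs
    · simp [Pi.single_eq_of_ne hne]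
  have key : ∀ (K : Fin d → Poly d) (x : Pt d),
      ∑ i', peval (K i') x * peval ((Pi.single i (G i - G' i) : Fin d → Poly d) i') x =
        peval (K i) x * peval (G i - G' i) x := by
    intro K x
    rw [Finset.sum_eq_single i]
    · simp
    · intro i' _ hne; simp [Pi.single_eq_of_ne hne, peval]
    · simp
  have := (h.2 _ hq).trans (h'.2 _ hq).symm
  simp only [key] at this
  refine sub_eq_zero.1 (T.eq_zero_of_integral _ ?_)
  simp only [peval_sub (G i) (G' i), sub_mul (peval (G i) _)] at this ⊢
  rw [integral_sub, this, sub_self]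
  all_goals simpa only [peval_sub, IntegrableOn] using peval_integrableOn T _ (G i - G' i)

end WG

end

/-!
The error is split at the interpolant `{Q₀ u, Q_b u}`. The part `u - Q₀ u` is an approximation
error; the part `ε = {Q₀ u, Q_b u} - u_h` is estimated first in the energy norm and then, by
duality, in `L²`.

**Error equation.** Let `q` be the `L²` projection of `∇u` onto `[P_j(T)]^d`. Green's formula on
each element, together with the cancellation of the facet terms of `∇u · n` against the
single-valued `v_b`, shows that `q` satisfies the discrete equations up to the consistency
functional `∑_T ⟨(∇u - q) · n, v₀ - v_b⟩_{∂T}` (`consistency`). The weak gradient of the interpolant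
is not `q`, but the inverse and trace inequalities show that the difference is of optimal order
(`exists_weakGradient_sub_proj_le`). Thus
`(∇_w ε, ∇_w v)` is the sum of that difference and of the consistency functional
(`IsInterpolant.error_eq`).

**Control of the jumps.** No stabilizer is present, so the jump `v₀ - v_b` must be bounded by
`∇_w v` alone; this is `exists_jump_bound`, where the degree `n_T + k - 1` is used. On a facet with
normal `ν`, extend the jump constantly along `ν` to a polynomial `r`, and test with the field
`ν L (r + l_ν s)`, where `l_ν` is the scaled distance to the hyperplane of the facet and `L` is the
product of the scaled distances to the other `n_T - 1` facets. It vanishes on all other facets and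
is the weighted jump on the given one; the polynomial `s` of degree `k - 1` is chosen such that the
field is orthogonal to `∇v₀`. Polynomial norms weighted by such products are bounded from below
uniformly over all shape-regular elements (`exists_weighted_lower_bound`): polynomials of bounded
degree form a finite-dimensional space, so by compactness each of the finitely many factors is small
only on a small part of the unit ball, and no reference element is needed. The same sublevel
estimate yields the inverse inequality.

**Approximation and traces.** The Poincaré inequality on a convex polytope (`poincare`), iterated on
the difference of `u` and the polynomial with the same mean values of all derivatives, gives the
error of the `L²` projection (`exists_proj_error`). The divergence theorem on a polytope
(`integral_pd_eq`) is obtained from smooth cut-offs of the distances to the facets; it gives the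
trace inequality, hence traces of `H¹` functions (`exists_isTrace`). Traces from the two sides of an
interior facet agree and traces of `H_0^1(Ω)` functions vanish on boundary facets, which is what
makes the facet terms cancel (`sum_integral_trace_eq_zero`).

**Conclusion.** Testing the error equation with `ε` gives the energy estimate
(`IsInterpolant.sum_gradNorm_sq_le`). For the `L²` estimate let `Φ` solve the dual problem, which is
possible by the Lax–Milgram theorem on the bounded set `Ω` (`exists_isPoissonSolution`). Then
`‖ε₀‖²` is expanded with the error equation tested with the interpolant of `Φ`, and every term is a
product of an interpolation error of `u`, or the energy error, and an interpolation error of `Φ`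
(`IsInterpolant.nrm_sq_le`). The only term that is not of this form a priori, the pairing of
`∇_w {Q₀ u, Q_b u} - q` with the projected gradient of `Φ`, becomes so after integrating by parts
against `u`, whose trace vanishes on the boundary (`IsInterpolant.sum_integral_dual`).
-/

noncomputable section

namespace WG

/-! ### Calculus of polynomial functions -/

/-- The classical partial derivative `∂φ/∂x_i`. -/
def pd {d : ℕ} (i : Fin d) (φ : Pt d → ℝ) (x : Pt d) : ℝ :=
  fderiv ℝ φ x (EuclideanSpace.single i (1 : ℝ))

theorem peval_mul {d : ℕ} (p q : Poly d) (x : Pt d) : peval (p * q) x = peval p x * peval q x := by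
  simp [peval]

theorem peval_C {d : ℕ} (c : ℝ) (x : Pt d) : peval (MvPolynomial.C c) x = c := by
  simp [peval]

theorem peval_X {d : ℕ} (i : Fin d) (x : Pt d) : peval (MvPolynomial.X i) x = x i := by
  simp [peval]

theorem peval_sum {d : ℕ} {ι : Type*} (s : Finset ι) (p : ι → Poly d) (x : Pt d) :
    peval (∑ a ∈ s, p a) x = ∑ a ∈ s, peval (p a) x := by
  simp [peval]

theorem peval_prod {d : ℕ} {ι : Type*} (s : Finset ι) (p : ι → Poly d) (x : Pt d) :
    peval (∏ a ∈ s, p a) x = ∏ a ∈ s, peval (p a) x := by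
  simp [peval, map_prod]

@[simp] theorem peval_zero {d : ℕ} (x : Pt d) : peval (0 : Poly d) x = 0 := by
  simp [peval]

theorem peval_neg {d : ℕ} (p : Poly d) (x : Pt d) : peval (-p) x = -peval p x := by
  simp [peval]

theorem contDiff_peval_and_pd {d : ℕ} (p : Poly d) : ContDiff ℝ ∞ (peval p) ∧
    ∀ i x, pd i (peval p) x = peval (MvPolynomial.pderiv i p) x := by
  induction p using MvPolynomial.induction_on with
  | C a =>
    have : peval (MvPolynomial.C a : Poly d) = fun _ => a := funext fun x => peval_C a x
    rw [this]
    exact ⟨contDiff_const, fun i x => by simp [pd]⟩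
  | add p q hp hq =>
    have : peval (p + q) = peval p + peval q := funext fun x => peval_add p q x
    rw [this]
    refine ⟨hp.1.add hq.1, fun i x => ?_⟩
    have h1 := (hp.1.differentiable (by simp)).differentiableAt (x := x)
    have h2 := (hq.1.differentiable (by simp)).differentiableAt (x := x)
    rw [pd, fderiv_add h1 h2, map_add, peval_add, ← hp.2, ← hq.2]
    rfl
  | mul_X p k hp =>
    have : peval (p * MvPolynomial.X k) = fun x => peval p x * x k :=
      funext fun x => by rw [peval_mul, peval_X]
    rw [this]
    have hk : ContDiff ℝ ∞ fun x : Pt d => x k := by fun_prop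
    refine ⟨hp.1.mul hk, fun i x => ?_⟩
    have h1 := (hp.1.differentiable (by simp)).differentiableAt (x := x)
    have hk' : HasFDerivAt (fun x : Pt d => x k) (EuclideanSpace.proj k : Pt d →L[ℝ] ℝ) x :=
      (EuclideanSpace.proj k : Pt d →L[ℝ] ℝ).hasFDerivAt
    have h3 : HasFDerivAt (fun x : Pt d => peval p x * x k) _ x := h1.hasFDerivAt.mul hk'
    rw [pd, h3.fderiv, Derivation.leibniz, peval_add, smul_eq_mul, smul_eq_mul, peval_mul,
      peval_mul, ← hp.2, MvPolynomial.pderiv_X]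
    simp only [pd, add_apply, smul_apply, smul_eq_mul, EuclideanSpace.coe_proj, peval_X]
    rcases eq_or_ne i k with rfl | hne
    · simp [peval]
    · simp [hne.symm]

theorem contDiff_peval {d : ℕ} (p : Poly d) : ContDiff ℝ ∞ (peval p) := (contDiff_peval_and_pd p).1

theorem pd_peval {d : ℕ} (p : Poly d) (i : Fin d) (x : Pt d) :
    pd i (peval p) x = peval (MvPolynomial.pderiv i p) x := (contDiff_peval_and_pd p).2 i x

theorem mem_polyDeg {d k : ℕ} {p : Poly d} : p ∈ PolyDeg d k ↔ p.totalDegree ≤ k :=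
  MvPolynomial.mem_restrictTotalDegree _ _ _

theorem polyDeg_mono {d k l : ℕ} (h : k ≤ l) {p : Poly d} (hp : p ∈ PolyDeg d k) :
    p ∈ PolyDeg d l :=
  mem_polyDeg.2 ((mem_polyDeg.1 hp).trans h)

theorem polyDeg_mul {d k l : ℕ} {p q : Poly d} (hp : p ∈ PolyDeg d k) (hq : q ∈ PolyDeg d l) :
    p * q ∈ PolyDeg d (k + l) :=
  mem_polyDeg.2 ((MvPolynomial.totalDegree_mul _ _).trans
    (add_le_add (mem_polyDeg.1 hp) (mem_polyDeg.1 hq)))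

theorem polyDeg_pderiv {d k : ℕ} {p : Poly d} (hp : p ∈ PolyDeg d k) (i : Fin d) :
    MvPolynomial.pderiv i p ∈ PolyDeg d (k - 1) := by
  rw [p.as_sum, map_sum]
  refine Submodule.sum_mem _ fun s hs => ?_
  rw [MvPolynomial.pderiv_monomial, mem_polyDeg]
  by_cases h : s i = 0
  · simp [h]
  refine (MvPolynomial.totalDegree_monomial_le _ _).trans ?_
  have h1 : (s.sum fun _ e => e) ≤ k := (MvPolynomial.le_totalDegree hs).trans (mem_polyDeg.1 hp)
  have h2 : s = (s - Finsupp.single i 1) + Finsupp.single i 1 := by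
    ext j
    rcases eq_or_ne j i with rfl | hne
    · simp; omega
    · simp [hne.symm]
  have h3 : (s.sum fun _ e => e) = ((s - Finsupp.single i 1).sum fun _ e => e) + 1 := by
    conv_lhs => rw [h2]
    rw [Finsupp.sum_add_index' (by simp) (by simp), Finsupp.sum_single_index rfl]
  have h4 : Finsupp.degree (s - Finsupp.single i 1) =
      (s - Finsupp.single i 1).sum fun _ e => e := by
    rw [Finsupp.degree_eq_sum, Finsupp.sum_fintype _ _ (by simp)]
  change ((s - Finsupp.single i 1).sum fun _ e => e) ≤ k - 1
  omega

theorem totalDegree_bind₁_le {m d : ℕ} (A : Fin d → Poly m) (hA : ∀ i, (A i).totalDegree ≤ 1)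
    (q : Poly d) : (MvPolynomial.bind₁ A q).totalDegree ≤ q.totalDegree := by
  rw [MvPolynomial.bind₁, MvPolynomial.aeval_def, MvPolynomial.eval₂_eq]
  refine (MvPolynomial.totalDegree_finsetSum _ _).trans (Finset.sup_le fun s hs => ?_)
  refine (MvPolynomial.totalDegree_mul _ _).trans ?_
  rw [MvPolynomial.algebraMap_eq, MvPolynomial.totalDegree_C, zero_add]
  refine (MvPolynomial.totalDegree_finsetProd _ _).trans ?_
  refine le_trans ?_ (MvPolynomial.le_totalDegree hs)
  rw [Finsupp.sum]
  refine Finset.sum_le_sum fun i _ => (MvPolynomial.totalDegree_pow _ _).trans ?_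
  calc s i * (A i).totalDegree ≤ s i * 1 := Nat.mul_le_mul_left _ (hA i)
    _ = s i := mul_one _

/-- The affine function `x ↦ a + ∑ c_i x_i` as a polynomial. -/
def affinePoly {d : ℕ} (a : ℝ) (c : Fin d → ℝ) : Poly d :=
  MvPolynomial.C a + ∑ i, MvPolynomial.C (c i) * MvPolynomial.X i

theorem affinePoly_mem {d : ℕ} (a : ℝ) (c : Fin d → ℝ) : affinePoly a c ∈ PolyDeg d 1 := by
  refine Submodule.add_mem _ (mem_polyDeg.2 (by simp)) (Submodule.sum_mem _ fun i _ => ?_)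
  exact mem_polyDeg.2 ((MvPolynomial.totalDegree_mul _ _).trans (by simp))

theorem peval_affinePoly {d : ℕ} (a : ℝ) (c : Fin d → ℝ) (x : Pt d) :
    peval (affinePoly a c) x = a + ∑ i, c i * x i := by
  simp [affinePoly, peval]

/-- Composition with an affine map does not raise the degree of a polynomial. -/
theorem exists_peval_comp_affine {m d J : ℕ} (x₀ : Pt d) (U : Pt m →ₗ[ℝ] Pt d) {q : Poly d}
    (hq : q ∈ PolyDeg d J) : ∃ q' ∈ PolyDeg m J, ∀ y, peval q' y = peval q (x₀ + U y) := by
  let A : Fin d → Poly m := fun i =>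
    affinePoly (x₀ i) fun k => U (EuclideanSpace.single k (1 : ℝ)) i
  refine ⟨MvPolynomial.bind₁ A q, mem_polyDeg.2 ((totalDegree_bind₁_le A (fun i =>
    mem_polyDeg.1 (affinePoly_mem _ _)) q).trans (mem_polyDeg.1 hq)), fun y => ?_⟩
  have hy : U y = ∑ k, y k • U (EuclideanSpace.single k (1 : ℝ)) := by
    conv_lhs => rw [← (EuclideanSpace.basisFun (Fin m) ℝ).sum_repr y]
    simp
  have : ∀ i, peval (A i) y = (x₀ + U y) i := by
    intro i
    rw [peval_affinePoly, hy]
    simp [mul_comm]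
  rw [peval, MvPolynomial.eval, MvPolynomial.eval₂Hom_bind₁]
  simp only [peval, MvPolynomial.eval] at this ⊢
  simp only [this]

/-! ### Zero sets and sublevel sets of polynomials -/

/-- The zero set of a nonzero polynomial is a null set, by induction on the number of variables and
Fubini's theorem. -/
theorem volume_eval_eq_zero : ∀ {m : ℕ} (q : Poly m), q ≠ 0 →
    volume {x : Fin m → ℝ | MvPolynomial.eval x q = 0} = 0 := by
  intro m
  induction m with
  | zero =>
    intro q hq
    have : {x : Fin 0 → ℝ | MvPolynomial.eval x q = 0} = ∅ := by
      ext x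
      simp only [Set.mem_ofPred_eq, Set.mem_empty_iff_false, iff_false]
      intro h
      apply hq
      rw [MvPolynomial.eq_C_of_isEmpty q] at h ⊢
      simp at h
      simp [h]
    rw [this, measure_empty]
  | succ m ih =>
    intro q hq
    let e := MeasurableEquiv.piFinSuccAbove (fun _ : Fin (m + 1) => ℝ) 0
    have hmp : MeasurePreserving (fun z : (Fin m → ℝ) × ℝ => e.symm z.swap) :=
      (volume_preserving_piFinSuccAbove (fun _ : Fin (m + 1) => ℝ) 0).symm.comp
        Measure.measurePreserving_swap
    have hms : MeasurableSet {x : Fin (m + 1) → ℝ | MvPolynomial.eval x q = 0} :=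
      (isClosed_eq (MvPolynomial.continuous_eval q) continuous_const).measurableSet
    rw [← hmp.measure_preimage hms.nullMeasurableSet, Measure.volume_eq_prod,
      Measure.measure_prod_null (hmp.measurable hms)]
    set r := MvPolynomial.finSuccEquiv ℝ m q with hr
    have hr0 : r ≠ 0 := by simpa [hr] using hq
    have hl := ih r.leadingCoeff (by simpa using hr0)
    have hl' : ∀ᵐ s : Fin m → ℝ, MvPolynomial.eval s r.leadingCoeff ≠ 0 := by
      rw [ae_iff]; simpa using hl
    filter_upwards [hl'] with s hs
    have hp : r.map (MvPolynomial.eval s) ≠ 0 := fun h => hs (by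
      have := congrArg (fun p => p.coeff r.natDegree) h
      simpa using this)
    refine ((r.map (MvPolynomial.eval s)).roots.toFinset.finite_toSet.subset ?_).measure_zero _
    intro y hy
    have hy' : MvPolynomial.eval (e.symm (y, s)) q = 0 := hy
    have he : e.symm (y, s) = (Fin.cons y s : Fin (m + 1) → ℝ) := by
      simp [e, MeasurableEquiv.piFinSuccAbove, Fin.insertNthEquiv]
    rw [he] at hy'
    rw [MvPolynomial.eval_eq_eval_mv_eval'] at hy'
    simpa [hp] using hy'

theorem volume_peval_eq_zero {m : ℕ} {q : Poly m} (hq : q ≠ 0) :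
    volume {x : Pt m | peval q x = 0} = 0 := by
  have hms : MeasurableSet {x : Fin m → ℝ | MvPolynomial.eval x q = 0} :=
    (isClosed_eq (MvPolynomial.continuous_eval q) continuous_const).measurableSet
  rw [← volume_eval_eq_zero q hq]
  exact (PiLp.volume_preserving_ofLp (Fin m)).measure_preimage hms.nullMeasurableSet

/-- Coordinates on the space of polynomials of degree at most `J`, used to give it a norm. -/
def polyCoord (d J : ℕ) : PolyDeg d J ≃ₗ[ℝ] (Fin (Module.finrank ℝ (PolyDeg d J)) → ℝ) :=
  (Module.finBasis ℝ (PolyDeg d J)).equivFun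

theorem exists_norm_le_polyCoord (d J : ℕ) (L : Poly d →ₗ[ℝ] Poly d) :
    ∃ K > 0, ∀ q : PolyDeg d J, ∀ x ∈ Metric.closedBall (0 : Pt d) 1,
      |peval (L q) x| ≤ K * ‖polyCoord d J q‖ := by
  set b := Module.finBasis ℝ (PolyDeg d J)
  have hK : ∀ i, ∃ K, ∀ x ∈ Metric.closedBall (0 : Pt d) 1, |peval (L (b i)) x| ≤ K := by
    intro i
    obtain ⟨K, hK⟩ := (isCompact_closedBall (0 : Pt d) 1).exists_bound_of_continuousOn
      (peval_continuous (L (b i))).continuousOn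
    exact ⟨K, hK⟩
  choose K hK using hK
  refine ⟨1 + ∑ i, |K i|, by positivity, fun q x hx => ?_⟩
  have hq : (q : Poly d) = ∑ i, polyCoord d J q i • (b i : Poly d) := by
    conv_lhs => rw [← b.sum_repr q]
    simp [polyCoord, b, -Module.Basis.sum_repr]
  have hLq : peval (L q) x = ∑ i, polyCoord d J q i * peval (L (b i)) x := by
    conv_lhs => rw [hq]
    rw [map_sum, peval_sum]
    exact Finset.sum_congr rfl fun i _ => by rw [map_smul, peval_smul]
  rw [hLq, add_mul, Finset.sum_mul]
  refine (Finset.abs_sum_le_sum_abs _ _).trans ?_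
  have : ∑ i, |polyCoord d J q i * peval (L (b i)) x| ≤ ∑ i, |K i| * ‖polyCoord d J q‖ := by
    refine Finset.sum_le_sum fun i _ => ?_
    rw [abs_mul, mul_comm]
    exact mul_le_mul ((hK i x hx).trans (le_abs_self _)) (norm_le_pi_norm (polyCoord d J q) i)
      (abs_nonneg _) (abs_nonneg _)
  have h0 : 0 ≤ 1 * ‖polyCoord d J q‖ := by positivity
  linarith

/-- A polynomial of bounded degree can be small, compared with its norm, only on a small part of
the unit ball. This follows from the compactness of the unit sphere of the space of polynomials and
from the fact that a nonzero polynomial vanishes on a null set only. -/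
theorem exists_volume_sublevel_polyCoord_le (d J : ℕ) {δ : ℝ} (hδ : 0 < δ) :
    ∃ η > 0, ∀ q : PolyDeg d J,
      volume {y ∈ Metric.closedBall (0 : Pt d) 1 | |peval q y| < η * ‖polyCoord d J q‖} ≤
        ENNReal.ofReal δ := by
  obtain ⟨K, hK0, hK⟩ := exists_norm_le_polyCoord d J LinearMap.id
  have key : ∃ η > 0, ∀ c ∈ Metric.sphere (0 : Fin (Module.finrank ℝ (PolyDeg d J)) → ℝ) 1,
      volume {y ∈ Metric.closedBall (0 : Pt d) 1 | |peval ((polyCoord d J).symm c) y| < η} ≤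
        ENNReal.ofReal δ := by
    refine (isCompact_sphere (0 : Fin (Module.finrank ℝ (PolyDeg d J)) → ℝ) 1).induction_on
      (p := fun s => ∃ η > 0, ∀ c ∈ s, volume {y ∈ Metric.closedBall (0 : Pt d) 1 |
        |peval ((polyCoord d J).symm c) y| < η} ≤ ENNReal.ofReal δ)
      ⟨1, one_pos, by simp⟩ ?_ ?_ ?_
    · rintro s t hst ⟨η, hη, h⟩
      exact ⟨η, hη, fun c hc => h c (hst hc)⟩
    · rintro s t ⟨η, hη, h⟩ ⟨η', hη', h'⟩
      refine ⟨min η η', lt_min hη hη', fun c hc => ?_⟩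
      rcases hc with hc | hc
      · refine le_trans (measure_mono fun y hy => ?_) (h c hc)
        exact ⟨hy.1, hy.2.trans_le (min_le_left _ _)⟩
      · refine le_trans (measure_mono fun y hy => ?_) (h' c hc)
        exact ⟨hy.1, hy.2.trans_le (min_le_right _ _)⟩
    · intro c₀ hc₀
      set q₀ : Poly d := ((polyCoord d J).symm c₀).1 with hq₀
      have hq₀0 : q₀ ≠ 0 := by
        intro h
        have h1 : (polyCoord d J).symm c₀ = 0 := Subtype.ext h
        rw [LinearEquiv.map_eq_zero_iff] at h1
        simp [h1] at hc₀
      -- The sets `S n` decrease to the zero set of `q₀`, so some `S n` has small measure.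
      -- Polynomials near `q₀` are uniformly close to it on the ball, so the bound holds for them.
      let S : ℕ → Set (Pt d) := fun n =>
        {y ∈ Metric.closedBall (0 : Pt d) 1 | |peval q₀ y| < 1 / ((n : ℝ) + 1)}
      have hSm : ∀ n, MeasurableSet (S n) := fun n =>
        measurableSet_closedBall.inter (isOpen_lt (peval_continuous q₀).abs
          continuous_const).measurableSet
      have hSanti : Antitone S := fun a b hab y hy =>
        ⟨hy.1, hy.2.trans_le (one_div_le_one_div_of_le (by positivity)
          (add_le_add_left (Nat.cast_le.2 hab) 1))⟩
      have hlim := tendsto_measure_iInter_atTop (μ := volume)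
        (fun n => (hSm n).nullMeasurableSet) hSanti
        ⟨0, ((measure_mono (Set.sep_subset _ _)).trans_lt measure_closedBall_lt_top).ne⟩
      have h0 : volume (⋂ n, S n) = 0 := by
        refine measure_mono_null (fun y hy => ?_) (volume_peval_eq_zero hq₀0)
        by_contra hne
        obtain ⟨n, hn⟩ := exists_nat_one_div_lt (abs_pos.2 hne)
        exact absurd ((Set.mem_iInter.1 hy n).2) (not_lt.2 hn.le)
      rw [h0] at hlim
      obtain ⟨n, hn⟩ := (hlim.eventually (gt_mem_nhds (ENNReal.ofReal_pos.2 hδ))).exists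
      have hη : (0 : ℝ) < 1 / ((n : ℝ) + 1) := by positivity
      refine ⟨Metric.ball c₀ (1 / ((n : ℝ) + 1) / (2 * K)) ∩ Metric.sphere 0 1, ?_,
        1 / ((n : ℝ) + 1) / 2, by positivity, ?_⟩
      · exact inter_mem (mem_nhdsWithin_of_mem_nhds (Metric.ball_mem_nhds _ (by positivity)))
          self_mem_nhdsWithin
      · rintro c ⟨hc, -⟩
        refine le_trans (measure_mono fun y hy => ?_) hn.le
        refine ⟨hy.1, ?_⟩
        have h1 := hK ((polyCoord d J).symm (c₀ - c)) y hy.1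
        rw [LinearEquiv.apply_symm_apply, LinearMap.id_apply, map_sub, Submodule.coe_sub,
          peval_sub] at h1
        have h2 : K * ‖c₀ - c‖ < 1 / ((n : ℝ) + 1) / 2 := by
          rw [Metric.mem_ball', dist_eq_norm, lt_div_iff₀ (by positivity)] at hc
          linarith
        have h3 := abs_sub_abs_le_abs_sub (peval q₀ y) (peval ((polyCoord d J).symm c) y)
        have h4 := hy.2
        linarith
  obtain ⟨η, hη, h⟩ := key
  refine ⟨η, hη, fun q => ?_⟩
  rcases eq_or_ne q 0 with rfl | hq
  · simp
  have hn : 0 < ‖polyCoord d J q‖ := norm_pos_iff.2 (by simpa using hq)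
  refine le_trans (measure_mono fun y hy => ?_)
    (h (‖polyCoord d J q‖⁻¹ • polyCoord d J q) (by simp [norm_smul, hn.ne']))
  refine ⟨hy.1, ?_⟩
  rw [map_smul, LinearEquiv.symm_apply_apply, Submodule.coe_smul, peval_smul, abs_mul,
    abs_of_pos (inv_pos.2 hn), inv_mul_lt_iff₀ hn, mul_comm]
  exact hy.2

/-- Uniform sublevel estimate on the unit ball, for the image of a polynomial under a linear map
(the identity or a derivative). -/
theorem exists_volume_sublevel_le (d J : ℕ) (L : Poly d →ₗ[ℝ] Poly d) {δ : ℝ} (hδ : 0 < δ) :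
    ∃ η > 0, ∀ q ∈ PolyDeg d J, ∀ x ∈ Metric.closedBall (0 : Pt d) 1,
      volume {y ∈ Metric.closedBall (0 : Pt d) 1 | |peval q y| < η * |peval (L q) x|} ≤
        ENNReal.ofReal δ := by
  obtain ⟨η, hη, h⟩ := exists_volume_sublevel_polyCoord_le d J hδ
  obtain ⟨K, hK0, hK⟩ := exists_norm_le_polyCoord d J L
  refine ⟨η / K, by positivity, fun q hq x hx => ?_⟩
  refine le_trans (measure_mono fun y hy => ?_) (h ⟨q, hq⟩)
  refine ⟨hy.1, hy.2.trans_le ?_⟩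
  rw [div_mul_eq_mul_div, div_le_iff₀ hK0, mul_assoc]
  have := mul_le_mul_of_nonneg_left (hK ⟨q, hq⟩ x hx) hη.le
  linarith

/-- Weighted lower bound: for nonnegative polynomial weights `l a` that are not small at some point
of the unit ball, `∫_S (∏ l a) w²` controls `w` and its derivatives at every point. -/
theorem exists_weighted_lower_bound (d J n : ℕ) (L : Poly d →ₗ[ℝ] Poly d) {ρ c₀ : ℝ}
    (hρ : 0 < ρ) (hc₀ : 0 < c₀) :
    ∃ c > 0, ∀ (S : Set (Pt d)), S ⊆ Metric.closedBall 0 1 → MeasurableSet S →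
      ENNReal.ofReal ρ ≤ volume S → ∀ (ι : Type) (s : Finset ι) (l : ι → Poly d),
      s.card ≤ n → (∀ a ∈ s, l a ∈ PolyDeg d J) → (∀ a ∈ s, ∀ x ∈ S, 0 ≤ peval (l a) x) →
      (∀ a ∈ s, ∃ x ∈ Metric.closedBall (0 : Pt d) 1, c₀ ≤ |peval (l a) x|) →
      ∀ w ∈ PolyDeg d J, ∀ x ∈ Metric.closedBall (0 : Pt d) 1,
        c * peval (L w) x ^ 2 ≤ ∫ y in S, (∏ a ∈ s, peval (l a) y) * peval w y ^ 2 := by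
  have hδ : 0 < ρ / (2 * (n + 1)) := by positivity
  obtain ⟨η₁, hη₁, h₁⟩ := exists_volume_sublevel_le d J LinearMap.id hδ
  obtain ⟨η₂, hη₂, h₂⟩ := exists_volume_sublevel_le d J L hδ
  set t := min 1 (η₁ * c₀) with ht
  have ht0 : 0 < t := lt_min one_pos (by positivity)
  refine ⟨t ^ n * η₂ ^ 2 * (ρ / 2), by positivity, ?_⟩
  intro S hSB hSm hSρ ι s l hs hl hl0 hlc w hw x hx
  classical
  let B : ι → Set (Pt d) := fun a => {y ∈ Metric.closedBall (0 : Pt d) 1 | |peval (l a) y| < t}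
  let W : Set (Pt d) :=
    {y ∈ Metric.closedBall (0 : Pt d) 1 | |peval w y| < η₂ * |peval (L w) x|}
  have hWm : MeasurableSet W := measurableSet_closedBall.inter
    (isOpen_lt (peval_continuous w).abs continuous_const).measurableSet
  have hBm : ∀ a, MeasurableSet (B a) := fun a => measurableSet_closedBall.inter
    (isOpen_lt (peval_continuous (l a)).abs continuous_const).measurableSet
  have hB : ∀ a ∈ s, volume (B a) ≤ ENNReal.ofReal (ρ / (2 * (n + 1))) := by
    intro a ha
    obtain ⟨z, hz, hzc⟩ := hlc a ha
    refine le_trans (measure_mono fun y hy => ?_) (h₁ (l a) (hl a ha) z hz)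
    refine ⟨hy.1, hy.2.trans_le ?_⟩
    exact (min_le_right _ _).trans (mul_le_mul_of_nonneg_left hzc hη₁.le)
  -- Outside the bad set, of measure at most `ρ / 2`, every weight is at least `t` and `|w|` is at
  -- least `η₂ * |L w (x)|`.
  let G : Set (Pt d) := S \ (W ∪ ⋃ a ∈ s, B a)
  have hUm : MeasurableSet (W ∪ ⋃ a ∈ s, B a) :=
    hWm.union (Finset.measurableSet_biUnion s fun a _ => hBm a)
  have hGm : MeasurableSet G := hSm.diff hUm
  have hfin : volume S ≠ ⊤ := ((measure_mono hSB).trans_lt measure_closedBall_lt_top).ne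
  have hbad : volume (W ∪ ⋃ a ∈ s, B a) ≤ ENNReal.ofReal (ρ / 2) := by
    calc volume (W ∪ ⋃ a ∈ s, B a) ≤ volume W + ∑ a ∈ s, volume (B a) :=
          (measure_union_le _ _).trans (add_le_add le_rfl (measure_biUnion_finset_le _ _))
      _ ≤ ENNReal.ofReal (ρ / (2 * (n + 1))) + ∑ a ∈ s, ENNReal.ofReal (ρ / (2 * (n + 1))) :=
          add_le_add (h₂ w hw x hx) (Finset.sum_le_sum hB)
      _ = ENNReal.ofReal ((s.card + 1) * (ρ / (2 * (n + 1)))) := by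
          rw [Finset.sum_const, nsmul_eq_mul, ENNReal.ofReal_mul (by positivity),
            ENNReal.ofReal_add (by positivity) one_pos.le, ENNReal.ofReal_natCast,
            ENNReal.ofReal_one]
          ring
      _ ≤ ENNReal.ofReal (ρ / 2) := by
          apply ENNReal.ofReal_le_ofReal
          have : (s.card : ℝ) ≤ n := by exact_mod_cast hs
          calc ((s.card : ℝ) + 1) * (ρ / (2 * (n + 1))) ≤ (n + 1) * (ρ / (2 * (n + 1))) := by gcongr
            _ = ρ / 2 := by field_simp
  have hGρ : ρ / 2 ≤ volume.real G := by
    have h3 : ENNReal.ofReal (ρ / 2) ≤ volume G := by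
      calc ENNReal.ofReal (ρ / 2) = ENNReal.ofReal ρ - ENNReal.ofReal (ρ / 2) := by
            rw [← ENNReal.ofReal_sub _ (by positivity)]; congr 1; ring
        _ ≤ volume S - volume (W ∪ ⋃ a ∈ s, B a) := tsub_le_tsub hSρ hbad
        _ ≤ volume G := le_measure_sdiff
    exact (ENNReal.ofReal_le_iff_le_toReal
      ((measure_mono Set.sdiff_subset).trans_lt hfin.lt_top).ne).1 h3
  have hcont : Continuous fun y => (∏ a ∈ s, peval (l a) y) * peval w y ^ 2 :=
    (continuous_finsetProd _ fun a _ => peval_continuous _).mul ((peval_continuous w).pow 2)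
  have hint : IntegrableOn (fun y => (∏ a ∈ s, peval (l a) y) * peval w y ^ 2) S :=
    (hcont.continuousOn.integrableOn_compact (isCompact_closedBall 0 1)).mono_set hSB
  calc t ^ n * η₂ ^ 2 * (ρ / 2) * peval (L w) x ^ 2
      = (t ^ n * (η₂ * |peval (L w) x|) ^ 2) * (ρ / 2) := by rw [mul_pow, sq_abs]; ring
    _ ≤ (t ^ n * (η₂ * |peval (L w) x|) ^ 2) * volume.real G := by gcongr
    _ = ∫ _ in G, t ^ n * (η₂ * |peval (L w) x|) ^ 2 := by
        rw [setIntegral_const, smul_eq_mul, mul_comm]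
    _ ≤ ∫ y in G, (∏ a ∈ s, peval (l a) y) * peval w y ^ 2 := by
        refine setIntegral_mono_on ?_ (hint.mono_set Set.sdiff_subset) hGm fun y hy => ?_
        · exact integrableOn_const ((measure_mono Set.sdiff_subset).trans_lt hfin.lt_top).ne
        · have hyB := hSB hy.1
          have hyW : η₂ * |peval (L w) x| ≤ |peval w y| := by
            by_contra hcon
            exact hy.2 (Or.inl ⟨hyB, not_le.1 hcon⟩)
          have hyt : ∀ a ∈ s, t ≤ peval (l a) y := by
            intro a ha
            rw [← abs_of_nonneg (hl0 a ha y hy.1)]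
            by_contra hcon
            exact hy.2 (Or.inr (Set.mem_biUnion ha ⟨hyB, not_le.1 hcon⟩))
          refine mul_le_mul ?_ ?_ (by positivity)
            (Finset.prod_nonneg fun a ha => hl0 a ha y hy.1)
          · calc t ^ n ≤ t ^ s.card := pow_le_pow_of_le_one ht0.le (min_le_left _ _) hs
              _ = ∏ _a ∈ s, t := by rw [Finset.prod_const]
              _ ≤ _ := Finset.prod_le_prod (fun _ _ => ht0.le) hyt
          · rw [← sq_abs (peval w y)]
            gcongr
    _ ≤ ∫ y in S, (∏ a ∈ s, peval (l a) y) * peval w y ^ 2 := by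
        refine setIntegral_mono_set hint ?_ (LE.le.eventuallyLE Set.sdiff_subset)
        filter_upwards [ae_restrict_mem hSm] with y hy
        exact mul_nonneg (Finset.prod_nonneg fun a ha => hl0 a ha y hy) (sq_nonneg _)

end WG
end

noncomputable section

namespace WG

/-! ### Hyperplane coordinates -/

theorem exists_chart_succ {m : ℕ} (ν : Pt (m + 1)) (hν : ‖ν‖ = 1) :
    ∃ U : Pt m →ₗᵢ[ℝ] Pt (m + 1), (∀ y, inner ℝ ν (U y) = 0) ∧
      (∀ z, inner ℝ ν z = 0 → ∃ y, U y = z) ∧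
      MeasurePreserving (fun p : Pt m × ℝ => U p.1 - p.2 • ν) := by
  classical
  have ho : Orthonormal ℝ (({0} : Set (Fin (m + 1))).domRestrict fun _ => ν) := by
    refine ⟨fun _ => hν, fun a b hab => (hab (Subsingleton.elim a b)).elim⟩
  obtain ⟨b, hb⟩ := ho.exists_orthonormalBasis_extension_of_card_eq (by simp)
  have hb0 : b 0 = ν := hb 0 rfl
  let E : Pt m →ₗ[ℝ] Pt (m + 1) :=
    { toFun := fun y => WithLp.toLp 2 (Fin.cons 0 y.ofLp)
      map_add' := fun x y => by
        ext i; refine Fin.cases ?_ (fun i => ?_) i <;> simp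
      map_smul' := fun c x => by
        ext i; refine Fin.cases ?_ (fun i => ?_) i <;> simp }
  let E' : Pt m →ₗᵢ[ℝ] Pt (m + 1) := ⟨E, fun y => by
    simp [E, EuclideanSpace.norm_eq, Fin.sum_univ_succ]⟩
  let U : Pt m →ₗᵢ[ℝ] Pt (m + 1) := b.repr.symm.toLinearIsometry.comp E'
  have hU : ∀ y, b.repr (U y) = E y := fun y => by simp [U, E']
  have hinner : ∀ z, inner ℝ ν z = b.repr z 0 := fun z => by
    rw [b.repr_apply_apply, hb0]
  refine ⟨U, fun y => ?_, fun z hz => ?_, ?_⟩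
  · rw [hinner, hU]; rfl
  · refine ⟨WithLp.toLp 2 fun i => b.repr z i.succ, b.repr.injective ?_⟩
    rw [hU]
    ext i
    refine Fin.cases ?_ (fun i => ?_) i
    · rw [← hinner, hz]; rfl
    · rfl
  · let e := MeasurableEquiv.piFinSuccAbove (fun _ : Fin (m + 1) => ℝ) 0
    have h1 : MeasurePreserving (fun p : Pt m × ℝ => ((-p.2 : ℝ), (p.1.ofLp : Fin m → ℝ))) := by
      have := ((Measure.measurePreserving_neg (volume : Measure ℝ)).prod
        (PiLp.volume_preserving_ofLp (Fin m))).comp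
        (Measure.measurePreserving_swap (μ := (volume : Measure (Pt m)))
          (ν := (volume : Measure ℝ)))
      exact this
    have h2 : MeasurePreserving fun p : Pt m × ℝ =>
        b.repr.symm (WithLp.toLp 2 (e.symm ((-p.2 : ℝ), (p.1.ofLp : Fin m → ℝ)))) :=
      (b.repr.symm.measurePreserving.comp (PiLp.volume_preserving_toLp (Fin (m + 1)))).comp
        ((volume_preserving_piFinSuccAbove (fun _ : Fin (m + 1) => ℝ) 0).symm.comp h1)
    convert h2 using 2 with p
    apply b.repr.injective
    rw [LinearIsometryEquiv.apply_symm_apply, map_sub, map_smul, hU, ← hb0]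
    ext i
    refine Fin.cases ?_ (fun i => ?_) i
    · simp [E, e, MeasurableEquiv.piFinSuccAbove, Fin.insertNthEquiv]
    · simp [E, e, MeasurableEquiv.piFinSuccAbove, Fin.insertNthEquiv]

/-- Orthonormal coordinates `(y, s) ↦ U y - s ν` adapted to a unit vector `ν`. -/
theorem exists_chart {d : ℕ} (ν : Pt d) (hν : ‖ν‖ = 1) :
    ∃ U : Pt (d - 1) →ₗᵢ[ℝ] Pt d, (∀ y, inner ℝ ν (U y) = 0) ∧
      (∀ z, inner ℝ ν z = 0 → ∃ y, U y = z) ∧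
      MeasurePreserving (fun p : Pt (d - 1) × ℝ => U p.1 - p.2 • ν) := by
  rcases d with _ | m
  · simp [Subsingleton.elim ν 0] at hν
  · exact exists_chart_succ ν hν

theorem isometry_const_add {m d : ℕ} (x₀ : Pt d) (U : Pt m →ₗᵢ[ℝ] Pt d) :
    Isometry fun y => x₀ + U y :=
  (IsometryEquiv.addLeft x₀).isometry.comp U.isometry

theorem setIntegral_hausdorff_eq {m d : ℕ} (x₀ : Pt d) (U : Pt m →ₗᵢ[ℝ] Pt d) {K : Set (Pt d)}
    (hK : MeasurableSet K) (hKU : K ⊆ Set.range fun y => x₀ + U y) (F : Pt d → ℝ) :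
    ∫ x in K, F x ∂μHE[m] = ∫ y in (fun y => x₀ + U y) ⁻¹' K, F (x₀ + U y) := by
  have hi := isometry_const_add x₀ U
  have h1 := hi.map_euclideanHausdorffMeasure (d := m)
  rw [EuclideanSpace.euclideanHausdorffMeasure_eq_volume] at h1
  have h2 : (μHE[m] : Measure (Pt d)).restrict K =
      ((volume : Measure (Pt m)).map fun y => x₀ + U y).restrict K := by
    rw [h1, Measure.restrict_restrict hK, Set.inter_eq_left.2 hKU]
  rw [h2, hi.isClosedEmbedding.measurableEmbedding.setIntegral_map]

theorem hausdorff_eq_volume_preimage {m d : ℕ} (x₀ : Pt d) (U : Pt m →ₗᵢ[ℝ] Pt d) {K : Set (Pt d)}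
    (hKU : K ⊆ Set.range fun y => x₀ + U y) :
    μHE[m] K = volume ((fun y => x₀ + U y) ⁻¹' K) := by
  rw [← EuclideanSpace.euclideanHausdorffMeasure_eq_volume,
    (isometry_const_add x₀ U).euclideanHausdorffMeasure_preimage, Set.inter_eq_left.2 hKU]

namespace ConvexPolytope

variable {d : ℕ} (T : ConvexPolytope d)

/-- The signed distance of `x` from the facet hyperplane with normal `ν`, positive inside `T`. -/
def gap (ν x : Pt d) : ℝ := T.offset ν - inner ℝ ν x

theorem gap_contDiff (ν : Pt d) : ContDiff ℝ ∞ (T.gap ν) := by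
  exact contDiff_const.sub (contDiff_const.inner ℝ contDiff_id)

theorem gap_continuous (ν : Pt d) : Continuous (T.gap ν) := (T.gap_contDiff ν).continuous

theorem gap_nonneg {ν x : Pt d} (hν : ν ∈ T.normals) (hx : x ∈ T.carrier) : 0 ≤ T.gap ν x :=
  sub_nonneg.2 (hx ν hν)

theorem gap_add (ν x z : Pt d) : T.gap ν (x + z) = T.gap ν x - inner ℝ ν z := by
  simp only [gap, inner_add_right]; ring

theorem gap_of_mem_facet {ν x : Pt d} (hx : x ∈ T.facet ν) : T.gap ν x = 0 :=
  sub_eq_zero.2 hx.2.symm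

theorem convex_carrier : Convex ℝ T.carrier := by
  intro x hx y hy a b ha hb hab ν hν
  rw [inner_add_right, inner_smul_right, inner_smul_right]
  calc a * inner ℝ ν x + b * inner ℝ ν y ≤ a * T.offset ν + b * T.offset ν :=
        add_le_add (mul_le_mul_of_nonneg_left (hx ν hν) ha)
          (mul_le_mul_of_nonneg_left (hy ν hν) hb)
    _ = T.offset ν := by rw [← add_mul, hab, one_mul]

theorem interior_carrier : interior T.carrier = {x | ∀ ν ∈ T.normals, 0 < T.gap ν x} := by
  apply Set.Subset.antisymm
  · intro x hx ν hν
    by_contra hcon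
    obtain ⟨ε, hε, hb⟩ := Metric.isOpen_iff.1 isOpen_interior x hx
    have hx' : x + (ε / 2) • ν ∈ T.carrier := interior_subset (hb (by
      rw [Metric.mem_ball, dist_eq_norm, add_sub_cancel_left, norm_smul, T.norm_normal ν hν,
        mul_one, Real.norm_of_nonneg (by positivity)]
      linarith))
    have h1 := T.gap_nonneg hν hx'
    rw [gap_add, inner_smul_right, real_inner_self_eq_norm_sq, T.norm_normal ν hν] at h1
    linarith
  · refine interior_maximal (fun x hx ν hν => sub_nonneg.1 (hx ν hν).le) ?_
    have : {x : Pt d | ∀ ν ∈ T.normals, 0 < T.gap ν x} =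
        ⋂ ν ∈ T.normals, {x | 0 < T.gap ν x} := by ext x; simp
    rw [this]
    exact isOpen_biInter_finset fun ν _ => isOpen_lt continuous_const (T.gap_continuous ν)

theorem measurableSet_carrier : MeasurableSet T.carrier := T.isCompact_carrier.measurableSet

theorem interior_ae_eq : interior T.carrier =ᵐ[volume] T.carrier :=
  interior_ae_eq_of_null_frontier (T.convex_carrier.addHaar_frontier volume)

theorem volume_lt_top : volume T.carrier < ⊤ := T.isCompact_carrier.measure_lt_top

theorem openFacet_nonempty {ν : Pt d} (hν : ν ∈ T.normals) : (T.openFacet ν).Nonempty :=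
  T.irredundant ν hν

theorem openFacet_subset_facet {ν : Pt d} : T.openFacet ν ⊆ T.facet ν := by
  intro x hx
  refine ⟨fun μ hμ => ?_, hx.1⟩
  rcases eq_or_ne μ ν with rfl | hne
  · exact hx.1.le
  · exact (hx.2 μ hμ hne).le

theorem facet_subset_carrier {ν : Pt d} : T.facet ν ⊆ T.carrier := fun _ hx => hx.1

theorem measurableSet_facet (ν : Pt d) : MeasurableSet (T.facet ν) :=
  (T.isCompact_facet ν).measurableSet

theorem facet_subset_range {ν x₀ : Pt d} (hx₀ : inner ℝ ν x₀ = T.offset ν)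
    {U : Pt (d - 1) →ₗᵢ[ℝ] Pt d} (hU : ∀ z, inner ℝ ν z = 0 → ∃ y, U y = z) :
    T.facet ν ⊆ Set.range fun y => x₀ + U y := by
  intro x hx
  obtain ⟨y, hy⟩ := hU (x - x₀) (by rw [inner_sub_right, hx.2, hx₀, sub_self])
  exact ⟨y, by simp [hy]⟩

/-- The relative boundary of a facet is negligible. -/
theorem hausdorff_facet_diff_openFacet {ν : Pt d} (hν : ν ∈ T.normals) :
    μHE[d - 1] (T.facet ν \ T.openFacet ν) = 0 := by
  obtain ⟨x₀, hx₀⟩ := T.openFacet_nonempty hν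
  obtain ⟨U, hU0, hU1, -⟩ := exists_chart ν (T.norm_normal ν hν)
  rw [hausdorff_eq_volume_preimage x₀ U
    (Set.sdiff_subset.trans (T.facet_subset_range hx₀.1 hU1))]
  have hsub : (fun y => x₀ + U y) ⁻¹' (T.facet ν \ T.openFacet ν) ⊆
      ⋃ μ ∈ T.normals.filter (· ≠ ν), {y | inner ℝ μ (x₀ + U y) = T.offset μ} := by
    rintro y ⟨hy1, hy2⟩
    by_contra hcon
    simp only [Finset.mem_filter, Set.mem_iUnion, exists_prop, not_exists, not_and, and_imp] at hcon
    exact hy2 ⟨hy1.2, fun μ hμ hne => lt_of_le_of_ne (hy1.1 μ hμ) (hcon μ hμ hne)⟩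
  refine measure_mono_null hsub ((measure_biUnion_null_iff (Finset.countable_toSet _)).2 ?_)
  intro μ hμ
  rw [Finset.mem_coe, Finset.mem_filter] at hμ
  let p : Poly d := affinePoly (-T.offset μ) fun i => μ i
  have hp : ∀ x, peval p x = inner ℝ μ x - T.offset μ := by
    intro x
    rw [peval_affinePoly, PiLp.inner_apply]
    simp only [RCLike.inner_apply, conj_trivial]
    rw [neg_add_eq_sub]
    simp_rw [mul_comm]
  obtain ⟨q, -, hq⟩ := exists_peval_comp_affine x₀ U.toLinearMap (affinePoly_mem (-T.offset μ)
    fun i => μ i)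
  have hq' : ∀ y, peval q y = inner ℝ μ (x₀ + U y) - T.offset μ := fun y => (hq y).trans (hp _)
  have hq0 : q ≠ 0 := by
    rintro rfl
    have h1 := hq' 0
    rw [peval_zero, map_zero, add_zero] at h1
    have := hx₀.2 μ hμ.1 hμ.2
    linarith
  refine measure_mono_null (fun y hy => ?_) (volume_peval_eq_zero hq0)
  have hy' : inner ℝ μ (x₀ + U y) = T.offset μ := hy
  change peval q y = 0
  rw [hq', hy', sub_self]

theorem facet_sub_le_diam {x y : Pt d} (hx : x ∈ T.carrier) (hy : y ∈ T.carrier) :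
    ‖x - y‖ ≤ T.diam := by
  rw [← dist_eq_norm]
  exact Metric.dist_le_diam_of_mem T.bounded hx hy

theorem diam_nonneg : 0 ≤ T.diam := Metric.diam_nonneg

/-- An element with the volume lower bound contains a point far from any given facet. Otherwise it
would lie in a slab of height `c * T.diam` next to the facet, whose part within the diameter of `T`
has too small a volume. -/
theorem exists_gap_ge {ρ : ℝ} (hρ : 0 < ρ) : ∃ c > 0, ∀ T : ConvexPolytope d,
    ρ * T.diam ^ d ≤ (volume T.carrier).toReal → ∀ ν ∈ T.normals,
      ∃ a ∈ T.carrier, c * T.diam ≤ T.gap ν a := by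
  set κ := (volume (Metric.closedBall (0 : Pt (d - 1)) 1)).toReal
  have hκ : 0 ≤ κ := ENNReal.toReal_nonneg
  refine ⟨ρ / (2 ^ (d - 1) * κ + 1), by positivity, fun T hT ν hν => ?_⟩
  set c := ρ / (2 ^ (d - 1) * κ + 1) with hc
  have hc0 : 0 < c := by positivity
  by_contra! hcon
  obtain ⟨x₀, hx₀⟩ := T.openFacet_nonempty hν
  have hx₀T := T.facet_subset_carrier (T.openFacet_subset_facet hx₀)
  obtain ⟨U, hU0, hU1, hmp⟩ := exists_chart ν (T.norm_normal ν hν)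
  have hh : 0 < T.diam := by
    have h1 := hcon x₀ hx₀T
    rw [T.gap_of_mem_facet (T.openFacet_subset_facet hx₀)] at h1
    exact pos_of_mul_pos_right h1 hc0.le
  have hd : d = d - 1 + 1 := by
    rcases d with _ | m
    · have h1 := T.norm_normal ν hν
      simp [Subsingleton.elim ν 0] at h1
    · rfl
  have hmp' : MeasurePreserving (fun p : Pt (d - 1) × ℝ => x₀ + (U p.1 - p.2 • ν)) :=
    (measurePreserving_add_left volume x₀).comp hmp
  have hvol : volume T.carrier ≤
      volume (Metric.closedBall (0 : Pt (d - 1)) (2 * T.diam) ×ˢ Set.Icc 0 (c * T.diam)) := by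
    rw [← hmp'.measure_preimage T.measurableSet_carrier.nullMeasurableSet]
    refine measure_mono ?_
    rintro ⟨y, s⟩ hys
    have hxT : x₀ + (U y - s • ν) ∈ T.carrier := hys
    have hgap : T.gap ν (x₀ + (U y - s • ν)) = s := by
      rw [gap_add, T.gap_of_mem_facet (T.openFacet_subset_facet hx₀), inner_sub_right, hU0,
        inner_smul_right, real_inner_self_eq_norm_sq, T.norm_normal ν hν]
      ring
    have hs0 : 0 ≤ s := hgap ▸ T.gap_nonneg hν hxT
    have hs1 : s ≤ c * T.diam := (hgap ▸ hcon _ hxT).le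
    have h2 := T.facet_sub_le_diam hxT hx₀T
    rw [add_sub_cancel_left] at h2
    have h3 : s ≤ T.diam := by
      have h4 : s = -inner ℝ ν (U y - s • ν) := by
        rw [gap_add, T.gap_of_mem_facet (T.openFacet_subset_facet hx₀)] at hgap
        linarith
      rw [h4]
      calc -inner ℝ ν (U y - s • ν) ≤ ‖ν‖ * ‖U y - s • ν‖ :=
            (neg_le_abs _).trans (abs_real_inner_le_norm _ _)
        _ ≤ T.diam := by rw [T.norm_normal ν hν, one_mul]; exact h2
    refine ⟨?_, hs0, hs1⟩
    rw [mem_closedBall_zero_iff, ← U.norm_map y]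
    calc ‖U y‖ = ‖(U y - s • ν) + s • ν‖ := by rw [sub_add_cancel]
      _ ≤ ‖U y - s • ν‖ + ‖s • ν‖ := norm_add_le _ _
      _ ≤ T.diam + T.diam := by
          refine add_le_add h2 ?_
          rw [norm_smul, T.norm_normal ν hν, mul_one, Real.norm_of_nonneg hs0]
          exact h3
      _ = 2 * T.diam := by ring
  have hvol2 : (volume (Metric.closedBall (0 : Pt (d - 1)) (2 * T.diam) ×ˢ
      Set.Icc 0 (c * T.diam))).toReal = (2 * T.diam) ^ (d - 1) * κ * (c * T.diam) := by
    rw [Measure.volume_eq_prod, Measure.prod_prod, Measure.addHaar_closedBall' _ _ (by positivity),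
      Real.volume_Icc, ENNReal.toReal_mul, ENNReal.toReal_mul, ENNReal.toReal_ofReal
      (by positivity), ENNReal.toReal_ofReal (by rw [sub_zero]; positivity), sub_zero]
    simp [κ]
  have h5 := ENNReal.toReal_mono (by
    rw [Measure.volume_eq_prod, Measure.prod_prod]
    exact ENNReal.mul_ne_top measure_closedBall_lt_top.ne (by simp)) hvol
  rw [hvol2] at h5
  have h6 : ρ * T.diam ^ d ≤ (2 ^ (d - 1) * κ * c) * T.diam ^ d := by
    refine (hT.trans h5).trans (le_of_eq ?_)
    have h8 : T.diam ^ d = T.diam ^ (d - 1) * T.diam := by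
      rw [← pow_succ]; congr 1
    rw [h8, mul_pow]
    ring
  have h7 := le_of_mul_le_mul_right h6 (by positivity)
  rw [hc, mul_div_assoc', le_div_iff₀ (by positivity)] at h7
  nlinarith

end ConvexPolytope

/-! ### The divergence theorem on a polytope -/

theorem pd_continuous {d : ℕ} {n : WithTop ℕ∞} {φ : Pt d → ℝ} (hφ : ContDiff ℝ n φ) (hn : n ≠ 0)
    (i : Fin d) : Continuous (pd i φ) :=
  (hφ.continuous_fderiv hn).clm_apply continuous_const

theorem pd_mul {d : ℕ} {φ ψ : Pt d → ℝ} (hφ : Differentiable ℝ φ) (hψ : Differentiable ℝ ψ)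
    (i : Fin d) (x : Pt d) :
    pd i (fun x => φ x * ψ x) x = pd i φ x * ψ x + φ x * pd i ψ x := by
  rw [pd, fderiv_fun_mul (hφ x) (hψ x)]
  simp only [pd, add_apply, smul_apply, smul_eq_mul]
  ring

theorem pd_add {d : ℕ} {φ ψ : Pt d → ℝ} (hφ : Differentiable ℝ φ) (hψ : Differentiable ℝ ψ)
    (i : Fin d) (x : Pt d) : pd i (fun x => φ x + ψ x) x = pd i φ x + pd i ψ x := by
  rw [pd, fderiv_fun_add (hφ x) (hψ x)]
  simp only [pd, add_apply]

theorem pd_sub {d : ℕ} {φ ψ : Pt d → ℝ} (hφ : Differentiable ℝ φ) (hψ : Differentiable ℝ ψ)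
    (i : Fin d) (x : Pt d) : pd i (fun x => φ x - ψ x) x = pd i φ x - pd i ψ x := by
  rw [pd, fderiv_fun_sub (hφ x) (hψ x)]
  simp only [pd, sub_apply]

theorem integral_pd_eq_zero {d : ℕ} {φ : Pt d → ℝ} (hφ : ContDiff ℝ 1 φ)
    (hc : HasCompactSupport φ) (i : Fin d) : ∫ x, pd i φ x = 0 := by
  have hc' : HasCompactSupport (pd i φ) := (hc.fderiv (𝕜 := ℝ)).comp_left
    (g := fun L : Pt d →L[ℝ] ℝ => L (EuclideanSpace.single i (1 : ℝ))) rfl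
  have hi := (pd_continuous hφ one_ne_zero i).integrable_of_hasCompactSupport hc' (μ := volume)
  have h := integral_mul_fderiv_eq_neg_fderiv_mul_of_integrable (μ := (volume : Measure (Pt d)))
    (f := fun _ => (1 : ℝ)) (g := φ) (v := EuclideanSpace.single i (1 : ℝ)) (by simp)
    (by simp only [one_mul]; exact hi) (by simpa using
      hφ.continuous.integrable_of_hasCompactSupport hc (μ := volume)) (by simp)
    (fun x _ => (hφ.differentiable one_ne_zero) x)
  simpa [pd] using h

theorem smoothTransition_deriv_eq_zero {s : ℝ} (hs : s ∉ Set.Icc (0 : ℝ) 1) :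
    deriv Real.smoothTransition s = 0 := by
  rw [Set.mem_Icc, not_and_or, not_le, not_le] at hs
  rcases hs with hs | hs
  · have : Real.smoothTransition =ᶠ[𝓝 s] fun _ => 0 := by
      filter_upwards [gt_mem_nhds hs] with t ht
      exact Real.smoothTransition.zero_of_nonpos ht.le
    rw [this.deriv_eq, deriv_const]
  · have : Real.smoothTransition =ᶠ[𝓝 s] fun _ => 1 := by
      filter_upwards [lt_mem_nhds hs] with t ht
      exact Real.smoothTransition.one_of_one_le ht.le
    rw [this.deriv_eq, deriv_const]

theorem smoothTransition_contDiff : ContDiff ℝ ∞ Real.smoothTransition :=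
  Real.smoothTransition.contDiff

theorem smoothTransition_deriv_continuous : Continuous (deriv Real.smoothTransition) :=
  (smoothTransition_contDiff.of_le (by simp)).continuous_deriv_one

theorem integral_deriv_smoothTransition : ∫ s, deriv Real.smoothTransition s = 1 := by
  have h1 : ∫ s in (0 : ℝ)..1, deriv Real.smoothTransition s = 1 := by
    rw [intervalIntegral.integral_deriv_eq_sub
      (fun x _ => (smoothTransition_contDiff.differentiable (by simp)) x)
      (smoothTransition_deriv_continuous.intervalIntegrable _ _)]
    simp
  rw [intervalIntegral.integral_of_le zero_le_one, ← integral_Icc_eq_integral_Ioc] at h1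
  rw [← h1, setIntegral_eq_integral_of_forall_compl_eq_zero]
  exact fun s hs => smoothTransition_deriv_eq_zero hs

namespace ConvexPolytope

variable {d : ℕ} (T : ConvexPolytope d)

/-- The product of the cut-offs `θ(n l_ν)` over the facets in `s`, where `l_ν` is the distance from
the facet and `θ` a smooth step. -/
def cutoff (s : Finset (Pt d)) (n : ℝ) (x : Pt d) : ℝ :=
  ∏ ν ∈ s, Real.smoothTransition (n * T.gap ν x)

theorem cutoff_contDiff (s : Finset (Pt d)) (n : ℝ) : ContDiff ℝ ∞ (T.cutoff s n) := by
  unfold cutoff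
  exact contDiff_prod fun ν _ => smoothTransition_contDiff.comp
    (contDiff_const.mul (T.gap_contDiff ν))

theorem cutoff_nonneg (s : Finset (Pt d)) (n : ℝ) (x : Pt d) : 0 ≤ T.cutoff s n x :=
  Finset.prod_nonneg fun _ _ => Real.smoothTransition.nonneg _

theorem cutoff_le_one (s : Finset (Pt d)) (n : ℝ) (x : Pt d) : T.cutoff s n x ≤ 1 :=
  Finset.prod_le_one (fun _ _ => Real.smoothTransition.nonneg _)
    fun _ _ => Real.smoothTransition.le_one _

theorem gap_pos_of_cutoff_ne_zero {s : Finset (Pt d)} {n : ℝ} (hn : 0 < n) {x : Pt d}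
    (hx : T.cutoff s n x ≠ 0) {ν : Pt d} (hν : ν ∈ s) : 0 < T.gap ν x := by
  have h := Finset.prod_ne_zero_iff.1 hx ν hν
  by_contra hcon
  exact h (Real.smoothTransition.zero_of_nonpos
    (mul_nonpos_of_nonneg_of_nonpos hn.le (not_lt.1 hcon)))

theorem tendsto_cutoff_one {s : Finset (Pt d)} {x : ℕ → Pt d} {z : Pt d}
    (hx : Tendsto x atTop (𝓝 z)) (hz : ∀ ν ∈ s, 0 < T.gap ν z) :
    ∀ᶠ n : ℕ in atTop, T.cutoff s (n + 1) (x n) = 1 := by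
  have h1 : ∀ ν ∈ s, ∀ᶠ n : ℕ in atTop, 1 ≤ ((n : ℝ) + 1) * T.gap ν (x n) := by
    intro ν hν
    have h2 : Tendsto (fun n => T.gap ν (x n)) atTop (𝓝 (T.gap ν z)) :=
      ((T.gap_continuous ν).tendsto z).comp hx
    have h3 : Tendsto (fun n : ℕ => ((n : ℝ) + 1) * T.gap ν (x n)) atTop atTop :=
      (tendsto_atTop_add_const_right _ 1 tendsto_natCast_atTop_atTop).atTop_mul_pos (hz ν hν) h2
    exact h3.eventually_ge_atTop 1
  filter_upwards [(Finset.eventually_all s).2 h1] with n hn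
  exact Finset.prod_eq_one fun ν hν => Real.smoothTransition.one_of_one_le (hn ν hν)

theorem tendsto_cutoff_zero {s : Finset (Pt d)} {x : ℕ → Pt d} {z : Pt d}
    (hx : Tendsto x atTop (𝓝 z)) {ν : Pt d} (hν : ν ∈ s) (hz : T.gap ν z < 0) :
    ∀ᶠ n : ℕ in atTop, T.cutoff s (n + 1) (x n) = 0 := by
  have h2 : Tendsto (fun n => T.gap ν (x n)) atTop (𝓝 (T.gap ν z)) :=
    ((T.gap_continuous ν).tendsto z).comp hx
  filter_upwards [h2.eventually (gt_mem_nhds hz)] with n hn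
  exact Finset.prod_eq_zero hν (Real.smoothTransition.zero_of_nonpos
    (mul_nonpos_of_nonneg_of_nonpos (by positivity) hn.le))

theorem pd_cutoff (n : ℝ) (i : Fin d) (x : Pt d) :
    pd i (T.cutoff T.normals n) x = ∑ ν ∈ T.normals,
      -(ν i * (n * (deriv Real.smoothTransition (n * T.gap ν x) *
        T.cutoff (T.normals.erase ν) n x))) := by
  classical
  have hgap : ∀ ν, HasFDerivAt (T.gap ν) (-innerSL ℝ ν) x := by
    intro ν
    have := ((innerSL ℝ ν).hasFDerivAt (x := x)).const_sub (T.offset ν)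
    exact this
  have h1 : ∀ ν ∈ T.normals, HasFDerivAt (fun x => Real.smoothTransition (n * T.gap ν x))
      (deriv Real.smoothTransition (n * T.gap ν x) • (n • (-innerSL ℝ ν))) x := by
    intro ν _
    have h2 := ((smoothTransition_contDiff.differentiable (by simp))
      (n * T.gap ν x)).hasDerivAt
    exact h2.comp_hasFDerivAt x ((hgap ν).const_mul n)
  have h2 := HasFDerivAt.finsetProd h1
  rw [pd, show T.cutoff T.normals n = fun x => ∏ ν ∈ T.normals,
    Real.smoothTransition (n * T.gap ν x) from rfl, h2.fderiv, sum_apply]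
  refine Finset.sum_congr rfl fun ν _ => ?_
  simp only [smul_apply, neg_apply, innerSL_apply_apply, smul_eq_mul,
    EuclideanSpace.inner_single_right, cutoff]
  simp
  ring

/-- The smoothed surface integrals converge to the integral over the facet. -/
theorem tendsto_smoothed_facet_integral {g : Pt d → ℝ} (hg : Continuous g) {ν : Pt d}
    (hν : ν ∈ T.normals) :
    Tendsto (fun n : ℕ => ∫ x, g x * (((n : ℝ) + 1) * (deriv Real.smoothTransition
      (((n : ℝ) + 1) * T.gap ν x) * T.cutoff (T.normals.erase ν) (n + 1) x))) atTop
      (𝓝 (∫ x in T.facet ν, g x ∂μHE[d - 1])) := by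
  classical
  obtain ⟨x₀, hx₀⟩ := T.openFacet_nonempty hν
  have hx₀F := T.openFacet_subset_facet hx₀
  have hx₀T := T.facet_subset_carrier hx₀F
  have hν1 := T.norm_normal ν hν
  obtain ⟨U, hU0, hU1, hmp⟩ := exists_chart ν hν1
  set A : Pt (d - 1) × ℝ → Pt d := fun p => x₀ + (U p.1 - p.2 • ν) with hA
  have hAc : Continuous A := by fun_prop
  have hmp' : MeasurePreserving A := (measurePreserving_add_left volume x₀).comp hmp
  have hgapA : ∀ p, T.gap ν (A p) = p.2 := by
    intro p
    rw [hA, gap_add, T.gap_of_mem_facet hx₀F, inner_sub_right, hU0, inner_smul_right,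
      real_inner_self_eq_norm_sq, hν1]
    ring
  obtain ⟨K₁, hK₁⟩ := T.isCompact_carrier.exists_bound_of_continuousOn hg.continuousOn
  obtain ⟨K₂, hK₂⟩ := (isCompact_Icc (a := (0 : ℝ)) (b := 1)).exists_bound_of_continuousOn
    smoothTransition_deriv_continuous.continuousOn
  set B : Set (Pt (d - 1) × ℝ) := Metric.closedBall 0 (T.diam + 1) ×ˢ Set.Icc 0 1 with hB
  have hBm : MeasurableSet B := measurableSet_closedBall.prod measurableSet_Icc
  have hBfin : volume B ≠ ⊤ := by
    rw [hB, Measure.volume_eq_prod, Measure.prod_prod]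
    exact ENNReal.mul_ne_top measure_closedBall_lt_top.ne (by simp)
  set bound : Pt (d - 1) × ℝ → ℝ := B.indicator fun _ => K₂ * K₁ with hbound
  have hboundi : Integrable bound := (integrable_indicator_iff hBm).2 (integrableOn_const hBfin)
  -- Every integrand below is supported in a fixed bounded set of the coordinates `(y, s)`.
  have hmain : ∀ (n s t : ℝ) (y : Pt (d - 1)), 0 < n → 0 ≤ s → s ≤ 1 → t = n * s →
      ‖deriv Real.smoothTransition t * (g (A (y, s)) *
        T.cutoff (T.normals.erase ν) n (A (y, s)))‖ ≤ K₂ * K₁ ∧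
      (deriv Real.smoothTransition t * (g (A (y, s)) *
        T.cutoff (T.normals.erase ν) n (A (y, s))) ≠ 0 → ‖y‖ ≤ T.diam + 1 ∧ t ∈ Set.Icc 0 1) := by
    intro n s t y hn hs0 hs1 ht
    by_cases h0 : deriv Real.smoothTransition t * (g (A (y, s)) *
        T.cutoff (T.normals.erase ν) n (A (y, s))) = 0
    · refine ⟨?_, fun h => (h h0).elim⟩
      rw [h0, norm_zero]
      exact mul_nonneg ((norm_nonneg _).trans (hK₂ 0 (by simp)))
        ((norm_nonneg _).trans (hK₁ x₀ hx₀T))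
    have ht1 : t ∈ Set.Icc (0 : ℝ) 1 := by
      by_contra hcon
      exact h0 (by rw [smoothTransition_deriv_eq_zero hcon, zero_mul])
    have hxT : A (y, s) ∈ T.carrier := by
      intro μ hμ
      refine sub_nonneg.1 (?_ : 0 ≤ T.gap μ (A (y, s)))
      rcases eq_or_ne μ ν with rfl | hne
      · rw [hgapA]; exact hs0
      · exact (T.gap_pos_of_cutoff_ne_zero hn (right_ne_zero_of_mul (right_ne_zero_of_mul h0))
          (Finset.mem_erase.2 ⟨hne, hμ⟩)).le
    refine ⟨?_, fun _ => ⟨?_, ht1⟩⟩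
    · rw [norm_mul, norm_mul]
      refine mul_le_mul (hK₂ t ht1) ?_ (by positivity) ((norm_nonneg _).trans (hK₂ t ht1))
      calc ‖g (A (y, s))‖ * ‖T.cutoff (T.normals.erase ν) n (A (y, s))‖ ≤ K₁ * 1 := by
            refine mul_le_mul (hK₁ _ hxT) ?_ (norm_nonneg _) ((norm_nonneg _).trans (hK₁ x₀ hx₀T))
            rw [Real.norm_of_nonneg (T.cutoff_nonneg _ _ _)]
            exact T.cutoff_le_one _ _ _
        _ = K₁ := mul_one _
    · have h2 := T.facet_sub_le_diam hxT hx₀T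
      rw [hA, add_sub_cancel_left] at h2
      simp only at h2
      rw [← U.norm_map y]
      calc ‖U y‖ = ‖(U y - s • ν) + s • ν‖ := by rw [sub_add_cancel]
        _ ≤ ‖U y - s • ν‖ + ‖s • ν‖ := norm_add_le _ _
        _ ≤ T.diam + 1 := by
            refine add_le_add h2 ?_
            rw [norm_smul, hν1, mul_one, Real.norm_of_nonneg hs0]
            exact hs1
  set G : ℕ → Pt (d - 1) × ℝ → ℝ := fun n p =>
    deriv Real.smoothTransition ((n + 1) * p.2) * (g (A p) *
      T.cutoff (T.normals.erase ν) (n + 1) (A p)) with hG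
  set F : ℕ → Pt (d - 1) × ℝ → ℝ := fun n p =>
    deriv Real.smoothTransition p.2 * (g (A (p.1, ((n : ℝ) + 1)⁻¹ * p.2)) *
      T.cutoff (T.normals.erase ν) (n + 1) (A (p.1, ((n : ℝ) + 1)⁻¹ * p.2))) with hF
  have hGc : ∀ n, Continuous (G n) := fun n =>
    (smoothTransition_deriv_continuous.comp (by fun_prop)).mul ((hg.comp hAc).mul
      ((T.cutoff_contDiff _ _).continuous.comp hAc))
  have hFc : ∀ n, Continuous (F n) := fun n => by
    have h1 : Continuous fun p : Pt (d - 1) × ℝ => A (p.1, ((n : ℝ) + 1)⁻¹ * p.2) :=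
      hAc.comp (by fun_prop)
    exact (smoothTransition_deriv_continuous.comp continuous_snd).mul ((hg.comp h1).mul
      ((T.cutoff_contDiff _ _).continuous.comp h1))
  have hn0 : ∀ n : ℕ, (0 : ℝ) < n + 1 := fun n => by positivity
  have hn1 : ∀ n : ℕ, ((n : ℝ) + 1)⁻¹ ≤ 1 := fun n => inv_le_one_of_one_le₀ (by simp)
  have hFb : ∀ n p, ‖F n p‖ ≤ bound p := by
    rintro n ⟨y, s⟩
    by_cases hs : s ∈ Set.Icc (0 : ℝ) 1
    · have h1 := hmain (n + 1) (((n : ℝ) + 1)⁻¹ * s) s y (hn0 n)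
        (mul_nonneg (inv_nonneg.2 (hn0 n).le) hs.1)
        (mul_le_one₀ (hn1 n) hs.1 hs.2) (by rw [mul_inv_cancel_left₀ (hn0 n).ne'])
      by_cases h0 : F n (y, s) = 0
      · rw [h0, norm_zero]
        exact Set.indicator_nonneg (fun _ _ => (norm_nonneg _).trans h1.1) _
      · have h2 := h1.2 h0
        have hmem : ((y, s) : Pt (d - 1) × ℝ) ∈ B := ⟨by simpa using h2.1, hs⟩
        rw [hbound, Set.indicator_of_mem hmem]
        exact h1.1
    · have h0 : F n (y, s) = 0 := by
        simp only [hF]; rw [smoothTransition_deriv_eq_zero hs, zero_mul]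
      rw [h0, norm_zero]
      exact Set.indicator_nonneg (fun _ _ => mul_nonneg ((norm_nonneg _).trans (hK₂ 0 (by simp)))
        ((norm_nonneg _).trans (hK₁ x₀ hx₀T))) _
  have hGb : ∀ n p, ‖G n p‖ ≤ bound p := by
    rintro n ⟨y, s⟩
    by_cases h0 : G n (y, s) = 0
    · rw [h0, norm_zero]
      exact Set.indicator_nonneg (fun _ _ => mul_nonneg ((norm_nonneg _).trans (hK₂ 0 (by simp)))
        ((norm_nonneg _).trans (hK₁ x₀ hx₀T))) _
    have hs : ((n : ℝ) + 1) * s ∈ Set.Icc (0 : ℝ) 1 := by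
      by_contra hcon
      exact h0 (by simp only [hG]; rw [smoothTransition_deriv_eq_zero hcon, zero_mul])
    have hs0 : 0 ≤ s := nonneg_of_mul_nonneg_right hs.1 (hn0 n)
    have hs1 : s ≤ 1 := le_trans (le_mul_of_one_le_left hs0 (by simp)) hs.2
    have h1 := hmain (n + 1) s (((n : ℝ) + 1) * s) y (hn0 n) hs0 hs1 rfl
    have hmem : ((y, s) : Pt (d - 1) × ℝ) ∈ B := ⟨by simpa using (h1.2 h0).1, hs0, hs1⟩
    rw [hbound, Set.indicator_of_mem hmem]
    exact h1.1
  have hFi : ∀ n, Integrable (F n) := fun n =>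
    hboundi.mono' (hFc n).aestronglyMeasurable (ae_of_all _ (hFb n))
  have hGi : ∀ n, Integrable (G n) := fun n =>
    hboundi.mono' (hGc n).aestronglyMeasurable (ae_of_all _ (hGb n))
  have hscale : ∀ n : ℕ, ∫ x, g x * (((n : ℝ) + 1) * (deriv Real.smoothTransition
      (((n : ℝ) + 1) * T.gap ν x) * T.cutoff (T.normals.erase ν) (n + 1) x)) = ∫ p, F n p := by
    intro n
    have hemb : ∫ x, g x * (((n : ℝ) + 1) * (deriv Real.smoothTransition
        (((n : ℝ) + 1) * T.gap ν x) * T.cutoff (T.normals.erase ν) (n + 1) x)) =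
        ∫ p, ((n : ℝ) + 1) * G n p := by
      have hc : Continuous fun x => g x * (((n : ℝ) + 1) * (deriv Real.smoothTransition
          (((n : ℝ) + 1) * T.gap ν x) * T.cutoff (T.normals.erase ν) (n + 1) x)) :=
        hg.mul (continuous_const.mul ((smoothTransition_deriv_continuous.comp
          (continuous_const.mul (T.gap_continuous ν))).mul (T.cutoff_contDiff _ _).continuous))
      rw [← hmp'.map_eq, integral_map hmp'.measurable.aemeasurable hc.aestronglyMeasurable]
      refine integral_congr_ae (ae_of_all _ fun p => ?_)
      simp only [hG, hgapA]
      ring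
    rw [hemb, integral_const_mul, Measure.volume_eq_prod, integral_prod _ (hGi n),
      integral_prod _ (hFi n), ← integral_const_mul]
    refine integral_congr_ae (ae_of_all _ fun y => ?_)
    have h1 := Measure.integral_comp_mul_left (fun s => G n (y, s)) (((n : ℝ) + 1)⁻¹)
    rw [inv_inv, abs_of_pos (hn0 n), smul_eq_mul] at h1
    simp only
    rw [← h1]
    refine integral_congr_ae (ae_of_all _ fun s => ?_)
    simp only [hG, hF, mul_inv_cancel_left₀ (hn0 n).ne']
  simp only [hscale]
  -- The pointwise limit, off the preimage of the relative boundary of the facet.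
  set P : Set (Pt (d - 1)) := (fun y => x₀ + U y) ⁻¹' T.facet ν with hP
  have hPm : MeasurableSet P := (isometry_const_add x₀ U).continuous.measurable
    (T.measurableSet_facet ν)
  have hlim_eq : ∫ x in T.facet ν, g x ∂μHE[d - 1] =
      ∫ p : Pt (d - 1) × ℝ, P.indicator (fun y => g (x₀ + U y)) p.1 *
        deriv Real.smoothTransition p.2 := by
    rw [setIntegral_hausdorff_eq x₀ U (T.measurableSet_facet ν)
      (T.facet_subset_range hx₀.1 hU1), Measure.volume_eq_prod,
      integral_prod_mul (P.indicator fun y => g (x₀ + U y)) (deriv Real.smoothTransition),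
      integral_deriv_smoothTransition, mul_one, integral_indicator hPm]
  rw [hlim_eq]
  refine tendsto_integral_of_dominated_convergence bound
    (fun n => (hFc n).aestronglyMeasurable) hboundi (fun n => ae_of_all _ (hFb n)) ?_
  have hnull : ∀ᵐ y : Pt (d - 1), x₀ + U y ∉ T.facet ν \ T.openFacet ν := by
    have h1 := T.hausdorff_facet_diff_openFacet hν
    rw [hausdorff_eq_volume_preimage x₀ U
      (Set.sdiff_subset.trans (T.facet_subset_range hx₀.1 hU1))] at h1
    exact measure_eq_zero_iff_ae_notMem.1 h1
  have hnull' : ∀ᵐ p : Pt (d - 1) × ℝ, x₀ + U p.1 ∉ T.facet ν \ T.openFacet ν :=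
    Measure.quasiMeasurePreserving_fst.ae hnull
  filter_upwards [hnull'] with p hp
  have hto : Tendsto (fun n : ℕ => A (p.1, ((n : ℝ) + 1)⁻¹ * p.2)) atTop (𝓝 (x₀ + U p.1)) := by
    have h1 : Tendsto (fun n : ℕ => ((n : ℝ) + 1)⁻¹ * p.2) atTop (𝓝 (0 * p.2)) := by
      have := tendsto_one_div_add_atTop_nhds_zero_nat (𝕜 := ℝ)
      simp only [one_div] at this
      exact this.mul_const _
    have h2 : Tendsto (fun n : ℕ => A (p.1, ((n : ℝ) + 1)⁻¹ * p.2)) atTop (𝓝 (A (p.1, 0))) := by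
      rw [zero_mul] at h1
      exact (hAc.tendsto _).comp (tendsto_const_nhds.prodMk_nhds h1)
    simpa [hA] using h2
  rw [mul_comm]
  refine Tendsto.mul tendsto_const_nhds ?_
  by_cases hxF : x₀ + U p.1 ∈ T.facet ν
  · have hxO : x₀ + U p.1 ∈ T.openFacet ν := by
      by_contra hcon
      exact hp ⟨hxF, hcon⟩
    rw [Set.indicator_of_mem (show p.1 ∈ P from hxF)]
    have h1 := T.tendsto_cutoff_one (s := T.normals.erase ν) hto fun μ hμ =>
      sub_pos.2 (hxO.2 μ (Finset.mem_of_mem_erase hμ) (Finset.ne_of_mem_erase hμ))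
    refine Tendsto.congr' (f₁ := fun n : ℕ => g (A (p.1, ((n : ℝ) + 1)⁻¹ * p.2))) ?_
      ((hg.tendsto _).comp hto)
    filter_upwards [h1] with n hn
    rw [hn, mul_one]
  · rw [Set.indicator_of_notMem (show p.1 ∉ P from hxF)]
    have hex : ∃ μ ∈ T.normals.erase ν, T.gap μ (x₀ + U p.1) < 0 := by
      by_contra! hcon
      refine hxF ⟨fun μ hμ => ?_, by rw [inner_add_right, hU0, add_zero, hx₀.1]⟩
      rcases eq_or_ne μ ν with rfl | hne
      · rw [inner_add_right, hU0, add_zero, hx₀.1]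
      · exact sub_nonneg.1 (hcon μ (Finset.mem_erase.2 ⟨hne, hμ⟩))
    obtain ⟨μ, hμ, hneg⟩ := hex
    refine Tendsto.congr' (f₁ := fun _ => (0 : ℝ)) ?_ tendsto_const_nhds
    filter_upwards [T.tendsto_cutoff_zero hto hμ hneg] with n hn
    rw [hn, mul_zero]

/-- The divergence theorem on a convex polytope, one component at a time. It is obtained by
integrating by parts against smooth cut-offs of `T` whose gradients concentrate on the facets. -/
theorem integral_pd_eq {g : Pt d → ℝ} (hg : ContDiff ℝ 1 g) (i : Fin d) :
    ∫ x in T.carrier, pd i g x =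
      ∑ ν ∈ T.normals, ν i * ∫ x in T.facet ν, g x ∂μHE[d - 1] := by
  classical
  set χ : ℕ → Pt d → ℝ := fun n => T.cutoff T.normals (n + 1) with hχ
  have hχd : ∀ n, ContDiff ℝ 1 (χ n) := fun n => (T.cutoff_contDiff _ _).of_le (by simp)
  have hn0 : ∀ n : ℕ, (0 : ℝ) < n + 1 := fun n => by positivity
  have hχ0 : ∀ n x, x ∉ T.carrier → χ n x = 0 := by
    intro n x hx
    by_contra hcon
    exact hx fun ν hν => sub_nonneg.1 (T.gap_pos_of_cutoff_ne_zero (hn0 n) hcon hν).le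
  have hχs : ∀ n, HasCompactSupport (χ n) := fun n =>
    HasCompactSupport.intro T.isCompact_carrier (hχ0 n)
  have hpd := pd_continuous hg one_ne_zero i
  have hi1 : ∀ n, Integrable fun x => pd i g x * χ n x := fun n =>
    (hpd.mul (hχd n).continuous).integrable_of_hasCompactSupport (hχs n).mul_left
  have hi2 : ∀ n : ℕ, ∀ ν ∈ T.normals, Integrable fun x => g x * (((n : ℝ) + 1) *
      (deriv Real.smoothTransition (((n : ℝ) + 1) * T.gap ν x) *
        T.cutoff (T.normals.erase ν) (n + 1) x)) := by
    intro n ν hν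
    have hc : Continuous fun x => g x * (((n : ℝ) + 1) * (deriv Real.smoothTransition
        (((n : ℝ) + 1) * T.gap ν x) * T.cutoff (T.normals.erase ν) (n + 1) x)) :=
      hg.continuous.mul (continuous_const.mul ((smoothTransition_deriv_continuous.comp
        (continuous_const.mul (T.gap_continuous ν))).mul (T.cutoff_contDiff _ _).continuous))
    refine hc.integrable_of_hasCompactSupport (HasCompactSupport.intro T.isCompact_carrier ?_)
    intro x hx
    by_contra hcon
    refine hx fun μ hμ => sub_nonneg.1 (?_ : 0 ≤ T.gap μ x)
    have h1 := right_ne_zero_of_mul (right_ne_zero_of_mul hcon)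
    rcases eq_or_ne μ ν with rfl | hne
    · by_contra hneg
      refine left_ne_zero_of_mul h1 (smoothTransition_deriv_eq_zero fun hmem => ?_)
      exact hneg (nonneg_of_mul_nonneg_right hmem.1 (hn0 n))
    · exact (T.gap_pos_of_cutoff_ne_zero (hn0 n) (right_ne_zero_of_mul h1)
        (Finset.mem_erase.2 ⟨hne, hμ⟩)).le
  have hident : ∀ n : ℕ, ∫ x, pd i g x * χ n x = ∑ ν ∈ T.normals, ν i *
      ∫ x, g x * (((n : ℝ) + 1) * (deriv Real.smoothTransition
      (((n : ℝ) + 1) * T.gap ν x) * T.cutoff (T.normals.erase ν) (n + 1) x)) := by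
    intro n
    have h0 := integral_pd_eq_zero (hg.mul (hχd n)) (hχs n).mul_left i
    have h1 : ∀ x, pd i (fun x => g x * χ n x) x = pd i g x * χ n x -
        ∑ ν ∈ T.normals, ν i * (g x * (((n : ℝ) + 1) * (deriv Real.smoothTransition
        (((n : ℝ) + 1) * T.gap ν x) * T.cutoff (T.normals.erase ν) (n + 1) x))) := by
      intro x
      rw [pd_mul (hg.differentiable one_ne_zero) ((hχd n).differentiable one_ne_zero), hχ,
        pd_cutoff, Finset.mul_sum, sub_eq_add_neg, ← Finset.sum_neg_distrib]
      congr 1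
      exact Finset.sum_congr rfl fun ν _ => by ring
    rw [integral_congr_ae (ae_of_all _ h1), integral_sub (hi1 n)
      (integrable_finsetSum _ fun ν hν => (hi2 n ν hν).const_mul _),
      integral_finsetSum _ fun ν hν => (hi2 n ν hν).const_mul _] at h0
    rw [sub_eq_zero.1 h0]
    exact Finset.sum_congr rfl fun ν _ => integral_const_mul _ _
  have hlim1 : Tendsto (fun n => ∫ x, pd i g x * χ n x) atTop
      (𝓝 (∫ x in T.carrier, pd i g x)) := by
    rw [← integral_indicator T.measurableSet_carrier]
    refine tendsto_integral_of_dominated_convergence (T.carrier.indicator fun x => |pd i g x|)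
      (fun n => (hi1 n).aestronglyMeasurable) ?_ ?_ ?_
    · rw [integrable_indicator_iff T.measurableSet_carrier]
      exact hpd.abs.continuousOn.integrableOn_compact T.isCompact_carrier
    · refine fun n => ae_of_all _ fun x => ?_
      by_cases hx : x ∈ T.carrier
      · rw [Set.indicator_of_mem hx, norm_mul, Real.norm_of_nonneg (T.cutoff_nonneg _ _ _)]
        exact mul_le_of_le_one_right (norm_nonneg _) (T.cutoff_le_one _ _ _)
      · rw [hχ0 n x hx, mul_zero, norm_zero, Set.indicator_of_notMem hx]
    · filter_upwards [T.interior_ae_eq] with x hx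
      by_cases hxT : x ∈ T.carrier
      · have hxi : x ∈ interior T.carrier := hx.mpr hxT
        rw [interior_carrier] at hxi
        rw [Set.indicator_of_mem hxT]
        refine Tendsto.congr' (f₁ := fun _ => pd i g x) ?_ tendsto_const_nhds
        filter_upwards [T.tendsto_cutoff_one tendsto_const_nhds hxi] with n hn
        rw [hχ]
        simp only
        rw [hn, mul_one]
      · rw [Set.indicator_of_notMem hxT]
        simp only [hχ0 _ x hxT, mul_zero]
        exact tendsto_const_nhds
  refine tendsto_nhds_unique hlim1 ?_
  simp only [hident]
  exact tendsto_finsetSum _ fun ν hν =>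
    (T.tendsto_smoothed_facet_integral hg.continuous hν).const_mul _

end ConvexPolytope

end WG
end

noncomputable section

namespace WG

/-! ### The `L²` norm with respect to a measure -/

/-- The `L²(μ)` norm of a real function, `√(∫ f² dμ)`. -/
def nrm {α : Type*} [MeasurableSpace α] (μ : Measure α) (f : α → ℝ) : ℝ :=
  Real.sqrt (∫ x, f x ^ 2 ∂μ)

section Nrm

variable {α : Type*} [MeasurableSpace α] {μ : Measure α} {f g : α → ℝ}

theorem nrm_nonneg : 0 ≤ nrm μ f := Real.sqrt_nonneg _

theorem nrm_sq : nrm μ f ^ 2 = ∫ x, f x ^ 2 ∂μ :=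
  Real.sq_sqrt (integral_nonneg fun _ => sq_nonneg _)

theorem nrm_congr (h : f =ᵐ[μ] g) : nrm μ f = nrm μ g := by
  unfold nrm
  congr 1
  exact integral_congr_ae (h.mono fun x hx => by simp only [hx])

theorem nrm_eq_toReal (hf : MemLp f 2 μ) : nrm μ f = (eLpNorm f 2 μ).toReal := by
  rw [hf.eLpNorm_eq_integral_rpow_norm (by simp) (by simp), ENNReal.toReal_ofReal (by positivity),
    nrm, Real.sqrt_eq_rpow]
  simp

theorem nrm_eq_norm_toLp (hf : MemLp f 2 μ) : nrm μ f = ‖hf.toLp f‖ := by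
  rw [Lp.norm_toLp, nrm_eq_toReal hf]

theorem nrm_add_le (hf : MemLp f 2 μ) (hg : MemLp g 2 μ) :
    nrm μ (fun x => f x + g x) ≤ nrm μ f + nrm μ g := by
  have h : MemLp (fun x => f x + g x) 2 μ := hf.add hg
  rw [nrm_eq_norm_toLp hf, nrm_eq_norm_toLp hg, nrm_eq_norm_toLp h]
  exact norm_add_le (hf.toLp f) (hg.toLp g)

theorem nrm_neg : nrm μ (fun x => -f x) = nrm μ f := by simp [nrm]

theorem nrm_sub_comm : nrm μ (fun x => f x - g x) = nrm μ (fun x => g x - f x) := by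
  rw [← nrm_neg]; simp

theorem nrm_sub_le_sub {h : α → ℝ} (hf : MemLp f 2 μ) (hg : MemLp g 2 μ) (hh : MemLp h 2 μ) :
    nrm μ (fun x => f x - h x) ≤ nrm μ (fun x => f x - g x) + nrm μ (fun x => g x - h x) := by
  have := nrm_add_le (f := fun x => f x - g x) (g := fun x => g x - h x) (hf.sub hg) (hg.sub hh)
  simpa using this

theorem nrm_le_nrm_add_nrm_sub (hf : MemLp f 2 μ) (hg : MemLp g 2 μ) :
    nrm μ f ≤ nrm μ g + nrm μ (fun x => f x - g x) := by
  have := nrm_add_le hg (g := fun x => f x - g x) (hf.sub hg)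
  simpa using this

theorem nrm_const_mul (c : ℝ) : nrm μ (fun x => c * f x) = |c| * nrm μ f := by
  simp only [nrm, mul_pow, integral_const_mul]
  rw [Real.sqrt_mul (sq_nonneg c), Real.sqrt_sq_eq_abs]

theorem nrm_zero : nrm μ (fun _ => (0 : ℝ)) = 0 := by simp [nrm]

theorem integrable_mul_of_memLp (hf : MemLp f 2 μ) (hg : MemLp g 2 μ) :
    Integrable (fun x => f x * g x) μ := hf.integrable_mul hg

theorem abs_integral_mul_le (hf : MemLp f 2 μ) (hg : MemLp g 2 μ) :
    |∫ x, f x * g x ∂μ| ≤ nrm μ f * nrm μ g := by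
  have h1 : ∫ x, f x * g x ∂μ = inner ℝ (hg.toLp g) (hf.toLp f) := by
    rw [L2.inner_def]
    refine integral_congr_ae ?_
    filter_upwards [hf.coeFn_toLp, hg.coeFn_toLp] with x h1 h2
    rw [h1, h2]; simp
  rw [h1, nrm_eq_norm_toLp hf, nrm_eq_norm_toLp hg, mul_comm]
  exact abs_real_inner_le_norm _ _

theorem integral_mul_le (hf : MemLp f 2 μ) (hg : MemLp g 2 μ) :
    ∫ x, f x * g x ∂μ ≤ nrm μ f * nrm μ g := (le_abs_self _).trans (abs_integral_mul_le hf hg)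

theorem ae_eq_zero_of_nrm (hf : MemLp f 2 μ) (h : nrm μ f = 0) : f =ᵐ[μ] 0 := by
  have h1 : ∫ x, f x ^ 2 ∂μ = 0 := by rw [← nrm_sq, h]; simp
  rw [integral_eq_zero_iff_of_nonneg (fun x => sq_nonneg _) hf.integrable_sq] at h1
  filter_upwards [h1] with x hx
  simpa using hx

theorem tendsto_integral_mul {F : ℕ → α → ℝ} (hF : ∀ n, MemLp (F n) 2 μ) (hf : MemLp f 2 μ)
    (hg : MemLp g 2 μ) (h : Tendsto (fun n => nrm μ fun x => F n x - f x) atTop (𝓝 0)) :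
    Tendsto (fun n => ∫ x, F n x * g x ∂μ) atTop (𝓝 (∫ x, f x * g x ∂μ)) := by
  rw [tendsto_iff_norm_sub_tendsto_zero]
  have h1 : Tendsto (fun n => (nrm μ fun x => F n x - f x) * nrm μ g) atTop (𝓝 0) := by
    simpa using h.mul_const (nrm μ g)
  refine squeeze_zero (fun _ => norm_nonneg _) (fun n => ?_) h1
  rw [← integral_sub (integrable_mul_of_memLp (hF n) hg) (integrable_mul_of_memLp hf hg)]
  have h2 := abs_integral_mul_le (f := fun x => F n x - f x) ((hF n).sub hf) hg
  simpa only [sub_mul, Real.norm_eq_abs] using h2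

theorem tendsto_nrm {F : ℕ → α → ℝ} (hF : ∀ n, MemLp (F n) 2 μ) (hf : MemLp f 2 μ)
    (h : Tendsto (fun n => nrm μ fun x => F n x - f x) atTop (𝓝 0)) :
    Tendsto (fun n => nrm μ (F n)) atTop (𝓝 (nrm μ f)) := by
  rw [tendsto_iff_norm_sub_tendsto_zero]
  refine squeeze_zero (fun _ => norm_nonneg _) (fun n => ?_) h
  rw [Real.norm_eq_abs, abs_sub_le_iff]
  constructor
  · linarith [nrm_le_nrm_add_nrm_sub (hF n) hf]
  · have := nrm_le_nrm_add_nrm_sub hf (hF n)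
    rw [nrm_sub_comm] at this
    linarith

theorem nrm_mono_measure {ν : Measure α} (h : μ ≤ ν) (hf : MemLp f 2 ν) : nrm μ f ≤ nrm ν f :=
  Real.sqrt_le_sqrt (integral_mono_measure h (ae_of_all _ fun _ => sq_nonneg _) hf.integrable_sq)

end Nrm

theorem memLp_of_continuous {d : ℕ} {K : Set (Pt d)} (hK : IsCompact K) {μ : Measure (Pt d)}
    (hμ : μ K < ⊤) {f : Pt d → ℝ} (hf : Continuous f) : MemLp f 2 (μ.restrict K) := by
  obtain ⟨C, hC⟩ := hK.exists_bound_of_continuousOn hf.continuousOn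
  have : IsFiniteMeasure (μ.restrict K) := ⟨by simpa using hμ⟩
  refine MemLp.of_bound hf.aestronglyMeasurable C ?_
  filter_upwards [ae_restrict_mem hK.measurableSet] with x hx
  exact hC x hx

/-! ### Weak gradients and density of smooth functions -/

/-- `g ∈ L²(S)` has the weak gradient `G ∈ L²(S)^d` on the open set `S`. -/
structure HasWeakGrad {d : ℕ} (S : Set (Pt d)) (g : Pt d → ℝ) (G : Fin d → Pt d → ℝ) : Prop where
  memLp : MemLp g 2 (volume.restrict S)
  memLp_grad : ∀ i, MemLp (G i) 2 (volume.restrict S)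
  integral_eq : ∀ i φ, IsTestFunction S φ →
    ∫ x in S, g x * pd i φ x = -∫ x in S, G i x * φ x

theorem IsTestFunction.mono {d : ℕ} {S S' : Set (Pt d)} (h : S ⊆ S') {φ : Pt d → ℝ}
    (hφ : IsTestFunction S φ) : IsTestFunction S' φ :=
  ⟨hφ.1, hφ.2.1, hφ.2.2.trans h⟩

theorem IsTestFunction.pd {d : ℕ} {S : Set (Pt d)} {φ : Pt d → ℝ} (hφ : IsTestFunction S φ)
    (i : Fin d) : IsTestFunction S (pd i φ) := by
  have h1 : tsupport (WG.pd i φ) ⊆ tsupport φ :=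
    (closure_mono (Function.support_comp_subset (g := fun L : Pt d →L[ℝ] ℝ =>
      L (EuclideanSpace.single i (1 : ℝ))) rfl (fderiv ℝ φ))).trans (tsupport_fderiv_subset ℝ)
  refine ⟨?_, hφ.2.1.of_isClosed_subset (isClosed_tsupport _) h1, h1.trans hφ.2.2⟩
  exact (hφ.1.fderiv_right (m := ∞) (by simp)).clm_apply contDiff_const

theorem setIntegral_mul_eq_of_tsupport_subset {d : ℕ} {S : Set (Pt d)} {g φ : Pt d → ℝ}
    (hφ : tsupport φ ⊆ S) : ∫ x in S, g x * φ x = ∫ x, g x * φ x := by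
  refine setIntegral_eq_integral_of_forall_compl_eq_zero fun x hx => ?_
  rw [image_eq_zero_of_notMem_tsupport fun h => hx (hφ h), mul_zero]

theorem HasWeakGrad.mono {d : ℕ} {S S' : Set (Pt d)} (h : S ⊆ S') {g : Pt d → ℝ}
    {G : Fin d → Pt d → ℝ} (hg : HasWeakGrad S' g G) : HasWeakGrad S g G := by
  refine ⟨hg.memLp.mono_measure (Measure.restrict_mono h le_rfl),
    fun i => (hg.memLp_grad i).mono_measure (Measure.restrict_mono h le_rfl), fun i φ hφ => ?_⟩
  have h1 := hg.integral_eq i φ (hφ.mono h)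
  rwa [setIntegral_mul_eq_of_tsupport_subset ((hφ.pd i).2.2.trans h),
    setIntegral_mul_eq_of_tsupport_subset (hφ.2.2.trans h),
    ← setIntegral_mul_eq_of_tsupport_subset (hφ.pd i).2.2,
    ← setIntegral_mul_eq_of_tsupport_subset hφ.2.2] at h1

/-- Mollification of `f` by a normalized bump function. -/
def mollify {d : ℕ} (φ : ContDiffBump (0 : Pt d)) (f : Pt d → ℝ) : Pt d → ℝ :=
  convolution (φ.normed volume) f (ContinuousLinearMap.lsmul ℝ ℝ) volume

section Mollify

variable {d : ℕ} (φ : ContDiffBump (0 : Pt d)) {f : Pt d → ℝ}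

theorem mollify_apply (f : Pt d → ℝ) (x : Pt d) :
    mollify φ f x = ∫ t, φ.normed volume t * f (x - t) := by
  simp [mollify, convolution]

theorem mollify_contDiff (hf : MemLp f 2 volume) : ContDiff ℝ ∞ (mollify φ f) :=
  φ.hasCompactSupport_normed.contDiff_convolution_left _ φ.contDiff_normed
    (hf.locallyIntegrable (by simp))

theorem memLp_comp_sub_left (hf : MemLp f 2 volume) (x : Pt d) :
    MemLp (fun t => f (x - t)) 2 volume :=
  hf.comp_measurePreserving (Measure.measurePreserving_sub_left volume x)

theorem memLp_normed : MemLp (φ.normed volume) 2 volume :=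
  φ.continuous_normed.memLp_of_hasCompactSupport φ.hasCompactSupport_normed

theorem integrable_mollify (hf : MemLp f 2 volume) (x : Pt d) :
    Integrable fun t => φ.normed volume t * f (x - t) :=
  integrable_mul_of_memLp (memLp_normed φ) (memLp_comp_sub_left hf x)

theorem mollify_sub {h : Pt d → ℝ} (hf : MemLp f 2 volume) (hh : MemLp h 2 volume) (x : Pt d) :
    mollify φ (fun x => f x - h x) x = mollify φ f x - mollify φ h x := by
  simp only [mollify_apply, mul_sub]
  exact integral_sub (integrable_mollify φ hf x) (integrable_mollify φ hh x)

/-- Jensen's inequality for the averages with respect to the normalized bump function. -/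
theorem mollify_sq_le (hf : MemLp f 2 volume) (x : Pt d) :
    mollify φ f x ^ 2 ≤ mollify φ (fun x => f x ^ 2) x := by
  have h0 : ∀ t, 0 ≤ φ.normed volume t := fun t => φ.nonneg_normed t
  obtain ⟨C, hC⟩ := φ.hasCompactSupport_normed.exists_bound_of_continuous
    (φ.continuous_normed (μ := volume))
  have hsq : Continuous fun t => Real.sqrt (φ.normed volume t) :=
    Real.continuous_sqrt.comp φ.continuous_normed
  have h1 : MemLp (fun t => Real.sqrt (φ.normed volume t)) 2 volume :=
    hsq.memLp_of_hasCompactSupport (φ.hasCompactSupport_normed.comp_left Real.sqrt_zero)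
  have h2 : MemLp (fun t => Real.sqrt (φ.normed volume t) * f (x - t)) 2 volume := by
    refine (memLp_comp_sub_left hf x).of_le_mul (c := Real.sqrt C)
      (hsq.aestronglyMeasurable.mul (memLp_comp_sub_left hf x).aestronglyMeasurable) ?_
    refine ae_of_all _ fun t => ?_
    rw [norm_mul, Real.norm_of_nonneg (Real.sqrt_nonneg _)]
    exact mul_le_mul_of_nonneg_right (Real.sqrt_le_sqrt ((le_abs_self _).trans (hC t)))
      (norm_nonneg _)
  have h3 := abs_integral_mul_le h1 h2
  have h4 : ∫ t, Real.sqrt (φ.normed volume t) * (Real.sqrt (φ.normed volume t) * f (x - t)) =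
      mollify φ f x := by
    rw [mollify_apply]
    refine integral_congr_ae (ae_of_all _ fun t => ?_)
    simp only
    rw [← mul_assoc, Real.mul_self_sqrt (h0 t)]
  have h5 : nrm volume (fun t => Real.sqrt (φ.normed volume t)) = 1 := by
    rw [nrm]
    simp only [Real.sq_sqrt (h0 _)]
    rw [φ.integral_normed, Real.sqrt_one]
  have h6 : nrm volume (fun t => Real.sqrt (φ.normed volume t) * f (x - t)) ^ 2 =
      mollify φ (fun x => f x ^ 2) x := by
    rw [nrm_sq, mollify_apply]
    refine integral_congr_ae (ae_of_all _ fun t => ?_)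
    simp only
    rw [mul_pow, Real.sq_sqrt (h0 t)]
  rw [h4, h5, one_mul] at h3
  rw [← h6, ← sq_abs]
  exact pow_le_pow_left₀ (abs_nonneg _) h3 2

theorem memLp_mollify (hf : MemLp f 2 volume) : MemLp (mollify φ f) 2 volume := by
  rw [memLp_two_iff_integrable_sq (mollify_contDiff φ hf).continuous.aestronglyMeasurable]
  have h1 : Integrable (mollify φ fun x => f x ^ 2) :=
    (φ.continuous_normed.integrable_of_hasCompactSupport
      φ.hasCompactSupport_normed).integrable_convolution _ hf.integrable_sq
  refine h1.mono' ((mollify_contDiff φ hf).continuous.pow 2).aestronglyMeasurable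
    (ae_of_all _ fun x => ?_)
  rw [Real.norm_of_nonneg (sq_nonneg _)]
  exact mollify_sq_le φ hf x

theorem nrm_mollify_le (hf : MemLp f 2 volume) : nrm volume (mollify φ f) ≤ nrm volume f := by
  have h1 : Integrable (mollify φ fun x => f x ^ 2) :=
    (φ.continuous_normed.integrable_of_hasCompactSupport
      φ.hasCompactSupport_normed).integrable_convolution _ hf.integrable_sq
  refine Real.sqrt_le_sqrt ?_
  calc ∫ x, mollify φ f x ^ 2 ≤ ∫ x, mollify φ (fun x => f x ^ 2) x :=
        integral_mono (memLp_mollify φ hf).integrable_sq h1 fun x => mollify_sq_le φ hf x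
    _ = ∫ x, f x ^ 2 := by
        have h2 := integral_convolution (μ := (volume : Measure (Pt d)))
          (ν := (volume : Measure (Pt d))) (ContinuousLinearMap.lsmul ℝ ℝ)
          (φ.continuous_normed.integrable_of_hasCompactSupport
            (φ.hasCompactSupport_normed (μ := volume))) hf.integrable_sq
        rw [mollify, h2, φ.integral_normed]
        simp

end Mollify

theorem nrm_comp_dilation_le {d : ℕ} {F : Pt d → ℝ} (hF : MemLp F 2 volume) (hFc : Continuous F)
    {s : ℝ} (hs : 1 / 2 ≤ s) (b : Pt d) (K : Set (Pt d)) :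
    MemLp (fun x => F (s • x + b)) 2 volume ∧
    nrm (volume.restrict K) (fun x => F (s • x + b)) ≤ 2 ^ d * nrm volume F := by
  have hs0 : 0 < s := by linarith
  have h1 : ∫ x, F (s • x + b) ^ 2 = |(s ^ d)⁻¹| * ∫ x, F x ^ 2 := by
    have h2 := Measure.integral_comp_smul (volume : Measure (Pt d)) (fun x => F (x + b) ^ 2) s
    rw [h2, integral_add_right_eq_self (fun x => F x ^ 2) b]
    simp
  have hi : Integrable fun x => F (s • x + b) ^ 2 := by
    have := (hF.integrable_sq.comp_add_right b).comp_smul hs0.ne'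
    exact this
  have hm : MemLp (fun x => F (s • x + b)) 2 volume := by
    rw [memLp_two_iff_integrable_sq]
    · exact hi
    · exact (hFc.comp (by fun_prop)).aestronglyMeasurable
  refine ⟨hm, (nrm_mono_measure Measure.restrict_le_self hm).trans ?_⟩
  have h3 : |(s ^ d)⁻¹| ≤ 2 ^ d := by
    rw [abs_of_pos (by positivity), ← inv_pow]
    exact pow_le_pow_left₀ (by positivity) (by rw [inv_le_comm₀ hs0 two_pos]; simpa using hs) d
  have h4 : (1 : ℝ) ≤ 2 ^ d := one_le_pow₀ (by norm_num)
  refine abs_le_of_sq_le_sq' ?_ (by have := nrm_nonneg (μ := volume) (f := F); positivity) |>.2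
  rw [nrm_sq, h1, mul_pow, nrm_sq]
  have h5 : 0 ≤ ∫ x, F x ^ 2 := integral_nonneg fun _ => sq_nonneg _
  calc |(s ^ d)⁻¹| * ∫ x, F x ^ 2 ≤ 2 ^ d * ∫ x, F x ^ 2 := by gcongr
    _ ≤ (2 ^ d) ^ 2 * ∫ x, F x ^ 2 := by
        refine mul_le_mul_of_nonneg_right ?_ h5
        nlinarith

/-- Mollification composed with dilations close to the identity converges in `L²` on compacts. -/
theorem tendsto_nrm_mollify_dilation {d : ℕ} {K : Set (Pt d)} (hK : IsCompact K)
    {φ : ℕ → ContDiffBump (0 : Pt d)} (hφ : Tendsto (fun n => (φ n).rOut) atTop (𝓝 0))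
    {s : ℕ → ℝ} (hs : ∀ n, 1 / 2 ≤ s n) (hs1 : Tendsto s atTop (𝓝 1)) (a : Pt d)
    {f : Pt d → ℝ} (hf : MemLp f 2 volume) :
    Tendsto (fun n => nrm (volume.restrict K) fun x =>
      mollify (φ n) f (s n • x + (1 - s n) • a) - f x) atTop (𝓝 0) := by
  rw [Metric.tendsto_atTop]
  intro ε hε
  set κ := (volume K).toReal
  set ε' := ε / (2 * (2 ^ d + 1)) with hε'
  have hε'0 : 0 < ε' := by positivity
  obtain ⟨h, hhc, hhε, hhcont, hhL⟩ := hf.exists_hasCompactSupport_eLpNorm_sub_le (by simp)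
    (ε := ENNReal.ofReal ε') (by simpa using hε'0)
  have hfh : MemLp (fun x => f x - h x) 2 volume := hf.sub hhL
  have hnfh : nrm volume (fun x => f x - h x) ≤ ε' := by
    rw [nrm_eq_toReal hfh]
    exact ENNReal.toReal_le_of_le_ofReal hε'0.le hhε
  set δ := ε / (4 * (Real.sqrt κ + 1)) with hδ
  have hδ0 : 0 < δ := by positivity
  obtain ⟨η, hη, hηu⟩ := Metric.uniformContinuous_iff.1
    (hhc.uniformContinuous_of_continuous hhcont) (δ / 2) (by positivity)
  obtain ⟨R, hR⟩ := hK.isBounded.subset_closedBall a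
  have hR' : ∀ x ∈ K, ‖x - a‖ ≤ |R| := fun x hx => by
    have := hR hx
    rw [Metric.mem_closedBall, dist_eq_norm] at this
    exact this.trans (le_abs_self R)
  have hev1 : ∀ᶠ n in atTop, (φ n).rOut < η := hφ.eventually (gt_mem_nhds hη)
  have hev2 : ∀ᶠ n in atTop, |s n - 1| * |R| < η := by
    have h1 : Tendsto (fun n => |s n - 1| * |R|) atTop (𝓝 (|1 - 1| * |R|)) :=
      ((hs1.sub_const 1).abs).mul_const _
    rw [sub_self, abs_zero, zero_mul] at h1
    exact h1.eventually (gt_mem_nhds hη)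
  obtain ⟨N, hN⟩ := eventually_atTop.1 (hev1.and hev2)
  refine ⟨N, fun n hn => ?_⟩
  obtain ⟨hn1, hn2⟩ := hN n hn
  rw [Real.dist_eq, sub_zero, abs_of_nonneg nrm_nonneg]
  set p : Pt d → Pt d := fun x => s n • x + (1 - s n) • a with hp
  have hpc : Continuous p := by fun_prop
  have hcomp : ∀ {g : Pt d → ℝ}, MemLp g 2 volume →
      MemLp (fun x => mollify (φ n) g (p x)) 2 (volume.restrict K) := fun hg =>
    ((nrm_comp_dilation_le (memLp_mollify (φ n) hg) (mollify_contDiff (φ n) hg).continuous (hs n)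
      ((1 - s n) • a) K).1).mono_measure Measure.restrict_le_self
  have hfK := hf.mono_measure (Measure.restrict_le_self (s := K))
  have hhK := hhL.mono_measure (Measure.restrict_le_self (s := K))
  have e1 : nrm (volume.restrict K) (fun x => mollify (φ n) f (p x) - mollify (φ n) h (p x)) ≤
      2 ^ d * ε' := by
    have := (nrm_comp_dilation_le (memLp_mollify (φ n) hfh)
      (mollify_contDiff (φ n) hfh).continuous (hs n) ((1 - s n) • a) K).2
    simp only [mollify_sub (φ n) hf hhL] at this
    refine this.trans (mul_le_mul_of_nonneg_left ?_ (by positivity))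
    have h2 := nrm_mollify_le (φ n) hfh
    exact h2.trans hnfh
  have e2 : nrm (volume.restrict K) (fun x => mollify (φ n) h (p x) - h x) ≤ δ * Real.sqrt κ := by
    have hpt : ∀ x ∈ K, |mollify (φ n) h (p x) - h x| ≤ δ := by
      intro x hx
      have h1 : dist (mollify (φ n) h (p x)) (h (p x)) ≤ δ / 2 :=
        ContDiffBump.dist_normed_convolution_le hhcont.aestronglyMeasurable fun y hy =>
          (hηu ((Metric.mem_ball.1 hy).trans hn1)).le
      have h2 : dist (h (p x)) (h x) ≤ δ / 2 := by
        refine (hηu ?_).le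
        have : p x - x = (s n - 1) • (x - a) := by
          rw [hp]; simp only; module
        rw [dist_eq_norm, this, norm_smul, Real.norm_eq_abs]
        exact (mul_le_mul_of_nonneg_left (hR' x hx) (abs_nonneg _)).trans_lt hn2
      rw [← Real.dist_eq]
      linarith [dist_triangle (mollify (φ n) h (p x)) (h (p x)) (h x)]
    refine abs_le_of_sq_le_sq' ?_ (by positivity) |>.2
    rw [nrm_sq, mul_pow, Real.sq_sqrt ENNReal.toReal_nonneg]
    have h3 : ∫ x in K, (mollify (φ n) h (p x) - h x) ^ 2 ≤ ∫ _ in K, δ ^ 2 := by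
      refine setIntegral_mono_on ((hcomp hhL).sub hhK).integrable_sq
        (integrableOn_const hK.measure_lt_top.ne) hK.measurableSet fun x hx => ?_
      rw [← sq_abs]
      exact pow_le_pow_left₀ (abs_nonneg _) (hpt x hx) 2
    rw [setIntegral_const, smul_eq_mul, mul_comm] at h3
    exact h3
  have e3 : nrm (volume.restrict K) (fun x => h x - f x) ≤ ε' := by
    rw [nrm_sub_comm]
    exact (nrm_mono_measure Measure.restrict_le_self hfh).trans hnfh
  have t1 := nrm_sub_le_sub (hcomp hf) (hcomp hhL) hfK
  have t2 := nrm_sub_le_sub (hcomp hhL) hhK hfK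
  have f1 : δ * Real.sqrt κ ≤ ε / 4 := by
    rw [hδ, div_mul_eq_mul_div, div_le_div_iff₀ (by positivity) (by positivity)]
    nlinarith [Real.sqrt_nonneg κ]
  have f2 : 2 ^ d * ε' + ε' = ε / 2 := by
    rw [hε']; field_simp
  linarith

namespace ConvexPolytope

variable {d : ℕ} (T : ConvexPolytope d)

theorem restrict_interior :
    (volume : Measure (Pt d)).restrict (interior T.carrier) = volume.restrict T.carrier :=
  Measure.restrict_congr_set T.interior_ae_eq

/-- `L²` convergence on `T` of smooth functions and of their gradients. -/
structure ApproxH1 (g : Pt d → ℝ) (G : Fin d → Pt d → ℝ) (F : ℕ → Pt d → ℝ) : Prop where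
  contDiff : ∀ n, ContDiff ℝ ∞ (F n)
  tendsto : Tendsto (fun n => nrm (volume.restrict T.carrier) fun x => F n x - g x) atTop (𝓝 0)
  tendsto_grad : ∀ i, Tendsto (fun n => nrm (volume.restrict T.carrier) fun x =>
    pd i (F n) x - G i x) atTop (𝓝 0)

/-- The derivative of the mollification is the mollification of the weak derivative, at points
whose distance from the complement of `T` exceeds the radius of the mollifier. -/
theorem pd_mollify {g : Pt d → ℝ} {G : Fin d → Pt d → ℝ}
    (hg : HasWeakGrad (interior T.carrier) g G) (φ : ContDiffBump (0 : Pt d)) {z : Pt d}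
    (hz : Metric.closedBall z φ.rOut ⊆ interior T.carrier) (i : Fin d) :
    pd i (mollify φ (T.carrier.indicator g)) z = mollify φ (T.carrier.indicator (G i)) z := by
  have hgT : MemLp (T.carrier.indicator g) 2 volume := by
    rw [memLp_indicator_iff_restrict T.measurableSet_carrier, ← restrict_interior]
    exact hg.memLp
  have hφ1 : ContDiff ℝ 1 (φ.normed volume) := φ.contDiff_normed
  have hD := φ.hasCompactSupport_normed.hasFDerivAt_convolution_left
    (ContinuousLinearMap.lsmul ℝ ℝ) hφ1 (hgT.locallyIntegrable (by simp)) z (μ := volume)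
  have h1 : pd i (mollify φ (T.carrier.indicator g)) z =
      ∫ t, pd i (φ.normed volume) t * T.carrier.indicator g (z - t) := by
    have hint := φ.hasCompactSupport_normed.fderiv (𝕜 := ℝ) |>.convolutionExists_left
      ((ContinuousLinearMap.lsmul ℝ ℝ).precompL (Pt d)) (hφ1.continuous_fderiv one_ne_zero)
      (hgT.locallyIntegrable (by simp)) z (μ := volume)
    rw [pd, mollify, hD.fderiv, convolution_def, ContinuousLinearMap.integral_apply hint]
    rfl
  set ψ : Pt d → ℝ := fun y => φ.normed volume (z - y) with hψ
  have hψc : ContDiff ℝ ∞ ψ := φ.contDiff_normed.comp (contDiff_const.sub contDiff_id)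
  have hsupp : Function.support ψ ⊆ Metric.closedBall z φ.rOut := by
    intro y hy
    have h2 : z - y ∈ Function.support (φ.normed volume) := hy
    rw [φ.support_normed_eq, mem_ball_zero_iff] at h2
    rw [Metric.mem_closedBall', dist_eq_norm]
    exact h2.le
  have hts : tsupport ψ ⊆ Metric.closedBall z φ.rOut :=
    closure_minimal hsupp Metric.isClosed_closedBall
  have htest : IsTestFunction (interior T.carrier) ψ :=
    ⟨hψc, (isCompact_closedBall _ _).of_isClosed_subset (isClosed_tsupport _) hts, hts.trans hz⟩
  have hpdψ : ∀ y, pd i ψ y = -pd i (φ.normed volume) (z - y) := by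
    intro y
    have h2 := (hφ1.differentiable one_ne_zero (z - y)).hasFDerivAt.comp y
      ((hasFDerivAt_id y).const_sub z)
    have h3 : HasFDerivAt ψ _ y := h2
    rw [pd, h3.fderiv]
    simp [pd]
  have h3 := hg.integral_eq i ψ htest
  rw [restrict_interior] at h3
  rw [h1, ← integral_sub_left_eq_self _ volume z, mollify_apply,
    ← integral_sub_left_eq_self (fun t => φ.normed volume t * _) volume z]
  simp only [sub_sub_cancel]
  have h4 : ∫ x, pd i (φ.normed volume) (z - x) * T.carrier.indicator g x =
      -∫ x in T.carrier, g x * pd i ψ x := by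
    rw [← integral_indicator T.measurableSet_carrier, ← integral_neg]
    refine integral_congr_ae (ae_of_all _ fun x => ?_)
    by_cases hx : x ∈ T.carrier
    · simp only [Set.indicator_of_mem hx, hpdψ]; ring
    · simp only [Set.indicator_of_notMem hx]; ring
  have h5 : ∫ x, φ.normed volume (z - x) * T.carrier.indicator (G i) x =
      ∫ x in T.carrier, G i x * ψ x := by
    rw [← integral_indicator T.measurableSet_carrier]
    refine integral_congr_ae (ae_of_all _ fun x => ?_)
    by_cases hx : x ∈ T.carrier
    · simp only [Set.indicator_of_mem hx, hψ]; ring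
    · simp only [Set.indicator_of_notMem hx]; ring
  rw [h4, h5, h3, neg_neg]

/-- Functions in `H¹(T)` are limits of functions smooth up to the boundary: dilate towards an
interior point, then mollify. -/
theorem exists_approxH1 {g : Pt d → ℝ} {G : Fin d → Pt d → ℝ}
    (hg : HasWeakGrad (interior T.carrier) g G) : ∃ F, T.ApproxH1 g G F := by
  obtain ⟨a, ha⟩ := T.interior_nonempty
  obtain ⟨r, hr, hball⟩ := Metric.nhds_basis_closedBall.mem_iff.1
    (isOpen_interior.mem_nhds ha)
  set t : ℕ → ℝ := fun n => ((n : ℝ) + 2)⁻¹ with ht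
  have ht0 : ∀ n, 0 < t n := fun n => by positivity
  have ht2 : ∀ n, t n ≤ 1 / 2 := fun n => by
    rw [ht, one_div]
    exact inv_anti₀ two_pos (by simp)
  have htlim : Tendsto t atTop (𝓝 0) :=
    tendsto_inv_atTop_zero.comp (tendsto_atTop_add_const_right _ 2 tendsto_natCast_atTop_atTop)
  let φ : ℕ → ContDiffBump (0 : Pt d) := fun n =>
    ⟨t n * r / 2, t n * r, by have := ht0 n; positivity,
      by have := ht0 n; nlinarith [mul_pos this hr]⟩
  have hφ : Tendsto (fun n => (φ n).rOut) atTop (𝓝 0) := by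
    simpa using htlim.mul_const r
  set s : ℕ → ℝ := fun n => 1 - t n with hs
  have hs2 : ∀ n, 1 / 2 ≤ s n := fun n => by rw [hs]; simp only; linarith [ht2 n]
  have hs1 : Tendsto s atTop (𝓝 1) := by simpa using htlim.const_sub 1
  have hL : ∀ {f : Pt d → ℝ}, MemLp f 2 (volume.restrict (interior T.carrier)) →
      MemLp (T.carrier.indicator f) 2 volume := by
    intro f hf
    rw [memLp_indicator_iff_restrict T.measurableSet_carrier, ← restrict_interior]
    exact hf
  have hconv : ∀ {f : Pt d → ℝ}, MemLp f 2 (volume.restrict (interior T.carrier)) →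
      Tendsto (fun n => nrm (volume.restrict T.carrier) fun x =>
        mollify (φ n) (T.carrier.indicator f) (s n • x + (1 - s n) • a) - f x) atTop (𝓝 0) := by
    intro f hf
    refine (tendsto_nrm_mollify_dilation T.isCompact_carrier hφ hs2 hs1 a (hL hf)).congr fun n => ?_
    refine nrm_congr ?_
    filter_upwards [ae_restrict_mem T.measurableSet_carrier] with x hx
    rw [Set.indicator_of_mem hx]
  set F : ℕ → Pt d → ℝ := fun n x =>
    mollify (φ n) (T.carrier.indicator g) (s n • x + (1 - s n) • a) with hF
  have hpc : ∀ n, ContDiff ℝ ∞ fun x : Pt d => s n • x + (1 - s n) • a := fun n => by fun_prop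
  have hin : ∀ n, ∀ x ∈ T.carrier,
      Metric.closedBall (s n • x + (1 - s n) • a) (φ n).rOut ⊆ interior T.carrier := by
    intro n x hx y hy
    have h1 : y = s n • x + (1 - s n) • (a + (t n)⁻¹ • (y - (s n • x + (1 - s n) • a))) := by
      have h2 : 1 - s n = t n := by simp [hs]
      rw [h2, smul_add, smul_smul, mul_inv_cancel₀ (ht0 n).ne', one_smul]
      abel
    have h3 : a + (t n)⁻¹ • (y - (s n • x + (1 - s n) • a)) ∈ interior T.carrier := by
      apply hball
      rw [Metric.mem_closedBall, dist_eq_norm, add_sub_cancel_left, norm_smul,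
        Real.norm_of_nonneg (inv_nonneg.2 (ht0 n).le), inv_mul_le_iff₀ (ht0 n)]
      rw [Metric.mem_closedBall, dist_eq_norm] at hy
      exact hy
    rw [h1]
    refine T.convex_carrier.combo_self_interior_mem_interior hx h3 ?_ ?_ (by ring)
    · linarith [hs2 n]
    · have h2 : 1 - s n = t n := by simp [hs]
      rw [h2]; exact ht0 n
  refine ⟨F, fun n => (mollify_contDiff (φ n) (hL hg.memLp)).comp (hpc n), hconv hg.memLp,
    fun i => ?_⟩
  have hpdF : ∀ n, ∀ x ∈ T.carrier, pd i (F n) x =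
      s n * mollify (φ n) (T.carrier.indicator (G i)) (s n • x + (1 - s n) • a) := by
    intro n x hx
    rw [← T.pd_mollify hg (φ n) (hin n x hx)]
    have h1 : HasFDerivAt (fun x : Pt d => s n • x + (1 - s n) • a)
        (s n • ContinuousLinearMap.id ℝ (Pt d)) x :=
      ((hasFDerivAt_id x).const_smul (s n)).add_const _
    have h2 := (((mollify_contDiff (φ n) (hL hg.memLp)).differentiable (by simp))
      (s n • x + (1 - s n) • a)).hasFDerivAt.comp x h1
    rw [pd, show F n = mollify (φ n) (T.carrier.indicator g) ∘
      fun x => s n • x + (1 - s n) • a from rfl, h2.fderiv]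
    simp [pd]
  have hGm := hg.memLp_grad i
  have hGK : MemLp (G i) 2 (volume.restrict T.carrier) := by rw [← restrict_interior]; exact hGm
  set M : ℕ → Pt d → ℝ := fun n x =>
    mollify (φ n) (T.carrier.indicator (G i)) (s n • x + (1 - s n) • a) with hM
  have hMm : ∀ n, MemLp (M n) 2 (volume.restrict T.carrier) := fun n =>
    memLp_of_continuous T.isCompact_carrier T.volume_lt_top
      ((mollify_contDiff (φ n) (hL hGm)).continuous.comp (hpc n).continuous)
  have hMlim := tendsto_nrm hMm hGK (hconv hGm)
  have hlim : Tendsto (fun n => |s n - 1| * nrm (volume.restrict T.carrier) (M n) +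
      nrm (volume.restrict T.carrier) (fun x => M n x - G i x)) atTop (𝓝 0) := by
    have h1 := (((hs1.sub_const 1).abs).mul hMlim).add (hconv hGm)
    simpa using h1
  refine squeeze_zero (fun _ => nrm_nonneg) (fun n => ?_) hlim
  have h1 : nrm (volume.restrict T.carrier) (fun x => pd i (F n) x - G i x) =
      nrm (volume.restrict T.carrier) (fun x => (s n - 1) * M n x + (M n x - G i x)) := by
    refine nrm_congr ?_
    filter_upwards [ae_restrict_mem T.measurableSet_carrier] with x hx
    rw [hpdF n x hx, hM]
    ring
  rw [h1]
  refine (nrm_add_le (g := fun x => M n x - G i x) ((hMm n).const_mul _)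
    ((hMm n).sub hGK)).trans ?_
  rw [nrm_const_mul]

end ConvexPolytope

end WG
end

noncomputable section

namespace WG

/-! ### Traces on the facets -/

namespace ConvexPolytope

variable {d : ℕ} (T : ConvexPolytope d)

/-- Lebesgue measure on `T`. -/
abbrev vol : Measure (Pt d) := volume.restrict T.carrier

/-- Surface measure on the facet with normal `ν`. -/
abbrev surf (ν : Pt d) : Measure (Pt d) := (μHE[d - 1]).restrict (T.facet ν)

theorem memLp_vol {f : Pt d → ℝ} (hf : Continuous f) : MemLp f 2 T.vol :=
  memLp_of_continuous T.isCompact_carrier T.volume_lt_top hf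

theorem memLp_surf {ν : Pt d} (hν : ν ∈ T.normals) {f : Pt d → ℝ} (hf : Continuous f) :
    MemLp f 2 (T.surf ν) :=
  memLp_of_continuous (T.isCompact_facet ν) (T.facet_lt_top hν) hf

/-- The part of the `H¹` norm scaled by the diameter, `‖g‖ + h_T ∑ ‖G_i‖`. -/
def h1Norm (g : Pt d → ℝ) (G : Fin d → Pt d → ℝ) : ℝ :=
  nrm T.vol g + T.diam * ∑ i, nrm T.vol (G i)

theorem h1Norm_nonneg (g : Pt d → ℝ) (G : Fin d → Pt d → ℝ) : 0 ≤ T.h1Norm g G :=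
  add_nonneg nrm_nonneg (mul_nonneg T.diam_nonneg (Finset.sum_nonneg fun _ _ => nrm_nonneg))

theorem exists_interior_gap_pos : ∃ a ∈ T.carrier, ∀ ν ∈ T.normals, 0 < T.gap ν a := by
  obtain ⟨a, ha⟩ := T.interior_nonempty
  exact ⟨a, interior_subset ha, by simpa [interior_carrier] using ha⟩

/-- Trace inequality for smooth functions, from the divergence theorem applied to the field
`F² (x - a)`, whose flux through a facet is `gap(a) ∫ F²`. -/
theorem nrm_surf_le {F : Pt d → ℝ} (hF : ContDiff ℝ ∞ F) {a : Pt d} (ha : a ∈ T.carrier)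
    {ν : Pt d} (hν : ν ∈ T.normals) (hgap : 0 < T.gap ν a) :
    nrm (T.surf ν) F ≤ Real.sqrt ((d + 1) / T.gap ν a) * T.h1Norm F fun i => pd i F := by
  have hF1 : ContDiff ℝ 1 F := hF.of_le (by simp)
  have hdF := hF1.differentiable one_ne_zero
  have hlin : ∀ i : Fin d, ContDiff ℝ 1 fun x : Pt d => x i - a i := fun i => by fun_prop
  have hpdl : ∀ i x, pd i (fun x : Pt d => x i - a i) x = 1 := by
    intro i x
    have h1 : HasFDerivAt (fun x : Pt d => x i - a i) (EuclideanSpace.proj i : Pt d →L[ℝ] ℝ) x :=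
      ((EuclideanSpace.proj i : Pt d →L[ℝ] ℝ).hasFDerivAt).sub_const _
    rw [pd, h1.fderiv]; simp
  have hpd : ∀ i x, pd i (fun x => (x i - a i) * (F x * F x)) x =
      F x ^ 2 + 2 * (((x i - a i) * F x) * pd i F x) := by
    intro i x
    rw [pd_mul ((hlin i).differentiable one_ne_zero) (hdF.fun_mul hdF), pd_mul hdF hdF, hpdl]
    ring
  have hpdc := fun i => pd_continuous hF1 one_ne_zero i
  have hm1 : ∀ i : Fin d, MemLp (fun x => (x i - a i) * F x) 2 T.vol := fun i =>
    T.memLp_vol ((hlin i).continuous.mul hF.continuous)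
  have hmF := T.memLp_vol hF.continuous
  have hmp := fun i => T.memLp_vol (hpdc i)
  have hsum : ∑ ν ∈ T.normals, T.gap ν a * nrm (T.surf ν) F ^ 2 =
      ∑ i : Fin d, (nrm T.vol F ^ 2 + 2 * ∫ x in T.carrier, ((x i - a i) * F x) * pd i F x) := by
    have h1 : ∀ i : Fin d, nrm T.vol F ^ 2 + 2 * ∫ x in T.carrier, ((x i - a i) * F x) * pd i F x =
        ∑ ν ∈ T.normals, ν i * ∫ x in T.facet ν, (x i - a i) * (F x * F x) ∂μHE[d - 1] := by
      intro i
      rw [← T.integral_pd_eq ((hlin i).mul (hF1.mul hF1)) i]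
      simp only [hpd]
      rw [integral_add hmF.integrable_sq ((integrable_mul_of_memLp (hm1 i) (hmp i)).const_mul 2),
        integral_const_mul, nrm_sq]
    simp only [h1]
    rw [Finset.sum_comm]
    refine Finset.sum_congr rfl fun μ hμ => ?_
    rw [nrm_sq, ← integral_const_mul]
    simp only [← integral_const_mul]
    rw [← integral_finsetSum]
    · refine setIntegral_congr_fun (T.measurableSet_facet μ) fun x hx => ?_
      have h2 : T.gap μ a = ∑ i, μ i * (x i - a i) := by
        rw [gap, ← hx.2, ← inner_sub_right, PiLp.inner_apply]
        refine Finset.sum_congr rfl fun i _ => ?_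
        simp [mul_comm]
      simp only [h2, Finset.sum_mul]
      exact Finset.sum_congr rfl fun i _ => by ring
    · intro i _
      exact (integrable_mul_of_memLp (T.memLp_surf hμ (hlin i).continuous)
        (T.memLp_surf hμ (hF.continuous.mul hF.continuous))).const_mul _
  have hpos : T.gap ν a * nrm (T.surf ν) F ^ 2 ≤
      ∑ ν ∈ T.normals, T.gap ν a * nrm (T.surf ν) F ^ 2 :=
    Finset.single_le_sum (f := fun ν => T.gap ν a * nrm (T.surf ν) F ^ 2)
      (fun μ hμ => mul_nonneg (T.gap_nonneg hμ ha) (sq_nonneg _)) hν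
  have hterm : ∀ i : Fin d, ∫ x in T.carrier, ((x i - a i) * F x) * pd i F x ≤
      nrm T.vol F * (T.diam * nrm T.vol (pd i F)) := by
    intro i
    refine (integral_mul_le (hm1 i) (hmp i)).trans ?_
    have h2 : nrm T.vol (fun x => (x i - a i) * F x) ≤ T.diam * nrm T.vol F := by
      refine abs_le_of_sq_le_sq' ?_ (mul_nonneg T.diam_nonneg nrm_nonneg) |>.2
      rw [nrm_sq, mul_pow, nrm_sq, ← integral_const_mul]
      refine setIntegral_mono_on (hm1 i).integrable_sq (hmF.integrable_sq.const_mul _)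
        T.measurableSet_carrier fun x hx => ?_
      rw [mul_pow]
      refine mul_le_mul_of_nonneg_right ?_ (sq_nonneg _)
      have h3 : |(x - a) i| ≤ ‖x - a‖ := PiLp.norm_apply_le (x - a) i
      rw [← sq_abs]
      exact pow_le_pow_left₀ (abs_nonneg _) (h3.trans (T.facet_sub_le_diam hx ha)) 2
    calc nrm T.vol (fun x => (x i - a i) * F x) * nrm T.vol (pd i F)
        ≤ (T.diam * nrm T.vol F) * nrm T.vol (pd i F) :=
          mul_le_mul_of_nonneg_right h2 nrm_nonneg
      _ = _ := by ring
  set A := nrm T.vol F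
  set B := T.diam * ∑ i, nrm T.vol (pd i F) with hB
  have hA0 : 0 ≤ A := nrm_nonneg
  have hB0 : 0 ≤ B := mul_nonneg T.diam_nonneg (Finset.sum_nonneg fun _ _ => nrm_nonneg)
  have htot : T.gap ν a * nrm (T.surf ν) F ^ 2 ≤ (d + 1) * (A + B) ^ 2 := by
    refine hpos.trans (hsum.trans_le ?_)
    calc ∑ i : Fin d, (A ^ 2 + 2 * ∫ x in T.carrier, ((x i - a i) * F x) * pd i F x)
        ≤ ∑ i : Fin d, (A ^ 2 + 2 * (A * (T.diam * nrm T.vol (pd i F)))) :=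
          Finset.sum_le_sum fun i _ => by linarith [hterm i]
      _ = d * A ^ 2 + 2 * A * B := by
          rw [Finset.sum_add_distrib, hB, Finset.mul_sum, Finset.mul_sum]
          simp only [Finset.sum_const, Finset.card_univ, Fintype.card_fin, nsmul_eq_mul]
          congr 1
          exact Finset.sum_congr rfl fun i _ => by ring
      _ ≤ (d + 1) * (A + B) ^ 2 := by
          have : (0 : ℝ) ≤ d := by positivity
          nlinarith [mul_nonneg hA0 hB0, mul_nonneg this (mul_nonneg hA0 hB0),
            mul_nonneg this (sq_nonneg B), sq_nonneg A, sq_nonneg B]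
  have hh : T.h1Norm F (fun i => pd i F) = A + B := rfl
  rw [hh]
  refine abs_le_of_sq_le_sq' ?_ (by positivity) |>.2
  rw [mul_pow, Real.sq_sqrt (by positivity), div_mul_eq_mul_div, le_div_iff₀ hgap]
  linarith

/-- `t ν ∈ L²` is the trace on the facet with normal `ν` of the function `g ∈ H¹(T)` with weak
gradient `G`: the limit of the restrictions of smooth approximations of `g`. -/
def IsTrace (g : Pt d → ℝ) (G : Fin d → Pt d → ℝ) (t : Pt d → Pt d → ℝ) : Prop :=
  ∃ F, T.ApproxH1 g G F ∧ ∀ ν ∈ T.normals, MemLp (t ν) 2 (T.surf ν) ∧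
    Tendsto (fun n => nrm (T.surf ν) fun x => F n x - t ν x) atTop (𝓝 0)

variable {T}

theorem IsTrace.memLp {g : Pt d → ℝ} {G : Fin d → Pt d → ℝ} {t : Pt d → Pt d → ℝ}
    (h : T.IsTrace g G t) {ν : Pt d} (hν : ν ∈ T.normals) : MemLp (t ν) 2 (T.surf ν) := by
  obtain ⟨F, -, hF⟩ := h
  exact (hF ν hν).1

theorem memLp_vol_of_interior {f : Pt d → ℝ}
    (hf : MemLp f 2 (volume.restrict (interior T.carrier))) : MemLp f 2 T.vol := by
  rw [vol, ← restrict_interior]; exact hf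

/-- Functions in `H¹(T)` have traces: by the trace inequality the restrictions to a facet of smooth
approximations form a Cauchy sequence in `L²`. -/
theorem exists_isTrace {g : Pt d → ℝ} {G : Fin d → Pt d → ℝ}
    (hg : HasWeakGrad (interior T.carrier) g G) : ∃ t, T.IsTrace g G t := by
  obtain ⟨F, hF⟩ := T.exists_approxH1 hg
  have hgm := memLp_vol_of_interior hg.memLp
  have hGm := fun i => memLp_vol_of_interior (hg.memLp_grad i)
  obtain ⟨a, ha, hgap⟩ := T.exists_interior_gap_pos
  have hFm : ∀ n, MemLp (F n) 2 T.vol := fun n => T.memLp_vol (hF.contDiff n).continuous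
  have hpdm : ∀ n i, MemLp (pd i (F n)) 2 T.vol := fun n i =>
    T.memLp_vol (pd_continuous (hF.contDiff n) (by simp) i)
  set e : ℕ → ℝ := fun n => nrm T.vol (fun x => F n x - g x) +
    T.diam * ∑ i, nrm T.vol (fun x => pd i (F n) x - G i x) with he
  have helim : Tendsto e atTop (𝓝 0) := by
    have h1 := hF.tendsto.add ((tendsto_finsetSum Finset.univ fun i _ =>
      hF.tendsto_grad i).const_mul T.diam)
    simpa using h1
  have hex : ∀ ν ∈ T.normals, ∃ t, MemLp t 2 (T.surf ν) ∧
      Tendsto (fun n => nrm (T.surf ν) fun x => F n x - t x) atTop (𝓝 0) := by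
    intro ν hν
    have hFs : ∀ n, MemLp (F n) 2 (T.surf ν) := fun n =>
      T.memLp_surf hν (hF.contDiff n).continuous
    set K := Real.sqrt ((d + 1) / T.gap ν a)
    have hbound : ∀ n m, nrm (T.surf ν) (fun x => F n x - F m x) ≤ K * (e n + e m) := by
      intro n m
      refine (T.nrm_surf_le ((hF.contDiff n).sub (hF.contDiff m)) ha hν (hgap ν hν)).trans ?_
      refine mul_le_mul_of_nonneg_left ?_ (Real.sqrt_nonneg _)
      have h1 : nrm T.vol (fun x => F n x - F m x) ≤
          nrm T.vol (fun x => F n x - g x) + nrm T.vol (fun x => F m x - g x) := by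
        have := nrm_sub_le_sub (hFm n) hgm (hFm m)
        rwa [nrm_sub_comm (f := g)] at this
      have h2 : ∀ i, nrm T.vol (pd i fun x => F n x - F m x) ≤
          nrm T.vol (fun x => pd i (F n) x - G i x) +
            nrm T.vol (fun x => pd i (F m) x - G i x) := by
        intro i
        have h3 : (pd i fun x => F n x - F m x) = fun x => pd i (F n) x - pd i (F m) x :=
          funext fun x => pd_sub ((hF.contDiff n).differentiable (by simp))
            ((hF.contDiff m).differentiable (by simp)) i x
        rw [h3]
        have := nrm_sub_le_sub (hpdm n i) (hGm i) (hpdm m i)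
        rwa [nrm_sub_comm (f := G i)] at this
      have h4 := mul_le_mul_of_nonneg_left (Finset.sum_le_sum fun i (_ : i ∈ Finset.univ) => h2 i)
        T.diam_nonneg
      rw [Finset.sum_add_distrib, mul_add] at h4
      rw [h1Norm, he]
      simp only
      linarith
    have hcauchy : CauchySeq fun n => (hFs n).toLp (F n) := by
      have hKe : Tendsto (fun n => K * e n) atTop (𝓝 0) := by simpa using helim.const_mul K
      refine Metric.cauchySeq_iff.2 fun ε hε => ?_
      obtain ⟨N, hN⟩ := eventually_atTop.1 (hKe.eventually (gt_mem_nhds (half_pos hε)))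
      refine ⟨N, fun n hn m hm => ?_⟩
      have h1 : dist ((hFs n).toLp (F n)) ((hFs m).toLp (F m)) =
          nrm (T.surf ν) (fun x => F n x - F m x) := by
        have h2 : MemLp (fun x => F n x - F m x) 2 (T.surf ν) := (hFs n).sub (hFs m)
        rw [nrm_eq_norm_toLp h2, dist_eq_norm, ← MemLp.toLp_sub (hFs n) (hFs m)]
        rfl
      rw [h1]
      linarith [hbound n m, hN n hn, hN m hm]
    obtain ⟨L, hL⟩ := cauchySeq_tendsto_of_complete hcauchy
    refine ⟨L, Lp.memLp L, ?_⟩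
    rw [tendsto_iff_norm_sub_tendsto_zero] at hL
    refine hL.congr fun n => ?_
    have h1 : MemLp (fun x => F n x - L x) 2 (T.surf ν) := (hFs n).sub (Lp.memLp L)
    rw [nrm_eq_norm_toLp h1]
    congr 1
    have := MemLp.toLp_sub (hFs n) (Lp.memLp L)
    rw [Lp.toLp_coeFn] at this
    exact this.symm
  choose! t ht using hex
  exact ⟨t, F, hF, ht⟩

theorem IsTrace.nrm_le {g : Pt d → ℝ} {G : Fin d → Pt d → ℝ} {t : Pt d → Pt d → ℝ}
    (h : T.IsTrace g G t) (hgm : MemLp g 2 T.vol) (hGm : ∀ i, MemLp (G i) 2 T.vol)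
    {a : Pt d} (ha : a ∈ T.carrier) {ν : Pt d} (hν : ν ∈ T.normals) (hgap : 0 < T.gap ν a) :
    nrm (T.surf ν) (t ν) ≤ Real.sqrt ((d + 1) / T.gap ν a) * T.h1Norm g G := by
  obtain ⟨F, hF, ht⟩ := h
  have hFm : ∀ n, MemLp (F n) 2 T.vol := fun n => T.memLp_vol (hF.contDiff n).continuous
  have hpdm : ∀ n i, MemLp (pd i (F n)) 2 T.vol := fun n i =>
    T.memLp_vol (pd_continuous (hF.contDiff n) (by simp) i)
  have h1 := tendsto_nrm (fun n => T.memLp_surf hν (hF.contDiff n).continuous) (ht ν hν).1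
    (ht ν hν).2
  have h2 := ((tendsto_nrm hFm hgm hF.tendsto).add ((tendsto_finsetSum Finset.univ fun i _ =>
    tendsto_nrm (fun n => hpdm n i) (hGm i) (hF.tendsto_grad i)).const_mul T.diam)).const_mul
    (Real.sqrt ((d + 1) / T.gap ν a))
  exact le_of_tendsto_of_tendsto' h1 h2 fun n => T.nrm_surf_le (hF.contDiff n) ha hν hgap

/-- Green's formula for a function in `H¹(T)` and a smooth function. -/
theorem IsTrace.green {g : Pt d → ℝ} {G : Fin d → Pt d → ℝ} {t : Pt d → Pt d → ℝ}
    (h : T.IsTrace g G t) (hgm : MemLp g 2 T.vol) (hGm : ∀ i, MemLp (G i) 2 T.vol)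
    {ψ : Pt d → ℝ} (hψ : ContDiff ℝ 1 ψ) (i : Fin d) :
    (∫ x in T.carrier, G i x * ψ x) + ∫ x in T.carrier, g x * pd i ψ x =
      ∑ ν ∈ T.normals, ν i * ∫ x in T.facet ν, t ν x * ψ x ∂μHE[d - 1] := by
  obtain ⟨F, hF, ht⟩ := h
  have hFm : ∀ n, MemLp (F n) 2 T.vol := fun n => T.memLp_vol (hF.contDiff n).continuous
  have hpdm : ∀ n i, MemLp (pd i (F n)) 2 T.vol := fun n i =>
    T.memLp_vol (pd_continuous (hF.contDiff n) (by simp) i)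
  have hψm := T.memLp_vol hψ.continuous
  have hpψm := T.memLp_vol (pd_continuous hψ one_ne_zero i)
  have h1 := (tendsto_integral_mul (fun n => hpdm n i) (hGm i) hψm (hF.tendsto_grad i)).add
    (tendsto_integral_mul hFm hgm hpψm hF.tendsto)
  have h2 : Tendsto (fun n => ∑ ν ∈ T.normals, ν i * ∫ x in T.facet ν, F n x * ψ x ∂μHE[d - 1])
      atTop (𝓝 (∑ ν ∈ T.normals, ν i * ∫ x in T.facet ν, t ν x * ψ x ∂μHE[d - 1])) :=
    tendsto_finsetSum _ fun ν hν => (tendsto_integral_mul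
      (fun n => T.memLp_surf hν (hF.contDiff n).continuous) (ht ν hν).1
      (T.memLp_surf hν hψ.continuous) (ht ν hν).2).const_mul _
  refine tendsto_nhds_unique (h1.congr fun n => ?_) h2
  have hF1 : ContDiff ℝ 1 (F n) := (hF.contDiff n).of_le (by simp)
  rw [← T.integral_pd_eq (hF1.mul hψ) i, ← integral_add (integrable_mul_of_memLp (hpdm n i) hψm)
    (integrable_mul_of_memLp (hFm n) hpψm)]
  refine integral_congr_ae (ae_of_all _ fun x => ?_)
  exact (pd_mul (hF1.differentiable one_ne_zero) (hψ.differentiable one_ne_zero) i x).symm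

theorem IsTrace.sub_smooth {g : Pt d → ℝ} {G : Fin d → Pt d → ℝ} {t : Pt d → Pt d → ℝ}
    (h : T.IsTrace g G t) {φ : Pt d → ℝ} (hφ : ContDiff ℝ ∞ φ) :
    T.IsTrace (fun x => g x - φ x) (fun i x => G i x - pd i φ x) fun ν x => t ν x - φ x := by
  obtain ⟨F, hF, ht⟩ := h
  refine ⟨fun n x => F n x - φ x, ⟨fun n => (hF.contDiff n).sub hφ, ?_, fun i => ?_⟩,
    fun ν hν => ⟨(ht ν hν).1.sub (T.memLp_surf hν hφ.continuous), ?_⟩⟩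
  · simpa only [sub_sub_sub_cancel_right] using hF.tendsto
  · have h1 : ∀ n x, pd i (fun x => F n x - φ x) x = pd i (F n) x - pd i φ x := fun n x =>
      pd_sub ((hF.contDiff n).differentiable (by simp)) (hφ.differentiable (by simp)) i x
    simpa only [h1, sub_sub_sub_cancel_right] using hF.tendsto_grad i
  · simpa only [sub_sub_sub_cancel_right] using (ht ν hν).2

/-- Functions in `H_0^1(Ω)` have zero trace on the facets contained in the boundary of `Ω`: the
approximating test functions `φ n` vanish on such a facet, so the trace of `g` is also the trace of
`g - φ n`, which is small by the trace inequality. -/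
theorem IsTrace.nrm_eq_zero {Ω : Set (Pt d)} (hΩ : IsOpen Ω) (hT : interior T.carrier ⊆ Ω)
    {g : Pt d → ℝ} {G : Fin d → Pt d → ℝ} {t : Pt d → Pt d → ℝ} (h : T.IsTrace g G t)
    (hg : HasWeakGrad Ω g G) {φ : ℕ → Pt d → ℝ} (hφ : ∀ n, IsTestFunction Ω (φ n))
    (h0 : Tendsto (fun n => nrm (volume.restrict Ω) fun x => g x - φ n x) atTop (𝓝 0))
    (h1 : ∀ i, Tendsto (fun n => nrm (volume.restrict Ω) fun x => G i x - pd i (φ n) x) atTop (𝓝 0))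
    {ν : Pt d} (hν : ν ∈ T.normals) (hfr : T.facet ν ⊆ frontier Ω) : nrm (T.surf ν) (t ν) = 0 := by
  obtain ⟨a, ha, hgap⟩ := T.exists_interior_gap_pos
  have hle : T.vol ≤ volume.restrict Ω := by
    rw [vol, ← restrict_interior]; exact Measure.restrict_mono hT le_rfl
  have hφΩ : ∀ n, MemLp (φ n) 2 (volume.restrict Ω) := fun n =>
    ((hφ n).1.continuous.memLp_of_hasCompactSupport (hφ n).2.1).mono_measure
      Measure.restrict_le_self
  have hpφΩ : ∀ n i, MemLp (pd i (φ n)) 2 (volume.restrict Ω) := fun n i =>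
    (((hφ n).pd i).1.continuous.memLp_of_hasCompactSupport ((hφ n).pd i).2.1).mono_measure
      Measure.restrict_le_self
  have hkey : ∀ n, nrm (T.surf ν) (t ν) ≤ Real.sqrt ((d + 1) / T.gap ν a) *
      (nrm (volume.restrict Ω) (fun x => g x - φ n x) +
        T.diam * ∑ i, nrm (volume.restrict Ω) fun x => G i x - pd i (φ n) x) := by
    intro n
    have h2 := (h.sub_smooth (hφ n).1).nrm_le ((hg.memLp.sub (hφΩ n)).mono_measure hle)
      (fun i => ((hg.memLp_grad i).sub (hpφΩ n i)).mono_measure hle) ha hν (hgap ν hν)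
    have h3 : nrm (T.surf ν) (fun x => t ν x - φ n x) = nrm (T.surf ν) (t ν) := by
      refine nrm_congr ?_
      filter_upwards [ae_restrict_mem (T.measurableSet_facet ν)] with x hx
      have h4 : x ∉ Ω := fun hxΩ => by
        have := hfr hx
        rw [frontier, hΩ.interior_eq] at this
        exact this.2 hxΩ
      rw [image_eq_zero_of_notMem_tsupport fun hx' => h4 ((hφ n).2.2 hx'), sub_zero]
    rw [h3] at h2
    refine h2.trans (mul_le_mul_of_nonneg_left ?_ (Real.sqrt_nonneg _))
    refine add_le_add (nrm_mono_measure hle (hg.memLp.sub (hφΩ n)))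
      (mul_le_mul_of_nonneg_left (Finset.sum_le_sum fun i _ =>
        nrm_mono_measure hle ((hg.memLp_grad i).sub (hpφΩ n i))) T.diam_nonneg)
  refine le_antisymm ?_ nrm_nonneg
  refine le_of_tendsto_of_tendsto' (tendsto_const_nhds (f := atTop)) ?_ hkey
  have h2 := (h0.add ((tendsto_finsetSum Finset.univ fun i _ => h1 i).const_mul
    T.diam)).const_mul (Real.sqrt ((d + 1) / T.gap ν a))
  simpa using h2

variable (T)

/-- A smooth cut-off vanishing where the distance from a facet in `s` is less than `1/n`. -/
def innerCutoff (s : Finset (Pt d)) (n : ℝ) (x : Pt d) : ℝ :=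
  ∏ ν ∈ s, Real.smoothTransition (n * T.gap ν x - 1)

theorem innerCutoff_contDiff (s : Finset (Pt d)) (n : ℝ) : ContDiff ℝ ∞ (T.innerCutoff s n) := by
  unfold innerCutoff
  exact contDiff_prod fun ν _ => smoothTransition_contDiff.comp
    ((contDiff_const.mul (T.gap_contDiff ν)).sub contDiff_const)

theorem abs_innerCutoff_le_one (s : Finset (Pt d)) (n : ℝ) (x : Pt d) :
    |T.innerCutoff s n x| ≤ 1 := by
  unfold innerCutoff
  rw [abs_of_nonneg (Finset.prod_nonneg fun _ _ => Real.smoothTransition.nonneg _)]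
  exact Finset.prod_le_one (fun _ _ => Real.smoothTransition.nonneg _)
    fun _ _ => Real.smoothTransition.le_one _

theorem one_le_of_innerCutoff_ne_zero {s : Finset (Pt d)} {n : ℝ} {x : Pt d}
    (hx : T.innerCutoff s n x ≠ 0) {ν : Pt d} (hν : ν ∈ s) : 1 ≤ n * T.gap ν x := by
  have h := Finset.prod_ne_zero_iff.1 hx ν hν
  by_contra hcon
  exact h (Real.smoothTransition.zero_of_nonpos (by linarith))

theorem innerCutoff_eventually_eq_one {s : Finset (Pt d)} {x : Pt d}
    (hz : ∀ ν ∈ s, 0 < T.gap ν x) : ∀ᶠ n : ℕ in atTop, T.innerCutoff s (n + 1) x = 1 := by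
  have h1 : ∀ ν ∈ s, ∀ᶠ n : ℕ in atTop, 2 ≤ ((n : ℝ) + 1) * T.gap ν x := by
    intro ν hν
    have h3 : Tendsto (fun n : ℕ => ((n : ℝ) + 1) * T.gap ν x) atTop atTop :=
      (tendsto_atTop_add_const_right _ 1 tendsto_natCast_atTop_atTop).atTop_mul_const (hz ν hν)
    exact h3.eventually_ge_atTop 2
  filter_upwards [(Finset.eventually_all s).2 h1] with n hn
  exact Finset.prod_eq_one fun ν hν => Real.smoothTransition.one_of_one_le (by linarith [hn ν hν])

variable {T}

/-- The traces of a function in `H¹(Ω)` from the two sides of an interior facet agree. Green's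
formula on both elements is applied with `p χ_n`, where the cut-offs `χ_n` are supported near the
relative interior of the facet and converge to `1` on it. The sum of the two volume terms vanishes
by the definition of the weak gradient on `Ω`. -/
theorem IsTrace.integral_eq_of_neighbor {Ω : Set (Pt d)} {T' : ConvexPolytope d}
    (hT : interior T.carrier ⊆ Ω) (hT' : interior T'.carrier ⊆ Ω)
    (hdisj : Disjoint (interior T.carrier) (interior T'.carrier))
    {ν : Pt d} (hν : ν ∈ T.normals) (hν' : -ν ∈ T'.normals) (hface : T'.facet (-ν) = T.facet ν)
    (hfΩ : T.openFacet ν ⊆ Ω) {g : Pt d → ℝ} {G : Fin d → Pt d → ℝ} (hg : HasWeakGrad Ω g G)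
    {t t' : Pt d → Pt d → ℝ} (ht : T.IsTrace g G t) (ht' : T'.IsTrace g G t')
    {p : Pt d → ℝ} (hp : ContDiff ℝ ∞ p) :
    ∫ x in T.facet ν, t ν x * p x ∂μHE[d - 1] = ∫ x in T.facet ν, t' (-ν) x * p x ∂μHE[d - 1] := by
  classical
  obtain ⟨x₀, hx₀⟩ := T.openFacet_nonempty hν
  have hx₀F := T.openFacet_subset_facet hx₀
  have hoff : T'.offset (-ν) = -T.offset ν := by
    rw [← hface] at hx₀F
    rw [← hx₀F.2, inner_neg_left, hx₀.1]
  have hgap' : ∀ x, T'.gap (-ν) x = -T.gap ν x := fun x => by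
    simp only [gap, hoff, inner_neg_left]; ring
  set s := T.normals.erase ν
  set s' := T'.normals.erase (-ν)
  set χ : ℕ → Pt d → ℝ := fun n x => T.innerCutoff s (n + 1) x * T'.innerCutoff s' (n + 1) x with hχ
  have hχc : ∀ n, ContDiff ℝ ∞ (χ n) := fun n =>
    (T.innerCutoff_contDiff _ _).mul (T'.innerCutoff_contDiff _ _)
  set ψ : ℕ → Pt d → ℝ := fun n x => p x * χ n x with hψ
  have hψc : ∀ n, ContDiff ℝ ∞ (ψ n) := fun n => hp.mul (hχc n)
  have hψ1 : ∀ n, ContDiff ℝ 1 (ψ n) := fun n => (hψc n).of_le (by simp)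
  let K : ℕ → Set (Pt d) := fun n =>
    {x | (∀ μ ∈ s, 1 ≤ ((n : ℝ) + 1) * T.gap μ x) ∧ ∀ μ ∈ s', 1 ≤ ((n : ℝ) + 1) * T'.gap μ x}
  have hKc : ∀ n, IsClosed (K n) := by
    intro n
    have : K n = (⋂ μ ∈ s, {x | 1 ≤ ((n : ℝ) + 1) * T.gap μ x}) ∩
        ⋂ μ ∈ s', {x | 1 ≤ ((n : ℝ) + 1) * T'.gap μ x} := by
      ext x
      simp only [Set.mem_inter_iff, Set.mem_iInter]
      rfl
    rw [this]
    exact (isClosed_biInter fun μ _ => isClosed_le continuous_const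
      (continuous_const.mul (T.gap_continuous μ))).inter (isClosed_biInter fun μ _ =>
      isClosed_le continuous_const (continuous_const.mul (T'.gap_continuous μ)))
  have hsupp : ∀ n, Function.support (ψ n) ⊆ K n := by
    intro n x hx
    have h1 := right_ne_zero_of_mul (show p x * χ n x ≠ 0 from hx)
    exact ⟨fun μ hμ => T.one_le_of_innerCutoff_ne_zero (left_ne_zero_of_mul h1) hμ,
      fun μ hμ => T'.one_le_of_innerCutoff_ne_zero (right_ne_zero_of_mul h1) hμ⟩
  have hts : ∀ n, tsupport (ψ n) ⊆ K n := fun n => closure_minimal (hsupp n) (hKc n)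
  have hpos : ∀ (n : ℕ) (r : ℝ), 1 ≤ ((n : ℝ) + 1) * r → 0 < r := fun n r h =>
    pos_of_mul_pos_right (lt_of_lt_of_le one_pos h) (by positivity)
  have hKgap : ∀ n x, x ∈ K n → (∀ μ ∈ T.normals, μ ≠ ν → 0 < T.gap μ x) ∧
      ∀ μ ∈ T'.normals, μ ≠ -ν → 0 < T'.gap μ x := fun n x hx =>
    ⟨fun μ hμ hne => hpos n _ (hx.1 μ (Finset.mem_erase.2 ⟨hne, hμ⟩)),
      fun μ hμ hne => hpos n _ (hx.2 μ (Finset.mem_erase.2 ⟨hne, hμ⟩))⟩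
  have hKT : ∀ n, K n ⊆ T.carrier ∪ T'.carrier := by
    intro n x hx
    obtain ⟨h1, h2⟩ := hKgap n x hx
    rcases le_total 0 (T.gap ν x) with h0 | h0
    · left
      intro μ hμ
      rcases eq_or_ne μ ν with rfl | hne
      · exact sub_nonneg.1 h0
      · exact sub_nonneg.1 (h1 μ hμ hne).le
    · right
      intro μ hμ
      rcases eq_or_ne μ (-ν) with rfl | hne
      · refine sub_nonneg.1 (?_ : 0 ≤ T'.gap (-ν) x)
        rw [hgap']; linarith
      · exact sub_nonneg.1 (h2 μ hμ hne).le
  have hKΩ : ∀ n, K n ⊆ Ω := by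
    intro n x hx
    obtain ⟨h1, h2⟩ := hKgap n x hx
    rcases lt_trichotomy (T.gap ν x) 0 with h0 | h0 | h0
    · apply hT'
      rw [interior_carrier]
      intro μ hμ
      rcases eq_or_ne μ (-ν) with rfl | hne
      · rw [hgap']; linarith
      · exact h2 μ hμ hne
    · exact hfΩ ⟨(sub_eq_zero.1 h0).symm, fun μ hμ hne => sub_pos.1 (h1 μ hμ hne)⟩
    · apply hT
      rw [interior_carrier]
      intro μ hμ
      rcases eq_or_ne μ ν with rfl | hne
      · exact h0
      · exact h1 μ hμ hne
  have htest : ∀ n, IsTestFunction Ω (ψ n) := fun n =>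
    ⟨hψc n, (T.isCompact_carrier.union T'.isCompact_carrier).of_isClosed_subset
      (isClosed_tsupport _) ((hts n).trans (hKT n)), (hts n).trans (hKΩ n)⟩
  have hleT : ∀ {f : Pt d → ℝ}, MemLp f 2 (volume.restrict Ω) → MemLp f 2 T.vol := fun hf =>
    memLp_vol_of_interior (hf.mono_measure (Measure.restrict_mono hT le_rfl))
  have hleT' : ∀ {f : Pt d → ℝ}, MemLp f 2 (volume.restrict Ω) → MemLp f 2 T'.vol := fun hf =>
    memLp_vol_of_interior (hf.mono_measure (Measure.restrict_mono hT' le_rfl))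
  -- Split integrals over `Ω` of functions supported in `T ∪ T'`.
  have hsplit : ∀ {f φ : Pt d → ℝ}, MemLp f 2 (volume.restrict Ω) → Continuous φ →
      tsupport φ ⊆ Ω → tsupport φ ⊆ T.carrier ∪ T'.carrier →
      ∫ x in Ω, f x * φ x = (∫ x in T.carrier, f x * φ x) + ∫ x in T'.carrier, f x * φ x := by
    intro f φ hf hφ h1 h2
    rw [setIntegral_mul_eq_of_tsupport_subset h1, ← setIntegral_mul_eq_of_tsupport_subset h2,
      ← setIntegral_congr_set (T.interior_ae_eq.union T'.interior_ae_eq),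
      setIntegral_union hdisj isOpen_interior.measurableSet, restrict_interior, restrict_interior]
    · rw [IntegrableOn, restrict_interior]
      exact integrable_mul_of_memLp (hleT hf) (T.memLp_vol hφ)
    · rw [IntegrableOn, restrict_interior]
      exact integrable_mul_of_memLp (hleT' hf) (T'.memLp_vol hφ)
  have hzero : ∀ n, ∀ μ ∈ T.normals, μ ≠ ν → ∀ f : Pt d → ℝ,
      ∫ x in T.facet μ, f x * ψ n x ∂μHE[d - 1] = 0 := by
    intro n μ hμ hne f
    refine setIntegral_eq_zero_of_forall_eq_zero fun x hx => ?_
    have : ψ n x = 0 := by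
      by_contra hcon
      have := (hKgap n x (hsupp n hcon)).1 μ hμ hne
      rw [T.gap_of_mem_facet hx] at this
      exact lt_irrefl _ this
    rw [this, mul_zero]
  have hzero' : ∀ n, ∀ μ ∈ T'.normals, μ ≠ -ν → ∀ f : Pt d → ℝ,
      ∫ x in T'.facet μ, f x * ψ n x ∂μHE[d - 1] = 0 := by
    intro n μ hμ hne f
    refine setIntegral_eq_zero_of_forall_eq_zero fun x hx => ?_
    have : ψ n x = 0 := by
      by_contra hcon
      have := (hKgap n x (hsupp n hcon)).2 μ hμ hne
      rw [T'.gap_of_mem_facet hx] at this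
      exact lt_irrefl _ this
    rw [this, mul_zero]
  obtain ⟨i, hi⟩ : ∃ i, ν i ≠ 0 := by
    by_contra! hcon
    have h1 := T.norm_normal ν hν
    rw [show ν = 0 by ext i; simpa using hcon i] at h1
    simp at h1
  have heq : ∀ n, ∫ x in T.facet ν, t ν x * ψ n x ∂μHE[d - 1] =
      ∫ x in T.facet ν, t' (-ν) x * ψ n x ∂μHE[d - 1] := by
    intro n
    have h1 := ht.green (hleT hg.memLp) (fun i => hleT (hg.memLp_grad i)) (hψ1 n) i
    have h2 := ht'.green (hleT' hg.memLp) (fun i => hleT' (hg.memLp_grad i)) (hψ1 n) i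
    rw [Finset.sum_eq_single ν (fun μ hμ hne => by rw [hzero n μ hμ hne, mul_zero])
      (fun h => (h hν).elim)] at h1
    rw [Finset.sum_eq_single (-ν) (fun μ hμ hne => by rw [hzero' n μ hμ hne, mul_zero])
      (fun h => (h hν').elim), hface] at h2
    have h3 := hg.integral_eq i (ψ n) (htest n)
    have h4 : tsupport (pd i (ψ n)) ⊆ tsupport (ψ n) :=
      (closure_mono (Function.support_comp_subset (g := fun L : Pt d →L[ℝ] ℝ =>
        L (EuclideanSpace.single i (1 : ℝ))) rfl (fderiv ℝ (ψ n)))).trans (tsupport_fderiv_subset ℝ)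
    rw [hsplit hg.memLp ((htest n).pd i).1.continuous ((htest n).pd i).2.2
      (h4.trans ((hts n).trans (hKT n))), hsplit (hg.memLp_grad i) (hψc n).continuous
      (htest n).2.2 ((hts n).trans (hKT n))] at h3
    have h5 : (-ν) i = -ν i := rfl
    rw [h5] at h2
    have h6 : ν i * (∫ x in T.facet ν, t ν x * ψ n x ∂μHE[d - 1] -
        ∫ x in T.facet ν, t' (-ν) x * ψ n x ∂μHE[d - 1]) = 0 := by linarith
    exact sub_eq_zero.1 ((mul_eq_zero.1 h6).resolve_left hi)
  have hlim : ∀ {f : Pt d → ℝ}, MemLp f 2 (T.surf ν) →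
      Tendsto (fun n => ∫ x in T.facet ν, f x * ψ n x ∂μHE[d - 1]) atTop
        (𝓝 (∫ x in T.facet ν, f x * p x ∂μHE[d - 1])) := by
    intro f hf
    have hfp := integrable_mul_of_memLp hf (T.memLp_surf hν hp.continuous)
    refine tendsto_integral_of_dominated_convergence (fun x => |f x * p x|)
      (fun n => (integrable_mul_of_memLp hf
        (T.memLp_surf hν (hψc n).continuous)).aestronglyMeasurable) hfp.abs
      (fun n => ae_of_all _ fun x => ?_) ?_
    · rw [Real.norm_eq_abs, hψ, hχ]
      simp only
      rw [← mul_assoc, ← mul_assoc, abs_mul (f x * p x * _),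
        abs_mul (f x * p x) (T.innerCutoff s _ x)]
      exact (mul_le_of_le_one_right (by positivity) (T'.abs_innerCutoff_le_one _ _ _)).trans
        (mul_le_of_le_one_right (abs_nonneg _) (T.abs_innerCutoff_le_one _ _ _))
    · have n1 : ∀ᵐ x ∂(T.surf ν), x ∉ T.facet ν \ T.openFacet ν :=
        ae_restrict_of_ae (measure_eq_zero_iff_ae_notMem.1 (T.hausdorff_facet_diff_openFacet hν))
      have n2 : ∀ᵐ x ∂(T.surf ν), x ∉ T'.facet (-ν) \ T'.openFacet (-ν) :=
        ae_restrict_of_ae (measure_eq_zero_iff_ae_notMem.1 (T'.hausdorff_facet_diff_openFacet hν'))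
      filter_upwards [n1, n2, ae_restrict_mem (T.measurableSet_facet ν)] with x hx1 hx2 hx
      have hx' : x ∈ T'.facet (-ν) := by rw [hface]; exact hx
      have ho : x ∈ T.openFacet ν := by
        by_contra hcon; exact hx1 ⟨hx, hcon⟩
      have ho' : x ∈ T'.openFacet (-ν) := by
        by_contra hcon; exact hx2 ⟨hx', hcon⟩
      refine Tendsto.congr' (f₁ := fun _ => f x * p x) ?_ tendsto_const_nhds
      filter_upwards [T.innerCutoff_eventually_eq_one (s := s) (x := x) fun μ hμ =>
          sub_pos.2 (ho.2 μ (Finset.mem_of_mem_erase hμ) (Finset.ne_of_mem_erase hμ)),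
        T'.innerCutoff_eventually_eq_one (s := s') (x := x) fun μ hμ =>
          sub_pos.2 (ho'.2 μ (Finset.mem_of_mem_erase hμ) (Finset.ne_of_mem_erase hμ))] with n h1 h2
      simp only [hψ, hχ, h1, h2, mul_one]
  have hm' : MemLp (t' (-ν)) 2 (T.surf ν) := by
    have := ht'.memLp hν'
    rwa [surf, hface] at this
  refine tendsto_nhds_unique (hlim (ht.memLp hν)) ?_
  simp only [heq]
  exact hlim hm'

end ConvexPolytope

end WG
end

noncomputable section

namespace WG

open scoped Pointwise

/-! ### Inverse inequalities for polynomials -/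

/-- The weighted lower bound for polynomials on a flat `m`-dimensional piece `K` of diameter at
most `h` and measure at least `ρ h^m`. -/
theorem exists_weighted_lower_bound_flat (m d J n : ℕ) {ρ c₀ : ℝ} (hρ : 0 < ρ) (hc₀ : 0 < c₀) :
    ∃ c > 0, ∀ (x₀ : Pt d) (U : Pt m →ₗᵢ[ℝ] Pt d) (h : ℝ), 0 < h → ∀ K : Set (Pt d),
      MeasurableSet K → K ⊆ Set.range (fun y => x₀ + U y) → K ⊆ Metric.closedBall x₀ h →
      ENNReal.ofReal (ρ * h ^ m) ≤ μHE[m] K → ∀ (s : Finset (Pt d)) (l : Pt d → Poly d),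
      s.card ≤ n → (∀ a ∈ s, l a ∈ PolyDeg d J) → (∀ a ∈ s, ∀ x ∈ K, 0 ≤ peval (l a) x) →
      (∀ a ∈ s, ∃ y, ‖y‖ ≤ h ∧ c₀ ≤ |peval (l a) (x₀ + U y)|) →
      ∀ w ∈ PolyDeg d J, ∀ y, ‖y‖ ≤ h →
        c * h ^ m * peval w (x₀ + U y) ^ 2 ≤
          ∫ x in K, (∏ a ∈ s, peval (l a) x) * peval w x ^ 2 ∂μHE[m] := by
  obtain ⟨c, hc, H⟩ := exists_weighted_lower_bound m J n LinearMap.id hρ hc₀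
  refine ⟨c, hc, fun x₀ U h hh K hKm hKU hKb hKρ s l hs hl hl0 hlc w hw y hy => ?_⟩
  have hiso := isometry_const_add x₀ U
  set P : Set (Pt m) := (fun y => x₀ + U y) ⁻¹' K with hP
  have hPm : MeasurableSet P := hiso.continuous.measurable hKm
  set S : Set (Pt m) := (fun y => h • y) ⁻¹' P with hS
  have hSm : MeasurableSet S := (measurable_const_smul h) hPm
  have hSP : h • S = P := by
    ext z
    rw [Set.mem_smul_set]
    constructor
    · rintro ⟨y, hy, rfl⟩; exact hy
    · intro hz
      refine ⟨h⁻¹ • z, ?_, smul_inv_smul₀ hh.ne' z⟩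
      change h • h⁻¹ • z ∈ P
      rwa [smul_inv_smul₀ hh.ne' z]
  have hScale : ∀ y : Pt m, x₀ + (h • U.toLinearMap) y = x₀ + U (h • y) := fun y => by simp
  choose! l' hl'J hl' using fun a (ha : a ∈ s) =>
    exists_peval_comp_affine x₀ (h • U.toLinearMap) (hl a ha)
  obtain ⟨w', hw'J, hw'⟩ := exists_peval_comp_affine x₀ (h • U.toLinearMap) hw
  have hunit : ∀ z : Pt m, ‖z‖ ≤ h → h⁻¹ • z ∈ Metric.closedBall (0 : Pt m) 1 := by
    intro z hz
    rw [mem_closedBall_zero_iff, norm_smul, norm_inv, Real.norm_of_nonneg hh.le,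
      inv_mul_le_iff₀ hh, mul_one]
    exact hz
  have hSB : S ⊆ Metric.closedBall 0 1 := by
    intro z hz
    have h1 : x₀ + U (h • z) ∈ K := hz
    have h2 := hKb h1
    rw [Metric.mem_closedBall, dist_eq_norm, add_sub_cancel_left, U.norm_map] at h2
    simpa [smul_smul, inv_mul_cancel₀ hh.ne'] using hunit _ h2
  have hSρ : ENNReal.ofReal ρ ≤ volume S := by
    have h1 : volume P = ENNReal.ofReal (h ^ m) * volume S := by
      rw [← hSP, Measure.addHaar_smul]; simp [abs_of_pos hh]
    rw [hausdorff_eq_volume_preimage x₀ U hKU, ← hP, h1, mul_comm,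
      ENNReal.ofReal_mul' hρ.le] at hKρ
    exact (ENNReal.mul_le_mul_iff_right (by simpa using pow_pos hh m) ENNReal.ofReal_ne_top).1 hKρ
  have key := H S hSB hSm hSρ (Pt d) s l' hs hl'J
    (fun a ha z hz => by rw [hl' a ha, hScale]; exact hl0 a ha _ hz)
    (fun a ha => by
      obtain ⟨z, hz, hzc⟩ := hlc a ha
      refine ⟨h⁻¹ • z, hunit z hz, ?_⟩
      rw [hl' a ha, hScale, smul_inv_smul₀ hh.ne']
      exact hzc) w' hw'J (h⁻¹ • y) (hunit y hy)
  rw [LinearMap.id_apply, hw', hScale, smul_inv_smul₀ hh.ne'] at key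
  have hint : ∫ x in K, (∏ a ∈ s, peval (l a) x) * peval w x ^ 2 ∂μHE[m] =
      h ^ m * ∫ z in S, (∏ a ∈ s, peval (l' a) z) * peval w' z ^ 2 := by
    rw [setIntegral_hausdorff_eq x₀ U hKm hKU]
    have h1 := Measure.setIntegral_comp_smul_of_pos (volume : Measure (Pt m))
      (fun y => (∏ a ∈ s, peval (l a) (x₀ + U y)) * peval w (x₀ + U y) ^ 2) S hh
    rw [hSP, finrank_euclideanSpace, Fintype.card_fin, smul_eq_mul] at h1
    rw [← hP, ← mul_inv_cancel_left₀ (pow_pos hh m).ne' (∫ y in P, _), ← h1]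
    congr 1
    refine integral_congr_ae (ae_of_all _ fun z => ?_)
    simp only [hw', hScale]
    congr 1
    exact Finset.prod_congr rfl fun a ha => by rw [hl' a ha, hScale]
  rw [hint]
  calc c * h ^ m * peval w (x₀ + U y) ^ 2 = h ^ m * (c * peval w (x₀ + U y) ^ 2) := by ring
    _ ≤ _ := mul_le_mul_of_nonneg_left key (pow_pos hh m).le

namespace ConvexPolytope

variable {d : ℕ}

theorem carrier_subset_closedBall (T : ConvexPolytope d) {x₀ : Pt d} (hx₀ : x₀ ∈ T.carrier) :
    T.carrier ⊆ Metric.closedBall x₀ T.diam := fun _ hx => by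
  rw [Metric.mem_closedBall]
  exact Metric.dist_le_diam_of_mem T.bounded hx hx₀

theorem ofReal_le_volume {T : ConvexPolytope d} {r : ℝ} (h : r ≤ (volume T.carrier).toReal) :
    ENNReal.ofReal r ≤ volume T.carrier :=
  (ENNReal.ofReal_le_ofReal h).trans ENNReal.ofReal_toReal_le

/-- The weighted lower bound on an element. -/
theorem exists_weighted_lower_bound_carrier (d J n : ℕ) {ρ c₀ : ℝ} (hρ : 0 < ρ) (hc₀ : 0 < c₀) :
    ∃ c > 0, ∀ T : ConvexPolytope d, 0 < T.diam → ρ * T.diam ^ d ≤ (volume T.carrier).toReal →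
      ∀ (s : Finset (Pt d)) (l : Pt d → Poly d), s.card ≤ n → (∀ a ∈ s, l a ∈ PolyDeg d J) →
      (∀ a ∈ s, ∀ x ∈ T.carrier, 0 ≤ peval (l a) x) →
      (∀ a ∈ s, ∃ x ∈ T.carrier, c₀ ≤ |peval (l a) x|) →
      ∀ w ∈ PolyDeg d J, ∀ x₀ ∈ T.carrier, ∀ x, ‖x - x₀‖ ≤ T.diam →
        c * T.diam ^ d * peval w x ^ 2 ≤
          ∫ x in T.carrier, (∏ a ∈ s, peval (l a) x) * peval w x ^ 2 := by
  obtain ⟨c, hc, H⟩ := exists_weighted_lower_bound_flat d d J n hρ hc₀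
  refine ⟨c, hc, fun T hT hvol s l hs hl hl0 hlc w hw x₀ hx₀ x hx => ?_⟩
  have := H x₀ LinearIsometry.id T.diam hT T.carrier T.measurableSet_carrier
    (fun z _ => ⟨z - x₀, by simp⟩) (T.carrier_subset_closedBall hx₀)
    (by rw [EuclideanSpace.euclideanHausdorffMeasure_eq_volume]; exact ofReal_le_volume hvol)
    s l hs hl hl0 (fun a ha => by
      obtain ⟨z, hz, hzc⟩ := hlc a ha
      exact ⟨z - x₀, T.facet_sub_le_diam hz hx₀, by simpa using hzc⟩) w hw (x - x₀) hx
  rw [EuclideanSpace.euclideanHausdorffMeasure_eq_volume] at this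
  simpa using this

theorem volume_le (T : ConvexPolytope d) :
    (volume T.carrier).toReal ≤
      (volume (Metric.closedBall (0 : Pt d) 1)).toReal * T.diam ^ d := by
  obtain ⟨a, ha⟩ := T.interior_nonempty
  have h1 := measure_mono (μ := volume) (T.carrier_subset_closedBall (interior_subset ha))
  rw [Measure.addHaar_closedBall' _ _ T.diam_nonneg] at h1
  have h2 := ENNReal.toReal_mono (ENNReal.mul_ne_top (by simp)
    measure_closedBall_lt_top.ne) h1
  rw [ENNReal.toReal_mul, ENNReal.toReal_ofReal (pow_nonneg T.diam_nonneg _)] at h2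
  simpa [mul_comm] using h2

/-- A pointwise bound on `T` gives an `L²` bound, by the volume of `T`. -/
theorem nrm_vol_le_of_forall (T : ConvexPolytope d) {f : Pt d → ℝ} (hf : Continuous f) {B : ℝ}
    (hB : ∀ x ∈ T.carrier, f x ^ 2 ≤ B) :
    nrm T.vol f ^ 2 ≤ (volume (Metric.closedBall (0 : Pt d) 1)).toReal * T.diam ^ d * B := by
  have hB0 : 0 ≤ B := by
    obtain ⟨a, ha⟩ := T.interior_nonempty
    exact (sq_nonneg _).trans (hB a (interior_subset ha))
  rw [nrm_sq]
  calc ∫ x in T.carrier, f x ^ 2 ≤ ∫ _ in T.carrier, B :=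
        setIntegral_mono_on (T.memLp_vol hf).integrable_sq
          (integrableOn_const T.volume_lt_top.ne) T.measurableSet_carrier hB
    _ = (volume T.carrier).toReal * B := by rw [setIntegral_const, smul_eq_mul]; rfl
    _ ≤ _ := mul_le_mul_of_nonneg_right T.volume_le hB0

theorem exists_mem_carrier (T : ConvexPolytope d) : ∃ x, x ∈ T.carrier :=
  T.interior_nonempty.imp fun _ hx => interior_subset hx

/-- Inverse inequality for derivatives. -/
theorem exists_inverse_ineq (d J : ℕ) {ρ : ℝ} (hρ : 0 < ρ) :
    ∃ C > 0, ∀ T : ConvexPolytope d, 0 < T.diam → ρ * T.diam ^ d ≤ (volume T.carrier).toReal →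
      ∀ q ∈ PolyDeg d J, ∀ i, T.diam * nrm T.vol (pd i (peval q)) ≤ C * nrm T.vol (peval q) := by
  have H0 := fun i : Fin d =>
    exists_weighted_lower_bound d J 0 (MvPolynomial.pderiv i).toLinearMap hρ one_pos
  choose c hc H using H0
  set κ := (volume (Metric.closedBall (0 : Pt d) 1)).toReal
  have hκ : 0 ≤ κ := ENNReal.toReal_nonneg
  refine ⟨1 + ∑ i, Real.sqrt (κ / c i), by positivity, fun T hT hvol q hq i => ?_⟩
  obtain ⟨x₀, hx₀⟩ := T.exists_mem_carrier
  set h := T.diam with hh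
  obtain ⟨q', hq'J, hq'⟩ := exists_peval_comp_affine x₀ (h • LinearMap.id : Pt d →ₗ[ℝ] Pt d) hq
  have hq'' : ∀ y, peval q' y = peval q (x₀ + h • y) := fun y => by rw [hq']; simp
  have hpd : ∀ y, peval (MvPolynomial.pderiv i q') y = h * pd i (peval q) (x₀ + h • y) := by
    intro y
    rw [← pd_peval, show peval q' = fun y => peval q (x₀ + h • y) from funext hq'']
    have h1 : HasFDerivAt (fun y : Pt d => x₀ + h • y) (h • ContinuousLinearMap.id ℝ (Pt d)) y :=
      ((hasFDerivAt_id y).const_smul h).const_add _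
    have h2 := (((contDiff_peval q).differentiable (by simp)) (x₀ + h • y)).hasFDerivAt.comp y h1
    have h3 : HasFDerivAt (fun y => peval q (x₀ + h • y)) _ y := h2
    rw [pd, h3.fderiv]
    simp [pd]
  set S : Set (Pt d) := (fun y => x₀ + h • y) ⁻¹' T.carrier with hS
  have hcont : Continuous fun y : Pt d => x₀ + h • y := by fun_prop
  have hSm : MeasurableSet S := hcont.measurable T.measurableSet_carrier
  have hunit : ∀ x ∈ T.carrier, h⁻¹ • (x - x₀) ∈ Metric.closedBall (0 : Pt d) 1 := by
    intro x hx
    rw [mem_closedBall_zero_iff, norm_smul, norm_inv, Real.norm_of_nonneg hT.le,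
      inv_mul_le_iff₀ hT, mul_one]
    exact T.facet_sub_le_diam hx hx₀
  have hback : ∀ x : Pt d, x₀ + h • h⁻¹ • (x - x₀) = x := fun x => by
    rw [smul_inv_smul₀ hT.ne', add_sub_cancel]
  have hSB : S ⊆ Metric.closedBall 0 1 := by
    intro z hz
    have := hunit _ hz
    rwa [add_sub_cancel_left, inv_smul_smul₀ hT.ne'] at this
  have hSsmul : h • S = (fun z => x₀ + z) ⁻¹' T.carrier := by
    ext z
    rw [Set.mem_smul_set]
    constructor
    · rintro ⟨y, hy, rfl⟩; exact hy
    · intro hz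
      refine ⟨h⁻¹ • z, ?_, smul_inv_smul₀ hT.ne' z⟩
      change x₀ + h • h⁻¹ • z ∈ T.carrier
      rw [smul_inv_smul₀ hT.ne' z]
      exact hz
  have hSρ : ENNReal.ofReal ρ ≤ volume S := by
    have h1 : volume T.carrier = ENNReal.ofReal (h ^ d) * volume S := by
      rw [← measure_preimage_add volume x₀ T.carrier, ← hSsmul, Measure.addHaar_smul]
      simp [abs_of_pos hT]
    have h2 := ofReal_le_volume hvol
    rw [h1, mul_comm, ENNReal.ofReal_mul' hρ.le] at h2
    exact (ENNReal.mul_le_mul_iff_right (by simpa using pow_pos hT d) ENNReal.ofReal_ne_top).1 h2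
  have hint : nrm T.vol (peval q) ^ 2 = h ^ d * ∫ y in S, peval q' y ^ 2 := by
    have h1 := Measure.setIntegral_comp_smul_of_pos (volume : Measure (Pt d))
      (fun y => peval q (x₀ + y) ^ 2) S hT
    rw [hSsmul, finrank_euclideanSpace, Fintype.card_fin, smul_eq_mul,
      (measurePreserving_add_left volume x₀).setIntegral_preimage_emb
        (measurableEmbedding_addLeft x₀) (fun y => peval q y ^ 2)] at h1
    rw [nrm_sq, ← mul_inv_cancel_left₀ (pow_pos hT d).ne' (∫ x in T.carrier, _), ← h1]
    simp only [hq'']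
  have hpt : ∀ x ∈ T.carrier, pd i (peval q) x ^ 2 ≤
      nrm T.vol (peval q) ^ 2 / (c i * h ^ d * h ^ 2) := by
    intro x hx
    have h1 := H i S hSB hSm hSρ Empty ∅ (fun _ => 0) (by simp) (by simp) (by simp) (by simp)
      q' hq'J (h⁻¹ • (x - x₀)) (hunit x hx)
    simp only [Finset.prod_empty, one_mul] at h1
    have h2 : peval ((MvPolynomial.pderiv i).toLinearMap q') (h⁻¹ • (x - x₀)) =
        h * pd i (peval q) x := by
      have := hpd (h⁻¹ • (x - x₀))
      rwa [hback] at this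
    rw [h2] at h1
    have hci := hc i
    rw [le_div_iff₀ (by positivity), hint]
    have h3 : (0 : ℝ) < h ^ d := pow_pos hT d
    calc pd i (peval q) x ^ 2 * (c i * h ^ d * h ^ 2)
        = h ^ d * (c i * (h * pd i (peval q) x) ^ 2) := by ring
      _ ≤ _ := mul_le_mul_of_nonneg_left h1 h3.le
  have h4 := T.nrm_vol_le_of_forall (pd_continuous (contDiff_peval q) (by simp) i) hpt
  have h5 : h * nrm T.vol (pd i (peval q)) ≤ Real.sqrt (κ / c i) * nrm T.vol (peval q) := by
    have hci := hc i
    refine abs_le_of_sq_le_sq' ?_ (mul_nonneg (Real.sqrt_nonneg _) nrm_nonneg) |>.2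
    rw [mul_pow, mul_pow, Real.sq_sqrt (by positivity)]
    calc h ^ 2 * nrm T.vol (pd i (peval q)) ^ 2
        ≤ h ^ 2 * (κ * h ^ d * (nrm T.vol (peval q) ^ 2 / (c i * h ^ d * h ^ 2))) := by gcongr
      _ = κ / c i * nrm T.vol (peval q) ^ 2 := by field_simp
  refine h5.trans (mul_le_mul_of_nonneg_right ?_ nrm_nonneg)
  have h6 := Finset.single_le_sum (f := fun i => Real.sqrt (κ / c i))
    (fun j _ => Real.sqrt_nonneg _) (Finset.mem_univ i)
  linarith

theorem peval_isTrace (T : ConvexPolytope d) (q : Poly d) :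
    T.IsTrace (peval q) (fun i => pd i (peval q)) fun _ => peval q := by
  refine ⟨fun _ => peval q, ⟨fun _ => contDiff_peval q, ?_, fun i => ?_⟩, fun ν hν =>
    ⟨T.memLp_surf hν (peval_continuous q), ?_⟩⟩ <;> simp [nrm]

/-- The trace inequality on shape-regular elements. -/
theorem exists_trace_ineq (d : ℕ) {ρ : ℝ} (hρ : 0 < ρ) :
    ∃ C > 0, ∀ T : ConvexPolytope d, 0 < T.diam → ρ * T.diam ^ d ≤ (volume T.carrier).toReal →
      ∀ g G t, T.IsTrace g G t → MemLp g 2 T.vol → (∀ i, MemLp (G i) 2 T.vol) →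
      ∀ ν ∈ T.normals, Real.sqrt T.diam * nrm (T.surf ν) (t ν) ≤ C * T.h1Norm g G := by
  obtain ⟨c, hc, H⟩ := exists_gap_ge (d := d) hρ
  refine ⟨Real.sqrt ((d + 1) / c), by positivity, fun T hT hvol g G t ht hg hG ν hν => ?_⟩
  obtain ⟨a, ha, hgap⟩ := H T hvol ν hν
  have hgap0 : 0 < T.gap ν a := lt_of_lt_of_le (by positivity) hgap
  have h1 := ht.nrm_le hg hG ha hν hgap0
  have h2 : Real.sqrt T.diam * Real.sqrt ((d + 1) / T.gap ν a) ≤ Real.sqrt ((d + 1) / c) := by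
    rw [← Real.sqrt_mul hT.le]
    refine Real.sqrt_le_sqrt ?_
    rw [mul_div_assoc', div_le_div_iff₀ hgap0 hc]
    have : (0 : ℝ) ≤ d + 1 := by positivity
    nlinarith
  calc Real.sqrt T.diam * nrm (T.surf ν) (t ν)
      ≤ Real.sqrt T.diam * (Real.sqrt ((d + 1) / T.gap ν a) * T.h1Norm g G) :=
        mul_le_mul_of_nonneg_left h1 (Real.sqrt_nonneg _)
    _ = (Real.sqrt T.diam * Real.sqrt ((d + 1) / T.gap ν a)) * T.h1Norm g G := by ring
    _ ≤ _ := mul_le_mul_of_nonneg_right h2 (T.h1Norm_nonneg _ _)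

/-- The trace inequality for polynomials, without derivatives. -/
theorem exists_trace_ineq_poly (d J : ℕ) {ρ : ℝ} (hρ : 0 < ρ) :
    ∃ C > 0, ∀ T : ConvexPolytope d, 0 < T.diam → ρ * T.diam ^ d ≤ (volume T.carrier).toReal →
      ∀ q ∈ PolyDeg d J, ∀ ν ∈ T.normals,
        Real.sqrt T.diam * nrm (T.surf ν) (peval q) ≤ C * nrm T.vol (peval q) := by
  obtain ⟨C₁, hC₁, H₁⟩ := exists_trace_ineq d hρ
  obtain ⟨C₂, hC₂, H₂⟩ := exists_inverse_ineq d J hρ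
  refine ⟨C₁ * (1 + d * C₂), by positivity, fun T hT hvol q hq ν hν => ?_⟩
  have h1 := H₁ T hT hvol _ _ _ (T.peval_isTrace q) (T.memLp_vol (peval_continuous q))
    (fun i => T.memLp_vol (pd_continuous (contDiff_peval q) (by simp) i)) ν hν
  refine h1.trans ?_
  rw [mul_assoc]
  refine mul_le_mul_of_nonneg_left ?_ hC₁.le
  rw [h1Norm, Finset.mul_sum]
  have h2 := Finset.sum_le_sum fun i (_ : i ∈ Finset.univ) => H₂ T hT hvol q hq i
  rw [Finset.sum_const, Finset.card_univ, Fintype.card_fin, nsmul_eq_mul] at h2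
  linarith

/-! ### The Poincaré inequality on convex polytopes -/

/-- The fundamental theorem of calculus along the segment from `y` to `x`. -/
theorem sq_sub_le_integral (T : ConvexPolytope d) {F : Pt d → ℝ} (hF : ContDiff ℝ ∞ F) {x y : Pt d}
    (hx : x ∈ T.carrier) (hy : y ∈ T.carrier) :
    (F x - F y) ^ 2 ≤ T.diam ^ 2 * ∫ t in Set.Ioc (0 : ℝ) 1,
      ∑ i, pd i F (y + t • (x - y)) ^ 2 := by
  have hpdc : ∀ i, Continuous (pd i F) := fun i => pd_continuous hF (by simp) i
  have hline : Continuous fun t : ℝ => y + t • (x - y) := by fun_prop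
  set Ψ : ℝ → ℝ := fun t => ∑ i, pd i F (y + t • (x - y)) ^ 2 with hΨ
  have hΨc : Continuous Ψ := continuous_finsetSum _ fun i _ => ((hpdc i).comp hline).pow 2
  set D : ℝ → ℝ := fun t => ∑ i, pd i F (y + t • (x - y)) * (x - y) i with hD
  have hDc : Continuous D :=
    continuous_finsetSum _ fun i _ => ((hpdc i).comp hline).mul continuous_const
  have hder : ∀ t, HasDerivAt (fun t : ℝ => F (y + t • (x - y))) (D t) t := by
    intro t
    have h1 : HasDerivAt (fun t : ℝ => y + t • (x - y)) (x - y) t := by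
      simpa using ((hasDerivAt_id t).smul_const (x - y)).const_add y
    have h2 := ((hF.differentiable (by simp)) (y + t • (x - y))).hasFDerivAt.comp_hasDerivAt t h1
    refine h2.congr_deriv ?_
    have hxy : x - y = ∑ i, (x - y) i • EuclideanSpace.single i (1 : ℝ) := by
      have := (EuclideanSpace.basisFun (Fin d) ℝ).sum_repr (x - y)
      simpa using this.symm
    have h3 : ∀ L : Pt d →L[ℝ] ℝ,
        L (x - y) = ∑ i, L (EuclideanSpace.single i (1 : ℝ)) * (x - y) i := fun L => by
      conv_lhs => rw [hxy, map_sum]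
      exact Finset.sum_congr rfl fun i _ => by rw [map_smul, smul_eq_mul, mul_comm]
    exact h3 (fderiv ℝ F (y + t • (x - y)))
  have hftc : F x - F y = ∫ t in Set.Ioc (0 : ℝ) 1, D t := by
    rw [← intervalIntegral.integral_of_le zero_le_one,
      intervalIntegral.integral_eq_sub_of_hasDerivAt (fun t _ => hder t)
        (hDc.intervalIntegrable _ _)]
    simp
  have hI : (volume : Measure ℝ).restrict (Set.Ioc 0 1) =
      (volume : Measure ℝ).restrict (Set.Icc 0 1) := Measure.restrict_congr_set Ioc_ae_eq_Icc
  have hm : ∀ {f : ℝ → ℝ}, Continuous f → MemLp f 2 (volume.restrict (Set.Ioc (0 : ℝ) 1)) := by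
    intro f hf
    obtain ⟨C, hC⟩ := (isCompact_Icc (a := (0 : ℝ)) (b := 1)).exists_bound_of_continuousOn
      hf.continuousOn
    refine MemLp.of_bound hf.aestronglyMeasurable C ?_
    filter_upwards [ae_restrict_mem measurableSet_Ioc] with t ht
    exact hC t ⟨ht.1.le, ht.2⟩
  have h1 := abs_integral_mul_le (hm hDc) (hm continuous_const (f := fun _ => (1 : ℝ)))
  have h2 : nrm (volume.restrict (Set.Ioc (0 : ℝ) 1)) (fun _ => (1 : ℝ)) = 1 := by
    simp [nrm]
  rw [h2, mul_one] at h1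
  simp only [mul_one] at h1
  rw [hftc, ← sq_abs]
  calc |∫ t in Set.Ioc (0 : ℝ) 1, D t| ^ 2
      ≤ nrm (volume.restrict (Set.Ioc (0 : ℝ) 1)) D ^ 2 := pow_le_pow_left₀ (abs_nonneg _) h1 2
    _ = ∫ t in Set.Ioc (0 : ℝ) 1, D t ^ 2 := nrm_sq
    _ ≤ ∫ t in Set.Ioc (0 : ℝ) 1, T.diam ^ 2 * Ψ t := by
        refine integral_mono (hm hDc).integrable_sq ?_ fun t => ?_
        · rw [hI]
          exact (continuous_const.mul hΨc).continuousOn.integrableOn_compact isCompact_Icc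
        · have h3 := Finset.sum_mul_sq_le_sq_mul_sq Finset.univ
            (fun i => pd i F (y + t • (x - y))) (fun i => (x - y) i)
          have h4 : ∑ i, (x - y) i ^ 2 ≤ T.diam ^ 2 := by
            rw [← EuclideanSpace.real_norm_sq_eq]
            exact pow_le_pow_left₀ (norm_nonneg _) (T.facet_sub_le_diam hx hy) 2
          calc D t ^ 2 ≤ Ψ t * ∑ i, (x - y) i ^ 2 := h3
            _ ≤ Ψ t * T.diam ^ 2 := mul_le_mul_of_nonneg_left h4
                (Finset.sum_nonneg fun _ _ => sq_nonneg _)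
            _ = _ := mul_comm _ _
    _ = T.diam ^ 2 * ∫ t in Set.Ioc (0 : ℝ) 1, Ψ t := integral_const_mul _ _

/-- For fixed `y` and `t ≥ 1/2`, the contraction `x ↦ y + t (x - y)` of `T` has Jacobian at least
`2^{-d}`. -/
theorem setIntegral_comp_contraction_le (T : ConvexPolytope d) {Ψ : Pt d → ℝ} (hΨ : Continuous Ψ)
    (h0 : ∀ x, 0 ≤ Ψ x) {y : Pt d} (hy : y ∈ T.carrier) {t : ℝ} (ht : 1 / 2 ≤ t) (ht1 : t ≤ 1) :
    ∫ x in T.carrier, Ψ (y + t • (x - y)) ≤ 2 ^ d * ∫ x in T.carrier, Ψ x := by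
  have ht0 : 0 < t := by linarith
  set b : Pt d := y - t • y with hb
  have hyx : ∀ x, y + t • (x - y) = t • x + b := fun x => by rw [hb]; module
  have h1 := Measure.setIntegral_comp_smul_of_pos (volume : Measure (Pt d))
    (fun z => Ψ (z + b)) T.carrier ht0
  simp only [hyx]
  rw [h1, finrank_euclideanSpace, Fintype.card_fin, smul_eq_mul]
  have h2 : (t ^ d)⁻¹ ≤ 2 ^ d := by
    rw [← inv_pow]
    exact pow_le_pow_left₀ (by positivity) (by rw [inv_le_comm₀ ht0 two_pos]; simpa using ht) d
  have h3 : ∫ z in t • T.carrier, Ψ (z + b) ≤ ∫ x in T.carrier, Ψ x := by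
    have h4 : ∫ z in (fun z => z + b) ⁻¹' T.carrier, Ψ (z + b) = ∫ x in T.carrier, Ψ x :=
      (measurePreserving_add_right volume b).setIntegral_preimage_emb
        (measurableEmbedding_addRight b) Ψ T.carrier
    rw [← h4]
    refine setIntegral_mono_set ?_ (ae_of_all _ fun _ => h0 _) (LE.le.eventuallyLE ?_)
    · have h5 : IntegrableOn Ψ T.carrier := hΨ.continuousOn.integrableOn_compact T.isCompact_carrier
      exact ((measurePreserving_add_right volume b).integrableOn_comp_preimage
        (measurableEmbedding_addRight b)).2 h5
    · intro z hz
      obtain ⟨x, hx, rfl⟩ := Set.mem_smul_set.1 hz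
      change t • x + b ∈ T.carrier
      rw [← hyx]
      have : y + t • (x - y) = t • x + (1 - t) • y := by module
      rw [this]
      exact T.convex_carrier hx hy ht0.le (by linarith) (by ring)
  exact mul_le_mul h2 h3 (integral_nonneg fun _ => h0 _) (by positivity)

theorem vol_prod_vol (T : ConvexPolytope d) : T.vol.prod T.vol =
    (volume : Measure (Pt d × Pt d)).restrict (T.carrier ×ˢ T.carrier) :=
  Measure.prod_restrict _ _

theorem integrable_vol_prod (T : ConvexPolytope d) {f : Pt d × Pt d → ℝ} (hf : Continuous f) :
    Integrable f (T.vol.prod T.vol) := by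
  rw [vol_prod_vol]
  exact hf.continuousOn.integrableOn_compact (T.isCompact_carrier.prod T.isCompact_carrier)

theorem integrable_vol_prod_prod (T : ConvexPolytope d) {f : (Pt d × Pt d) × ℝ → ℝ}
    (hf : Continuous f) :
    Integrable f ((T.vol.prod T.vol).prod (volume.restrict (Set.Ioc (0 : ℝ) 1))) := by
  rw [vol_prod_vol, Measure.prod_restrict]
  have h : IntegrableOn f ((T.carrier ×ˢ T.carrier) ×ˢ Set.Icc (0 : ℝ) 1)
      ((volume : Measure (Pt d × Pt d)).prod volume) :=
    hf.continuousOn.integrableOn_compact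
      ((T.isCompact_carrier.prod T.isCompact_carrier).prod isCompact_Icc)
  exact h.mono_set (Set.prod_mono le_rfl Set.Ioc_subset_Icc_self)

theorem setIntegral_carrier_const (T : ConvexPolytope d) (c : ℝ) :
    ∫ _ in T.carrier, c = (volume T.carrier).toReal * c := by
  rw [setIntegral_const, smul_eq_mul]; rfl

theorem isFiniteMeasure_vol (T : ConvexPolytope d) : IsFiniteMeasure T.vol :=
  ⟨by simpa using T.volume_lt_top⟩

theorem setIntegral_carrier_le (T : ConvexPolytope d) {K : Pt d → ℝ} {B : ℝ}
    (hK : Integrable K T.vol) (hB : ∀ y ∈ T.carrier, K y ≤ B) :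
    ∫ y in T.carrier, K y ≤ (volume T.carrier).toReal * B := by
  have := T.isFiniteMeasure_vol
  rw [← setIntegral_carrier_const]
  exact setIntegral_mono_on hK (integrable_const (μ := T.vol) _) T.measurableSet_carrier hB

/-- The variance of `F` on `T` as a double integral of squared differences. -/
theorem integral_vol_prod_sub_sq (T : ConvexPolytope d) {F : Pt d → ℝ} (hF : Continuous F) :
    ∫ p, (F p.1 - F p.2) ^ 2 ∂(T.vol.prod T.vol) =
      2 * (volume T.carrier).toReal * nrm T.vol F ^ 2 - 2 * (∫ x in T.carrier, F x) ^ 2 := by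
  have e1 : ∫ p : Pt d × Pt d, F p.1 ^ 2 * 1 ∂(T.vol.prod T.vol) =
      nrm T.vol F ^ 2 * (volume T.carrier).toReal := by
    rw [integral_prod_mul (fun x => F x ^ 2) (fun _ => (1 : ℝ)), nrm_sq,
      setIntegral_carrier_const, mul_one]
  have e2 : ∫ p : Pt d × Pt d, 1 * F p.2 ^ 2 ∂(T.vol.prod T.vol) =
      (volume T.carrier).toReal * nrm T.vol F ^ 2 := by
    rw [integral_prod_mul (fun _ => (1 : ℝ)) (fun x => F x ^ 2), nrm_sq,
      setIntegral_carrier_const, mul_one]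
  have e3 : ∫ p : Pt d × Pt d, F p.1 * F p.2 ∂(T.vol.prod T.vol) =
      (∫ x in T.carrier, F x) ^ 2 := by
    rw [integral_prod_mul F F, sq]
  have i1 : Integrable (fun p : Pt d × Pt d => F p.1 ^ 2 * 1) (T.vol.prod T.vol) :=
    T.integrable_vol_prod (by fun_prop)
  have i2 : Integrable (fun p : Pt d × Pt d => 1 * F p.2 ^ 2) (T.vol.prod T.vol) :=
    T.integrable_vol_prod (by fun_prop)
  have i3 : Integrable (fun p : Pt d × Pt d => 2 * (F p.1 * F p.2)) (T.vol.prod T.vol) :=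
    T.integrable_vol_prod (by fun_prop)
  have i12 : Integrable (fun p : Pt d × Pt d => F p.1 ^ 2 * 1 + 1 * F p.2 ^ 2)
      (T.vol.prod T.vol) := i1.add i2
  have e4 : ∀ p : Pt d × Pt d, (F p.1 - F p.2) ^ 2 =
      F p.1 ^ 2 * 1 + 1 * F p.2 ^ 2 - 2 * (F p.1 * F p.2) := fun p => by ring
  simp only [e4]
  rw [integral_sub i12 i3, integral_add i1 i2, integral_const_mul 2, e1, e2, e3]
  ring

/-- Averages along segments between points of `T` are bounded by averages over `T`. The segment
point is a contraction of `x` towards `y` for `t ≥ 1/2`, and of `y` towards `x` for `t ≤ 1/2`. -/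
theorem integral_vol_prod_segment_le (T : ConvexPolytope d) {Ψ : Pt d → ℝ} (hΨ : Continuous Ψ)
    (h0 : ∀ x, 0 ≤ Ψ x) {t : ℝ} (ht : 0 ≤ t) (ht1 : t ≤ 1) :
    ∫ p, Ψ (p.2 + t • (p.1 - p.2)) ∂(T.vol.prod T.vol) ≤
      (volume T.carrier).toReal * (2 ^ d * ∫ x in T.carrier, Ψ x) := by
  have hW : Integrable (fun p : Pt d × Pt d => Ψ (p.2 + t • (p.1 - p.2))) (T.vol.prod T.vol) :=
    T.integrable_vol_prod (hΨ.comp (by fun_prop))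
  have := T.isFiniteMeasure_vol
  rcases le_total (1 / 2) t with h12 | h12
  · rw [integral_prod_symm _ hW]
    exact T.setIntegral_carrier_le hW.integral_prod_right fun y hy =>
      T.setIntegral_comp_contraction_le hΨ h0 hy h12 ht1
  · rw [integral_prod _ hW]
    refine T.setIntegral_carrier_le hW.integral_prod_left fun x hx => ?_
    have h1 : ∀ y, Ψ (y + t • (x - y)) = Ψ (x + (1 - t) • (y - x)) := fun y => by
      congr 1
      module
    simp only [h1]
    exact T.setIntegral_comp_contraction_le hΨ h0 hx (by linarith) (by linarith)

theorem integral_vol_prod_sub_sq_le (T : ConvexPolytope d) {F : Pt d → ℝ} (hF : ContDiff ℝ ∞ F) :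
    ∫ p, (F p.1 - F p.2) ^ 2 ∂(T.vol.prod T.vol) ≤ T.diam ^ 2 *
      ((volume T.carrier).toReal * (2 ^ d * ∑ i, nrm T.vol (pd i F) ^ 2)) := by
  have := T.isFiniteMeasure_vol
  have hpdc : ∀ i, Continuous (pd i F) := fun i => pd_continuous hF (by simp) i
  set Ψ : Pt d → ℝ := fun x => ∑ i, pd i F x ^ 2 with hΨ
  have hΨc : Continuous Ψ := continuous_finsetSum _ fun i _ => (hpdc i).pow 2
  have hΨ0 : ∀ x, 0 ≤ Ψ x := fun x => Finset.sum_nonneg fun _ _ => sq_nonneg _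
  have hΨi : ∫ x in T.carrier, Ψ x = ∑ i, nrm T.vol (pd i F) ^ 2 := by
    simp only [nrm_sq]
    exact integral_finsetSum _ fun i _ => (T.memLp_vol (hpdc i)).integrable_sq
  set W : (Pt d × Pt d) → ℝ → ℝ := fun p t => Ψ (p.2 + t • (p.1 - p.2)) with hW
  have hWc : Continuous (Function.uncurry W) := hΨc.comp (by fun_prop)
  have hWi := T.integrable_vol_prod_prod hWc
  have hpt : ∫ p, (F p.1 - F p.2) ^ 2 ∂(T.vol.prod T.vol) ≤
      ∫ p, (T.diam ^ 2 * ∫ t in Set.Ioc (0 : ℝ) 1, W p t) ∂(T.vol.prod T.vol) := by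
    refine integral_mono_ae ?_ (hWi.integral_prod_left.const_mul _) ?_
    · exact T.integrable_vol_prod (((hF.continuous.comp continuous_fst).sub
        (hF.continuous.comp continuous_snd)).pow 2)
    · rw [vol_prod_vol]
      filter_upwards [ae_restrict_mem (T.measurableSet_carrier.prod T.measurableSet_carrier)]
        with p hp
      exact T.sq_sub_le_integral hF hp.1 hp.2
  refine hpt.trans ?_
  rw [integral_const_mul]
  refine mul_le_mul_of_nonneg_left ?_ (sq_nonneg _)
  rw [integral_integral_swap hWi, ← hΨi]
  have h5 := setIntegral_mono_on (μ := volume) (s := Set.Ioc (0 : ℝ) 1)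
    hWi.integral_prod_right (integrableOn_const (by simp)) measurableSet_Ioc
    fun t ht => T.integral_vol_prod_segment_le hΨc hΨ0 ht.1.le ht.2
  refine h5.trans (le_of_eq ?_)
  rw [setIntegral_const]
  simp

theorem poincare_smooth (T : ConvexPolytope d) {F : Pt d → ℝ} (hF : ContDiff ℝ ∞ F) :
    (volume T.carrier).toReal * nrm T.vol F ^ 2 ≤ (∫ x in T.carrier, F x) ^ 2 +
      2 ^ d * T.diam ^ 2 * (volume T.carrier).toReal * ∑ i, nrm T.vol (pd i F) ^ 2 := by
  have hbound := T.integral_vol_prod_sub_sq_le hF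
  rw [T.integral_vol_prod_sub_sq hF.continuous] at hbound
  have h6 : (0 : ℝ) ≤ T.diam ^ 2 *
      ((volume T.carrier).toReal * (2 ^ d * ∑ i, nrm T.vol (pd i F) ^ 2)) :=
    mul_nonneg (sq_nonneg _) (mul_nonneg ENNReal.toReal_nonneg
      (mul_nonneg (by positivity) (Finset.sum_nonneg fun _ _ => sq_nonneg _)))
  linarith

/-- The Poincaré inequality for functions with zero mean on a convex polytope. -/
theorem poincare (T : ConvexPolytope d) {g : Pt d → ℝ} {G : Fin d → Pt d → ℝ}
    (hg : HasWeakGrad (interior T.carrier) g G) (hmean : ∫ x in T.carrier, g x = 0) :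
    nrm T.vol g ^ 2 ≤ 2 ^ d * T.diam ^ 2 * ∑ i, nrm T.vol (G i) ^ 2 := by
  obtain ⟨F, hF⟩ := T.exists_approxH1 hg
  have hgm := memLp_vol_of_interior hg.memLp
  have hGm := fun i => memLp_vol_of_interior (hg.memLp_grad i)
  have hFm : ∀ n, MemLp (F n) 2 T.vol := fun n => T.memLp_vol (hF.contDiff n).continuous
  have hpdm : ∀ n i, MemLp (pd i (F n)) 2 T.vol := fun n i =>
    T.memLp_vol (pd_continuous (hF.contDiff n) (by simp) i)
  have hV0 : 0 < (volume T.carrier).toReal :=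
    ENNReal.toReal_pos ((isOpen_interior.measure_pos volume T.interior_nonempty).trans_le
      (measure_mono interior_subset)).ne' T.volume_lt_top.ne
  have h1 : Tendsto (fun n => ∫ x in T.carrier, F n x) atTop (𝓝 0) := by
    have := tendsto_integral_mul hFm hgm (T.memLp_vol continuous_const (f := fun _ => (1 : ℝ)))
      hF.tendsto
    simpa [hmean] using this
  have h2 := ((tendsto_nrm hFm hgm hF.tendsto).pow 2).const_mul (volume T.carrier).toReal
  have h3 := (h1.pow 2).add ((tendsto_finsetSum Finset.univ fun i _ =>
    (tendsto_nrm (fun n => hpdm n i) (hGm i) (hF.tendsto_grad i)).pow 2).const_mul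
      (2 ^ d * T.diam ^ 2 * (volume T.carrier).toReal))
  have h4 := le_of_tendsto_of_tendsto' h2 h3 fun n => T.poincare_smooth (hF.contDiff n)
  have h5 : (volume T.carrier).toReal * nrm T.vol g ^ 2 ≤ (volume T.carrier).toReal *
      (2 ^ d * T.diam ^ 2 * ∑ i, nrm T.vol (G i) ^ 2) := by
    refine h4.trans (le_of_eq ?_)
    ring
  exact le_of_mul_le_mul_left h5 hV0

end ConvexPolytope

end WG
end

noncomputable section

namespace WG

/-! ### Jets of weak derivatives and approximation by polynomials -/

theorem hasWeakGrad_of_contDiff {d : ℕ} {S : Set (Pt d)} {g : Pt d → ℝ} (hg : ContDiff ℝ ∞ g)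
    (hm : MemLp g 2 (volume.restrict S)) (hG : ∀ i, MemLp (pd i g) 2 (volume.restrict S)) :
    HasWeakGrad S g fun i => pd i g := by
  refine ⟨hm, hG, fun i φ hφ => ?_⟩
  have hsub : tsupport (pd i φ) ⊆ S := hφ.pd i |>.2.2
  rw [setIntegral_mul_eq_of_tsupport_subset hsub, setIntegral_mul_eq_of_tsupport_subset hφ.2.2]
  have hgd : Differentiable ℝ g := hg.differentiable (by simp)
  have hφd : Differentiable ℝ φ := hφ.1.differentiable (by simp)
  have h1 := integral_pd_eq_zero (φ := fun x => g x * φ x)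
    ((hg.mul hφ.1).of_le (by simp)) (hφ.2.1.mul_left) i
  have h2 : ∀ x, pd i (fun x => g x * φ x) x = g x * pd i φ x + pd i g x * φ x := fun x => by
    rw [pd_mul hgd hφd]; ring
  simp only [h2] at h1
  rw [integral_add] at h1
  · linarith
  · exact (hg.continuous.mul (pd_continuous hφ.1 (by simp) i)).integrable_of_hasCompactSupport
      ((hφ.pd i).2.1.mul_left)
  · exact ((pd_continuous hg (by simp) i).mul hφ.1.continuous).integrable_of_hasCompactSupport
      (hφ.2.1.mul_left)

theorem IsTestFunction.memLp {d : ℕ} {S : Set (Pt d)} {φ : Pt d → ℝ} (hφ : IsTestFunction S φ)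
    {μ : Measure (Pt d)} [IsFiniteMeasureOnCompacts μ] : MemLp φ 2 μ :=
  hφ.1.continuous.memLp_of_hasCompactSupport hφ.2.1

theorem HasWeakGrad.sub {d : ℕ} {S : Set (Pt d)} {g g' : Pt d → ℝ} {G G' : Fin d → Pt d → ℝ}
    (h : HasWeakGrad S g G) (h' : HasWeakGrad S g' G') :
    HasWeakGrad S (fun x => g x - g' x) fun i x => G i x - G' i x := by
  refine ⟨h.memLp.sub h'.memLp, fun i => (h.memLp_grad i).sub (h'.memLp_grad i), fun i φ hφ => ?_⟩
  simp only [sub_mul]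
  rw [integral_sub (integrable_mul_of_memLp h.memLp (hφ.pd i).memLp)
      (integrable_mul_of_memLp h'.memLp (hφ.pd i).memLp),
    integral_sub (integrable_mul_of_memLp (h.memLp_grad i) hφ.memLp)
      (integrable_mul_of_memLp (h'.memLp_grad i) hφ.memLp), h.integral_eq i φ hφ,
    h'.integral_eq i φ hφ]
  ring

/-- The iterated partial derivative of a polynomial along a word of directions. -/
def polyDeriv {d : ℕ} (p : Poly d) (I : List (Fin d)) : Poly d :=
  I.foldr (fun i q => MvPolynomial.pderiv i q) p

section PolyDeriv

variable {d : ℕ}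

theorem polyDeriv_cons (p : Poly d) (i : Fin d) (I : List (Fin d)) :
    polyDeriv p (i :: I) = MvPolynomial.pderiv i (polyDeriv p I) := rfl

theorem pderiv_comm (i j : Fin d) (p : Poly d) :
    MvPolynomial.pderiv i (MvPolynomial.pderiv j p) =
      MvPolynomial.pderiv j (MvPolynomial.pderiv i p) := by
  have h : ⁅(MvPolynomial.pderiv i : Derivation ℝ (Poly d) (Poly d)),
      (MvPolynomial.pderiv j : Derivation ℝ (Poly d) (Poly d))⁆ = 0 := by
    refine MvPolynomial.derivation_ext fun l => ?_
    rw [Derivation.commutator_apply]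
    simp [MvPolynomial.pderiv_X, Pi.single_apply, apply_ite]
  have h2 := congrArg (fun D : Derivation ℝ (Poly d) (Poly d) => D p) h
  simp only [Derivation.commutator_apply] at h2
  exact sub_eq_zero.1 h2

theorem polyDeriv_perm (p : Poly d) {I I' : List (Fin d)} (h : I.Perm I') :
    polyDeriv p I = polyDeriv p I' := by
  induction h with
  | nil => rfl
  | cons i _ ih => rw [polyDeriv_cons, polyDeriv_cons, ih]
  | swap i j l => simp only [polyDeriv_cons]; exact pderiv_comm _ _ _
  | trans _ _ ih1 ih2 => exact ih1.trans ih2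

theorem polyDeriv_add (p q : Poly d) (I : List (Fin d)) :
    polyDeriv (p + q) I = polyDeriv p I + polyDeriv q I := by
  induction I with
  | nil => rfl
  | cons i I ih => rw [polyDeriv_cons, ih, map_add]; rfl

theorem polyDeriv_smul (c : ℝ) (p : Poly d) (I : List (Fin d)) :
    polyDeriv (c • p) I = c • polyDeriv p I := by
  induction I with
  | nil => rfl
  | cons i I ih => rw [polyDeriv_cons, ih, Derivation.map_smul]; rfl

theorem totalDegree_polyDeriv {p : Poly d} {m : ℕ} (hp : p ∈ PolyDeg d m) (I : List (Fin d)) :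
    polyDeriv p I ∈ PolyDeg d (m - I.length) := by
  induction I with
  | nil => exact hp
  | cons i I ih =>
    rw [polyDeriv_cons, List.length_cons, ← Nat.sub_sub]
    exact polyDeg_pderiv ih i

theorem pderiv_eq_zero_of_degree {p : Poly d} (hp : p ∈ PolyDeg d 0) (i : Fin d) :
    MvPolynomial.pderiv i p = 0 := by
  rw [mem_polyDeg, Nat.le_zero, MvPolynomial.totalDegree_eq_zero_iff_eq_C] at hp
  rw [hp, MvPolynomial.pderiv_C]

theorem polyDeriv_eq_zero {p : Poly d} {m : ℕ} (hp : p ∈ PolyDeg d m) {I : List (Fin d)}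
    (hI : m < I.length) : polyDeriv p I = 0 := by
  induction I with
  | nil => simp at hI
  | cons i I ih =>
    rw [polyDeriv_cons]
    rcases (Nat.lt_succ_iff.1 hI).lt_or_eq with h | h
    · rw [ih h, map_zero]
    · refine pderiv_eq_zero_of_degree ?_ i
      simpa [h] using totalDegree_polyDeriv hp I

end PolyDeriv

namespace ConvexPolytope

variable {d : ℕ} (T : ConvexPolytope d)

/-- A family of weak derivatives up to order `m`: `D I` is the weak derivative of the function
`D []` along the word `I`, and does not depend on the order of the letters. -/
structure IsJet (m : ℕ) (D : List (Fin d) → Pt d → ℝ) : Prop where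
  weakGrad : ∀ I, I.length < m → HasWeakGrad (interior T.carrier) (D I) fun i => D (i :: I)
  perm : ∀ {I I'}, I.Perm I' → D I = D I'

/-- The square of the `L²` norm of the tensor of derivatives of order `l`. -/
def jetSum (D : List (Fin d) → Pt d → ℝ) (l : ℕ) : ℝ :=
  ∑ I : Fin l → Fin d, nrm T.vol (D (List.ofFn I)) ^ 2

variable {T}

theorem jetSum_nonneg (D : List (Fin d) → Pt d → ℝ) (l : ℕ) : 0 ≤ T.jetSum D l :=
  Finset.sum_nonneg fun _ _ => sq_nonneg _

theorem jetSum_zero (D : List (Fin d) → Pt d → ℝ) : T.jetSum D 0 = nrm T.vol (D []) ^ 2 := by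
  simp [jetSum]

theorem jetSum_succ (D : List (Fin d) → Pt d → ℝ) (l : ℕ) :
    T.jetSum D (l + 1) =
      ∑ I : Fin l → Fin d, ∑ i, nrm T.vol (D (i :: List.ofFn I)) ^ 2 := by
  rw [jetSum, ← (Fin.consEquiv fun _ => Fin d).sum_comp, Fintype.sum_prod_type, Finset.sum_comm]
  refine Finset.sum_congr rfl fun I _ => Finset.sum_congr rfl fun i _ => ?_
  rw [List.ofFn_succ]
  simp [Fin.consEquiv]

/-- The derivatives of order `l + 1` are the derivatives of order `l` of the first derivatives. -/
theorem jetSum_succ' {m : ℕ} {D : List (Fin d) → Pt d → ℝ} (hD : T.IsJet m D) (l : ℕ) :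
    T.jetSum D (l + 1) = ∑ i, T.jetSum (fun I => D (I ++ [i])) l := by
  rw [jetSum_succ, Finset.sum_comm]
  refine Finset.sum_congr rfl fun i _ => Finset.sum_congr rfl fun I _ => ?_
  simp only [hD.perm (List.perm_append_singleton i (List.ofFn I))]

theorem IsJet.tail {m : ℕ} {D : List (Fin d) → Pt d → ℝ} (hD : T.IsJet (m + 1) D) (i : Fin d) :
    T.IsJet m fun I => D (I ++ [i]) :=
  ⟨fun I hI => by
    have := hD.weakGrad (I ++ [i]) (by simpa using hI)
    simpa using this, fun h => hD.perm (h.append_right _)⟩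

theorem IsJet.memLp {m : ℕ} {D : List (Fin d) → Pt d → ℝ} (hD : T.IsJet m D) (hm : 0 < m)
    {I : List (Fin d)} (hI : I.length ≤ m) : MemLp (D I) 2 T.vol := by
  cases I with
  | nil => exact memLp_vol_of_interior (hD.weakGrad [] hm).memLp
  | cons i I => exact memLp_vol_of_interior ((hD.weakGrad I hI).memLp_grad i)

theorem isJet_poly (p : Poly d) (m : ℕ) : T.IsJet m fun I => peval (polyDeriv p I) := by
  refine ⟨fun I _ => ?_, fun h => by rw [polyDeriv_perm p h]⟩
  have h : ∀ q : Poly d, MemLp (peval q) 2 (volume.restrict (interior T.carrier)) := fun q => by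
    rw [T.restrict_interior]; exact T.memLp_vol (peval_continuous q)
  have hpd : ∀ i, pd i (peval (polyDeriv p I)) = peval (polyDeriv p (i :: I)) := fun i =>
    funext fun x => pd_peval _ i x
  have := hasWeakGrad_of_contDiff (contDiff_peval (polyDeriv p I)) (h _)
    (fun i => by rw [hpd]; exact h _)
  simpa only [hpd] using this

theorem IsJet.sub {m : ℕ} {D D' : List (Fin d) → Pt d → ℝ} (hD : T.IsJet m D)
    (hD' : T.IsJet m D') : T.IsJet m fun I x => D I x - D' I x :=
  ⟨fun I hI => (hD.weakGrad I hI).sub (hD'.weakGrad I hI),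
    fun h => by rw [hD.perm h, hD'.perm h]⟩

theorem IsJet.jetSum_le {m l : ℕ} {D : List (Fin d) → Pt d → ℝ} (hD : T.IsJet m D) (hl : l < m)
    (hmean : ∀ I : List (Fin d), I.length = l → ∫ x in T.carrier, D I x = 0) :
    T.jetSum D l ≤ 2 ^ d * T.diam ^ 2 * T.jetSum D (l + 1) := by
  rw [jetSum_succ, Finset.mul_sum]
  exact Finset.sum_le_sum fun I _ =>
    T.poincare (hD.weakGrad _ (by simpa using hl)) (hmean _ (by simp))

/-- The Poincaré inequality, iterated. -/
theorem IsJet.jetSum_le_pow {m : ℕ} {D : List (Fin d) → Pt d → ℝ} (hD : T.IsJet m D)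
    (hmean : ∀ I : List (Fin d), I.length < m → ∫ x in T.carrier, D I x = 0) {l n : ℕ}
    (h : l + n ≤ m) : T.jetSum D l ≤ (2 ^ d * T.diam ^ 2) ^ n * T.jetSum D (l + n) := by
  induction n with
  | zero => simp
  | succ n ih =>
    have h1 := hD.jetSum_le (l := l + n) (by omega) fun I hI => hmean I (by omega)
    have h2 : (0 : ℝ) ≤ (2 ^ d * T.diam ^ 2) ^ n := by positivity
    calc _ ≤ _ := ih (by omega)
      _ ≤ _ := mul_le_mul_of_nonneg_left h1 h2
      _ = _ := by rw [pow_succ]; ring_nf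

theorem eq_zero_of_nrm_peval {p : Poly d} (h : nrm T.vol (peval p) = 0) : p = 0 := by
  refine T.eq_zero_of_integral p ?_
  have h1 : nrm T.vol (peval p) ^ 2 = ∫ x in T.carrier, peval p x ^ 2 := nrm_sq
  rw [h] at h1
  simpa [sq] using h1.symm

/-- A polynomial of degree at most `m` all of whose derivatives have mean zero vanishes. -/
theorem eq_zero_of_moments {p : Poly d} {m : ℕ} (hp : p ∈ PolyDeg d m)
    (h : ∀ I : List (Fin d), I.length ≤ m → ∫ x in T.carrier, peval (polyDeriv p I) x = 0) :
    p = 0 := by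
  have h1 := (isJet_poly (T := T) p (m + 1)).jetSum_le_pow
    (fun I hI => h I (Nat.lt_succ_iff.1 hI)) (l := 0) (n := m + 1) (by omega)
  have h2 : T.jetSum (fun I => peval (polyDeriv p I)) (0 + (m + 1)) = 0 := by
    refine Finset.sum_eq_zero fun I _ => ?_
    have h3 : peval (polyDeriv p (List.ofFn I)) = fun _ => 0 := by
      rw [polyDeriv_eq_zero hp (by simp)]; funext x; simp [peval]
    simp only [h3, nrm_zero]; simp
  rw [h2, mul_zero, jetSum_zero] at h1
  refine eq_zero_of_nrm_peval (T := T) ?_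
  exact pow_eq_zero_iff (n := 2) (by simp) |>.1 (le_antisymm h1 (sq_nonneg _))

/-- A polynomial of degree at most `m` is determined by the mean values on `T` of its derivatives up
to order `m`; as there are as many such derivatives as coefficients, all values are attained. -/
theorem exists_poly_moments (T : ConvexPolytope d) (m : ℕ) (c : List (Fin d) → ℝ)
    (hc : ∀ {I I' : List (Fin d)}, I.Perm I' → c I = c I') :
    ∃ p ∈ PolyDeg d m, ∀ I : List (Fin d), I.length ≤ m →
      ∫ x in T.carrier, peval (polyDeriv p I) x = c I := by
  classical
  have hi : ∀ p : Poly d, IntegrableOn (peval p) T.carrier := fun p =>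
    (peval_continuous p).continuousOn.integrableOn_compact T.isCompact_carrier
  set S : Finset (Fin d →₀ ℕ) := (Finsupp.finite_of_degree_le (σ := Fin d) m).toFinset with hS
  have hSm : ∀ α, α ∈ S ↔ α.degree ≤ m := fun α => by
    rw [hS, Set.Finite.mem_toFinset]; rfl
  set w : (Fin d →₀ ℕ) → List (Fin d) := fun α => α.toMultiset.toList with hw
  have hwlen : ∀ α, (w α).length = α.degree := fun α => by
    rw [hw, Multiset.length_toList, Finsupp.card_toMultiset]; rfl
  set B : ((Fin d →₀ ℕ) → ℝ) → Poly d := fun a => ∑ α ∈ S, MvPolynomial.monomial α (a α) with hB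
  have hBmem : ∀ a, B a ∈ PolyDeg d m := fun a => Submodule.sum_mem _ fun α hα => by
    rw [mem_polyDeg]
    exact (MvPolynomial.totalDegree_monomial_le _ _).trans ((hSm α).1 hα)
  have hBcoeff : ∀ a, ∀ α ∈ S, MvPolynomial.coeff α (B a) = a α := fun a α hα => by
    rw [hB, MvPolynomial.coeff_sum]
    simp [MvPolynomial.coeff_monomial, hα]
  have hper : ∀ (f : List (Fin d) → ℝ), (∀ {I I' : List (Fin d)}, I.Perm I' → f I = f I') →
      ∀ I : List (Fin d), I.length ≤ m → ∃ α ∈ S, f I = f (w α) := by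
    intro f hf I hI
    refine ⟨Multiset.toFinsupp (I : Multiset (Fin d)), ?_, ?_⟩
    · rw [hSm, ← hwlen, hw]
      simpa using hI
    · refine hf ?_
      rw [← Multiset.coe_eq_coe, hw]
      simp
  let A : PolyDeg d m →ₗ[ℝ] PolyDeg d m :=
    { toFun := fun p => ⟨B fun α => ∫ x in T.carrier, peval (polyDeriv p.1 (w α)) x, hBmem _⟩
      map_add' := fun p q => by
        ext1
        simp only [hB, Submodule.coe_add, polyDeriv_add, peval_add, ← Finset.sum_add_distrib]
        refine Finset.sum_congr rfl fun α _ => ?_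
        rw [integral_add (hi _) (hi _), map_add]
      map_smul' := fun r p => by
        ext1
        simp only [hB, Submodule.coe_smul, polyDeriv_smul, peval_smul, integral_const_mul,
          RingHom.id_apply, Finset.smul_sum, MvPolynomial.smul_monomial, smul_eq_mul] }
  have hinj : Function.Injective A := by
    rw [← LinearMap.ker_eq_bot, LinearMap.ker_eq_bot']
    intro p hp
    refine Subtype.ext (eq_zero_of_moments (T := T) p.2 fun I hI => ?_)
    obtain ⟨α, hα, h⟩ := hper (fun I => ∫ x in T.carrier, peval (polyDeriv p.1 I) x)
      (fun h => by simp only [polyDeriv_perm _ h]) I hI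
    have h2 : B (fun α => ∫ x in T.carrier, peval (polyDeriv p.1 (w α)) x) = 0 :=
      congrArg Subtype.val hp
    have h3 := hBcoeff (fun α => ∫ x in T.carrier, peval (polyDeriv p.1 (w α)) x) α hα
    rw [h2, MvPolynomial.coeff_zero] at h3
    exact h.trans h3.symm
  have hfin : FiniteDimensional ℝ (PolyDeg d m) := inferInstance
  obtain ⟨p, hp⟩ := (LinearMap.injective_iff_surjective.1 hinj) ⟨B fun α => c (w α), hBmem _⟩
  refine ⟨p.1, p.2, fun I hI => ?_⟩
  obtain ⟨α, hα, h⟩ := hper (fun I => (∫ x in T.carrier, peval (polyDeriv p.1 I) x) - c I)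
    (fun h => by simp only [polyDeriv_perm _ h, hc h]) I hI
  have h2 : B (fun α => ∫ x in T.carrier, peval (polyDeriv p.1 (w α)) x) = B fun α => c (w α) :=
    congrArg Subtype.val hp
  have h3 := hBcoeff (fun α => ∫ x in T.carrier, peval (polyDeriv p.1 (w α)) x) α hα
  rw [h2, hBcoeff _ α hα] at h3
  linarith

/-- The `L²` projection is the best approximation. -/
theorem IsProj.nrm_le {j : ℕ} {u : Pt d → ℝ} {p q : Poly d} (hu : MemLp u 2 T.vol)
    (h : T.IsProj j u p) (hq : q ∈ PolyDeg d j) :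
    nrm T.vol (fun x => u x - peval p x) ≤ nrm T.vol fun x => u x - peval q x := by
  have hc : ∀ r : Poly d, MemLp (peval r) 2 T.vol := fun r => T.memLp_vol (peval_continuous r)
  refine Real.sqrt_le_sqrt ?_
  have h1 := h.2 (p - q) (Submodule.sub_mem _ h.1 hq)
  have h2 : ∀ x, (u x - peval q x) ^ 2 =
      ((u x - peval p x) ^ 2 + peval (p - q) x ^ 2) +
        2 * (u x * peval (p - q) x - peval p x * peval (p - q) x) := fun x => by
    simp only [peval_sub]; ring
  have i1 : Integrable (fun x => (u x - peval p x) ^ 2) T.vol := (hu.sub (hc p)).integrable_sq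
  have i2 := (hc (p - q)).integrable_sq
  have i3 := integrable_mul_of_memLp hu (hc (p - q))
  have i4 := integrable_mul_of_memLp (hc p) (hc (p - q))
  have i5 : Integrable (fun x => (u x - peval p x) ^ 2 + peval (p - q) x ^ 2) T.vol := i1.add i2
  have i6 : Integrable (fun x => 2 * (u x * peval (p - q) x - peval p x * peval (p - q) x)) T.vol :=
    (i3.sub i4).const_mul 2
  have h3 : ∫ x in T.carrier, (u x - peval q x) ^ 2 =
      (∫ x in T.carrier, (u x - peval p x) ^ 2) + ∫ x in T.carrier, peval (p - q) x ^ 2 := by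
    simp only [h2]
    rw [integral_add i5 i6, integral_add i1 i2, integral_const_mul, integral_sub i3 i4, h1]
    ring
  rw [h3]
  have : 0 ≤ ∫ x in T.carrier, peval (p - q) x ^ 2 := integral_nonneg fun _ => sq_nonneg _
  linarith

/-- Approximation by the `L²` projection (Bramble–Hilbert). -/
theorem exists_proj_error (d m J : ℕ) {ρ : ℝ} (hρ : 0 < ρ) :
    ∃ C > 0, ∀ T : ConvexPolytope d, 0 < T.diam → ρ * T.diam ^ d ≤ (volume T.carrier).toReal →
      ∀ D, T.IsJet (m + 1) D → ∀ j, m ≤ j → j ≤ J → ∀ q, T.IsProj j (D []) q →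
        T.h1Norm (fun x => D [] x - peval q x) (fun i x => D [i] x - pd i (peval q) x) ≤
          C * T.diam ^ (m + 1) * Real.sqrt (T.jetSum D (m + 1)) := by
  obtain ⟨c, hc, H⟩ := exists_inverse_ineq d J hρ
  set K : ℝ := Real.sqrt (2 ^ d) with hK
  have hK0 : 0 < K := by positivity
  refine ⟨K ^ (m + 1) + d * (K ^ m + c * (2 * K ^ (m + 1))), by positivity,
    fun T hT hvol D hD j hmj hjJ q hq => ?_⟩
  -- All derivatives of `u - p` up to order `m` have zero mean, so the Poincaré inequality can be
  -- iterated. The projection `q` is compared with `p` by the inverse inequality.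
  obtain ⟨p, hp, hmom⟩ := T.exists_poly_moments m (fun I => ∫ x in T.carrier, D I x)
    fun h => by rw [hD.perm h]
  set h := T.diam with hh
  set E : List (Fin d) → Pt d → ℝ := fun I x => D I x - peval (polyDeriv p I) x with hE
  have hEj : T.IsJet (m + 1) E := hD.sub (isJet_poly p _)
  have hcont : ∀ r : Poly d, MemLp (peval r) 2 T.vol := fun r => T.memLp_vol (peval_continuous r)
  have hfin := T.isFiniteMeasure_vol
  have hmean : ∀ I : List (Fin d), I.length < m + 1 → ∫ x in T.carrier, E I x = 0 := by
    intro I hI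
    have h1 := (hD.memLp (by omega) hI.le).integrable (by norm_num)
    have h2 := (hcont (polyDeriv p I)).integrable (by norm_num)
    rw [hE, integral_sub h1 h2, hmom I (by omega), sub_self]
  have htop : T.jetSum E (m + 1) = T.jetSum D (m + 1) := by
    refine Finset.sum_congr rfl fun I _ => ?_
    have : E (List.ofFn I) = D (List.ofFn I) := by
      funext x
      simp only [hE]
      rw [polyDeriv_eq_zero hp (by simp)]
      simp [peval]
    rw [this]
  set S := Real.sqrt (T.jetSum D (m + 1)) with hS
  have hS2 : S ^ 2 = T.jetSum D (m + 1) := Real.sq_sqrt (jetSum_nonneg _ _)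
  have hKh : ∀ n, (2 ^ d * h ^ 2) ^ n * T.jetSum E (m + 1) = ((K * h) ^ n * S) ^ 2 := by
    intro n
    have hK2 : K ^ 2 = 2 ^ d := Real.sq_sqrt (by positivity)
    rw [htop, ← hS2, ← hK2]
    ring
  have e0 : nrm T.vol (E []) ≤ (K * h) ^ (m + 1) * S := by
    refine abs_le_of_sq_le_sq' ?_ (by positivity) |>.2
    rw [← hKh, ← jetSum_zero]
    have := hEj.jetSum_le_pow hmean (l := 0) (n := m + 1) (by omega)
    rwa [zero_add] at this
  have e1 : ∀ i, nrm T.vol (E [i]) ≤ (K * h) ^ m * S := by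
    intro i
    refine abs_le_of_sq_le_sq' ?_ (by positivity) |>.2
    rw [← hKh]
    have h1 := hEj.jetSum_le_pow hmean (l := 1) (n := m) (by omega)
    rw [add_comm 1 m] at h1
    refine le_trans ?_ h1
    have h2 : T.jetSum E 1 = ∑ i, nrm T.vol (E [i]) ^ 2 := by
      rw [jetSum_succ]; simp
    rw [h2]
    exact Finset.single_le_sum (f := fun i => nrm T.vol (E [i]) ^ 2)
      (fun _ _ => sq_nonneg _) (Finset.mem_univ i)
  have hE0 : E [] = fun x => D [] x - peval p x := rfl
  have hD0 := hD.memLp (by omega) (I := []) (by simp)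
  have hD1 := fun i => hD.memLp (by omega) (I := [i]) (by simp)
  have b0 : nrm T.vol (fun x => D [] x - peval q x) ≤ (K * h) ^ (m + 1) * S :=
    (hq.nrm_le hD0 (polyDeg_mono hmj hp)).trans e0
  have b1 : nrm T.vol (peval (p - q)) ≤ 2 * ((K * h) ^ (m + 1) * S) := by
    have h1 := nrm_sub_le_sub (hcont p) hD0 (hcont q)
    rw [nrm_sub_comm] at h1
    have h2 : peval (p - q) = fun x => peval p x - peval q x := funext fun x => peval_sub p q x
    rw [h2]
    rw [hE0, nrm_sub_comm] at e0
    rw [nrm_sub_comm] at h1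
    linarith
  have b2 : ∀ i, h * nrm T.vol (fun x => D [i] x - pd i (peval q) x) ≤
      (K ^ m + c * (2 * K ^ (m + 1))) * h ^ (m + 1) * S := by
    intro i
    have h1 := H T hT hvol (p - q)
      (Submodule.sub_mem _ (polyDeg_mono (hmj.trans hjJ) hp) (polyDeg_mono hjJ hq.1)) i
    have h2 : ∀ x, D [i] x - pd i (peval q) x = E [i] x + pd i (peval (p - q)) x := fun x => by
      simp only [hE, pd_peval, map_sub, peval_sub, polyDeriv, List.foldr]
      ring
    simp only [h2]
    have h3 := nrm_add_le (hEj.memLp (by omega) (I := [i]) (by simp))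
      (T.memLp_vol (pd_continuous (contDiff_peval (p - q)) (by simp) i))
    calc _ ≤ h * (nrm T.vol (E [i]) + nrm T.vol (pd i (peval (p - q)))) :=
          mul_le_mul_of_nonneg_left h3 hT.le
      _ = h * nrm T.vol (E [i]) + h * nrm T.vol (pd i (peval (p - q))) := mul_add _ _ _
      _ ≤ h * ((K * h) ^ m * S) + c * (2 * ((K * h) ^ (m + 1) * S)) :=
          add_le_add (mul_le_mul_of_nonneg_left (e1 i) hT.le)
            (h1.trans (mul_le_mul_of_nonneg_left b1 hc.le))
      _ = _ := by ring
  rw [h1Norm, Finset.mul_sum]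
  have b3 := Finset.sum_le_sum fun i (_ : i ∈ Finset.univ) => b2 i
  rw [Finset.sum_const, Finset.card_univ, Fintype.card_fin, nsmul_eq_mul] at b3
  calc _ ≤ (K * h) ^ (m + 1) * S + d * ((K ^ m + c * (2 * K ^ (m + 1))) * h ^ (m + 1) * S) :=
        add_le_add b0 b3
    _ = _ := by ring

end ConvexPolytope

end WG
end

noncomputable section

namespace WG

namespace ConvexPolytope

variable {d : ℕ}

/-! ### Weighted norms of polynomials on shape-regular elements -/

/-- Shape regularity of a single element. -/
structure Regular (T : ConvexPolytope d) (ρ : ℝ) : Prop where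
  diam_pos : 0 < T.diam
  volume_ge : ρ * T.diam ^ d ≤ (volume T.carrier).toReal
  area_ge : ∀ ν ∈ T.normals,
    ρ * Metric.diam (T.facet ν) ^ (d - 1) ≤ (μHE[d - 1] (T.facet ν)).toReal
  diam_ge : ∀ ν ∈ T.normals, ρ * T.diam ≤ Metric.diam (T.facet ν)
  inner_le : ∀ ν ∈ T.normals, ∀ μ ∈ T.normals, ν ≠ μ → inner ℝ ν μ ≤ 1 - ρ

/-- The affine function `gap ν / h_T` as a polynomial. -/
def gapPoly (T : ConvexPolytope d) (ν : Pt d) : Poly d :=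
  affinePoly (T.offset ν / T.diam) fun i => -ν i / T.diam

theorem peval_gapPoly (T : ConvexPolytope d) (ν x : Pt d) :
    peval (T.gapPoly ν) x = T.gap ν x / T.diam := by
  rw [gapPoly, peval_affinePoly, gap, PiLp.inner_apply, sub_div, Finset.sum_div, sub_eq_add_neg,
    ← Finset.sum_neg_distrib]
  congr 1
  refine Finset.sum_congr rfl fun i _ => ?_
  simp only [RCLike.inner_apply, conj_trivial]
  ring

theorem gapPoly_mem (T : ConvexPolytope d) (ν : Pt d) : T.gapPoly ν ∈ PolyDeg d 1 :=
  affinePoly_mem _ _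

theorem gapPoly_nonneg (T : ConvexPolytope d) {ν x : Pt d} (hν : ν ∈ T.normals)
    (hx : x ∈ T.carrier) : 0 ≤ peval (T.gapPoly ν) x := by
  rw [peval_gapPoly]
  exact div_nonneg (T.gap_nonneg hν hx) T.diam_nonneg

theorem gapPoly_of_mem_facet (T : ConvexPolytope d) {ν x : Pt d} (hx : x ∈ T.facet ν) :
    peval (T.gapPoly ν) x = 0 := by
  rw [peval_gapPoly, T.gap_of_mem_facet hx, zero_div]

theorem gap_le_diam (T : ConvexPolytope d) {ν x : Pt d} (hν : ν ∈ T.normals)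
    (hx : x ∈ T.carrier) : T.gap ν x ≤ T.diam := by
  obtain ⟨y, hy⟩ := T.openFacet_nonempty hν
  have hy' := T.openFacet_subset_facet hy
  have h1 : T.gap ν x = inner ℝ ν (y - x) := by rw [inner_sub_right, hy.1]; rfl
  rw [h1]
  calc _ ≤ ‖ν‖ * ‖y - x‖ := real_inner_le_norm _ _
    _ ≤ _ := by rw [T.norm_normal ν hν, one_mul]; exact T.facet_sub_le_diam hy'.1 hx

theorem gapPoly_le_one (T : ConvexPolytope d) {ν x : Pt d} (hν : ν ∈ T.normals)
    (hx : x ∈ T.carrier) : peval (T.gapPoly ν) x ≤ 1 := by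
  rw [peval_gapPoly]
  exact div_le_one_of_le₀ (T.gap_le_diam hν hx) T.diam_nonneg

theorem prod_gapPoly_nonneg (T : ConvexPolytope d) {s : Finset (Pt d)} (hs : s ⊆ T.normals)
    {x : Pt d} (hx : x ∈ T.carrier) : 0 ≤ ∏ a ∈ s, peval (T.gapPoly a) x :=
  Finset.prod_nonneg fun _ ha => T.gapPoly_nonneg (hs ha) hx

theorem prod_gapPoly_le_one (T : ConvexPolytope d) {s : Finset (Pt d)} (hs : s ⊆ T.normals)
    {x : Pt d} (hx : x ∈ T.carrier) : ∏ a ∈ s, peval (T.gapPoly a) x ≤ 1 :=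
  Finset.prod_le_one (fun _ ha => T.gapPoly_nonneg (hs ha) hx)
    fun _ ha => T.gapPoly_le_one (hs ha) hx

/-- On the hyperplane of a facet, the distance to another facet is not uniformly small: either
the two normals are far from parallel, or they are nearly opposite. -/
theorem exists_gapPoly_ge_facet (d : ℕ) {ρ : ℝ} (hρ : 0 < ρ) :
    ∃ c > 0, ∀ T : ConvexPolytope d, T.Regular ρ → ∀ ν ∈ T.normals, ∀ ν' ∈ T.normals, ν' ≠ ν →
      ∀ x₀ ∈ T.facet ν, ∃ z, inner ℝ ν z = 0 ∧ ‖z‖ ≤ T.diam ∧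
        c ≤ |peval (T.gapPoly ν') (x₀ + z)| := by
  obtain ⟨c, hc, H⟩ := exists_gap_ge (d := d) hρ
  set δ : ℝ := min 1 (min ρ (c ^ 2 / 8)) with hδ
  have hδ0 : 0 < δ := by positivity
  have hδ1 : δ ≤ 1 := min_le_left _ _
  have hδρ : δ ≤ ρ := (min_le_right _ _).trans (min_le_left _ _)
  have hδc : δ ≤ c ^ 2 / 8 := (min_le_right _ _).trans (min_le_right _ _)
  refine ⟨min (Real.sqrt δ) (c / 2), by positivity, fun T hT ν hν ν' hν' hne x₀ hx₀ => ?_⟩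
  have hh := hT.diam_pos
  have n1 := T.norm_normal ν hν
  have n2 := T.norm_normal ν' hν'
  set a := inner ℝ ν ν' with ha
  have ha1 : a ≤ 1 - δ := (hT.inner_le ν hν ν' hν' hne.symm).trans (by linarith)
  by_cases hcase : -(1 - δ) ≤ a
  · -- Move from `x₀` against the tangential part of `ν'`.
    set τ : Pt d := ν' - a • ν with hτ
    have hτν : inner ℝ ν τ = 0 := by
      rw [hτ, inner_sub_right, inner_smul_right, real_inner_self_eq_norm_sq, n1]; simp [ha]
    have hτν' : inner ℝ ν' τ = 1 - a ^ 2 := by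
      rw [hτ, inner_sub_right, inner_smul_right, real_inner_self_eq_norm_sq, n2,
        real_inner_comm]
      ring
    have hτn : ‖τ‖ ^ 2 = 1 - a ^ 2 := by
      rw [← real_inner_self_eq_norm_sq]
      nth_rewrite 1 [hτ]
      rw [inner_sub_left, hτν', real_inner_smul_left, hτν]; ring
    have hτδ : δ ≤ ‖τ‖ ^ 2 := by rw [hτn]; nlinarith
    have hτ0 : Real.sqrt δ ≤ ‖τ‖ := Real.sqrt_le_iff.2 ⟨norm_nonneg _, hτδ⟩
    have hτpos : 0 < ‖τ‖ := lt_of_lt_of_le (Real.sqrt_pos.2 hδ0) hτ0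
    refine ⟨(-(T.diam / ‖τ‖)) • τ, ?_, ?_, ?_⟩
    · rw [inner_smul_right, hτν, mul_zero]
    · rw [norm_smul, norm_neg, Real.norm_of_nonneg (by positivity), div_mul_cancel₀ _ hτpos.ne']
    · rw [peval_gapPoly, gap_add, inner_smul_right, hτν', ← hτn]
      have h1 : T.diam / ‖τ‖ * ‖τ‖ ^ 2 = T.diam * ‖τ‖ := by field_simp
      have h2 := T.gap_nonneg hν' hx₀.1
      refine (min_le_left _ _).trans (hτ0.trans (le_trans ?_ (le_abs_self _)))
      rw [le_div_iff₀ hh]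
      linarith
  · -- If `ν'` is nearly `-ν`, the distances to the two facets have a nearly constant sum, which is
    -- large because some point `b` of `T` is far from the facet with normal `ν`.
    refine ⟨0, by simp, by simpa using hh.le, ?_⟩
    rw [add_zero, peval_gapPoly]
    obtain ⟨b, hb, hgap⟩ := H T hT.volume_ge ν hν
    refine (min_le_right _ _).trans (le_trans ?_ (le_abs_self _))
    rw [le_div_iff₀ hh]
    have h1 : T.gap ν' x₀ = T.gap ν' b + T.gap ν b - T.gap ν x₀ + inner ℝ (ν + ν') (b - x₀) := by
      simp only [gap, inner_add_left, inner_sub_right]; ring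
    have h2 : ‖ν + ν'‖ ≤ c / 2 := by
      refine abs_le_of_sq_le_sq' ?_ (by positivity) |>.2
      rw [norm_add_sq_real, n1, n2]
      push Not at hcase
      nlinarith
    have h3 : |inner ℝ (ν + ν') (b - x₀)| ≤ c / 2 * T.diam :=
      (abs_real_inner_le_norm _ _).trans (mul_le_mul h2 (T.facet_sub_le_diam hb hx₀.1)
        (norm_nonneg _) (by positivity))
    have h4 := (abs_le.1 h3).1
    have h5 := T.gap_nonneg hν' hb
    have h6 := T.gap_of_mem_facet hx₀
    linarith

theorem Regular.ofReal_le_area {T : ConvexPolytope d} {ρ : ℝ} (hT : T.Regular ρ) (hρ : 0 < ρ)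
    {ν : Pt d} (hν : ν ∈ T.normals) :
    ENNReal.ofReal (ρ * ρ ^ (d - 1) * T.diam ^ (d - 1)) ≤ μHE[d - 1] (T.facet ν) := by
  refine (ENNReal.ofReal_le_ofReal (le_trans ?_ (hT.area_ge ν hν))).trans ENNReal.ofReal_toReal_le
  rw [mul_assoc, ← mul_pow]
  have := hT.diam_pos
  gcongr
  exact hT.diam_ge ν hν

theorem area_le (T : ConvexPolytope d) {ν : Pt d} (hν : ν ∈ T.normals) :
    (μHE[d - 1] (T.facet ν)).toReal ≤
      (volume (Metric.closedBall (0 : Pt (d - 1)) 1)).toReal * T.diam ^ (d - 1) := by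
  obtain ⟨U, -, hU, -⟩ := exists_chart ν (T.norm_normal ν hν)
  obtain ⟨x₀, hx₀⟩ := T.openFacet_nonempty hν
  rw [hausdorff_eq_volume_preimage x₀ U (T.facet_subset_range hx₀.1 hU)]
  have h1 : (fun y => x₀ + U y) ⁻¹' T.facet ν ⊆ Metric.closedBall 0 T.diam := by
    intro y hy
    have := T.facet_sub_le_diam hy.1 (T.openFacet_subset_facet hx₀).1
    rw [mem_closedBall_zero_iff]
    simpa using this
  have h2 := measure_mono (μ := volume) h1
  rw [Measure.addHaar_closedBall' _ _ T.diam_nonneg] at h2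
  have h3 := ENNReal.toReal_mono (ENNReal.mul_ne_top (by simp)
    measure_closedBall_lt_top.ne) h2
  rw [ENNReal.toReal_mul, ENNReal.toReal_ofReal (pow_nonneg T.diam_nonneg _)] at h3
  simpa [mul_comm] using h3

theorem nrm_surf_le_of_forall (T : ConvexPolytope d) {ν : Pt d} (hν : ν ∈ T.normals)
    {f : Pt d → ℝ} (hf : Continuous f) {B : ℝ} (hB : ∀ x ∈ T.facet ν, f x ^ 2 ≤ B) :
    nrm (T.surf ν) f ^ 2 ≤
      (volume (Metric.closedBall (0 : Pt (d - 1)) 1)).toReal * T.diam ^ (d - 1) * B := by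
  have hB0 : 0 ≤ B := by
    obtain ⟨a, ha⟩ := T.openFacet_nonempty hν
    exact (sq_nonneg _).trans (hB a (T.openFacet_subset_facet ha))
  rw [nrm_sq]
  calc ∫ x in T.facet ν, f x ^ 2 ∂μHE[d - 1] ≤ ∫ _ in T.facet ν, B ∂μHE[d - 1] :=
        setIntegral_mono_on (T.memLp_surf hν hf).integrable_sq
          (integrableOn_const (T.facet_lt_top hν).ne) (T.measurableSet_facet ν) hB
    _ = (μHE[d - 1] (T.facet ν)).toReal * B := by rw [setIntegral_const, smul_eq_mul]; rfl
    _ ≤ _ := mul_le_mul_of_nonneg_right (T.area_le hν) hB0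

/-- On a facet, the weight given by the other facets does not degrade the `L²` norm of
polynomials. -/
theorem exists_weighted_facet (d J : ℕ) {ρ : ℝ} (hρ : 0 < ρ) :
    ∃ c > 0, ∀ T : ConvexPolytope d, T.Regular ρ → T.normals.card ≤ J → ∀ ν ∈ T.normals,
      ∀ w ∈ PolyDeg d (J + 1), ∀ x₀ ∈ T.facet ν, ∀ z, inner ℝ ν z = 0 → ‖z‖ ≤ T.diam →
        c * T.diam ^ (d - 1) * peval w (x₀ + z) ^ 2 ≤ ∫ x in T.facet ν,
          (∏ a ∈ T.normals.erase ν, peval (T.gapPoly a) x) * peval w x ^ 2 ∂μHE[d - 1] := by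
  obtain ⟨c₀, hc₀, H₀⟩ := exists_gapPoly_ge_facet d hρ
  obtain ⟨c, hc, H⟩ := exists_weighted_lower_bound_flat (d - 1) d (J + 1) J
    (ρ := ρ * ρ ^ (d - 1)) (by positivity) hc₀
  refine ⟨c, hc, fun T hT hJ ν hν w hw x₀ hx₀ z hz hzn => ?_⟩
  obtain ⟨U, -, hU, -⟩ := exists_chart ν (T.norm_normal ν hν)
  obtain ⟨y, rfl⟩ := hU z hz
  refine H x₀ U T.diam hT.diam_pos (T.facet ν) (T.measurableSet_facet ν)
    (T.facet_subset_range hx₀.2 hU)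
    (T.facet_subset_carrier.trans (T.carrier_subset_closedBall hx₀.1)) (hT.ofReal_le_area hρ hν)
    _ T.gapPoly ((Finset.card_le_card (Finset.erase_subset _ _)).trans hJ)
    (fun a _ => polyDeg_mono (by omega) (T.gapPoly_mem a))
    (fun a ha x hx => T.gapPoly_nonneg (Finset.mem_of_mem_erase ha) hx.1) (fun a ha => ?_) w hw y
    (by simpa using hzn)
  obtain ⟨z', hz', hzn', h⟩ := H₀ T hT ν hν a (Finset.mem_of_mem_erase ha)
    (Finset.ne_of_mem_erase ha) x₀ hx₀
  obtain ⟨y', rfl⟩ := hU z' hz'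
  exact ⟨y', by simpa using hzn', h⟩

theorem exists_weighted_carrier (d J : ℕ) {ρ : ℝ} (hρ : 0 < ρ) :
    ∃ c > 0, ∀ T : ConvexPolytope d, T.Regular ρ → T.normals.card ≤ J →
      ∀ w ∈ PolyDeg d (J + 1), ∀ x ∈ T.carrier, c * T.diam ^ d * peval w x ^ 2 ≤
        ∫ x in T.carrier, (∏ a ∈ T.normals, peval (T.gapPoly a) x) * peval w x ^ 2 := by
  obtain ⟨c₀, hc₀, H₀⟩ := exists_gap_ge (d := d) hρ
  obtain ⟨c, hc, H⟩ := exists_weighted_lower_bound_carrier d (J + 1) J hρ hc₀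
  refine ⟨c, hc, fun T hT hJ w hw x hx => ?_⟩
  refine H T hT.diam_pos hT.volume_ge _ T.gapPoly hJ
    (fun a _ => polyDeg_mono (by omega) (T.gapPoly_mem a))
    (fun a ha x hx => T.gapPoly_nonneg ha hx) (fun a ha => ?_) w hw x hx x
    (by simpa using T.diam_nonneg)
  obtain ⟨y, hy, h⟩ := H₀ T hT.volume_ge a ha
  refine ⟨y, hy, le_trans ?_ (le_abs_self _)⟩
  rwa [peval_gapPoly, le_div_iff₀ hT.diam_pos]

/-- Riesz representation with respect to a weight. -/
theorem exists_weighted_rep (T : ConvexPolytope d) (j : ℕ) (W : Poly d)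
    (hW : ∀ p ∈ PolyDeg d j, ∫ x in T.carrier, peval W x * (peval p x * peval p x) = 0 → p = 0)
    (r : Poly d) : ∃ p ∈ PolyDeg d j, ∀ q ∈ PolyDeg d j,
      ∫ x in T.carrier, peval W x * (peval p x * peval q x) =
        ∫ x in T.carrier, peval r x * peval q x := by
  have hi : ∀ p q : Poly d,
      IntegrableOn (fun x => peval W x * (peval p x * peval q x)) T.carrier := fun p q => by
    have := peval_integrableOn T W (p * q)
    simpa only [peval_mul] using this
  let B : PolyDeg d j →ₗ[ℝ] PolyDeg d j →ₗ[ℝ] ℝ := LinearMap.mk₂ ℝ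
    (fun p q => ∫ x in T.carrier, peval W x * (peval p.1 x * peval q.1 x))
    (fun p p' q => by
      simp only [Submodule.coe_add, peval_add, add_mul, mul_add]
      exact integral_add (hi _ _) (hi _ _))
    (fun c p q => by
      simp only [Submodule.coe_smul, peval_smul, mul_assoc, mul_left_comm _ c, integral_const_mul,
        smul_eq_mul])
    (fun p q q' => by
      simp only [Submodule.coe_add, peval_add, mul_add]
      exact integral_add (hi _ _) (hi _ _))
    (fun c p q => by
      simp only [Submodule.coe_smul, peval_smul, mul_left_comm _ c, integral_const_mul,
        smul_eq_mul])
  let L : PolyDeg d j →ₗ[ℝ] ℝ :=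
    { toFun := fun q => ∫ x in T.carrier, peval r x * peval q.1 x
      map_add' := fun p q => by
        simp only [Submodule.coe_add, peval_add, mul_add]
        exact integral_add (peval_integrableOn T _ _) (peval_integrableOn T _ _)
      map_smul' := fun c q => by
        simp only [Submodule.coe_smul, peval_smul, mul_left_comm _ c, integral_const_mul,
          smul_eq_mul, RingHom.id_apply] }
  have hinj : Function.Injective B := by
    rw [← LinearMap.ker_eq_bot, LinearMap.ker_eq_bot']
    intro p hp
    exact Subtype.ext (hW p.1 p.2 (LinearMap.congr_fun hp p))
  have hsurj : Function.Surjective B :=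
    (LinearMap.injective_iff_surjective_of_finrank_eq_finrank
      (Subspace.dual_finrank_eq (K := ℝ) (V := PolyDeg d j)).symm).1 hinj
  obtain ⟨p, hp⟩ := hsurj L
  exact ⟨p.1, p.2, fun q hq => LinearMap.congr_fun hp ⟨q, hq⟩⟩

/-! ### The weak gradient controls the jumps -/

theorem integrable_surf (T : ConvexPolytope d) {ν : Pt d} (hν : ν ∈ T.normals) {f : Pt d → ℝ}
    (hf : Continuous f) : Integrable f (T.surf ν) :=
  hf.continuousOn.integrableOn_of_subset_isCompact (T.isCompact_facet ν)
    (T.measurableSet_facet ν) subset_rfl (T.facet_lt_top hν).ne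

theorem integrable_vol (T : ConvexPolytope d) {f : Pt d → ℝ} (hf : Continuous f) :
    Integrable f T.vol :=
  hf.continuousOn.integrableOn_compact T.isCompact_carrier

/-- The weak gradient after integration by parts. -/
theorem IsWeakGradient.integral_eq {T : ConvexPolytope d} {j : ℕ} {v₀ : Poly d}
    {vb : Set (Pt d) → Poly d} {G : Fin d → Poly d} (hG : T.IsWeakGradient j v₀ vb G)
    {q : Fin d → Poly d} (hq : ∀ i, q i ∈ PolyDeg d j) :
    ∑ i, ∫ x in T.carrier, peval (G i) x * peval (q i) x =
      (∑ i, ∫ x in T.carrier, pd i (peval v₀) x * peval (q i) x) +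
        ∑ ν ∈ T.normals, ∫ x in T.facet ν,
          (peval (vb (T.facet ν)) x - peval v₀ x) * ∑ i, peval (q i) x * ν i ∂μHE[d - 1] := by
  have h1 := hG.2 q hq
  rw [integral_finsetSum _ fun i _ => peval_integrableOn T _ _] at h1
  rw [h1]
  have hc : ∀ p : Poly d, Continuous (peval p) := peval_continuous
  have h2 : ∫ x in T.carrier, peval v₀ x * peval (∑ i, MvPolynomial.pderiv i (q i)) x =
      ∑ i, ∫ x in T.carrier, peval v₀ x * pd i (peval (q i)) x := by
    have hi : ∀ i, Integrable (fun x => peval v₀ x * pd i (peval (q i)) x) T.vol := fun i =>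
      T.integrable_vol ((hc _).mul (pd_continuous (contDiff_peval (q i)) (by simp) i))
    rw [← integral_finsetSum _ fun i _ => hi i]
    simp only [peval_sum, Finset.mul_sum, pd_peval]
  have h3 : ∀ i, ∫ x in T.carrier, pd i (peval v₀) x * peval (q i) x +
      peval v₀ x * pd i (peval (q i)) x =
        ∑ ν ∈ T.normals, ν i * ∫ x in T.facet ν, peval v₀ x * peval (q i) x ∂μHE[d - 1] := by
    intro i
    rw [← T.integral_pd_eq (((contDiff_peval v₀).mul (contDiff_peval (q i))).of_le (by simp)) i]
    refine integral_congr_ae (ae_of_all _ fun x => ?_)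
    exact (pd_mul ((contDiff_peval v₀).differentiable (by simp))
      ((contDiff_peval (q i)).differentiable (by simp)) i x).symm
  have h4 : ∀ i, ∫ x in T.carrier, pd i (peval v₀) x * peval (q i) x +
      peval v₀ x * pd i (peval (q i)) x = (∫ x in T.carrier, pd i (peval v₀) x * peval (q i) x) +
        ∫ x in T.carrier, peval v₀ x * pd i (peval (q i)) x := fun i =>
    integral_add (T.integrable_vol ((pd_continuous (contDiff_peval v₀) (by simp) i).mul (hc _)))
      (T.integrable_vol ((hc _).mul (pd_continuous (contDiff_peval (q i)) (by simp) i)))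
  have h5 : ∀ ν ∈ T.normals, ∫ x in T.facet ν,
      (peval (vb (T.facet ν)) x - peval v₀ x) * ∑ i, peval (q i) x * ν i ∂μHE[d - 1] =
        (∫ x in T.facet ν, peval (vb (T.facet ν)) x * ∑ i, peval (q i) x * ν i ∂μHE[d - 1]) -
          ∑ i, ν i * ∫ x in T.facet ν, peval v₀ x * peval (q i) x ∂μHE[d - 1] := by
    intro ν hν
    have hs : Continuous fun x => ∑ i, peval (q i) x * ν i :=
      continuous_finsetSum _ fun i _ => (hc _).mul continuous_const
    have hi : ∀ p : Poly d, Integrable (fun x => peval p x * ∑ i, peval (q i) x * ν i)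
        (T.surf ν) := fun p => T.integrable_surf hν ((hc _).mul hs)
    have hi' : ∀ i, Integrable (fun x => peval v₀ x * (peval (q i) x * ν i)) (T.surf ν) :=
      fun i => T.integrable_surf hν ((hc _).mul ((hc _).mul continuous_const))
    simp only [sub_mul]
    rw [integral_sub (hi _) (hi _)]
    congr 1
    simp only [Finset.mul_sum]
    rw [integral_finsetSum _ fun i _ => hi' i]
    refine Finset.sum_congr rfl fun i _ => ?_
    rw [← integral_const_mul]
    refine integral_congr_ae (ae_of_all _ fun x => ?_)
    simp only
    ring
  rw [Finset.sum_congr rfl h5, Finset.sum_sub_distrib, h2]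
  rw [Finset.sum_comm (s := T.normals)]
  have h6 : ∑ i, ∫ x in T.carrier, pd i (peval v₀) x * peval (q i) x =
      ∑ i, ∑ ν ∈ T.normals, ν i * ∫ x in T.facet ν, peval v₀ x * peval (q i) x ∂μHE[d - 1] -
        ∑ i, ∫ x in T.carrier, peval v₀ x * pd i (peval (q i)) x := by
    rw [← Finset.sum_sub_distrib]
    refine Finset.sum_congr rfl fun i _ => ?_
    rw [← h3, h4]; ring
  rw [h6]
  ring

theorem nrm_nonneg_sum (T : ConvexPolytope d) (G : Fin d → Poly d) :
    0 ≤ ∑ i, nrm T.vol (peval (G i)) := Finset.sum_nonneg fun _ _ => nrm_nonneg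

/-- Extension of a polynomial constantly in the direction of the normal of a facet. -/
theorem exists_const_extension (T : ConvexPolytope d) {ν : Pt d} {k : ℕ}
    {p : Poly d} (hp : p ∈ PolyDeg d k) :
    ∃ r ∈ PolyDeg d k, ∀ x, peval r x = peval p (x + T.gap ν x • ν) := by
  obtain ⟨r, hr, h⟩ := exists_peval_comp_affine (T.offset ν • ν)
    (LinearMap.id - (innerₛₗ ℝ ν).smulRight ν : Pt d →ₗ[ℝ] Pt d) hp
  refine ⟨r, hr, fun x => ?_⟩
  rw [h]
  congr 1
  simp only [LinearMap.sub_apply, LinearMap.id_apply, LinearMap.smulRight_apply,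
    innerₛₗ_apply_apply, gap, sub_smul]
  module

/-- The polynomial that isolates the jump on one facet. With `L` the product of the scaled distances
to the other facets, `s` is the solution of a square linear system that makes `L (r + l_ν s)`
orthogonal to the polynomials of degree at most `k`; the system is positive definite because the
weight `L l_ν` is positive in the interior of `T`. -/
theorem exists_jump_test {T : ConvexPolytope d} {k J : ℕ} {ρ c : ℝ} (hc : 0 < c)
    (hT : T.Regular ρ)
    (H : ∀ w ∈ PolyDeg d (J + 1), ∀ x ∈ T.carrier, c * T.diam ^ d * peval w x ^ 2 ≤
        ∫ x in T.carrier, (∏ a ∈ T.normals, peval (T.gapPoly a) x) * peval w x ^ 2)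
    {ν : Pt d} (hν : ν ∈ T.normals) (hk : k ≤ J + 1) (r : Poly d) :
    ∃ s ∈ PolyDeg d k,
      (∀ p ∈ PolyDeg d k, ∫ x in T.carrier,
        (∏ a ∈ T.normals.erase ν, peval (T.gapPoly a) x) *
          (peval r x + peval (T.gapPoly ν) x * peval s x) * peval p x = 0) ∧
      nrm T.vol (peval s) ≤
        (volume (Metric.closedBall (0 : Pt d) 1)).toReal / c * nrm T.vol (peval r) := by
  set κ := (volume (Metric.closedBall (0 : Pt d) 1)).toReal
  have hκ : 0 ≤ κ := ENNReal.toReal_nonneg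
  set L : Poly d := ∏ a ∈ T.normals.erase ν, T.gapPoly a with hL
  set W : Poly d := ∏ a ∈ T.normals, T.gapPoly a with hW
  have hLe : ∀ x, peval L x = ∏ a ∈ T.normals.erase ν, peval (T.gapPoly a) x := fun x =>
    peval_prod _ _ _
  have hWe : ∀ x, peval W x = ∏ a ∈ T.normals, peval (T.gapPoly a) x := fun x => peval_prod _ _ _
  have hWL : ∀ x, peval W x = peval L x * peval (T.gapPoly ν) x := fun x => by
    rw [hWe, hLe, mul_comm, Finset.mul_prod_erase _ (fun a => peval (T.gapPoly a) x) hν]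
  have hh := hT.diam_pos
  simp only [← hLe, ← hWe] at H ⊢
  have hdef : ∀ p ∈ PolyDeg d k,
      ∫ x in T.carrier, peval W x * (peval p x * peval p x) = 0 → p = 0 := by
    intro p hp h0
    refine eq_zero_of_nrm_peval (T := T) ?_
    have h1 : ∀ x ∈ T.carrier, peval p x ^ 2 ≤ 0 := by
      intro x hx
      have h2 := H p (polyDeg_mono hk hp) x hx
      simp only [sq (peval p _)] at h2 ⊢
      rw [h0] at h2
      have h3 : 0 < c * T.diam ^ d := by positivity
      by_contra hcon
      push Not at hcon
      have := mul_pos h3 hcon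
      linarith
    have h4 := T.nrm_vol_le_of_forall (peval_continuous p) h1
    rw [mul_zero] at h4
    exact pow_eq_zero_iff (n := 2) (by simp) |>.1 (le_antisymm h4 (sq_nonneg _))
  obtain ⟨s, hs, hsr⟩ := T.exists_weighted_rep k W hdef (-(L * r))
  refine ⟨s, hs, fun p hp => ?_, ?_⟩
  · have h1 := hsr p hp
    have e : ∀ x, peval L x * (peval r x + peval (T.gapPoly ν) x * peval s x) * peval p x =
        peval W x * (peval s x * peval p x) - peval (-(L * r)) x * peval p x := fun x => by
      rw [hWL, peval_neg, peval_mul]; ring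
    simp only [e]
    have i1 := peval_integrableOn T W (s * p)
    simp only [peval_mul] at i1
    rw [integral_sub i1 (peval_integrableOn T _ _), h1, sub_self]
  · have hsm := T.memLp_vol (peval_continuous s)
    have hrm := T.memLp_vol (peval_continuous r)
    have h1 : ∫ x in T.carrier, peval W x * peval s x ^ 2 ≤
        nrm T.vol (peval r) * nrm T.vol (peval s) := by
      have h2 := hsr s hs
      have h3 : ∫ x in T.carrier, peval W x * peval s x ^ 2 =
          ∫ x in T.carrier, peval (-(L * r)) x * peval s x := by
        rw [← h2]; simp only [sq]
      rw [h3]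
      refine (integral_mul_le (T.memLp_vol (peval_continuous _)) hsm).trans
        (mul_le_mul_of_nonneg_right (Real.sqrt_le_sqrt ?_) nrm_nonneg)
      refine setIntegral_mono_on (T.memLp_vol (peval_continuous _)).integrable_sq
        hrm.integrable_sq T.measurableSet_carrier fun x hx => ?_
      have h4 : 0 ≤ peval L x := by
        rw [hLe]; exact T.prod_gapPoly_nonneg (Finset.erase_subset _ _) hx
      have h5 : peval L x ≤ 1 := by
        rw [hLe]; exact T.prod_gapPoly_le_one (Finset.erase_subset _ _) hx
      rw [peval_neg, peval_mul, neg_sq, mul_pow]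
      exact mul_le_of_le_one_left (sq_nonneg _) (pow_le_one₀ h4 h5)
    have h2 : ∀ x ∈ T.carrier, peval s x ^ 2 ≤
        nrm T.vol (peval r) * nrm T.vol (peval s) / (c * T.diam ^ d) := fun x hx => by
      rw [le_div_iff₀ (by positivity), mul_comm]
      exact (H s (polyDeg_mono hk hs) x hx).trans h1
    have h3 := T.nrm_vol_le_of_forall (peval_continuous s) h2
    rcases (nrm_nonneg (μ := T.vol) (f := peval s)).eq_or_lt with h0 | h0
    · rw [← h0]; exact mul_nonneg (div_nonneg hκ hc.le) nrm_nonneg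
    · refine le_of_mul_le_mul_right ?_ h0
      rw [← sq]
      refine h3.trans (le_of_eq ?_)
      change κ * T.diam ^ d * _ = _
      field_simp

/-- The key bound: the jump `v₀ - v_b` on a facet is controlled by the weak gradient. The degree
`n_T + k - 1` leaves room for a test field which is normal to the facet, vanishes on all other
facets, equals the weighted jump on the facet, and is orthogonal to `∇ v₀`. -/
theorem exists_jump_bound (d : ℕ) {k : ℕ} (hk : 1 ≤ k) (J : ℕ) {ρ : ℝ} (hρ : 0 < ρ) :
    ∃ C > 0, ∀ T : ConvexPolytope d, T.Regular ρ → ∀ j, T.numFacets + k - 1 ≤ j → j ≤ J →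
      ∀ v₀ ∈ PolyDeg d k, ∀ vb : Set (Pt d) → Poly d,
      (∀ ν ∈ T.normals, vb (T.facet ν) ∈ PolyDeg d k) →
      ∀ G, T.IsWeakGradient j v₀ vb G → ∀ ν ∈ T.normals,
        nrm (T.surf ν) (fun x => peval v₀ x - peval (vb (T.facet ν)) x) ≤
          C * Real.sqrt T.diam * ∑ i, nrm T.vol (peval (G i)) := by
  obtain ⟨c₁, hc₁, H₁⟩ := exists_weighted_facet d J hρ
  obtain ⟨c₂, hc₂, H₂⟩ := exists_weighted_carrier d J hρ
  set κ := (volume (Metric.closedBall (0 : Pt d) 1)).toReal with hκd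
  set κ' := (volume (Metric.closedBall (0 : Pt (d - 1)) 1)).toReal with hκd'
  have hκ : 0 ≤ κ := ENNReal.toReal_nonneg
  have hκ' : 0 ≤ κ' := ENNReal.toReal_nonneg
  refine ⟨Real.sqrt (κ' / c₁) * ((1 + κ / c₂) * Real.sqrt (κ / c₁)) + 1, by positivity,
    fun T hT j hj hjJ v₀ hv₀ vb hvb G hG ν hν => ?_⟩
  have hcard : 1 ≤ T.normals.card := Finset.card_pos.2 ⟨ν, hν⟩
  have hcardJ : T.normals.card ≤ J := by rw [numFacets] at hj; omega
  have hkJ : k ≤ J := by rw [numFacets] at hj; omega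
  have hh := hT.diam_pos
  have hdpos : 1 ≤ d := by
    rcases Nat.eq_zero_or_pos d with rfl | h
    · have := T.norm_normal ν hν
      simp [Subsingleton.elim ν 0] at this
    · exact h
  set h := T.diam with hhd
  set w : Poly d := vb (T.facet ν) - v₀ with hw
  have hwk : w ∈ PolyDeg d k := Submodule.sub_mem _ (hvb ν hν) hv₀
  -- `r` extends the jump `w` constantly along `ν`.
  obtain ⟨r, hrk, hr⟩ := T.exists_const_extension (ν := ν) hwk
  obtain ⟨s, hsk, horth, hsn⟩ := exists_jump_test (k := k - 1) hc₂ hT (H₂ T hT hcardJ) hν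
    (by omega) r
  set L : Poly d := ∏ a ∈ T.normals.erase ν, T.gapPoly a with hL
  have hLe : ∀ x, peval L x = ∏ a ∈ T.normals.erase ν, peval (T.gapPoly a) x := fun x =>
    peval_prod _ _ _
  set Q : Poly d := L * (r + T.gapPoly ν * s) with hQ
  have hQe : ∀ x, peval Q x = peval L x * (peval r x + peval (T.gapPoly ν) x * peval s x) :=
    fun x => by rw [hQ, peval_mul, peval_add, peval_mul]
  have hLdeg : L ∈ PolyDeg d (T.normals.card - 1) := by
    rw [mem_polyDeg, hL, ← Finset.card_erase_of_mem hν]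
    refine (MvPolynomial.totalDegree_finsetProd _ _).trans ?_
    rw [Finset.card_eq_sum_ones]
    exact Finset.sum_le_sum fun a _ => mem_polyDeg.1 (T.gapPoly_mem a)
  have hQj : Q ∈ PolyDeg d j := by
    refine polyDeg_mono (k := (T.normals.card - 1) + k) (by rw [numFacets] at hj; omega) ?_
    refine polyDeg_mul hLdeg (Submodule.add_mem _ hrk ?_)
    exact polyDeg_mono (by omega) (polyDeg_mul (T.gapPoly_mem ν) hsk)
  set q : Fin d → Poly d := fun i => ν i • Q with hq
  have hqj : ∀ i, q i ∈ PolyDeg d j := fun i => Submodule.smul_mem _ _ hQj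
  have hqe : ∀ i x, peval (q i) x = ν i * peval Q x := fun i x => peval_smul _ _ _
  have hνν : ∑ i, ν i * ν i = 1 := by
    have h1 := T.norm_normal ν hν
    have h2 := EuclideanSpace.real_norm_sq_eq ν
    rw [h1] at h2
    simp only [← sq]
    linarith
  have hgreen := hG.integral_eq hqj
  -- The volume term vanishes by the choice of `s`.
  have hvol : ∑ i, ∫ x in T.carrier, pd i (peval v₀) x * peval (q i) x = 0 := by
    refine Finset.sum_eq_zero fun i _ => ?_
    have h1 := horth _ (polyDeg_pderiv hv₀ i)
    have h2 : ∀ x, pd i (peval v₀) x * peval (q i) x = ν i *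
        ((∏ a ∈ T.normals.erase ν, peval (T.gapPoly a) x) *
          (peval r x + peval (T.gapPoly ν) x * peval s x) *
            peval (MvPolynomial.pderiv i v₀) x) := fun x => by
      rw [hqe, hQe, pd_peval, hLe]; ring
    simp only [h2]
    rw [integral_const_mul, h1, mul_zero]
  set A : ℝ := ∫ x in T.facet ν, (∏ a ∈ T.normals.erase ν, peval (T.gapPoly a) x) *
    peval w x ^ 2 ∂μHE[d - 1] with hA
  have hsurf : ∑ ν' ∈ T.normals, ∫ x in T.facet ν',
      (peval (vb (T.facet ν')) x - peval v₀ x) * ∑ i, peval (q i) x * ν' i ∂μHE[d - 1] = A := by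
    rw [Finset.sum_eq_single_of_mem ν hν]
    · rw [hA]
      refine setIntegral_congr_fun (T.measurableSet_facet ν) fun x hx => ?_
      have h1 : ∑ i, peval (q i) x * ν i = peval Q x := by
        have : ∀ i, peval (q i) x * ν i = peval Q x * (ν i * ν i) := fun i => by
          rw [hqe]; ring
        rw [Finset.sum_congr rfl fun i _ => this i, ← Finset.mul_sum, hνν, mul_one]
      simp only
      rw [h1, hQe, T.gapPoly_of_mem_facet hx, hr, T.gap_of_mem_facet hx, zero_smul, add_zero,
        zero_mul, add_zero, ← hLe, hw, peval_sub]
      ring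
    · intro ν' hν' hne
      rw [← integral_zero (Pt d) ℝ (μ := T.surf ν')]
      refine setIntegral_congr_fun (T.measurableSet_facet ν') fun x hx => ?_
      have h1 : peval Q x = 0 := by
        have h0 : ∏ a ∈ T.normals.erase ν, peval (T.gapPoly a) x = 0 :=
          Finset.prod_eq_zero (Finset.mem_erase.2 ⟨hne, hν'⟩) (T.gapPoly_of_mem_facet hx)
        rw [hQe, hLe, h0, zero_mul]
      simp [hqe, h1]
  rw [hvol, hsurf, zero_add] at hgreen
  have hc : ∀ p : Poly d, MemLp (peval p) 2 T.vol := fun p => T.memLp_vol (peval_continuous p)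
  set N := ∑ i, nrm T.vol (peval (G i)) with hN
  have hN0 : 0 ≤ N := T.nrm_nonneg_sum G
  -- `A` is the weighted norm of the jump; Green's identity equates it with `∑ i, (G i, q i)_T`.
  have hAN : A ≤ N * nrm T.vol (peval Q) := by
    rw [← hgreen, hN, Finset.sum_mul]
    refine Finset.sum_le_sum fun i _ => (integral_mul_le (hc _) (hc _)).trans
      (mul_le_mul_of_nonneg_left ?_ nrm_nonneg)
    have h1 : peval (q i) = fun x => ν i * peval Q x := funext (hqe i)
    rw [h1, nrm_const_mul]
    refine mul_le_of_le_one_left nrm_nonneg ?_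
    have h2 := PiLp.norm_apply_le ν i
    rwa [T.norm_normal ν hν] at h2
  obtain ⟨x₀, hx₀⟩ := T.openFacet_nonempty hν
  have hx₀f := T.openFacet_subset_facet hx₀
  have hsup : ∀ z, inner ℝ ν z = 0 → ‖z‖ ≤ h →
      peval w (x₀ + z) ^ 2 ≤ A / (c₁ * h ^ (d - 1)) := fun z hz hzn => by
    rw [le_div_iff₀ (by positivity), mul_comm]
    exact H₁ T hT hcardJ ν hν w (polyDeg_mono (by omega) hwk) x₀ hx₀f z hz hzn
  have hA0 : 0 ≤ A := setIntegral_nonneg (T.measurableSet_facet ν) fun x hx =>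
    mul_nonneg (T.prod_gapPoly_nonneg (Finset.erase_subset _ _) hx.1) (sq_nonneg _)
  -- The projection of `x ∈ T` to the hyperplane of the facet lies in a ball of radius `h`, where
  -- `w` is bounded by its weighted norm on the facet.
  have hrsup : ∀ x ∈ T.carrier, peval r x ^ 2 ≤ A / (c₁ * h ^ (d - 1)) := by
    intro x hx
    set z := x + T.gap ν x • ν - x₀ with hz
    have hz0 : inner ℝ ν z = 0 := by
      rw [hz, inner_sub_right, inner_add_right, inner_smul_right, real_inner_self_eq_norm_sq,
        T.norm_normal ν hν, hx₀.1, gap]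
      ring
    have h1 : x + T.gap ν x • ν = x₀ + z := by rw [hz]; abel
    have h2 : x - x₀ = z - T.gap ν x • ν := by rw [hz]; abel
    have h3 : ‖z‖ ^ 2 ≤ ‖x - x₀‖ ^ 2 := by
      rw [h2, norm_sub_sq_real z, inner_smul_right, real_inner_comm, hz0]
      have := sq_nonneg ‖T.gap ν x • ν‖
      linarith
    rw [hr, h1]
    exact hsup z hz0 ((abs_le_of_sq_le_sq' h3 (norm_nonneg _)).2.trans
      (T.facet_sub_le_diam hx hx₀f.1))
  have hpow : h ^ d = h * h ^ (d - 1) := by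
    rw [← pow_succ', Nat.sub_add_cancel hdpos]
  have hrn : nrm T.vol (peval r) ≤ Real.sqrt (κ / c₁) * Real.sqrt h * Real.sqrt A := by
    have h1 := T.nrm_vol_le_of_forall (peval_continuous r) hrsup
    refine abs_le_of_sq_le_sq' ?_ (by positivity) |>.2
    rw [mul_pow, mul_pow, Real.sq_sqrt (by positivity), Real.sq_sqrt hh.le, Real.sq_sqrt hA0]
    refine h1.trans (le_of_eq ?_)
    rw [← hhd, ← hκd, hpow]
    field_simp
  have hQn : nrm T.vol (peval Q) ≤ (1 + κ / c₂) * nrm T.vol (peval r) := by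
    have h1 : nrm T.vol (peval Q) ≤ nrm T.vol (fun x => |peval r x| + |peval s x|) := by
      have hi : MemLp (fun x => |peval r x| + |peval s x|) 2 T.vol :=
        T.memLp_vol ((peval_continuous r).abs.add (peval_continuous s).abs)
      refine Real.sqrt_le_sqrt (setIntegral_mono_on (hc Q).integrable_sq hi.integrable_sq
        T.measurableSet_carrier fun x hx => ?_)
      have hsub := Finset.erase_subset ν T.normals
      have h2 : |peval L x| ≤ 1 := by
        rw [hLe, abs_of_nonneg (T.prod_gapPoly_nonneg hsub hx)]
        exact T.prod_gapPoly_le_one hsub hx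
      have h3 : |peval (T.gapPoly ν) x| ≤ 1 := by
        rw [abs_of_nonneg (T.gapPoly_nonneg hν hx)]
        exact T.gapPoly_le_one hν hx
      have h4 : |peval Q x| ≤ |peval r x| + |peval s x| := by
        rw [hQe, abs_mul]
        refine (mul_le_of_le_one_left (abs_nonneg _) h2).trans ((abs_add_le _ _).trans ?_)
        rw [abs_mul]
        exact add_le_add le_rfl (mul_le_of_le_one_left (abs_nonneg _) h3)
      rw [← sq_abs]
      exact pow_le_pow_left₀ (abs_nonneg _) h4 2
    have h2 : nrm T.vol (fun x => |peval r x| + |peval s x|) ≤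
        nrm T.vol (peval r) + nrm T.vol (peval s) := by
      have := nrm_add_le (T.memLp_vol (peval_continuous r).abs)
        (T.memLp_vol (peval_continuous s).abs)
      simpa [nrm] using this
    calc _ ≤ _ := h1
      _ ≤ _ := h2
      _ ≤ nrm T.vol (peval r) + κ / c₂ * nrm T.vol (peval r) := by gcongr
      _ = _ := by ring
  have hsqA : Real.sqrt A ≤ (1 + κ / c₂) * Real.sqrt (κ / c₁) * Real.sqrt h * N := by
    rcases (Real.sqrt_nonneg A).eq_or_lt with h0 | h0
    · rw [← h0]; positivity
    · refine le_of_mul_le_mul_right ?_ h0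
      rw [Real.mul_self_sqrt hA0]
      calc A ≤ N * nrm T.vol (peval Q) := hAN
        _ ≤ N * ((1 + κ / c₂) * (Real.sqrt (κ / c₁) * Real.sqrt h * Real.sqrt A)) := by
            gcongr
            exact hQn.trans (mul_le_mul_of_nonneg_left hrn (by positivity))
        _ = _ := by ring
  have hfin : nrm (T.surf ν) (fun x => peval v₀ x - peval (vb (T.facet ν)) x) ≤
      Real.sqrt (κ' / c₁) * Real.sqrt A := by
    have h1 : ∀ x ∈ T.facet ν, (peval v₀ x - peval (vb (T.facet ν)) x) ^ 2 ≤
        A / (c₁ * h ^ (d - 1)) := fun x hx => by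
      have h2 := hrsup x hx.1
      rw [hr, T.gap_of_mem_facet hx, zero_smul, add_zero, hw, peval_sub] at h2
      rwa [← neg_sq, neg_sub]
    have h2 := T.nrm_surf_le_of_forall hν
      ((peval_continuous v₀).sub (peval_continuous (vb (T.facet ν)))) h1
    refine abs_le_of_sq_le_sq' ?_ (by positivity) |>.2
    rw [mul_pow, Real.sq_sqrt (by positivity), Real.sq_sqrt hA0]
    refine h2.trans (le_of_eq ?_)
    rw [← hhd, ← hκd']
    field_simp
  calc _ ≤ _ := hfin
    _ ≤ Real.sqrt (κ' / c₁) * ((1 + κ / c₂) * Real.sqrt (κ / c₁) * Real.sqrt h * N) := by gcongr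
    _ = Real.sqrt (κ' / c₁) * ((1 + κ / c₂) * Real.sqrt (κ / c₁)) * Real.sqrt h * N := by ring
    _ ≤ _ := by
        gcongr
        linarith

end ConvexPolytope

end WG
end

noncomputable section

namespace WG

variable {d : ℕ}

/-! ### Sobolev functions and their jets -/

theorem fderiv_apply_const {φ : Pt d → ℝ} (hφ : ContDiff ℝ ∞ φ) (v w x : Pt d) :
    fderiv ℝ (fun y => fderiv ℝ φ y v) x w = fderiv ℝ (fderiv ℝ φ) x w v := by
  have h : DifferentiableAt ℝ (fderiv ℝ φ) x :=
    (hφ.fderiv_right (m := ∞) (by simp)).differentiable (by simp) x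
  have h2 := (h.hasFDerivAt.clm_apply (hasFDerivAt_const v x)).fderiv
  rw [h2]
  simp

theorem pd_comm {φ : Pt d → ℝ} (hφ : ContDiff ℝ ∞ φ) (i j : Fin d) :
    pd i (pd j φ) = pd j (pd i φ) := by
  funext x
  have h := (hφ.contDiffAt (x := x)).isSymmSndFDerivAt (by
    rw [minSmoothness_of_isRCLikeNormedField];
    exact WithTop.coe_le_coe.2 (le_top : (2 : ℕ∞) ≤ ⊤))
  have h1 := fderiv_apply_const hφ (EuclideanSpace.single j 1) (EuclideanSpace.single i 1) x
  have h2 := fderiv_apply_const hφ (EuclideanSpace.single i 1) (EuclideanSpace.single j 1) x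
  exact (h1.trans (h _ _)).trans h2.symm

/-- The iterated partial derivative of a function along a word of directions. -/
def wordDeriv (I : List (Fin d)) (φ : Pt d → ℝ) : Pt d → ℝ := I.foldr (fun i ψ => pd i ψ) φ

theorem wordDeriv_cons (i : Fin d) (I : List (Fin d)) (φ : Pt d → ℝ) :
    wordDeriv (i :: I) φ = pd i (wordDeriv I φ) := rfl

theorem wordDeriv_append_singleton (i : Fin d) (I : List (Fin d)) (φ : Pt d → ℝ) :
    wordDeriv (I ++ [i]) φ = wordDeriv I (pd i φ) := by
  simp [wordDeriv]

theorem contDiff_pd {φ : Pt d → ℝ} (hφ : ContDiff ℝ ∞ φ) (i : Fin d) : ContDiff ℝ ∞ (pd i φ) :=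
  (hφ.fderiv_right (m := ∞) (by simp)).clm_apply contDiff_const

theorem contDiff_wordDeriv {φ : Pt d → ℝ} (hφ : ContDiff ℝ ∞ φ) (I : List (Fin d)) :
    ContDiff ℝ ∞ (wordDeriv I φ) := by
  induction I with
  | nil => exact hφ
  | cons i I ih => exact contDiff_pd ih i

theorem wordDeriv_perm {φ : Pt d → ℝ} (hφ : ContDiff ℝ ∞ φ) {I I' : List (Fin d)}
    (h : I.Perm I') : wordDeriv I φ = wordDeriv I' φ := by
  induction h with
  | nil => rfl
  | cons i _ ih => rw [wordDeriv_cons, wordDeriv_cons, ih]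
  | swap i j l =>
    simp only [wordDeriv_cons]
    exact pd_comm (contDiff_wordDeriv hφ l) _ _
  | trans _ _ ih1 ih2 => exact ih1.trans ih2

theorem partialDeriv_eq {φ : Pt d → ℝ} (hφ : ContDiff ℝ ∞ φ) {m : ℕ} (I : Fin m → Fin d) :
    partialDeriv I φ = wordDeriv (List.ofFn I) φ := by
  induction m with
  | zero => funext x; simp [partialDeriv, wordDeriv]
  | succ m ih =>
    rw [List.ofFn_succ, wordDeriv_cons, ← ih fun t => I t.succ]
    funext x
    have hd : DifferentiableAt ℝ (iteratedFDeriv ℝ m φ) x :=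
      hφ.differentiable_iteratedFDeriv (by exact_mod_cast WithTop.coe_lt_top m) x
    have h := fderiv_continuousMultilinear_apply_const hd
      (fun t => EuclideanSpace.single (I t.succ) (1 : ℝ))
    rw [partialDeriv, iteratedFDeriv_succ_apply_left, pd]
    have h2 := congrArg (fun L : Pt d →L[ℝ] ℝ => L (EuclideanSpace.single (I 0) (1 : ℝ))) h
    exact h2.symm

/-- `g` is the weak derivative of `u` along the word `I`. -/
def HasWordDeriv (Ω : Set (Pt d)) (I : List (Fin d)) (u g : Pt d → ℝ) : Prop :=
  MemLp g 2 (volume.restrict Ω) ∧ ∀ φ, IsTestFunction Ω φ →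
    ∫ x in Ω, u x * wordDeriv I φ x = (-1) ^ I.length * ∫ x in Ω, g x * φ x

theorem hasWeakDeriv_iff {Ω : Set (Pt d)} {m : ℕ} {I : Fin m → Fin d} {u g : Pt d → ℝ} :
    HasWeakDeriv Ω I u g ↔ HasWordDeriv Ω (List.ofFn I) u g := by
  refine and_congr_right fun _ => forall_congr' fun φ => forall_congr' fun hφ => ?_
  rw [partialDeriv_eq hφ.1, List.length_ofFn]

theorem HasWordDeriv.perm {Ω : Set (Pt d)} {I I' : List (Fin d)} {u g : Pt d → ℝ}
    (h : HasWordDeriv Ω I u g) (hI : I.Perm I') : HasWordDeriv Ω I' u g :=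
  ⟨h.1, fun φ hφ => by rw [← wordDeriv_perm hφ.1 hI, ← hI.length_eq]; exact h.2 φ hφ⟩

/-- The fundamental lemma of the calculus of variations in `L²(Ω)`. -/
theorem ae_eq_of_integral_test {Ω : Set (Pt d)} (hΩ : IsOpen Ω) {g g' : Pt d → ℝ}
    (hg : MemLp g 2 (volume.restrict Ω)) (hg' : MemLp g' 2 (volume.restrict Ω))
    (h : ∀ φ, IsTestFunction Ω φ → ∫ x in Ω, g x * φ x = ∫ x in Ω, g' x * φ x) :
    g =ᵐ[volume.restrict Ω] g' := by
  have hm : MemLp (fun x => g x - g' x) 2 (volume.restrict Ω) := hg.sub hg'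
  have hl : LocallyIntegrableOn (fun x => g x - g' x) Ω := by
    intro x hx
    obtain ⟨r, hr, hb⟩ := Metric.isOpen_iff.1 hΩ x hx
    refine ⟨Metric.ball x r, mem_nhdsWithin_of_mem_nhds (Metric.ball_mem_nhds x hr), ?_⟩
    have h1 := hm.mono_measure (Measure.restrict_mono hb le_rfl)
    have : IsFiniteMeasure ((volume : Measure (Pt d)).restrict (Metric.ball x r)) :=
      ⟨by simpa using measure_ball_lt_top⟩
    exact h1.integrable (by norm_num)
  have h1 := hΩ.ae_eq_zero_of_integral_contDiff_smul_eq_zero hl fun φ h1 h2 h3 => by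
    have hφ : IsTestFunction Ω φ := ⟨h1, h2, h3⟩
    have h4 := h φ hφ
    have h5 : ∀ x, φ x • (g x - g' x) = (g x - g' x) * φ x := fun x => by
      rw [smul_eq_mul, mul_comm]
    simp only [h5]
    rw [← setIntegral_mul_eq_of_tsupport_subset h3]
    simp only [sub_mul]
    rw [integral_sub (integrable_mul_of_memLp hg hφ.memLp) (integrable_mul_of_memLp hg' hφ.memLp),
      h4, sub_self]
  rw [EventuallyEq, ae_restrict_iff' hΩ.measurableSet]
  filter_upwards [h1] with x hx hxΩ
  exact sub_eq_zero.1 (hx hxΩ)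

theorem HasWordDeriv.ae_eq {Ω : Set (Pt d)} (hΩ : IsOpen Ω) {I : List (Fin d)} {u g g' : Pt d → ℝ}
    (h : HasWordDeriv Ω I u g) (h' : HasWordDeriv Ω I u g') : g =ᵐ[volume.restrict Ω] g' := by
  refine ae_eq_of_integral_test hΩ h.1 h'.1 fun φ hφ => ?_
  have h1 := (h.2 φ hφ).symm.trans (h'.2 φ hφ)
  exact mul_left_cancel₀ (pow_ne_zero _ (by norm_num)) h1

theorem HasWordDeriv.ae_eq_weakDeriv {Ω : Set (Pt d)} (hΩ : IsOpen Ω) {m : ℕ} {I : Fin m → Fin d}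
    {u g : Pt d → ℝ} (h : HasWordDeriv Ω (List.ofFn I) u g) :
    weakDeriv Ω I u =ᵐ[volume.restrict Ω] g := by
  have hex : ∃ g, HasWeakDeriv Ω I u g := ⟨g, hasWeakDeriv_iff.2 h⟩
  rw [weakDeriv, dif_pos hex]
  exact (hasWeakDeriv_iff.1 hex.choose_spec).ae_eq hΩ h

theorem HasWordDeriv.hasWeakGrad {Ω : Set (Pt d)} {I : List (Fin d)} {u g : Pt d → ℝ}
    {G : Fin d → Pt d → ℝ} (h : HasWordDeriv Ω I u g) (hG : ∀ i, HasWordDeriv Ω (i :: I) u (G i)) :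
    HasWeakGrad Ω g G := by
  refine ⟨h.1, fun i => (hG i).1, fun i φ hφ => ?_⟩
  have h1 := h.2 _ (hφ.pd i)
  have h2 := (hG i).2 φ hφ
  rw [← wordDeriv_append_singleton, ← wordDeriv_perm hφ.1 (List.perm_append_singleton i I).symm,
    h2, List.length_cons, pow_succ, mul_assoc] at h1
  have h3 := mul_left_cancel₀ (pow_ne_zero _ (by norm_num)) h1
  rw [← h3]; ring

theorem hasWordDeriv_nil {Ω : Set (Pt d)} {u : Pt d → ℝ} (hu : MemLp u 2 (volume.restrict Ω)) :
    HasWordDeriv Ω [] u u := ⟨hu, fun φ _ => by simp [wordDeriv]⟩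

theorem HasWeakGrad.hasWordDeriv {Ω : Set (Pt d)} {u : Pt d → ℝ} {G : Fin d → Pt d → ℝ}
    (h : HasWeakGrad Ω u G) (i : Fin d) : HasWordDeriv Ω [i] u (G i) :=
  ⟨h.memLp_grad i, fun φ hφ => by
    have := h.integral_eq i φ hφ
    simpa [wordDeriv] using this⟩

/-- A jet of weak derivatives of `u` on `Ω`: for every word `I` of length at most `m`, `D I` is the
weak derivative of `u` along `I`, chosen independently of the order of the letters. -/
structure IsJetOn (Ω : Set (Pt d)) (m : ℕ) (u : Pt d → ℝ) (D : List (Fin d) → Pt d → ℝ) : Prop where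
  nil : D [] = u
  word : ∀ I, I.length ≤ m → HasWordDeriv Ω I u (D I)
  perm : ∀ {I I'}, I.Perm I' → D I = D I'

theorem MemSobolev.exists_jet {Ω : Set (Pt d)} {m : ℕ} {u : Pt d → ℝ} (hu : MemSobolev Ω m u) :
    ∃ D, IsJetOn Ω m u D := by
  classical
  have h : ∀ I : List (Fin d), ∃ g, I.length ≤ m → HasWordDeriv Ω I u g := by
    intro I
    by_cases hI : I.length ≤ m
    · obtain ⟨g, hg⟩ := hu.2 I.length hI I.get
      exact ⟨g, fun _ => by simpa using hasWeakDeriv_iff.1 hg⟩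
    · exact ⟨0, fun h => absurd h hI⟩
  choose g hg using h
  -- One representative for each multiset of directions.
  refine ⟨fun I => if I = [] then u else g (I : Multiset (Fin d)).toList, by simp,
    fun I hI => ?_, fun {I I'} hp => ?_⟩
  · by_cases h0 : I = []
    · rw [if_pos h0, h0]
      exact hasWordDeriv_nil hu.1
    · rw [if_neg h0]
      have hp : (I : Multiset (Fin d)).toList.Perm I := by
        rw [← Multiset.coe_eq_coe, Multiset.coe_toList]
      exact (hg _ (by rw [hp.length_eq]; exact hI)).perm hp
  · have h1 : I = [] ↔ I' = [] := by
      rw [← List.length_eq_zero_iff, hp.length_eq, List.length_eq_zero_iff]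
    simp only [h1, Multiset.coe_eq_coe.2 hp]

theorem IsJetOn.hasWeakGrad {Ω : Set (Pt d)} {m : ℕ} {u : Pt d → ℝ} {D : List (Fin d) → Pt d → ℝ}
    (h : IsJetOn Ω m u D) {I : List (Fin d)} (hI : I.length < m) :
    HasWeakGrad Ω (D I) fun i => D (i :: I) :=
  (h.word I hI.le).hasWeakGrad fun i => h.word (i :: I) hI

theorem IsJetOn.isJet {Ω : Set (Pt d)} {m : ℕ} {u : Pt d → ℝ} {D : List (Fin d) → Pt d → ℝ}
    (h : IsJetOn Ω m u D) {T : ConvexPolytope d} (hT : interior T.carrier ⊆ Ω) : T.IsJet m D :=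
  ⟨fun _ hI => (h.hasWeakGrad hI).mono hT, h.perm⟩

theorem IsJetOn.sobolevSeminorm_sq {Ω : Set (Pt d)} (hΩ : IsOpen Ω) {m l : ℕ} {u : Pt d → ℝ}
    {D : List (Fin d) → Pt d → ℝ} (h : IsJetOn Ω m u D) (hl : l ≤ m) :
    sobolevSeminorm Ω l u ^ 2 =
      ∑ I : Fin l → Fin d, nrm (volume.restrict Ω) (D (List.ofFn I)) ^ 2 := by
  rw [sobolevSeminorm, Real.sq_sqrt (Finset.sum_nonneg fun _ _ => sq_nonneg _)]
  refine Finset.sum_congr rfl fun I _ => ?_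
  congr 1
  exact nrm_congr ((h.word _ (by simpa using hl)).ae_eq_weakDeriv hΩ)

theorem sobolevSeminorm_le_sobolevNorm (Ω : Set (Pt d)) {l m : ℕ} (h : l ≤ m) (u : Pt d → ℝ) :
    sobolevSeminorm Ω l u ≤ sobolevNorm Ω m u := by
  refine Real.le_sqrt_of_sq_le ?_
  exact Finset.single_le_sum (f := fun l => sobolevSeminorm Ω l u ^ 2) (fun _ _ => sq_nonneg _)
    (Finset.mem_range.2 (Nat.lt_succ_of_le h))

theorem HasWeakGrad.memSobolev {Ω : Set (Pt d)} {u : Pt d → ℝ} {G : Fin d → Pt d → ℝ}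
    (h : HasWeakGrad Ω u G) : MemSobolev Ω 1 u := by
  refine ⟨h.memLp, fun l hl I => ?_⟩
  interval_cases l
  · exact ⟨u, hasWeakDeriv_iff.2 (by simpa using hasWordDeriv_nil h.memLp)⟩
  · exact ⟨G (I 0), hasWeakDeriv_iff.2 (by simpa using h.hasWordDeriv (I 0))⟩

theorem HasWeakGrad.weakDeriv_ae_eq {Ω : Set (Pt d)} (hΩ : IsOpen Ω) {u : Pt d → ℝ}
    {G : Fin d → Pt d → ℝ} (h : HasWeakGrad Ω u G) (i : Fin d) :
    weakDeriv Ω ![i] u =ᵐ[volume.restrict Ω] G i :=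
  HasWordDeriv.ae_eq_weakDeriv hΩ (by simpa using h.hasWordDeriv i)

theorem HasWeakGrad.sobolevNorm_sq {Ω : Set (Pt d)} (hΩ : IsOpen Ω) {u : Pt d → ℝ}
    {G : Fin d → Pt d → ℝ} (h : HasWeakGrad Ω u G) :
    sobolevNorm Ω 1 u ^ 2 = nrm (volume.restrict Ω) u ^ 2 +
      ∑ i, nrm (volume.restrict Ω) (G i) ^ 2 := by
  rw [sobolevNorm, Real.sq_sqrt (Finset.sum_nonneg fun _ _ => sq_nonneg _), Finset.sum_range_succ,
    Finset.sum_range_one]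
  have h0 : ∀ l, sobolevSeminorm Ω l u ^ 2 = ∑ I : Fin l → Fin d, l2Norm Ω (weakDeriv Ω I u) ^ 2 :=
    fun l => Real.sq_sqrt (Finset.sum_nonneg fun _ _ => sq_nonneg _)
  rw [h0, h0]
  congr 1
  · rw [Fintype.sum_unique]
    congr 1
    refine nrm_congr (HasWordDeriv.ae_eq_weakDeriv hΩ ?_)
    simpa using hasWordDeriv_nil h.memLp
  · rw [← (Equiv.funUnique (Fin 1) (Fin d)).symm.sum_comp]
    refine Finset.sum_congr rfl fun i _ => ?_
    congr 1
    refine nrm_congr (HasWordDeriv.ae_eq_weakDeriv hΩ ?_)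
    simpa using h.hasWordDeriv i

theorem IsTestFunction.hasWeakGrad {Ω : Set (Pt d)} {φ : Pt d → ℝ} (hφ : IsTestFunction Ω φ) :
    HasWeakGrad Ω φ fun i => WG.pd i φ :=
  hasWeakGrad_of_contDiff hφ.1 hφ.memLp fun i => (hφ.pd i).memLp

/-- `g ∈ H_0^1(Ω)` with gradient `G`. -/
structure IsH10 (Ω : Set (Pt d)) (g : Pt d → ℝ) (G : Fin d → Pt d → ℝ) : Prop where
  grad : HasWeakGrad Ω g G
  exists_approx : ∃ φ : ℕ → Pt d → ℝ, (∀ n, IsTestFunction Ω (φ n)) ∧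
    Tendsto (fun n => nrm (volume.restrict Ω) fun x => g x - φ n x) atTop (𝓝 0) ∧
    ∀ i, Tendsto (fun n => nrm (volume.restrict Ω) fun x => G i x - pd i (φ n) x) atTop (𝓝 0)

theorem tendsto_zero_of_sq_le {a b : ℕ → ℝ} (ha : ∀ n, 0 ≤ a n) (hab : ∀ n, a n ^ 2 ≤ b n ^ 2)
    (hb0 : ∀ n, 0 ≤ b n) (hb : Tendsto b atTop (𝓝 0)) : Tendsto a atTop (𝓝 0) :=
  squeeze_zero ha (fun n => (abs_le_of_sq_le_sq' (hab n) (hb0 n)).2) hb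

theorem MemH10.isH10 {Ω : Set (Pt d)} (hΩ : IsOpen Ω) {g : Pt d → ℝ} {G : Fin d → Pt d → ℝ}
    (h : MemH10 Ω g) (hG : HasWeakGrad Ω g G) : IsH10 Ω g G := by
  obtain ⟨-, φ, hφ, hlim⟩ := h
  have hsq := fun n => (hG.sub (hφ n).hasWeakGrad).sobolevNorm_sq hΩ
  have hs0 : ∀ n, 0 ≤ sobolevNorm Ω 1 (fun x => g x - φ n x) := fun n => Real.sqrt_nonneg _
  refine ⟨hG, φ, hφ, ?_, fun i => ?_⟩
  · refine tendsto_zero_of_sq_le (fun _ => nrm_nonneg) (fun n => ?_) hs0 hlim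
    rw [hsq n]
    exact le_add_of_nonneg_right (Finset.sum_nonneg fun _ _ => sq_nonneg _)
  · refine tendsto_zero_of_sq_le (fun _ => nrm_nonneg) (fun n => ?_) hs0 hlim
    rw [hsq n]
    exact (Finset.single_le_sum (f := fun i => nrm (volume.restrict Ω)
      (fun x => G i x - pd i (φ n) x) ^ 2) (fun _ _ => sq_nonneg _) (Finset.mem_univ i)).trans
        (le_add_of_nonneg_left (sq_nonneg _))

theorem MemSobolev.exists_hasWeakGrad {Ω : Set (Pt d)} {m : ℕ} (hm : 1 ≤ m) {u : Pt d → ℝ}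
    (hu : MemSobolev Ω m u) : ∃ G, HasWeakGrad Ω u G := by
  obtain ⟨D, hD⟩ := hu.exists_jet
  have := hD.hasWeakGrad (I := []) (by simp; omega)
  rw [hD.nil] at this
  exact ⟨_, this⟩

theorem IsH10.memH10 {Ω : Set (Pt d)} (hΩ : IsOpen Ω) {g : Pt d → ℝ} {G : Fin d → Pt d → ℝ}
    (h : IsH10 Ω g G) : MemH10 Ω g := by
  obtain ⟨hG, φ, hφ, h0, h1⟩ := h
  refine ⟨hG.memSobolev, φ, hφ, ?_⟩
  have hsq := fun n => (hG.sub (hφ n).hasWeakGrad).sobolevNorm_sq hΩ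
  have h2 := (h0.pow 2).add (tendsto_finsetSum Finset.univ fun i _ => (h1 i).pow 2)
  simp only [← hsq] at h2
  have h3 := h2.sqrt
  have h4 : ∀ v, Real.sqrt (sobolevNorm Ω 1 v ^ 2) = sobolevNorm Ω 1 v := fun v =>
    Real.sqrt_sq (Real.sqrt_nonneg _)
  simp only [h4] at h3
  simpa using h3

theorem IsTestFunction.isH10 {Ω : Set (Pt d)} {φ : Pt d → ℝ} (hφ : IsTestFunction Ω φ) :
    IsH10 Ω φ fun i => WG.pd i φ :=
  ⟨hφ.hasWeakGrad, fun _ => φ, fun _ => hφ, by simp [nrm], fun i => by simp [nrm]⟩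

theorem IsPoissonSolution.weak_form {Ω : Set (Pt d)} (hΩ : IsOpen Ω) {f u v : Pt d → ℝ}
    {G V : Fin d → Pt d → ℝ} (h : IsPoissonSolution Ω f u) (hG : HasWeakGrad Ω u G)
    (hv : IsH10 Ω v V) : ∑ i, ∫ x in Ω, G i x * V i x = ∫ x in Ω, f x * v x := by
  rw [← h.2 v (hv.memH10 hΩ)]
  refine Finset.sum_congr rfl fun i _ => integral_congr_ae ?_
  filter_upwards [hG.weakDeriv_ae_eq hΩ i, hv.grad.weakDeriv_ae_eq hΩ i] with x h1 h2
  rw [h1, h2]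

/-- The equation `-Δu = f` holds almost everywhere for `u ∈ H²`. -/
theorem IsPoissonSolution.ae_eq {Ω : Set (Pt d)} (hΩ : IsOpen Ω) {f u : Pt d → ℝ}
    (hf : MemLp f 2 (volume.restrict Ω)) (h : IsPoissonSolution Ω f u) {m : ℕ} (hm : 2 ≤ m)
    {D : List (Fin d) → Pt d → ℝ} (hD : IsJetOn Ω m u D) :
    f =ᵐ[volume.restrict Ω] fun x => -∑ i, D [i, i] x := by
  have h2 : ∀ i, MemLp (D [i, i]) 2 (volume.restrict Ω) := fun i => (hD.word [i, i] hm).1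
  refine ae_eq_of_integral_test hΩ hf (memLp_finsetSum Finset.univ fun i _ => h2 i).neg
    fun φ hφ => ?_
  have hG := hD.hasWeakGrad (I := []) (by simpa using Nat.lt_of_lt_of_le two_pos hm)
  rw [hD.nil] at hG
  rw [← h.weak_form hΩ hG hφ.isH10]
  simp only [neg_mul, Finset.sum_mul, integral_neg]
  rw [integral_finsetSum _ fun i _ => integrable_mul_of_memLp (h2 i) hφ.memLp,
    ← Finset.sum_neg_distrib]
  exact Finset.sum_congr rfl fun i _ =>
    (hD.hasWeakGrad (I := [i]) (by simp; omega)).integral_eq i φ hφ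

/-! ### Existence of weak solutions of the Dirichlet problem -/

/-- The Poincaré–Friedrichs inequality. -/
theorem friedrichs {Ω : Set (Pt d)} {R : ℝ} (i : Fin d) (hR : ∀ x ∈ Ω, ‖x‖ ≤ R)
    {φ : Pt d → ℝ} (hφ : IsTestFunction Ω φ) :
    nrm (volume.restrict Ω) φ ≤ 2 * R * nrm (volume.restrict Ω) (pd i φ) := by
  have hφd : Differentiable ℝ φ := hφ.1.differentiable (by simp)
  set X : Pt d → ℝ := fun x => x i with hX
  have hXc : ContDiff ℝ ∞ X := by rw [hX]; fun_prop
  have hXd : Differentiable ℝ X := hXc.differentiable (by simp)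
  have hX1 : ∀ x, pd i X x = 1 := by
    intro x
    have h1 : HasFDerivAt X (EuclideanSpace.proj i : Pt d →L[ℝ] ℝ) x :=
      (EuclideanSpace.proj i : Pt d →L[ℝ] ℝ).hasFDerivAt
    rw [pd, h1.fderiv]
    simp
  set ψ : Pt d → ℝ := fun x => X x * φ x with hψ
  have hψd : Differentiable ℝ ψ := hXd.mul hφd
  have hψt : IsTestFunction Ω ψ :=
    ⟨hXc.mul hφ.1, hφ.2.1.mul_left, (tsupport_mul_subset_right).trans hφ.2.2⟩
  have h1 := hφ.hasWeakGrad.integral_eq i ψ hψt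
  have h2 : ∀ x, pd i ψ x = φ x + X x * pd i φ x := fun x => by
    rw [hψ, pd_mul hXd hφd, hX1]; ring
  have i1 : Integrable (fun x => φ x ^ 2) (volume.restrict Ω) := hφ.memLp.integrable_sq
  have hψ2 : IsTestFunction Ω (fun x => X x * pd i φ x) :=
    ⟨hXc.mul (hφ.pd i).1, (hφ.pd i).2.1.mul_left,
      (tsupport_mul_subset_right).trans (hφ.pd i).2.2⟩
  have i2 : Integrable (fun x => φ x * (X x * pd i φ x)) (volume.restrict Ω) :=
    integrable_mul_of_memLp hφ.memLp hψ2.memLp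
  have h3 : ∫ x in Ω, φ x * pd i ψ x = nrm (volume.restrict Ω) φ ^ 2 +
      ∫ x in Ω, φ x * (X x * pd i φ x) := by
    rw [nrm_sq, ← integral_add i1 i2]
    refine integral_congr_ae (ae_of_all _ fun x => ?_)
    simp only [h2]; ring
  have h4 : ∫ x in Ω, pd i φ x * ψ x = ∫ x in Ω, φ x * (X x * pd i φ x) := by
    refine integral_congr_ae (ae_of_all _ fun x => ?_)
    simp only [hψ]; ring
  rw [h3, h4] at h1
  have hR0 : ∀ x ∈ tsupport φ, 0 ≤ R := fun x hx => (norm_nonneg x).trans (hR x (hφ.2.2 hx))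
  have h5 : |∫ x in Ω, φ x * (X x * pd i φ x)| ≤
      nrm (volume.restrict Ω) φ * (R * nrm (volume.restrict Ω) (pd i φ)) := by
    rcases (tsupport φ).eq_empty_or_nonempty with h0 | ⟨y, hy⟩
    · have : φ = 0 := by rwa [tsupport_eq_empty_iff] at h0
      subst this
      simp [nrm]
    · refine (abs_integral_mul_le hφ.memLp hψ2.memLp).trans
        (mul_le_mul_of_nonneg_left ?_ nrm_nonneg)
      rw [← abs_of_nonneg (hR0 y hy), ← nrm_const_mul]
      refine Real.sqrt_le_sqrt (integral_mono_ae hψ2.memLp.integrable_sq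
        (((hφ.pd i).memLp.const_mul R).integrable_sq) ?_)
      have h6 : ∀ x, (X x * pd i φ x) ^ 2 ≤ (R * pd i φ x) ^ 2 := by
        intro x
        by_cases hx : x ∈ tsupport (pd i φ)
        · rw [mul_pow, mul_pow]
          refine mul_le_mul_of_nonneg_right ?_ (sq_nonneg _)
          rw [← sq_abs]
          exact pow_le_pow_left₀ (abs_nonneg _) ((PiLp.norm_apply_le x i).trans
            (hR x ((hφ.pd i).2.2 hx))) 2
        · simp [image_eq_zero_of_notMem_tsupport hx]
      exact ae_of_all _ h6
  have h7 := (abs_le.1 h5).1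
  rcases (nrm_nonneg (μ := volume.restrict Ω) (f := φ)).eq_or_lt with h0 | h0
  · rcases (tsupport φ).eq_empty_or_nonempty with h8 | ⟨y, hy⟩
    · have : φ = 0 := by rwa [tsupport_eq_empty_iff] at h8
      have hp : pd i φ = 0 := by subst this; funext x; simp [pd]
      rw [← h0, hp]; simp [nrm]
    · rw [← h0]
      exact mul_nonneg (mul_nonneg two_pos.le (hR0 y hy)) nrm_nonneg
  · refine le_of_mul_le_mul_right ?_ h0
    nlinarith

theorem hasWeakGrad_of_tendsto {Ω : Set (Pt d)} {g : Pt d → ℝ} {G : Fin d → Pt d → ℝ}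
    (hg : MemLp g 2 (volume.restrict Ω)) (hG : ∀ i, MemLp (G i) 2 (volume.restrict Ω))
    {φ : ℕ → Pt d → ℝ} (hφ : ∀ n, IsTestFunction Ω (φ n))
    (h0 : Tendsto (fun n => nrm (volume.restrict Ω) fun x => g x - φ n x) atTop (𝓝 0))
    (h1 : ∀ i, Tendsto (fun n => nrm (volume.restrict Ω) fun x => G i x - pd i (φ n) x)
      atTop (𝓝 0)) : HasWeakGrad Ω g G := by
  refine ⟨hg, hG, fun i ψ hψ => ?_⟩
  have e0 : Tendsto (fun n => nrm (volume.restrict Ω) fun x => φ n x - g x) atTop (𝓝 0) := by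
    simpa only [nrm_sub_comm] using h0
  have e1 : Tendsto (fun n => nrm (volume.restrict Ω) fun x => pd i (φ n) x - G i x)
      atTop (𝓝 0) := by
    have := h1 i
    refine this.congr fun n => nrm_sub_comm
  have l0 := tendsto_integral_mul (fun n => (hφ n).memLp) hg (hψ.pd i).memLp e0
  have l1 := (tendsto_integral_mul (fun n => ((hφ n).pd i).memLp) (hG i) hψ.memLp e1).neg
  refine tendsto_nhds_unique l0 (l1.congr fun n => ?_)
  exact ((hφ n).hasWeakGrad.integral_eq i ψ hψ).symm

end WG
end

noncomputable section

namespace WG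

variable {d : ℕ}

theorem integral_mul_eq_inner {μ : Measure (Pt d)} (f g : Lp ℝ 2 μ) :
    ∫ x, f x * g x ∂μ = inner ℝ f g := by
  rw [L2.inner_def]
  refine integral_congr_ae (ae_of_all _ fun x => ?_)
  simp [mul_comm]

theorem norm_eq_nrm {μ : Measure (Pt d)} (f : Lp ℝ 2 μ) : ‖f‖ = nrm μ f := by
  rw [nrm_eq_norm_toLp (Lp.memLp f), Lp.toLp_coeFn]

/-- `L²` functions together with `d` further `L²` functions in the role of the gradient. -/
abbrev GradSpace (Ω : Set (Pt d)) : Type :=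
  PiLp 2 fun _ : Option (Fin d) => Lp ℝ 2 (volume.restrict Ω)

/-- The pairs `(φ, ∇φ)` of test functions and their gradients. -/
def testGraph (Ω : Set (Pt d)) : Submodule ℝ (GradSpace Ω) where
  carrier := {U | ∃ φ, IsTestFunction Ω φ ∧ U none =ᵐ[volume.restrict Ω] φ ∧
    ∀ i, U (some i) =ᵐ[volume.restrict Ω] pd i φ}
  zero_mem' := ⟨fun _ => 0, ⟨contDiff_const, HasCompactSupport.zero, by simp [tsupport]⟩,
    Lp.coeFn_zero _ _ _, fun i => by
      have : pd i (fun _ : Pt d => (0 : ℝ)) = 0 := by funext x; simp [pd]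
      rw [this]
      exact Lp.coeFn_zero _ _ _⟩
  add_mem' := by
    rintro U V ⟨φ, hφ, h0, h1⟩ ⟨ψ, hψ, k0, k1⟩
    refine ⟨fun x => φ x + ψ x, ⟨hφ.1.add hψ.1, hφ.2.1.add hψ.2.1,
      (tsupport_add φ ψ).trans (Set.union_subset hφ.2.2 hψ.2.2)⟩, ?_, fun i => ?_⟩
    · filter_upwards [Lp.coeFn_add (U none) (V none), h0, k0] with x e1 e2 e3
      rw [← e2, ← e3]; exact e1
    · filter_upwards [Lp.coeFn_add (U (some i)) (V (some i)), h1 i, k1 i] with x e1 e2 e3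
      rw [pd_add (hφ.1.differentiable (by simp)) (hψ.1.differentiable (by simp)), ← e2, ← e3]
      exact e1
  smul_mem' := by
    rintro c U ⟨φ, hφ, h0, h1⟩
    refine ⟨fun x => c * φ x, ⟨contDiff_const.mul hφ.1, hφ.2.1.mul_left,
      tsupport_mul_subset_right.trans hφ.2.2⟩, ?_, fun i => ?_⟩
    · filter_upwards [Lp.coeFn_smul c (U none), h0] with x e1 e2
      rw [← e2]; exact e1
    · filter_upwards [Lp.coeFn_smul c (U (some i)), h1 i] with x e1 e2
      have : pd i (fun x => c * φ x) x = c * pd i φ x := by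
        rw [pd_mul (by fun_prop) (hφ.1.differentiable (by simp))]
        simp [pd]
      rw [this, ← e2]
      exact e1

theorem norm_sq_gradSpace {Ω : Set (Pt d)} (U : GradSpace Ω) :
    ‖U‖ ^ 2 = ‖U none‖ ^ 2 + ∑ i, ‖U (some i)‖ ^ 2 := by
  rw [PiLp.norm_sq_eq_of_L2, Fintype.sum_option]

theorem friedrichs_closure {Ω : Set (Pt d)} {R : ℝ} (i : Fin d) (hR : ∀ x ∈ Ω, ‖x‖ ≤ R)
    {U : GradSpace Ω} (hU : U ∈ (testGraph Ω).topologicalClosure) :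
    ‖U none‖ ≤ 2 * R * ‖U (some i)‖ := by
  have hcl : IsClosed {U : GradSpace Ω | ‖U none‖ ≤ 2 * R * ‖U (some i)‖} :=
    isClosed_le (by fun_prop) (by fun_prop)
  refine closure_minimal ?_ hcl hU
  rintro V ⟨φ, hφ, h0, h1⟩
  change ‖V none‖ ≤ 2 * R * ‖V (some i)‖
  rw [norm_eq_nrm, norm_eq_nrm, nrm_congr h0, nrm_congr (h1 i)]
  exact friedrichs i hR hφ

/-- The Dirichlet form on the closure of the test functions. -/
def dirichletForm (Ω : Set (Pt d)) : (testGraph Ω).topologicalClosure →L[ℝ]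
    (testGraph Ω).topologicalClosure →L[ℝ] ℝ :=
  LinearMap.mkContinuous₂ (LinearMap.mk₂ ℝ
    (fun U V => ∑ i, inner ℝ (U.1 (some i)) (V.1 (some i)))
    (fun U U' V => by simp [inner_add_left, Finset.sum_add_distrib])
    (fun c U V => by simp [real_inner_smul_left, Finset.mul_sum])
    (fun U V V' => by simp [inner_add_right, Finset.sum_add_distrib])
    (fun c U V => by simp [real_inner_smul_right, Finset.mul_sum])) d fun U V => by
      rw [LinearMap.mk₂_apply]
      refine (norm_sum_le _ _).trans ?_
      have h : ∀ i : Fin d, ‖inner ℝ (U.1 (some i)) (V.1 (some i))‖ ≤ ‖U‖ * ‖V‖ := fun i =>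
        (norm_inner_le_norm _ _).trans (mul_le_mul (PiLp.norm_apply_le U.1 _)
          (PiLp.norm_apply_le V.1 _) (norm_nonneg _) (norm_nonneg _))
      refine (Finset.sum_le_sum fun i _ => h i).trans (le_of_eq ?_)
      rw [Finset.sum_const, Finset.card_univ, Fintype.card_fin, nsmul_eq_mul, mul_assoc]

theorem dirichletForm_apply {Ω : Set (Pt d)} (U V : (testGraph Ω).topologicalClosure) :
    dirichletForm Ω U V = ∑ i, inner ℝ (U.1 (some i)) (V.1 (some i)) := rfl

theorem isCoercive_dirichletForm {Ω : Set (Pt d)} {R : ℝ} (i : Fin d)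
    (hR : ∀ x ∈ Ω, ‖x‖ ≤ R) : IsCoercive (dirichletForm Ω) := by
  refine ⟨((2 * R) ^ 2 + 1)⁻¹, by positivity, fun U => ?_⟩
  have h1 := friedrichs_closure i hR U.2
  have h2 : ‖U.1 none‖ ^ 2 ≤ (2 * R) ^ 2 * ‖U.1 (some i)‖ ^ 2 := by
    rw [← mul_pow]
    exact pow_le_pow_left₀ (norm_nonneg _) h1 2
  have h3 := Finset.single_le_sum (f := fun i => ‖U.1 (some i)‖ ^ 2) (fun _ _ => sq_nonneg _)
    (Finset.mem_univ i)
  have h4 := norm_sq_gradSpace U.1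
  have h5 : dirichletForm Ω U U = ∑ i, ‖U.1 (some i)‖ ^ 2 := by
    rw [dirichletForm_apply]
    exact Finset.sum_congr rfl fun i _ => real_inner_self_eq_norm_sq _
  rw [h5, mul_assoc, ← sq, inv_mul_le_iff₀ (by positivity)]
  change ‖U.1‖ ^ 2 ≤ _
  simp only at h3
  nlinarith [sq_nonneg (2 * R)]

/-- Existence of a weak solution of the Dirichlet problem on a bounded open set (Lax–Milgram). -/
theorem exists_isPoissonSolution {Ω : Set (Pt d)} (hΩ : IsOpen Ω) {R : ℝ} (i₀ : Fin d)
    (hR : ∀ x ∈ Ω, ‖x‖ ≤ R) {f : Pt d → ℝ} (hf : MemLp f 2 (volume.restrict Ω)) :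
    ∃ Φ, IsPoissonSolution Ω f Φ := by
  set K := (testGraph Ω).topologicalClosure with hK
  have hcomp : CompleteSpace K := (testGraph Ω).isClosed_topologicalClosure.completeSpace_coe
  have hco := isCoercive_dirichletForm i₀ hR
  let ℓ : K →L[ℝ] ℝ := (innerSL ℝ (hf.toLp f)).comp
    ((PiLp.proj 2 (fun _ : Option (Fin d) => Lp ℝ 2 (volume.restrict Ω)) none).comp K.subtypeL)
  have hℓ : ∀ V : K, ℓ V = inner ℝ (hf.toLp f) (V.1 none) := fun V => rfl
  set F : K := (InnerProductSpace.toDual ℝ K).symm ℓ with hF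
  obtain ⟨U, hU⟩ := hco.continuousLinearEquivOfBilin.surjective F
  have hweak : ∀ V : K, ∑ i, inner ℝ (U.1 (some i)) (V.1 (some i)) =
      inner ℝ (hf.toLp f) (V.1 none) := by
    intro V
    rw [← dirichletForm_apply, ← hco.continuousLinearEquivOfBilin_apply, hU, hF,
      InnerProductSpace.toDual_symm_apply, hℓ]
  obtain ⟨Un, hUn, hlim⟩ := mem_closure_iff_seq_limit.1 (U.2 : U.1 ∈ closure (testGraph Ω : Set _))
  choose φ hφ h0 h1 using hUn
  have hcoord : ∀ o, Tendsto (fun n => ‖U.1 o - Un n o‖) atTop (𝓝 0) := fun o => by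
    have h2 : Tendsto (fun n => Un n o) atTop (𝓝 (U.1 o)) :=
      ((PiLp.continuous_apply 2 _ o).tendsto U.1).comp hlim
    have h3 := (tendsto_iff_norm_sub_tendsto_zero.1 h2)
    simpa only [norm_sub_rev] using h3
  have hn : ∀ o (g : Pt d → ℝ) n, Un n o =ᵐ[volume.restrict Ω] g →
      ‖U.1 o - Un n o‖ = nrm (volume.restrict Ω) fun x => U.1 o x - g x := by
    intro o g n hg
    rw [norm_eq_nrm]
    refine nrm_congr ?_
    filter_upwards [Lp.coeFn_sub (U.1 o) (Un n o), hg] with x e1 e2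
    rw [e1, Pi.sub_apply, e2]
  have l0 : Tendsto (fun n => nrm (volume.restrict Ω) fun x => U.1 none x - φ n x) atTop (𝓝 0) :=
    (hcoord none).congr fun n => hn none _ n (h0 n)
  have l1 : ∀ i, Tendsto (fun n => nrm (volume.restrict Ω) fun x =>
      U.1 (some i) x - pd i (φ n) x) atTop (𝓝 0) := fun i =>
    (hcoord (some i)).congr fun n => hn (some i) _ n (h1 n i)
  have hgrad := hasWeakGrad_of_tendsto (Lp.memLp (U.1 none)) (fun i => Lp.memLp (U.1 (some i)))
    hφ l0 l1
  have hΦ : IsH10 Ω (U.1 none) fun i => U.1 (some i) := ⟨hgrad, φ, hφ, l0, l1⟩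
  -- The weak form for test functions.
  have htest : ∀ ψ, IsTestFunction Ω ψ →
      ∑ i, ∫ x in Ω, pd i ψ x * U.1 (some i) x = ∫ x in Ω, ψ x * f x := by
    intro ψ hψ
    let V : GradSpace Ω := WithLp.toLp 2 fun o => match o with
      | none => (hψ.memLp (μ := volume.restrict Ω)).toLp ψ
      | some i => ((hψ.pd i).memLp (μ := volume.restrict Ω)).toLp (pd i ψ)
    have hV : V ∈ testGraph Ω :=
      ⟨ψ, hψ, MemLp.coeFn_toLp hψ.memLp, fun i => MemLp.coeFn_toLp (hψ.pd i).memLp⟩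
    have h2 := hweak ⟨V, (testGraph Ω).le_topologicalClosure hV⟩
    simp only [← integral_mul_eq_inner] at h2
    have e1 : ∀ i, ∫ x in Ω, pd i ψ x * U.1 (some i) x =
        ∫ x in Ω, U.1 (some i) x * V (some i) x := fun i => by
      refine integral_congr_ae ?_
      have : V (some i) =ᵐ[volume.restrict Ω] pd i ψ := MemLp.coeFn_toLp (hψ.pd i).memLp
      filter_upwards [this] with x hx
      rw [hx, mul_comm]
    have e2 : ∫ x in Ω, ψ x * f x = ∫ x in Ω, hf.toLp f x * V none x := by
      refine integral_congr_ae ?_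
      have : V none =ᵐ[volume.restrict Ω] ψ := MemLp.coeFn_toLp hψ.memLp
      filter_upwards [this, hf.coeFn_toLp] with x hx hx'
      rw [hx, hx', mul_comm]
    rw [Finset.sum_congr rfl fun i _ => e1 i, e2]
    exact h2
  refine ⟨U.1 none, hΦ.memH10 hΩ, fun v hv => ?_⟩
  obtain ⟨V, hV⟩ := hv.1.exists_hasWeakGrad le_rfl
  obtain ⟨-, ψ, hψ, k0, k1⟩ := hv.isH10 hΩ hV
  have e0 : Tendsto (fun n => nrm (volume.restrict Ω) fun x => ψ n x - v x) atTop (𝓝 0) :=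
    k0.congr fun n => nrm_sub_comm
  have e1 : ∀ i, Tendsto (fun n => nrm (volume.restrict Ω) fun x => pd i (ψ n) x - V i x)
      atTop (𝓝 0) := fun i => (k1 i).congr fun n => nrm_sub_comm
  have m0 := tendsto_integral_mul (fun n => (hψ n).memLp) hV.memLp hf e0
  have m1 := tendsto_finsetSum Finset.univ fun i (_ : i ∈ Finset.univ) =>
    tendsto_integral_mul (fun n => ((hψ n).pd i).memLp) (hV.memLp_grad i)
      (Lp.memLp (U.1 (some i))) (e1 i)
  have h2 := tendsto_nhds_unique (m1.congr fun n => htest _ (hψ n)) m0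
  have h3 : ∫ x in Ω, f x * v x = ∫ x in Ω, v x * f x := by simp only [mul_comm]
  rw [h3, ← h2]
  refine Finset.sum_congr rfl fun i _ => integral_congr_ae ?_
  filter_upwards [hgrad.weakDeriv_ae_eq hΩ i, hV.weakDeriv_ae_eq hΩ i] with x a1 a2
  rw [a1, a2, mul_comm]

end WG
end

noncomputable section

namespace WG

namespace ConvexPolytope

variable {d : ℕ}

/-! ### Local estimates for the interpolant -/

theorem nrm_le_h1Norm (T : ConvexPolytope d) (g : Pt d → ℝ) (G : Fin d → Pt d → ℝ) :
    nrm T.vol g ≤ T.h1Norm g G :=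
  le_add_of_nonneg_right (mul_nonneg T.diam_nonneg (Finset.sum_nonneg fun _ _ => nrm_nonneg))

theorem jetSum_tail_le {T : ConvexPolytope d} {m : ℕ} {D : List (Fin d) → Pt d → ℝ}
    (hD : T.IsJet m D) (l : ℕ) (i : Fin d) :
    T.jetSum (fun I => D (I ++ [i])) l ≤ T.jetSum D (l + 1) := by
  rw [jetSum_succ' hD]
  exact Finset.single_le_sum (f := fun i => T.jetSum (fun I => D (I ++ [i])) l)
    (fun _ _ => jetSum_nonneg _ _) (Finset.mem_univ i)

/-- The `L²(e)` projection is no farther from any polynomial than the projected function. -/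
theorem nrm_surf_sub_proj_le {T : ConvexPolytope d} {ν : Pt d} (hν : ν ∈ T.normals) {k : ℕ}
    {t : Pt d → ℝ} (ht : MemLp t 2 (T.surf ν)) {p q : Poly d} (hp : p ∈ PolyDeg d k)
    (hq : q ∈ PolyDeg d k)
    (h : ∀ r ∈ PolyDeg d k, ∫ x in T.facet ν, peval p x * peval r x ∂μHE[d - 1] =
      ∫ x in T.facet ν, t x * peval r x ∂μHE[d - 1]) :
    nrm (T.surf ν) (fun x => peval q x - peval p x) ≤ nrm (T.surf ν) fun x => t x - peval q x := by
  have hc : ∀ r : Poly d, MemLp (peval r) 2 (T.surf ν) := fun r =>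
    T.memLp_surf hν (peval_continuous r)
  have he : peval (q - p) = fun x => peval q x - peval p x := funext fun x => peval_sub q p x
  rw [← he]
  have h1 := h (q - p) (Submodule.sub_mem _ hq hp)
  have h2 : ∫ x in T.facet ν, peval (q - p) x ^ 2 ∂μHE[d - 1] =
      ∫ x in T.facet ν, (peval q x - t x) * peval (q - p) x ∂μHE[d - 1] := by
    have i1 := integrable_mul_of_memLp (hc q) (hc (q - p))
    have i2 := integrable_mul_of_memLp ht (hc (q - p))
    have i3 := integrable_mul_of_memLp (hc p) (hc (q - p))
    simp only [sub_mul]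
    rw [integral_sub i1 i2, ← h1, ← integral_sub i1 i3]
    refine integral_congr_ae (ae_of_all _ fun x => ?_)
    simp only [peval_sub]; ring
  have h3 := integral_mul_le ((hc q).sub ht) (hc (q - p)) (μ := T.surf ν)
  have h4 : nrm (T.surf ν) (peval (q - p)) ^ 2 ≤
      nrm (T.surf ν) (fun x => t x - peval q x) * nrm (T.surf ν) (peval (q - p)) := by
    rw [nrm_sq, h2, nrm_sub_comm]
    exact h3
  rcases (nrm_nonneg (μ := T.surf ν) (f := peval (q - p))).eq_or_lt with h0 | h0
  · rw [← h0]; exact nrm_nonneg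
  · rw [sq] at h4
    exact le_of_mul_le_mul_right h4 h0

/-- The defect of the commutation of the weak gradient with the projections. -/
theorem integral_weakGradient_sub_proj {T : ConvexPolytope d} {j : ℕ} {g : Pt d → ℝ}
    {Dg : Fin d → Pt d → ℝ} {t : Pt d → Pt d → ℝ} (hg : MemLp g 2 T.vol)
    (hDg : ∀ i, MemLp (Dg i) 2 T.vol) (ht : T.IsTrace g Dg t) {q : Fin d → Poly d}
    (hq : ∀ i, T.IsProj j (Dg i) (q i)) {p₀ : Poly d} {wb : Set (Pt d) → Poly d}
    {G : Fin d → Poly d} (hG : T.IsWeakGradient j p₀ wb G) {p : Fin d → Poly d}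
    (hp : ∀ i, p i ∈ PolyDeg d j) :
    ∑ i, ∫ x in T.carrier, (peval (G i) x - peval (q i) x) * peval (p i) x =
      (∑ i, ∫ x in T.carrier, (g x - peval p₀ x) * pd i (peval (p i)) x) +
        ∑ ν ∈ T.normals, ∑ i, ν i * ∫ x in T.facet ν,
          (peval (wb (T.facet ν)) x - t ν x) * peval (p i) x ∂μHE[d - 1] := by
  have hc : ∀ p : Poly d, MemLp (peval p) 2 T.vol := fun p => T.memLp_vol (peval_continuous p)
  have hcd : ∀ i, MemLp (pd i (peval (p i))) 2 T.vol := fun i =>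
    T.memLp_vol (pd_continuous (contDiff_peval _) (by simp) i)
  have hcs : ∀ ν ∈ T.normals, ∀ p : Poly d, MemLp (peval p) 2 (T.surf ν) := fun ν hν p =>
    T.memLp_surf hν (peval_continuous p)
  have h1 := hG.2 p hp
  rw [integral_finsetSum _ fun i _ => peval_integrableOn T _ _] at h1
  have h2 : ∫ x in T.carrier, peval p₀ x * peval (∑ i, MvPolynomial.pderiv i (p i)) x =
      ∑ i, ∫ x in T.carrier, peval p₀ x * pd i (peval (p i)) x := by
    rw [← integral_finsetSum _ fun i _ => integrable_mul_of_memLp (hc p₀) (hcd i)]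
    simp only [peval_sum, Finset.mul_sum, pd_peval]
  have h3 : ∀ ν ∈ T.normals, ∫ x in T.facet ν, peval (wb (T.facet ν)) x *
      ∑ i, peval (p i) x * ν i ∂μHE[d - 1] =
      ∑ i, ν i * ∫ x in T.facet ν, peval (wb (T.facet ν)) x * peval (p i) x ∂μHE[d - 1] := by
    intro ν hν
    simp only [← integral_const_mul]
    rw [← integral_finsetSum _ fun i _ =>
      (integrable_mul_of_memLp (hcs ν hν _) (hcs ν hν (p i))).const_mul (ν i)]
    refine integral_congr_ae (ae_of_all _ fun x => ?_)
    simp only [Finset.mul_sum]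
    exact Finset.sum_congr rfl fun i _ => by ring
  have h4 : ∀ i, ∫ x in T.carrier, peval (q i) x * peval (p i) x =
      (∑ ν ∈ T.normals, ν i * ∫ x in T.facet ν, t ν x * peval (p i) x ∂μHE[d - 1]) -
        ∫ x in T.carrier, g x * pd i (peval (p i)) x := fun i => by
    rw [(hq i).2 (p i) (hp i), ← ht.green hg hDg ((contDiff_peval (p i)).of_le (by simp)) i]
    ring
  have h5 : ∀ i, ∫ x in T.carrier, (peval (G i) x - peval (q i) x) * peval (p i) x =
      (∫ x in T.carrier, peval (G i) x * peval (p i) x) -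
        ∫ x in T.carrier, peval (q i) x * peval (p i) x := fun i => by
    simp only [sub_mul]
    exact integral_sub (integrable_mul_of_memLp (hc _) (hc _))
      (integrable_mul_of_memLp (hc _) (hc _))
  have h6 : ∀ i, ∫ x in T.carrier, (g x - peval p₀ x) * pd i (peval (p i)) x =
      (∫ x in T.carrier, g x * pd i (peval (p i)) x) -
        ∫ x in T.carrier, peval p₀ x * pd i (peval (p i)) x := fun i => by
    simp only [sub_mul]
    exact integral_sub (integrable_mul_of_memLp hg (hcd i)) (integrable_mul_of_memLp (hc _) (hcd i))
  have h7 : ∀ ν ∈ T.normals, ∑ i, ν i * ∫ x in T.facet ν,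
      (peval (wb (T.facet ν)) x - t ν x) * peval (p i) x ∂μHE[d - 1] =
      ∑ i, ν i * (∫ x in T.facet ν, peval (wb (T.facet ν)) x * peval (p i) x ∂μHE[d - 1]) -
        ∑ i, ν i * ∫ x in T.facet ν, t ν x * peval (p i) x ∂μHE[d - 1] := by
    intro ν hν
    rw [← Finset.sum_sub_distrib]
    refine Finset.sum_congr rfl fun i _ => ?_
    simp only [sub_mul]
    rw [integral_sub (integrable_mul_of_memLp (hcs ν hν _) (hcs ν hν _))
      (integrable_mul_of_memLp (ht.memLp hν) (hcs ν hν _)), mul_sub]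
  rw [Finset.sum_congr rfl fun i _ => h5 i, Finset.sum_sub_distrib, h1, h2,
    Finset.sum_congr rfl h3, Finset.sum_congr rfl fun i _ => h4 i, Finset.sum_sub_distrib,
    Finset.sum_congr rfl fun i _ => h6 i, Finset.sum_sub_distrib, Finset.sum_congr rfl h7,
    Finset.sum_sub_distrib, Finset.sum_comm (s := Finset.univ) (t := T.normals)]
  ring

theorem abs_normal_le_one (T : ConvexPolytope d) {ν : Pt d} (hν : ν ∈ T.normals) (i : Fin d) :
    |ν i| ≤ 1 := by
  have h2 := PiLp.norm_apply_le ν i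
  rwa [T.norm_normal ν hν] at h2

/-- The weak gradient `G` of `{p₀, w_b}` is close to the projected gradient `q` of `g` if `p₀` and
`w_b` are close to `g` and its trace. The defining identities are tested with `G - q`, whose
derivatives and traces are bounded by the inverse and trace inequalities. -/
theorem exists_weakGradient_sub_proj_le (d J : ℕ) {ρ : ℝ} (hρ : 0 < ρ) :
    ∃ C > 0, ∀ T : ConvexPolytope d, T.Regular ρ → T.normals.card ≤ J → ∀ j ≤ J,
      ∀ (g : Pt d → ℝ) (Dg : Fin d → Pt d → ℝ) (t : Pt d → Pt d → ℝ),
      MemLp g 2 T.vol → (∀ i, MemLp (Dg i) 2 T.vol) → T.IsTrace g Dg t →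
      ∀ q : Fin d → Poly d, (∀ i, T.IsProj j (Dg i) (q i)) →
      ∀ (p₀ : Poly d) (wb : Set (Pt d) → Poly d) (G : Fin d → Poly d), T.IsWeakGradient j p₀ wb G →
      ∀ E : ℝ, nrm T.vol (fun x => g x - peval p₀ x) ≤ E →
      (∀ ν ∈ T.normals, Real.sqrt T.diam *
        nrm (T.surf ν) (fun x => peval (wb (T.facet ν)) x - t ν x) ≤ E) →
      T.diam * ∑ i, nrm T.vol (fun x => peval (G i) x - peval (q i) x) ≤ C * E := by
  obtain ⟨c₁, hc₁, H₁⟩ := exists_inverse_ineq d J hρ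
  obtain ⟨c₂, hc₂, H₂⟩ := exists_trace_ineq_poly d J hρ
  refine ⟨(d + 1) * (c₁ + J * c₂), by positivity,
    fun T hT hJ j hj g Dg t hg hDg ht q hq p₀ wb G hG E hE hE' => ?_⟩
  have hh := hT.diam_pos
  set h := T.diam with hhd
  have hE0 : 0 ≤ E := nrm_nonneg.trans hE
  set p : Fin d → Poly d := fun i => G i - q i with hp
  have hpj : ∀ i, p i ∈ PolyDeg d j := fun i => Submodule.sub_mem _ (hG.1 i) (hq i).1
  have hpe : ∀ i x, peval (G i) x - peval (q i) x = peval (p i) x := fun i x =>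
    (peval_sub _ _ _).symm
  have hc : ∀ p : Poly d, MemLp (peval p) 2 T.vol := fun p => T.memLp_vol (peval_continuous p)
  have hR := integral_weakGradient_sub_proj hg hDg ht hq hG hpj
  simp only [hpe] at hR ⊢
  set N := ∑ i, nrm T.vol (peval (p i)) with hN
  have hN0 : 0 ≤ N := T.nrm_nonneg_sum p
  have hvol : ∀ i, h * ∫ x in T.carrier, (g x - peval p₀ x) * pd i (peval (p i)) x ≤
      E * (c₁ * nrm T.vol (peval (p i))) := fun i => by
    have h1 := integral_mul_le (hg.sub (hc p₀))
      (T.memLp_vol (pd_continuous (contDiff_peval (p i)) (by simp) i))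
    have h2 := H₁ T hh hT.volume_ge (p i) (polyDeg_mono hj (hpj i)) i
    calc _ ≤ h * (nrm T.vol (fun x => g x - peval p₀ x) * nrm T.vol (pd i (peval (p i)))) :=
          mul_le_mul_of_nonneg_left h1 hh.le
      _ = nrm T.vol (fun x => g x - peval p₀ x) * (h * nrm T.vol (pd i (peval (p i)))) := by ring
      _ ≤ _ := mul_le_mul hE h2 (mul_nonneg hh.le nrm_nonneg) hE0
  have hsurf : ∀ ν ∈ T.normals, ∀ i, h * (ν i * ∫ x in T.facet ν,
      (peval (wb (T.facet ν)) x - t ν x) * peval (p i) x ∂μHE[d - 1]) ≤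
        E * (c₂ * nrm T.vol (peval (p i))) := fun ν hν i => by
    have h1 := abs_integral_mul_le ((T.memLp_surf hν (peval_continuous (wb (T.facet ν)))).sub
      (ht.memLp hν)) (T.memLp_surf hν (peval_continuous (p i)))
    have h2 := H₂ T hh hT.volume_ge (p i) (polyDeg_mono hj (hpj i)) ν hν
    have h3 : ν i * ∫ x in T.facet ν,
        (peval (wb (T.facet ν)) x - t ν x) * peval (p i) x ∂μHE[d - 1] ≤
        nrm (T.surf ν) (fun x => peval (wb (T.facet ν)) x - t ν x) *
          nrm (T.surf ν) (peval (p i)) := by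
      refine (le_abs_self _).trans ?_
      rw [abs_mul]
      exact (mul_le_of_le_one_left (abs_nonneg _) (T.abs_normal_le_one hν i)).trans h1
    calc _ ≤ h * _ := mul_le_mul_of_nonneg_left h3 hh.le
      _ = (Real.sqrt h * nrm (T.surf ν) (fun x => peval (wb (T.facet ν)) x - t ν x)) *
          (Real.sqrt h * nrm (T.surf ν) (peval (p i))) := by
            rw [mul_mul_mul_comm, Real.mul_self_sqrt hh.le]
      _ ≤ _ := mul_le_mul (hE' ν hν) h2 (mul_nonneg (Real.sqrt_nonneg _) nrm_nonneg) hE0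
  have hsum : h * ∑ i, nrm T.vol (peval (p i)) ^ 2 ≤ E * ((c₁ + J * c₂) * N) := by
    have h1 : ∑ i, nrm T.vol (peval (p i)) ^ 2 =
        ∑ i, ∫ x in T.carrier, peval (p i) x * peval (p i) x :=
      Finset.sum_congr rfl fun i _ => by rw [nrm_sq]; simp only [sq]
    rw [h1, hR, mul_add, Finset.mul_sum, Finset.mul_sum]
    have h2 := Finset.sum_le_sum fun i (_ : i ∈ Finset.univ) => hvol i
    have h3 : ∀ ν ∈ T.normals, h * ∑ i, ν i * ∫ x in T.facet ν,
        (peval (wb (T.facet ν)) x - t ν x) * peval (p i) x ∂μHE[d - 1] ≤ E * (c₂ * N) := by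
      intro ν hν
      rw [Finset.mul_sum]
      refine (Finset.sum_le_sum fun i _ => hsurf ν hν i).trans (le_of_eq ?_)
      rw [hN, Finset.mul_sum, Finset.mul_sum]
    have h4 := Finset.sum_le_sum h3
    rw [Finset.sum_const, nsmul_eq_mul] at h4
    have h5 : ∑ i, E * (c₁ * nrm T.vol (peval (p i))) = E * (c₁ * N) := by
      rw [hN, Finset.mul_sum, Finset.mul_sum]
    rw [h5] at h2
    have h6 : (T.normals.card : ℝ) * (E * (c₂ * N)) ≤ J * (E * (c₂ * N)) :=
      mul_le_mul_of_nonneg_right (by exact_mod_cast hJ) (by positivity)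
    calc _ ≤ E * (c₁ * N) + J * (E * (c₂ * N)) := add_le_add h2 (h4.trans h6)
      _ = _ := by ring
  have hcs : N ^ 2 ≤ d * ∑ i, nrm T.vol (peval (p i)) ^ 2 := by
    have := sq_sum_le_card_mul_sum_sq (s := Finset.univ) (f := fun i => nrm T.vol (peval (p i)))
    simpa using this
  rcases hN0.eq_or_lt with h0 | h0
  · rw [← h0, mul_zero]; positivity
  · refine le_of_mul_le_mul_right ?_ h0
    have hd0 : (0 : ℝ) ≤ d := by positivity
    calc h * N * N = h * N ^ 2 := by ring
      _ ≤ h * (d * ∑ i, nrm T.vol (peval (p i)) ^ 2) := mul_le_mul_of_nonneg_left hcs hh.le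
      _ = d * (h * ∑ i, nrm T.vol (peval (p i)) ^ 2) := by ring
      _ ≤ d * (E * ((c₁ + J * c₂) * N)) := mul_le_mul_of_nonneg_left hsum hd0
      _ ≤ (d + 1) * (E * ((c₁ + J * c₂) * N)) := by
          refine mul_le_mul_of_nonneg_right (by linarith) (by positivity)
      _ = _ := by ring

/-- The interpolation `{Q₀ w, Q_b w}` of a function with the jet `D` on an element, together with
the projection `q` of its gradient, its weak gradient `G`, and the traces `t` of `w` and `τ i`
of `∂_i w`. -/
structure IsInterpolation (T : ConvexPolytope d) (k j : ℕ) (D : List (Fin d) → Pt d → ℝ)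
    (p₀ : Poly d) (wb : Set (Pt d) → Poly d) (q G : Fin d → Poly d) (t : Pt d → Pt d → ℝ)
    (τ : Fin d → Pt d → Pt d → ℝ) : Prop where
  proj : T.IsProj k (D []) p₀
  proj_grad : ∀ i, T.IsProj j (D [i]) (q i)
  facet_mem : ∀ ν ∈ T.normals, wb (T.facet ν) ∈ PolyDeg d k
  facet_proj : ∀ ν ∈ T.normals, ∀ r ∈ PolyDeg d k,
    ∫ x in T.facet ν, peval (wb (T.facet ν)) x * peval r x ∂μHE[d - 1] =
      ∫ x in T.facet ν, t ν x * peval r x ∂μHE[d - 1]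
  weakGradient : T.IsWeakGradient j p₀ wb G
  trace : T.IsTrace (D []) (fun i => D [i]) t
  trace_grad : ∀ i, T.IsTrace (D [i]) (fun l => D [l, i]) (τ i)

/-- The bounds, with a constant `C`, on the errors of the interpolation of a function in
`H^{m+2}`. -/
structure InterpolationBounds (T : ConvexPolytope d) (C : ℝ) (m : ℕ)
    (D : List (Fin d) → Pt d → ℝ) (p₀ : Poly d) (wb : Set (Pt d) → Poly d) (q G : Fin d → Poly d)
    (τ : Fin d → Pt d → Pt d → ℝ) : Prop where
  proj : nrm T.vol (fun x => D [] x - peval p₀ x) ≤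
    C * T.diam ^ (m + 2) * Real.sqrt (T.jetSum D (m + 2))
  proj_grad : ∀ i, nrm T.vol (fun x => D [i] x - peval (q i) x) ≤
    C * T.diam ^ (m + 1) * Real.sqrt (T.jetSum D (m + 2))
  trace_grad : ∀ ν ∈ T.normals, ∀ i, Real.sqrt T.diam *
    nrm (T.surf ν) (fun x => τ i ν x - peval (q i) x) ≤
      C * T.diam ^ (m + 1) * Real.sqrt (T.jetSum D (m + 2))
  jump : ∀ ν ∈ T.normals, nrm (T.surf ν) (fun x => peval p₀ x - peval (wb (T.facet ν)) x) ≤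
    Real.sqrt T.diam * (C * T.diam ^ (m + 1) * Real.sqrt (T.jetSum D (m + 2)))
  weakGradient : ∀ i, nrm T.vol (fun x => peval (G i) x - peval (q i) x) ≤
    C * T.diam ^ (m + 1) * Real.sqrt (T.jetSum D (m + 2))

/-- The interpolation errors on an element are of optimal order. -/
theorem exists_interpolationBounds (d m k J : ℕ) (hmk : m + 1 ≤ k) {ρ : ℝ} (hρ : 0 < ρ) :
    ∃ C > 0, ∀ T : ConvexPolytope d, T.Regular ρ → T.normals.card ≤ J → ∀ j, k ≤ j → j ≤ J →
      ∀ D, T.IsJet (m + 2) D → ∀ p₀ wb q G t τ, T.IsInterpolation k j D p₀ wb q G t τ →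
        T.InterpolationBounds C m D p₀ wb q G τ := by
  obtain ⟨c₁, hc₁, H₁⟩ := exists_proj_error d (m + 1) J hρ
  obtain ⟨c₂, hc₂, H₂⟩ := exists_proj_error d m J hρ
  obtain ⟨c₃, hc₃, H₃⟩ := exists_trace_ineq d hρ
  obtain ⟨c₄, hc₄, H₄⟩ := exists_weakGradient_sub_proj_le d J hρ
  refine ⟨c₁ + c₂ + c₃ * c₂ + c₃ * c₁ + c₄ * (c₁ + 2 * (c₃ * c₁)), by positivity,
    fun T hT hcard j hkj hj D hD p₀ wb q G t τ hI => ?_⟩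
  set C := c₁ + c₂ + c₃ * c₂ + c₃ * c₁ + c₄ * (c₁ + 2 * (c₃ * c₁)) with hC
  have p31 := mul_pos hc₃ hc₁
  have p32 := mul_pos hc₃ hc₂
  have p4 : 0 < c₄ * (c₁ + 2 * (c₃ * c₁)) := by positivity
  have hh := hT.diam_pos
  set h := T.diam with hhd
  set S := Real.sqrt (T.jetSum D (m + 2)) with hS
  have hS0 : 0 ≤ S := Real.sqrt_nonneg _
  have hcont : ∀ r : Poly d, MemLp (peval r) 2 T.vol := fun r => T.memLp_vol (peval_continuous r)
  have hD0 : MemLp (D []) 2 T.vol := hD.memLp (by omega) (by simp)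
  have hD1 : ∀ i, MemLp (D [i]) 2 T.vol := fun i => hD.memLp (by omega) (by simp)
  have hD2 : ∀ l i, MemLp (D [l, i]) 2 T.vol := fun l i => hD.memLp (by omega) (by simp)
  have a1 := H₁ T hh hT.volume_ge D hD k hmk (hkj.trans hj) p₀ hI.proj
  have a2 : ∀ i, T.h1Norm (fun x => D [i] x - peval (q i) x)
      (fun l x => D [l, i] x - pd l (peval (q i)) x) ≤ c₂ * h ^ (m + 1) * S := fun i => by
    refine (H₂ T hh hT.volume_ge _ (hD.tail i) j (by omega) hj (q i) (hI.proj_grad i)).trans ?_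
    exact mul_le_mul_of_nonneg_left (Real.sqrt_le_sqrt (jetSum_tail_le hD _ _)) (by positivity)
  have hpd : ∀ (r : Poly d) i, MemLp (pd i (peval r)) 2 T.vol := fun r i =>
    T.memLp_vol (pd_continuous (contDiff_peval r) (by simp) i)
  have a3 : ∀ ν ∈ T.normals, Real.sqrt h * nrm (T.surf ν) (fun x => t ν x - peval p₀ x) ≤
      c₃ * (c₁ * h ^ (m + 2) * S) := fun ν hν =>
    (H₃ T hh hT.volume_ge _ _ _ (hI.trace.sub_smooth (contDiff_peval p₀)) (hD0.sub (hcont p₀))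
      (fun i => (hD1 i).sub (hpd p₀ i)) ν hν).trans (mul_le_mul_of_nonneg_left a1 hc₃.le)
  have a4 : ∀ ν ∈ T.normals, nrm (T.surf ν) (fun x => peval p₀ x - peval (wb (T.facet ν)) x) ≤
      nrm (T.surf ν) (fun x => t ν x - peval p₀ x) := fun ν hν =>
    nrm_surf_sub_proj_le hν (hI.trace.memLp hν) (hI.facet_mem ν hν) hI.proj.1 (hI.facet_proj ν hν)
  have hX : 0 ≤ h ^ (m + 1) * S := by positivity
  have hXle : ∀ c, c ≤ C → c * h ^ (m + 1) * S ≤ C * h ^ (m + 1) * S := fun c hc => by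
    rw [mul_assoc, mul_assoc]; exact mul_le_mul_of_nonneg_right hc hX
  refine ⟨?_, fun i => ?_, fun ν hν i => ?_, fun ν hν => ?_, fun i => ?_⟩
  · refine (T.nrm_le_h1Norm _ _).trans (a1.trans ?_)
    rw [mul_assoc, mul_assoc]
    exact mul_le_mul_of_nonneg_right (by linarith) (by positivity)
  · exact (T.nrm_le_h1Norm _ _).trans ((a2 i).trans (hXle _ (by linarith)))
  · refine (H₃ T hh hT.volume_ge _ _ _ ((hI.trace_grad i).sub_smooth (contDiff_peval (q i)))
      ((hD1 i).sub (hcont _)) (fun l => (hD2 l i).sub (hpd (q i) l)) ν hν).trans ?_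
    refine (mul_le_mul_of_nonneg_left (a2 i) hc₃.le).trans ?_
    rw [← mul_assoc, ← mul_assoc]
    exact hXle _ (by linarith)
  · refine (a4 ν hν).trans ?_
    have hs : 0 < Real.sqrt h := Real.sqrt_pos.2 hh
    refine le_of_mul_le_mul_left ((a3 ν hν).trans ?_) hs
    change _ ≤ Real.sqrt h * (Real.sqrt h * (C * h ^ (m + 1) * S))
    rw [← mul_assoc (Real.sqrt h), Real.mul_self_sqrt hh.le]
    have h1 := hXle (c₃ * c₁) (by linarith)
    calc c₃ * (c₁ * h ^ (m + 2) * S) = h * (c₃ * c₁ * h ^ (m + 1) * S) := by ring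
      _ ≤ _ := mul_le_mul_of_nonneg_left h1 hh.le
  · have h1 := H₄ T hT hcard j hj (D []) (fun i => D [i]) t hD0 hD1 hI.trace q hI.proj_grad p₀ wb G
      hI.weakGradient ((c₁ + 2 * (c₃ * c₁)) * h ^ (m + 2) * S) ?_ fun ν hν => ?_
    · have h2 := Finset.single_le_sum
        (f := fun i => nrm T.vol (fun x => peval (G i) x - peval (q i) x))
        (fun _ _ => nrm_nonneg) (Finset.mem_univ i)
      have h3 := hXle (c₄ * (c₁ + 2 * (c₃ * c₁))) (by linarith)
      refine le_of_mul_le_mul_left ((mul_le_mul_of_nonneg_left h2 hh.le).trans (h1.trans ?_)) hh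
      calc _ = h * (c₄ * (c₁ + 2 * (c₃ * c₁)) * h ^ (m + 1) * S) := by ring
        _ ≤ _ := mul_le_mul_of_nonneg_left h3 hh.le
    · refine (T.nrm_le_h1Norm _ _).trans (a1.trans ?_)
      rw [mul_assoc, mul_assoc]
      exact mul_le_mul_of_nonneg_right (by linarith) (by positivity)
    · have h2 := nrm_sub_le_sub (T.memLp_surf hν (peval_continuous (wb (T.facet ν))))
        (T.memLp_surf hν (peval_continuous p₀)) (hI.trace.memLp hν)
      have h3 := a4 ν hν
      rw [nrm_sub_comm] at h3
      have h4 : nrm (T.surf ν) (fun x => peval (wb (T.facet ν)) x - t ν x) ≤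
          2 * nrm (T.surf ν) (fun x => t ν x - peval p₀ x) := by
        rw [nrm_sub_comm (f := peval p₀)] at h2
        linarith
      calc _ ≤ Real.sqrt h * (2 * nrm (T.surf ν) (fun x => t ν x - peval p₀ x)) :=
            mul_le_mul_of_nonneg_left h4 (Real.sqrt_nonneg _)
        _ = 2 * (Real.sqrt h * nrm (T.surf ν) (fun x => t ν x - peval p₀ x)) := by ring
        _ ≤ 2 * (c₃ * (c₁ * h ^ (m + 2) * S)) := mul_le_mul_of_nonneg_left (a3 ν hν) two_pos.le
        _ ≤ (c₁ + 2 * (c₃ * c₁)) * h ^ (m + 2) * S := by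
            have : 0 ≤ c₁ * h ^ (m + 2) * S := by positivity
            linarith

/-- The equation for the weak gradient on an element, tested with a weak function. -/
theorem IsInterpolation.integral_laplacian {T : ConvexPolytope d} {k j : ℕ}
    {D : List (Fin d) → Pt d → ℝ} {p₀ : Poly d} {wb : Set (Pt d) → Poly d} {q G : Fin d → Poly d}
    {t : Pt d → Pt d → ℝ} {τ : Fin d → Pt d → Pt d → ℝ} (hI : T.IsInterpolation k j D p₀ wb q G t τ)
    (hD : T.IsJet 2 D) (hkj : k ≤ j) {v₀ : Poly d} (hv₀ : v₀ ∈ PolyDeg d k)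
    {vb : Set (Pt d) → Poly d} {V : Fin d → Poly d} (hV : T.IsWeakGradient j v₀ vb V) :
    ∫ x in T.carrier, (-∑ i, D [i, i] x) * peval v₀ x =
      (∑ i, ∫ x in T.carrier, peval (q i) x * peval (V i) x) -
        (∑ ν ∈ T.normals, ∑ i, ν i * ∫ x in T.facet ν, (τ i ν x - peval (q i) x) *
          (peval v₀ x - peval (vb (T.facet ν)) x) ∂μHE[d - 1]) -
        ∑ i, ∑ ν ∈ T.normals, ν i * ∫ x in T.facet ν,
          τ i ν x * peval (vb (T.facet ν)) x ∂μHE[d - 1] := by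
  have hc : ∀ p : Poly d, MemLp (peval p) 2 T.vol := fun p => T.memLp_vol (peval_continuous p)
  have hD1 : ∀ i, MemLp (D [i]) 2 T.vol := fun i => hD.memLp (by omega) (by simp)
  have hD2 : ∀ l i, MemLp (D [l, i]) 2 T.vol := fun l i => hD.memLp (by omega) (by simp)
  have hcs : ∀ ν ∈ T.normals, ∀ p : Poly d, MemLp (peval p) 2 (T.surf ν) := fun ν hν p =>
    T.memLp_surf hν (peval_continuous p)
  have h1 : ∫ x in T.carrier, (-∑ i, D [i, i] x) * peval v₀ x =
      -∑ i, ∫ x in T.carrier, D [i, i] x * peval v₀ x := by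
    simp only [neg_mul, Finset.sum_mul, integral_neg]
    rw [integral_finsetSum _ fun i _ => integrable_mul_of_memLp (hD2 i i) (hc v₀)]
  have h2 : ∀ i, ∫ x in T.carrier, D [i, i] x * peval v₀ x =
      (∑ ν ∈ T.normals, ν i * ∫ x in T.facet ν, τ i ν x * peval v₀ x ∂μHE[d - 1]) -
        ∫ x in T.carrier, pd i (peval v₀) x * peval (q i) x := fun i => by
    rw [← (hI.trace_grad i).green (hD1 i) (fun l => hD2 l i)
      ((contDiff_peval v₀).of_le (by simp)) i]
    have h3 := (hI.proj_grad i).2 (MvPolynomial.pderiv i v₀)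
      (polyDeg_mono (by omega) (polyDeg_pderiv hv₀ i))
    simp only [pd_peval, mul_comm (peval (MvPolynomial.pderiv i v₀) _)]
    rw [h3]; ring
  have h4 := hV.integral_eq (q := q) fun i => (hI.proj_grad i).1
  have h5 : ∑ i, ∫ x in T.carrier, peval (q i) x * peval (V i) x =
      ∑ i, ∫ x in T.carrier, peval (V i) x * peval (q i) x := by simp only [mul_comm]
  have h6 : ∀ ν ∈ T.normals, ∫ x in T.facet ν, (peval (vb (T.facet ν)) x - peval v₀ x) *
      ∑ i, peval (q i) x * ν i ∂μHE[d - 1] =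
      (∑ i, ν i * ∫ x in T.facet ν, (τ i ν x - peval (q i) x) *
          (peval v₀ x - peval (vb (T.facet ν)) x) ∂μHE[d - 1]) +
        (∑ i, ν i * ∫ x in T.facet ν, τ i ν x * peval (vb (T.facet ν)) x ∂μHE[d - 1]) -
        ∑ i, ν i * ∫ x in T.facet ν, τ i ν x * peval v₀ x ∂μHE[d - 1] := by
    intro ν hν
    have hτ := fun i => (hI.trace_grad i).memLp hν
    have hs := hcs ν hν
    have e1 : ∫ x in T.facet ν, (peval (vb (T.facet ν)) x - peval v₀ x) *
        ∑ i, peval (q i) x * ν i ∂μHE[d - 1] = ∑ i, ν i * ∫ x in T.facet ν,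
          (peval (vb (T.facet ν)) x - peval v₀ x) * peval (q i) x ∂μHE[d - 1] := by
      simp only [← integral_const_mul]
      have hi : ∀ i, Integrable (fun x => ν i * ((peval (vb (T.facet ν)) x - peval v₀ x) *
          peval (q i) x)) (T.surf ν) := fun i =>
        (integrable_mul_of_memLp ((hs _).sub (hs v₀)) (hs (q i))).const_mul (ν i)
      rw [← integral_finsetSum _ fun i _ => hi i]
      refine integral_congr_ae (ae_of_all _ fun x => ?_)
      simp only [Finset.mul_sum]
      exact Finset.sum_congr rfl fun i _ => by ring
    rw [e1, ← Finset.sum_add_distrib, ← Finset.sum_sub_distrib]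
    refine Finset.sum_congr rfl fun i _ => ?_
    rw [← mul_add, ← mul_sub]
    congr 1
    have i1 : Integrable (fun x => (τ i ν x - peval (q i) x) *
        (peval v₀ x - peval (vb (T.facet ν)) x)) (T.surf ν) :=
      integrable_mul_of_memLp ((hτ i).sub (hs (q i))) ((hs v₀).sub (hs _))
    have i2 := integrable_mul_of_memLp (hτ i) (hs (vb (T.facet ν)))
    have i3 := integrable_mul_of_memLp (hτ i) (hs v₀)
    have i12 : Integrable (fun x => (τ i ν x - peval (q i) x) *
        (peval v₀ x - peval (vb (T.facet ν)) x) + τ i ν x * peval (vb (T.facet ν)) x)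
        (T.surf ν) := i1.add i2
    rw [← integral_add i1 i2, ← integral_sub i12 i3]
    refine integral_congr_ae (ae_of_all _ fun x => ?_)
    simp only
    ring
  rw [h1, h5, h4, Finset.sum_congr rfl fun i _ => h2 i, Finset.sum_congr rfl h6,
    Finset.sum_sub_distrib, Finset.sum_sub_distrib, Finset.sum_add_distrib,
    Finset.sum_comm (s := Finset.univ) (t := T.normals),
    Finset.sum_comm (s := Finset.univ) (t := T.normals)]
  ring

end ConvexPolytope

end WG
end

noncomputable section

namespace WG

/-! ### Facets shared by two elements -/

namespace ConvexPolytope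

variable {d : ℕ}

theorem exists_step_gap_pos (T : ConvexPolytope d) {s : Finset (Pt d)} {x : Pt d}
    (h : ∀ ν ∈ s, 0 < T.gap ν x) (z : Pt d) :
    ∃ δ > 0, δ ≤ 1 ∧ ∀ ν ∈ s, 0 < T.gap ν (x + (δ : ℝ) • z) := by
  have h1 : ∀ᶠ δ : ℝ in 𝓝[>] 0, ∀ ν ∈ s, 0 < T.gap ν (x + δ • z) := by
    refine (Filter.eventually_all_finset s).2 fun ν hν => Filter.Eventually.filter_mono
      nhdsWithin_le_nhds ?_
    have hc : Continuous fun δ : ℝ => T.gap ν (x + δ • z) :=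
      (T.gap_continuous ν).comp (by fun_prop)
    exact (hc.tendsto 0).eventually (lt_mem_nhds (by simpa using h ν hν))
  have h2 : ∀ᶠ δ : ℝ in 𝓝[>] 0, δ ≤ 1 :=
    Filter.Eventually.filter_mono nhdsWithin_le_nhds (eventually_le_nhds zero_lt_one)
  obtain ⟨δ, ⟨hδ1, hδ2⟩, hδ⟩ := ((h1.and h2).and self_mem_nhdsWithin).exists
  exact ⟨δ, hδ, hδ2, hδ1⟩

theorem gap_pos_of_mem_openFacet {T : ConvexPolytope d} {ν x : Pt d} (hx : x ∈ T.openFacet ν)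
    {μ : Pt d} (hμ : μ ∈ T.normals) (hne : μ ≠ ν) : 0 < T.gap μ x := sub_pos.2 (hx.2 μ hμ hne)

/-- A facet determines its normal up to sign. -/
theorem normal_eq_or_eq_neg {T T' : ConvexPolytope d} {ν ν' : Pt d} (hν : ν ∈ T.normals)
    (hν' : ν' ∈ T'.normals) (h : T'.facet ν' = T.facet ν) : ν' = ν ∨ ν' = -ν := by
  classical
  obtain ⟨x, hx⟩ := T.openFacet_nonempty hν
  have hxF := T.openFacet_subset_facet hx
  have n1 := T.norm_normal ν hν
  have n2 := T'.norm_normal ν' hν'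
  set c : ℝ := inner ℝ ν ν' with hc
  set z := ν' - c • ν with hz
  have hz0 : inner ℝ ν z = 0 := by
    rw [hz, inner_sub_right, inner_smul_right, real_inner_self_eq_norm_sq, n1, ← hc]; ring
  -- `z` is tangent to the facet, so a small step along `z` stays in it
  obtain ⟨δ, hδ, -, hs⟩ := T.exists_step_gap_pos (s := T.normals.erase ν) (x := x)
    (fun μ hμ => gap_pos_of_mem_openFacet hx (Finset.mem_of_mem_erase hμ)
      (Finset.ne_of_mem_erase hμ)) z
  have hy : x + δ • z ∈ T.openFacet ν := by
    refine ⟨?_, fun μ hμ hne => sub_pos.1 (hs μ (Finset.mem_erase.2 ⟨hne, hμ⟩))⟩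
    rw [inner_add_right, inner_smul_right, hz0, hx.1]; ring
  have hyF := T.openFacet_subset_facet hy
  rw [← h] at hxF hyF
  have h1 := hyF.2
  rw [inner_add_right, inner_smul_right, hxF.2] at h1
  have h2 : inner ℝ ν' z = 0 := by
    rcases mul_eq_zero.1 (show δ * inner ℝ ν' z = 0 by linarith) with h | h
    · exact absurd h hδ.ne'
    · exact h
  rw [hz, inner_sub_right, inner_smul_right, real_inner_self_eq_norm_sq, n2, real_inner_comm ν ν',
    ← hc] at h2
  have h3 : (c - 1) * (c + 1) = 0 := by linarith
  rcases mul_eq_zero.1 h3 with h4 | h4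
  · left
    exact ((inner_eq_one_iff_of_norm_eq_one n1 n2).1 (by rw [← hc]; linarith)).symm
  · right
    have := (inner_eq_one_iff_of_norm_eq_one (𝕜 := ℝ) (x := -ν) (by rwa [norm_neg]) n2).1
      (by rw [inner_neg_left, ← hc]; linarith)
    exact this.symm

theorem facet_injOn (T : ConvexPolytope d) : Set.InjOn T.facet T.normals := by
  intro ν hν ν' hν' h
  by_contra hne
  obtain ⟨x, hx⟩ := T.openFacet_nonempty hν
  have hxF := T.openFacet_subset_facet hx
  rw [h] at hxF
  exact (gap_pos_of_mem_openFacet hx hν' (Ne.symm hne)).ne' (T.gap_of_mem_facet hxF)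

/-- Two polytopes with a common facet and the same outward normal on it overlap. -/
theorem not_disjoint_of_facet_eq {T T' : ConvexPolytope d} {ν : Pt d} (hν : ν ∈ T.normals)
    (hν' : ν ∈ T'.normals) (h : T'.facet ν = T.facet ν) :
    ¬Disjoint (interior T.carrier) (interior T'.carrier) := by
  classical
  obtain ⟨x, hx⟩ := T.openFacet_nonempty hν
  have hxF := T.openFacet_subset_facet hx
  obtain ⟨a, ha⟩ := T'.interior_nonempty
  rw [interior_carrier] at ha
  have hxF' : x ∈ T'.facet ν := h ▸ hxF
  obtain ⟨δ, hδ, hδ1, hs⟩ := T.exists_step_gap_pos (s := T.normals.erase ν) (x := x)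
    (fun μ hμ => gap_pos_of_mem_openFacet hx (Finset.mem_of_mem_erase hμ)
      (Finset.ne_of_mem_erase hμ)) (a - x)
  have hT' : ∀ μ ∈ T'.normals, 0 < T'.gap μ (x + δ • (a - x)) := by
    intro μ hμ
    have h1 : T'.gap μ (x + δ • (a - x)) = (1 - δ) * T'.gap μ x + δ * T'.gap μ a := by
      simp only [gap, inner_add_right, inner_smul_right, inner_sub_right]; ring
    rw [h1]
    exact add_pos_of_nonneg_of_pos (mul_nonneg (by linarith) (T'.gap_nonneg hμ hxF'.1))
      (mul_pos hδ (ha μ hμ))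
  refine Set.not_disjoint_iff.2 ⟨x + δ • (a - x), ?_, ?_⟩
  · rw [interior_carrier]
    intro μ hμ
    rcases eq_or_ne μ ν with rfl | hne
    · have h1 := hT' μ hν'
      rwa [gap, ← hxF'.2, hxF.2] at h1
    · exact hs μ (Finset.mem_erase.2 ⟨hne, hμ⟩)
  · rw [interior_carrier]
    exact hT'

theorem normals_nonempty (T : ConvexPolytope d) (hd : 0 < d) : T.normals.Nonempty := by
  by_contra hcon
  rw [Finset.not_nonempty_iff_eq_empty] at hcon
  have hb := T.bounded
  have : Nonempty (Fin d) := ⟨⟨0, hd⟩⟩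
  rw [hcon] at hb
  simp only [Finset.notMem_empty, false_implies, implies_true, Set.ofPred_true] at hb
  exact NormedSpace.unbounded_univ ℝ (Pt d) hb

theorem diam_pos (T : ConvexPolytope d) (hd : 0 < d) : 0 < T.diam := by
  have : Nonempty (Fin d) := ⟨⟨0, hd⟩⟩
  refine Metric.diam_pos ?_ T.bounded
  rw [← Set.not_subsingleton_iff]
  intro h
  have h1 := isOpen_interior.measure_pos volume T.interior_nonempty
  exact h1.ne' (measure_mono_null interior_subset (h.measure_zero volume))

end ConvexPolytope

namespace PolytopalMesh

variable {d : ℕ} {Ω : Set (Pt d)} (M : PolytopalMesh Ω)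

/-- Two elements with a common facet lie on opposite sides of it, since their interiors are
disjoint. -/
theorem facet_eq_cases {T T' : Fin M.numElem} {ν ν' : Pt d} (hν : ν ∈ (M.elem T).normals)
    (hν' : ν' ∈ (M.elem T').normals) (h : (M.elem T').facet ν' = (M.elem T).facet ν) :
    (T' = T ∧ ν' = ν) ∨ (T' ≠ T ∧ ν' = -ν) := by
  by_cases hT : T' = T
  · subst hT
    exact Or.inl ⟨rfl, (M.elem T').facet_injOn hν' hν h⟩
  · refine Or.inr ⟨hT, (ConvexPolytope.normal_eq_or_eq_neg hν hν' h).resolve_left ?_⟩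
    rintro rfl
    exact ConvexPolytope.not_disjoint_of_facet_eq hν hν' h (M.disjoint_interior _ _ (Ne.symm hT))

/-- A facet which is not contained in the boundary is also a facet of another element, with the
opposite normal, and its relative interior lies in `Ω`. -/
theorem exists_neighbor {T : Fin M.numElem} {ν : Pt d} (hν : ν ∈ (M.elem T).normals)
    (hfr : ¬(M.elem T).facet ν ⊆ frontier Ω) :
    (M.elem T).openFacet ν ⊆ Ω ∧ ∃ T', T' ≠ T ∧ -ν ∈ (M.elem T').normals ∧
      (M.elem T').facet (-ν) = (M.elem T).facet ν := by
  obtain ⟨h1, T', hT', ν', hν', h⟩ := (M.conforming T ν hν).resolve_left hfr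
  rcases M.facet_eq_cases hν hν' h with ⟨h2, -⟩ | ⟨-, rfl⟩
  · exact absurd h2 hT'
  · exact ⟨h1, T', hT', hν', h⟩

variable {M}

/-- The trace on a facet does not depend on the element from which it is taken. -/
theorem integral_trace_eq_of_facet_eq {g : Pt d → ℝ} {G : Fin d → Pt d → ℝ}
    (hg : HasWeakGrad Ω g G) {t : Fin M.numElem → Pt d → Pt d → ℝ}
    (ht : ∀ T, (M.elem T).IsTrace g G (t T)) {T T' : Fin M.numElem} {ν ν' : Pt d}
    (hν : ν ∈ (M.elem T).normals) (hν' : ν' ∈ (M.elem T').normals)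
    (h : (M.elem T').facet ν' = (M.elem T).facet ν) (hfr : ¬(M.elem T).facet ν ⊆ frontier Ω)
    (p : Poly d) :
    ∫ x in (M.elem T).facet ν, t T ν x * peval p x ∂μHE[d - 1] =
      ∫ x in (M.elem T).facet ν, t T' ν' x * peval p x ∂μHE[d - 1] := by
  rcases M.facet_eq_cases hν hν' h with ⟨rfl, rfl⟩ | ⟨hT, rfl⟩
  · rfl
  · exact ConvexPolytope.IsTrace.integral_eq_of_neighbor (M.interior_subset T)
      (M.interior_subset T') (M.disjoint_interior _ _ (Ne.symm hT)) hν hν' h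
      (M.exists_neighbor hν hfr).1 hg (ht T) (ht T') (contDiff_peval p)

/-- The contributions of the two sides of each interior facet cancel. -/
theorem sum_integral_trace_eq_zero {g : Pt d → ℝ} {G : Fin d → Pt d → ℝ}
    (hg : HasWeakGrad Ω g G) {t : Fin M.numElem → Pt d → Pt d → ℝ}
    (ht : ∀ T, (M.elem T).IsTrace g G (t T)) {vb : Set (Pt d) → Poly d}
    (hvb : ∀ T, ∀ ν ∈ (M.elem T).normals, (M.elem T).facet ν ⊆ frontier Ω →
      ∀ x ∈ (M.elem T).facet ν, peval (vb ((M.elem T).facet ν)) x = 0) (i : Fin d) :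
    ∑ T, ∑ ν ∈ (M.elem T).normals, ν i * ∫ x in (M.elem T).facet ν,
      t T ν x * peval (vb ((M.elem T).facet ν)) x ∂μHE[d - 1] = 0 := by
  classical
  rw [Finset.sum_sigma']
  have hnb : ∀ a : (_ : Fin M.numElem) × Pt d, ∃ T', a.2 ∈ (M.elem a.1).normals →
      ¬(M.elem a.1).facet a.2 ⊆ frontier Ω → T' ≠ a.1 ∧ -a.2 ∈ (M.elem T').normals ∧
      (M.elem T').facet (-a.2) = (M.elem a.1).facet a.2 := by
    intro a
    by_cases h : a.2 ∈ (M.elem a.1).normals ∧ ¬(M.elem a.1).facet a.2 ⊆ frontier Ω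
    · obtain ⟨-, T', hT'⟩ := M.exists_neighbor h.1 h.2
      exact ⟨T', fun _ _ => hT'⟩
    · exact ⟨a.1, fun h1 h2 => absurd ⟨h1, h2⟩ h⟩
  choose nb hnb using hnb
  have hmem : ∀ a, a ∈ Finset.univ.sigma (fun T => (M.elem T).normals) →
      a.2 ∈ (M.elem a.1).normals := fun a ha => (Finset.mem_sigma.1 ha).2
  -- The two sides `(T, ν)` and `(T', -ν)` of an interior facet are paired by an involution, whose
  -- fixed points are the boundary facets, where `vb` vanishes.
  refine Finset.sum_involution (fun a _ =>
    if (M.elem a.1).facet a.2 ⊆ frontier Ω then a else ⟨nb a, -a.2⟩) ?_ ?_ ?_ ?_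
  · rintro ⟨T, ν⟩ ha
    have hν := hmem _ ha
    by_cases hfr : (M.elem T).facet ν ⊆ frontier Ω
    · have h0 : ∫ x in (M.elem T).facet ν,
          t T ν x * peval (vb ((M.elem T).facet ν)) x ∂μHE[d - 1] = 0 := by
        rw [setIntegral_congr_fun ((M.elem T).measurableSet_facet ν)
          (g := fun _ => 0) fun x hx => by simp only [hvb T ν hν hfr x hx, mul_zero]]
        simp
      simp only [hfr, if_true, h0]
      simp
    · obtain ⟨h1, h2, h3⟩ := hnb ⟨T, ν⟩ hν hfr
      simp only [hfr, if_false]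
      rw [integral_trace_eq_of_facet_eq hg ht hν h2 h3 hfr]
      simp only [h3, PiLp.neg_apply]
      ring
  · rintro ⟨T, ν⟩ ha hne
    have hν := hmem _ ha
    by_cases hfr : (M.elem T).facet ν ⊆ frontier Ω
    · exfalso
      apply hne
      simp only
      rw [setIntegral_congr_fun ((M.elem T).measurableSet_facet ν)
          (g := fun _ => 0) fun x hx => by simp only [hvb T ν hν hfr x hx, mul_zero]]
      simp
    · simp only [hfr, if_false]
      intro h
      exact (hnb ⟨T, ν⟩ hν hfr).1 (congrArg Sigma.fst h)
  · rintro ⟨T, ν⟩ ha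
    have hν := hmem _ ha
    by_cases hfr : (M.elem T).facet ν ⊆ frontier Ω
    · simpa only [hfr, if_true] using ha
    · simp only [hfr, if_false]
      exact Finset.mem_sigma.2 ⟨Finset.mem_univ _, (hnb ⟨T, ν⟩ hν hfr).2.1⟩
  · rintro ⟨T, ν⟩ ha
    have hν := hmem _ ha
    by_cases hfr : (M.elem T).facet ν ⊆ frontier Ω
    · simp only [hfr, if_true]
    · obtain ⟨h1, h2, h3⟩ := hnb ⟨T, ν⟩ hν hfr
      have hfr' : ¬(M.elem (nb ⟨T, ν⟩)).facet (-ν) ⊆ frontier Ω := by rwa [h3]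
      obtain ⟨h4, h5, h6⟩ := hnb ⟨nb ⟨T, ν⟩, -ν⟩ h2 hfr'
      simp only [hfr, if_false, hfr']
      simp only [neg_neg] at h5 h6 ⊢
      have h7 : nb ⟨nb ⟨T, ν⟩, -ν⟩ = T := by
        by_contra hne
        exact ConvexPolytope.not_disjoint_of_facet_eq hν h5 (h6.trans h3)
          (M.disjoint_interior _ _ (Ne.symm hne))
      rw [h7]

/-! ### Integrals over the mesh and piecewise polynomials -/

variable (M)

theorem ae_eq_iUnion_interior : (⋃ T, interior (M.elem T).carrier) =ᵐ[volume] Ω := by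
  have h1 : (⋃ T, interior (M.elem T).carrier) ⊆ Ω := Set.iUnion_subset M.interior_subset
  refine (LE.le.eventuallyLE h1).antisymm ?_
  rw [ae_le_set]
  have h2 : Ω \ (⋃ T, interior (M.elem T).carrier) ⊆
      ⋃ T, ((M.elem T).carrier \ interior (M.elem T).carrier) := by
    intro x hx
    have h3 : x ∈ ⋃ T, (M.elem T).carrier := by rw [M.iUnion_carrier]; exact subset_closure hx.1
    obtain ⟨T, hT⟩ := Set.mem_iUnion.1 h3
    exact Set.mem_iUnion.2 ⟨T, hT, fun h => hx.2 (Set.mem_iUnion.2 ⟨T, h⟩)⟩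
  refine measure_mono_null h2 (measure_iUnion_null fun T => ?_)
  exact (ae_le_set.1 (M.elem T).interior_ae_eq.symm.le)

theorem vol_le (T : Fin M.numElem) : (M.elem T).vol ≤ volume.restrict Ω := by
  rw [ConvexPolytope.vol, ← (M.elem T).restrict_interior]
  exact Measure.restrict_mono (M.interior_subset T) le_rfl

theorem integral_eq_sum {g : Pt d → ℝ} (hg : Integrable g (volume.restrict Ω)) :
    ∫ x in Ω, g x = ∑ T, ∫ x in (M.elem T).carrier, g x := by
  rw [← setIntegral_congr_set M.ae_eq_iUnion_interior]
  rw [integral_iUnion_fintype (fun T => isOpen_interior.measurableSet)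
    (fun T T' h => M.disjoint_interior T T' h)
    (fun T => IntegrableOn.mono_set hg (M.interior_subset T))]
  exact Finset.sum_congr rfl fun T _ => by rw [(M.elem T).restrict_interior]

theorem nrm_sq_eq_sum {g : Pt d → ℝ} (hg : MemLp g 2 (volume.restrict Ω)) :
    nrm (volume.restrict Ω) g ^ 2 = ∑ T, nrm (M.elem T).vol g ^ 2 := by
  rw [nrm_sq, M.integral_eq_sum hg.integrable_sq]
  exact Finset.sum_congr rfl fun T _ => nrm_sq.symm

theorem isCompact_closure (M : PolytopalMesh Ω) : IsCompact (closure Ω) := by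
  rw [← M.iUnion_carrier]
  exact isCompact_iUnion fun T => (M.elem T).isCompact_carrier

theorem memLp_of_continuous (M : PolytopalMesh Ω) {g : Pt d → ℝ} (hg : Continuous g) :
    MemLp g 2 (volume.restrict Ω) :=
  (WG.memLp_of_continuous M.isCompact_closure M.isCompact_closure.measure_lt_top hg).mono_measure
    (Measure.restrict_mono subset_closure le_rfl)

theorem memLp_piecewise (p : Fin M.numElem → Poly d) :
    MemLp (M.piecewise p) 2 (volume.restrict Ω) := by
  have h : M.piecewise p = fun x => ∑ T, (interior (M.elem T).carrier).indicator (peval (p T)) x :=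
    rfl
  rw [h]
  exact memLp_finsetSum _ fun T _ =>
    (M.memLp_of_continuous (peval_continuous (p T))).indicator isOpen_interior.measurableSet

theorem piecewise_ae_eq (p : Fin M.numElem → Poly d) (T : Fin M.numElem) :
    M.piecewise p =ᵐ[(M.elem T).vol] peval (p T) := by
  rw [ConvexPolytope.vol, ← (M.elem T).restrict_interior]
  refine ae_restrict_of_forall_mem isOpen_interior.measurableSet fun x hx => ?_
  rw [piecewise, Finset.sum_eq_single T]
  · exact Set.indicator_of_mem hx _
  · intro T' _ hne
    exact Set.indicator_of_notMem
      (fun h => Set.disjoint_left.1 (M.disjoint_interior T' T hne) h hx) _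
  · simp

theorem diam_le_meshSize (T : Fin M.numElem) : (M.elem T).diam ≤ M.meshSize :=
  le_ciSup (f := fun T => (M.elem T).diam) (Set.finite_range _).bddAbove T

theorem meshSize_nonneg : 0 ≤ M.meshSize :=
  Real.iSup_nonneg fun T => (M.elem T).diam_nonneg

variable {M}

theorem ShapeRegular.regular {ρ : ℝ} (h : M.ShapeRegular ρ) (hd : 0 < d) (T : Fin M.numElem) :
    (M.elem T).Regular ρ :=
  ⟨(M.elem T).diam_pos hd, h.volume_ge T, h.area_ge T, h.diam_ge T, h.inner_le T⟩

theorem sum_jetSum {D : List (Fin d) → Pt d → ℝ} {m l : ℕ} {u : Pt d → ℝ} (hΩ : IsOpen Ω)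
    (hD : IsJetOn Ω m u D) (hl : l ≤ m) :
    ∑ T, (M.elem T).jetSum D l = sobolevSeminorm Ω l u ^ 2 := by
  rw [hD.sobolevSeminorm_sq hΩ hl]
  simp only [ConvexPolytope.jetSum]
  rw [Finset.sum_comm]
  refine Finset.sum_congr rfl fun I _ => (M.nrm_sq_eq_sum ?_).symm
  exact (hD.word (List.ofFn I) (by simpa using hl)).1

end PolytopalMesh

/-! ### Existence of the interpolant -/

namespace ConvexPolytope

variable {d : ℕ}

/-- The `L²(e)` projection onto polynomials of degree at most `k` on a facet `e`. -/
theorem exists_facet_proj (T : ConvexPolytope d) {ν : Pt d} (hν : ν ∈ T.normals) (k : ℕ)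
    {t : Pt d → ℝ} (ht : MemLp t 2 (T.surf ν)) :
    ∃ p ∈ PolyDeg d k, ∀ r ∈ PolyDeg d k,
      ∫ x in T.facet ν, peval p x * peval r x ∂μHE[d - 1] =
        ∫ x in T.facet ν, t x * peval r x ∂μHE[d - 1] := by
  have hc : ∀ p : Poly d, MemLp (peval p) 2 (T.surf ν) := fun p =>
    T.memLp_surf hν (peval_continuous p)
  let L : PolyDeg d k →ₗ[ℝ] Lp ℝ 2 (T.surf ν) :=
    { toFun := fun p => (hc p.1).toLp _
      map_add' := fun p q => by
        rw [← MemLp.toLp_add]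
        congr 1
        exact funext fun x => peval_add p.1 q.1 x
      map_smul' := fun c p => by
        rw [RingHom.id_apply, ← MemLp.toLp_const_smul]
        congr 1
        exact funext fun x => peval_smul c p.1 x }
  have hfin : FiniteDimensional ℝ (LinearMap.range L) := inferInstance
  obtain ⟨p, hp⟩ := ((LinearMap.range L).starProjection_apply_mem (ht.toLp t))
  refine ⟨p.1, p.2, fun r hr => ?_⟩
  have h1 := (LinearMap.range L).sub_starProjection_mem_orthogonal (ht.toLp t)
  have h2 := (Submodule.mem_orthogonal _ _).1 h1 (L ⟨r, hr⟩) ⟨_, rfl⟩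
  rw [← hp, inner_sub_right, sub_eq_zero, ← integral_mul_eq_inner, ← integral_mul_eq_inner] at h2
  have e1 : L ⟨r, hr⟩ =ᵐ[T.surf ν] peval r := (hc r).coeFn_toLp
  have e2 : L p =ᵐ[T.surf ν] peval p.1 := (hc p.1).coeFn_toLp
  have h3 : ∫ x in T.facet ν, peval p.1 x * peval r x ∂μHE[d - 1] =
      ∫ x, L ⟨r, hr⟩ x * L p x ∂(T.surf ν) := by
    refine integral_congr_ae ?_
    filter_upwards [e1, e2] with x h1 h2
    rw [h1, h2, mul_comm]
  rw [h3, ← h2]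
  refine integral_congr_ae ?_
  filter_upwards [e1, ht.coeFn_toLp] with x h1 h2
  rw [h1, h2, mul_comm]

end ConvexPolytope

namespace PolytopalMesh

variable {d : ℕ} {Ω : Set (Pt d)} (M : PolytopalMesh Ω)

/-- The interpolant `{Q₀ w, Q_b w}` of `w ∈ H_0^1(Ω) ∩ H²(Ω)` exists and lies in `V_h^0`. The value
on a face does not depend on the element from which the trace is taken. -/
theorem exists_interpolant {m : ℕ} (hm : 2 ≤ m) (hΩ : IsOpen Ω) {w : Pt d → ℝ}
    {D : List (Fin d) → Pt d → ℝ} (hD : IsJetOn Ω m w D) (hw : IsH10 Ω w fun i => D [i]) (k : ℕ)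
    (j : Fin M.numElem → ℕ) :
    ∃ (wI : WeakFun d M.numElem) (q : Fin M.numElem → Fin d → Poly d)
      (t : Fin M.numElem → Pt d → Pt d → ℝ) (τ : Fin M.numElem → Fin d → Pt d → Pt d → ℝ),
      M.MemV0 k wI ∧ wI.v0 = M.Q0 k w ∧
        ∀ T, (M.elem T).IsInterpolation k (j T) D (wI.v0 T) wI.vb (q T) (M.weakGradient j wI T)
          (t T) (τ T) := by
  classical
  have hJ : ∀ T, (M.elem T).IsJet m D := fun T => hD.isJet (M.interior_subset T)
  have hD0 := hD.hasWeakGrad (I := []) (by simp; omega)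
  choose t ht using fun T => ConvexPolytope.exists_isTrace ((hJ T).weakGrad [] (by simp; omega))
  choose τ hτ using fun T (i : Fin d) =>
    ConvexPolytope.exists_isTrace ((hJ T).weakGrad [i] (by simp; omega))
  have hvb : ∀ e : Set (Pt d), ∃ p : Poly d, (e ⊆ frontier Ω → p = 0) ∧
      ∀ T, ∀ ν ∈ (M.elem T).normals, (M.elem T).facet ν = e → p ∈ PolyDeg d k ∧
        ∀ r ∈ PolyDeg d k, ∫ x in (M.elem T).facet ν, peval p x * peval r x ∂μHE[d - 1] =
          ∫ x in (M.elem T).facet ν, t T ν x * peval r x ∂μHE[d - 1] := by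
    intro e
    by_cases hfr : e ⊆ frontier Ω
    · refine ⟨0, fun _ => rfl, ?_⟩
      rintro T ν hν rfl
      refine ⟨Submodule.zero_mem _, fun r _ => ?_⟩
      obtain ⟨φ, hφ, h0, h1⟩ := hw.exists_approx
      have h2 : nrm ((M.elem T).surf ν) (t T ν) = 0 := (ht T).nrm_eq_zero hΩ
        (M.interior_subset T) (hD.nil.symm ▸ hw.grad) hφ (hD.nil.symm ▸ h0) h1 hν hfr
      have h3 := ae_eq_zero_of_nrm ((ht T).memLp hν) h2
      refine integral_congr_ae ?_
      filter_upwards [h3] with x hx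
      rw [hx, peval_zero]; rfl
    · by_cases hex : ∃ T, ∃ ν ∈ (M.elem T).normals, (M.elem T).facet ν = e
      · obtain ⟨T, ν, hν, rfl⟩ := hex
        obtain ⟨p, hp, hpr⟩ := (M.elem T).exists_facet_proj hν k ((ht T).memLp hν)
        refine ⟨p, fun h => absurd h hfr, fun T' ν' hν' h => ⟨hp, fun r hr => ?_⟩⟩
        rw [h, hpr r hr]
        exact integral_trace_eq_of_facet_eq hD0 ht hν hν' h hfr r
      · exact ⟨0, fun _ => rfl, fun T ν hν h => absurd ⟨T, ν, hν, h⟩ hex⟩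
  choose vb hvb0 hvb using hvb
  have hint : ∀ T I, I.length ≤ m → IntegrableOn (D I) (M.elem T).carrier := fun T I hI => by
    have := (M.elem T).isFiniteMeasure_vol
    exact (((hD.word I hI).1).mono_measure (M.vol_le T)).integrable (by simp)
  have hproj : ∀ T, (M.elem T).IsProj k (D []) (M.Q0 k w T) := fun T => by
    have := (M.elem T).isProj_proj k (hint T [] (by simp))
    rwa [hD.nil] at this ⊢
  refine ⟨⟨M.Q0 k w, vb⟩, fun T i => (M.elem T).proj (j T) (D [i]), t, τ,
    ⟨⟨fun T => (hproj T).1, fun T ν hν => (hvb _ T ν hν rfl).1⟩, fun T ν hν hfr x _ => ?_⟩, rfl,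
    fun T => ⟨hproj T, fun i => (M.elem T).isProj_proj _ (hint T [i] (by simp; omega)),
      fun ν hν => (hvb _ T ν hν rfl).1, fun ν hν => (hvb _ T ν hν rfl).2,
      (M.elem T).isWeakGradient_weakGradient _ _ _, ht T, hτ T⟩⟩
  change peval (vb ((M.elem T).facet ν)) x = 0
  rw [hvb0 _ hfr, peval_zero]

end PolytopalMesh

end WG
end

noncomputable section

namespace WG

/-! ### The consistency functional and the error equation -/

namespace ConvexPolytope

variable {d : ℕ}

theorem IsWeakGradient.sub {T : ConvexPolytope d} {j : ℕ} {v₀ v₀' : Poly d}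
    {vb vb' : Set (Pt d) → Poly d} {G G' : Fin d → Poly d} (h : T.IsWeakGradient j v₀ vb G)
    (h' : T.IsWeakGradient j v₀' vb' G') :
    T.IsWeakGradient j (v₀ - v₀') (fun e => vb e - vb' e) fun i => G i - G' i := by
  refine ⟨fun i => Submodule.sub_mem _ (h.1 i) (h'.1 i), fun q hq => ?_⟩
  have i1 : ∀ G : Fin d → Poly d,
      Integrable (fun x => ∑ i, peval (G i) x * peval (q i) x) T.vol := fun G =>
    integrable_finsetSum _ fun i _ => peval_integrableOn T _ _
  have i2 : ∀ ν ∈ T.normals, ∀ p : Poly d,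
      Integrable (fun x => peval p x * ∑ i, peval (q i) x * ν i) (T.surf ν) := fun ν hν p =>
    integrable_mul_of_memLp (T.memLp_surf hν (peval_continuous p)) (T.memLp_surf hν
      (continuous_finsetSum _ fun i _ => (peval_continuous (q i)).mul continuous_const))
  have e1 : ∀ ν ∈ T.normals, ∫ x in T.facet ν, (peval (vb (T.facet ν)) x -
      peval (vb' (T.facet ν)) x) * ∑ i, peval (q i) x * ν i ∂μHE[d - 1] =
      (∫ x in T.facet ν, peval (vb (T.facet ν)) x * ∑ i, peval (q i) x * ν i ∂μHE[d - 1]) -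
        ∫ x in T.facet ν, peval (vb' (T.facet ν)) x * ∑ i, peval (q i) x * ν i ∂μHE[d - 1] :=
    fun ν hν => by
      simp only [sub_mul]
      exact integral_sub (i2 ν hν _) (i2 ν hν _)
  simp only [peval_sub, sub_mul (peval (G _) _), sub_mul (peval v₀ _), Finset.sum_sub_distrib]
  rw [integral_sub (i1 G) (i1 G'), integral_sub (peval_integrableOn T _ _)
    (peval_integrableOn T _ _), h.2 q hq, h'.2 q hq, Finset.sum_congr rfl e1,
    Finset.sum_sub_distrib]
  ring

/-- The consistency error `⟨(∇w - q)·n, v₀ - v_b⟩_{∂T}`, where `τ i` is the trace of `∂_i w`. -/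
def consistency (T : ConvexPolytope d) (q : Fin d → Poly d) (τ : Fin d → Pt d → Pt d → ℝ)
    (v₀ : Poly d) (vb : Set (Pt d) → Poly d) : ℝ :=
  ∑ ν ∈ T.normals, ∑ i, ν i * ∫ x in T.facet ν, (τ i ν x - peval (q i) x) *
    (peval v₀ x - peval (vb (T.facet ν)) x) ∂μHE[d - 1]

theorem abs_consistency_le {T : ConvexPolytope d} {q : Fin d → Poly d}
    {τ : Fin d → Pt d → Pt d → ℝ} {v₀ : Poly d} {vb : Set (Pt d) → Poly d}
    (hτ : ∀ i, ∀ ν ∈ T.normals, MemLp (τ i ν) 2 (T.surf ν)) {A B : ℝ} (hB0 : 0 ≤ B)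
    (hA : ∀ ν ∈ T.normals, ∀ i,
      Real.sqrt T.diam * nrm (T.surf ν) (fun x => τ i ν x - peval (q i) x) ≤ A)
    (hB : ∀ ν ∈ T.normals, nrm (T.surf ν) (fun x => peval v₀ x - peval (vb (T.facet ν)) x) ≤
      Real.sqrt T.diam * B) :
    |T.consistency q τ v₀ vb| ≤ T.normals.card * (d * (A * B)) := by
  have h1 : ∀ ν ∈ T.normals, ∀ i, |ν i * ∫ x in T.facet ν, (τ i ν x - peval (q i) x) *
      (peval v₀ x - peval (vb (T.facet ν)) x) ∂μHE[d - 1]| ≤ A * B := fun ν hν i => by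
    have h2 := abs_integral_mul_le ((hτ i ν hν).sub (T.memLp_surf hν (peval_continuous (q i))))
      ((T.memLp_surf hν (peval_continuous v₀)).sub
        (T.memLp_surf hν (peval_continuous (vb (T.facet ν)))))
    rw [abs_mul]
    refine (mul_le_of_le_one_left (abs_nonneg _) (T.abs_normal_le_one hν i)).trans (h2.trans ?_)
    calc _ ≤ nrm (T.surf ν) (fun x => τ i ν x - peval (q i) x) * (Real.sqrt T.diam * B) :=
          mul_le_mul_of_nonneg_left (hB ν hν) nrm_nonneg
      _ = (Real.sqrt T.diam * nrm (T.surf ν) (fun x => τ i ν x - peval (q i) x)) * B := by ring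
      _ ≤ A * B := mul_le_mul_of_nonneg_right (hA ν hν i) hB0
  refine (Finset.abs_sum_le_sum_abs _ _).trans ?_
  rw [← nsmul_eq_mul]
  refine Finset.sum_le_card_nsmul _ _ _ fun ν hν => (Finset.abs_sum_le_sum_abs _ _).trans ?_
  refine (Finset.sum_le_card_nsmul _ _ _ fun i _ => h1 ν hν i).trans ?_
  simp

end ConvexPolytope

/-- The difference of two weak functions. -/
def WeakFun.sub {d N : ℕ} (v w : WeakFun d N) : WeakFun d N :=
  ⟨fun T => v.v0 T - w.v0 T, fun e => v.vb e - w.vb e⟩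

namespace PolytopalMesh

variable {d : ℕ} {Ω : Set (Pt d)} {M : PolytopalMesh Ω}

theorem MemV0.sub {k : ℕ} {v w : WeakFun d M.numElem} (hv : M.MemV0 k v) (hw : M.MemV0 k w) :
    M.MemV0 k (v.sub w) :=
  ⟨⟨fun T => Submodule.sub_mem _ (hv.1.1 T) (hw.1.1 T),
    fun T ν hν => Submodule.sub_mem _ (hv.1.2 T ν hν) (hw.1.2 T ν hν)⟩,
    fun T ν hν hfr x hx => by
      rw [WeakFun.sub, peval_sub, hv.2 T ν hν hfr x hx, hw.2 T ν hν hfr x hx, sub_zero]⟩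

theorem isWeakGradient (j : Fin M.numElem → ℕ) (v : WeakFun d M.numElem) (T : Fin M.numElem) :
    (M.elem T).IsWeakGradient (j T) (v.v0 T) v.vb (M.weakGradient j v T) :=
  (M.elem T).isWeakGradient_weakGradient _ _ _

theorem weakGradient_sub (j : Fin M.numElem → ℕ) (v w : WeakFun d M.numElem) (T : Fin M.numElem)
    (i : Fin d) :
    M.weakGradient j (v.sub w) T i = M.weakGradient j v T i - M.weakGradient j w T i :=
  congrFun ((isWeakGradient j (v.sub w) T).unique
    ((isWeakGradient j v T).sub (isWeakGradient j w T))) i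

variable (M) in
/-- The weak function `wI` interpolates on every element a function with the jet `D` on `Ω`. -/
structure IsInterpolant (m k : ℕ) (j : Fin M.numElem → ℕ) (w : Pt d → ℝ)
    (D : List (Fin d) → Pt d → ℝ) (wI : WeakFun d M.numElem) (q : Fin M.numElem → Fin d → Poly d)
    (t : Fin M.numElem → Pt d → Pt d → ℝ) (τ : Fin M.numElem → Fin d → Pt d → Pt d → ℝ) :
    Prop where
  two_le : 2 ≤ m
  jet : IsJetOn Ω m w D
  memV0 : M.MemV0 k wI
  isInterpolation : ∀ T, (M.elem T).IsInterpolation k (j T) D (wI.v0 T) wI.vb (q T)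
    (M.weakGradient j wI T) (t T) (τ T)

section

variable {m k : ℕ} {j : Fin M.numElem → ℕ} {w : Pt d → ℝ} {D : List (Fin d) → Pt d → ℝ}
  {wI : WeakFun d M.numElem} {q : Fin M.numElem → Fin d → Poly d}
  {t : Fin M.numElem → Pt d → Pt d → ℝ} {τ : Fin M.numElem → Fin d → Pt d → Pt d → ℝ}

theorem memLp_peval (T : Fin M.numElem) (p : Poly d) : MemLp (peval p) 2 (M.elem T).vol :=
  (M.elem T).memLp_vol (peval_continuous p)

theorem IsInterpolant.memLp (h : M.IsInterpolant m k j w D wI q t τ) {I : List (Fin d)}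
    (hI : I.length ≤ m) : MemLp (D I) 2 (volume.restrict Ω) := (h.jet.word I hI).1

/-- The scheme is satisfied by a smooth function up to the consistency error. -/
theorem IsInterpolant.sum_integral_laplacian (h : M.IsInterpolant m k j w D wI q t τ)
    (hkj : ∀ T, k ≤ j T) {f : Pt d → ℝ} (hf : f =ᵐ[volume.restrict Ω] fun x => -∑ i, D [i, i] x)
    {v : WeakFun d M.numElem} (hv : M.MemV0 k v) :
    ∑ T, ∫ x in (M.elem T).carrier, f x * peval (v.v0 T) x =
      (∑ T, ∑ i, ∫ x in (M.elem T).carrier,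
        peval (q T i) x * peval (M.weakGradient j v T i) x) -
        ∑ T, (M.elem T).consistency (q T) (τ T) (v.v0 T) v.vb := by
  have h2 := h.two_le
  have h1 : ∀ T, ∫ x in (M.elem T).carrier, f x * peval (v.v0 T) x =
      ∫ x in (M.elem T).carrier, (-∑ i, D [i, i] x) * peval (v.v0 T) x := fun T => by
    refine integral_congr_ae ?_
    have h3 : f =ᵐ[(M.elem T).vol] fun x => -∑ i, D [i, i] x :=
      ae_mono (M.vol_le T) hf
    filter_upwards [h3] with x hx
    rw [hx]
  have h3 : ∀ T, (M.elem T).IsJet 2 D := fun T =>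
    ⟨fun I hI => (h.jet.isJet (M.interior_subset T)).weakGrad I (by omega), h.jet.perm⟩
  rw [Finset.sum_congr rfl fun T _ => (h1 T).trans ((h.isInterpolation T).integral_laplacian (h3 T)
    (hkj T) (hv.1.1 T) (isWeakGradient j v T)), Finset.sum_sub_distrib, Finset.sum_sub_distrib]
  have h4 : ∑ T, ∑ i, ∑ ν ∈ (M.elem T).normals, ν i * ∫ x in (M.elem T).facet ν,
      τ T i ν x * peval (v.vb ((M.elem T).facet ν)) x ∂μHE[d - 1] = 0 := by
    rw [Finset.sum_comm]
    refine Finset.sum_eq_zero fun i _ => sum_integral_trace_eq_zero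
      (h.jet.hasWeakGrad (I := [i]) (by simp; omega)) (t := fun T => τ T i)
      (fun T => (h.isInterpolation T).trace_grad i) hv.2 i
  rw [h4, sub_zero]
  rfl

theorem integral_sub_mul {T : Fin M.numElem} {f g p : Pt d → ℝ} (hf : MemLp f 2 (M.elem T).vol)
    (hg : MemLp g 2 (M.elem T).vol) (hp : MemLp p 2 (M.elem T).vol) :
    ∫ x in (M.elem T).carrier, (f x - g x) * p x =
      (∫ x in (M.elem T).carrier, f x * p x) - ∫ x in (M.elem T).carrier, g x * p x := by
  simp only [sub_mul]
  exact integral_sub (integrable_mul_of_memLp hf hp) (integrable_mul_of_memLp hg hp)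

/-- The error equation. -/
theorem IsInterpolant.error_eq (h : M.IsInterpolant m k j w D wI q t τ) (hkj : ∀ T, k ≤ j T)
    {f : Pt d → ℝ} (hf : f =ᵐ[volume.restrict Ω] fun x => -∑ i, D [i, i] x)
    {uh : WeakFun d M.numElem} (huh : M.IsWGSolution k j f uh) {v : WeakFun d M.numElem}
    (hv : M.MemV0 k v) :
    ∑ T, ∑ i, ∫ x in (M.elem T).carrier,
        peval (M.weakGradient j (wI.sub uh) T i) x * peval (M.weakGradient j v T i) x =
      (∑ T, ∑ i, ∫ x in (M.elem T).carrier,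
        (peval (M.weakGradient j wI T i) x - peval (q T i) x) *
          peval (M.weakGradient j v T i) x) +
        ∑ T, (M.elem T).consistency (q T) (τ T) (v.v0 T) v.vb := by
  have h1 := huh.2 v hv
  rw [h.sum_integral_laplacian hkj hf hv] at h1
  rw [Finset.sum_congr rfl fun T _ => integral_finsetSum _ fun i _ =>
    peval_integrableOn (M.elem T) _ _] at h1
  simp only [weakGradient_sub, peval_sub, integral_sub_mul (memLp_peval _ _) (memLp_peval _ _)
    (memLp_peval _ _), Finset.sum_sub_distrib]
  rw [h1]
  ring

/-- The pairing of the interpolation error of the weak gradient of `u` with the projected gradient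
of the dual solution is of higher order: the part of lower order vanishes because the error of the
`L²` projection is orthogonal to `V_h`. -/
theorem IsInterpolant.sum_integral_dual (hΩ : IsOpen Ω) (h : M.IsInterpolant m k j w D wI q t τ)
    (hw : IsH10 Ω w fun i => D [i]) (hkj : ∀ T, k ≤ j T) {m' : ℕ} {Φ : Pt d → ℝ}
    {D' : List (Fin d) → Pt d → ℝ} {ΦI : WeakFun d M.numElem}
    {q' : Fin M.numElem → Fin d → Poly d} {t' : Fin M.numElem → Pt d → Pt d → ℝ}
    {τ' : Fin M.numElem → Fin d → Pt d → Pt d → ℝ}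
    (h' : M.IsInterpolant m' k j Φ D' ΦI q' t' τ') {p : Fin M.numElem → Poly d}
    (hp : ∀ T, p T ∈ PolyDeg d k) (hΦ : IsPoissonSolution Ω (M.piecewise p) Φ) :
    ∑ T, ∑ i, ∫ x in (M.elem T).carrier,
        (peval (M.weakGradient j wI T i) x - peval (q T i) x) * peval (q' T i) x =
      (∑ T, (M.elem T).consistency (q' T) (τ' T) (wI.v0 T) wI.vb) +
        ∑ T, ∑ i, ∫ x in (M.elem T).carrier,
          (D [i] x - peval (q T i) x) * (D' [i] x - peval (q' T i) x) := by
  have hm := h.two_le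
  have hm' := h'.two_le
  have hpw := M.memLp_piecewise p
  have hf := hΦ.ae_eq hΩ hpw hm' h'.jet
  have h1 := h'.sum_integral_laplacian hkj hf h.memV0
  have hD1 : ∀ i, MemLp (D [i]) 2 (volume.restrict Ω) := fun i => h.memLp (by simp; omega)
  have hD1' : ∀ i, MemLp (D' [i]) 2 (volume.restrict Ω) := fun i => h'.memLp (by simp; omega)
  have hDT : ∀ T i, MemLp (D [i]) 2 (M.elem T).vol := fun T i => (hD1 i).mono_measure (M.vol_le T)
  have hDT' : ∀ T i, MemLp (D' [i]) 2 (M.elem T).vol := fun T i =>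
    (hD1' i).mono_measure (M.vol_le T)
  -- the weak form of the dual problem, tested with `w`
  have h2 : ∑ T, ∑ i, ∫ x in (M.elem T).carrier, D [i] x * D' [i] x =
      ∑ T, ∫ x in (M.elem T).carrier, M.piecewise p x * w x := by
    have h3 := hΦ.weak_form hΩ (h'.jet.nil ▸ h'.jet.hasWeakGrad (I := []) (by simp; omega)) hw
    rw [M.integral_eq_sum (integrable_mul_of_memLp hpw hw.grad.memLp), Finset.sum_congr rfl
      fun i _ => M.integral_eq_sum (integrable_mul_of_memLp (hD1' i) (hD1 i)),
      Finset.sum_comm] at h3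
    rw [← h3]
    simp only [mul_comm]
  have h4 : ∀ T, ∫ x in (M.elem T).carrier, M.piecewise p x * peval (wI.v0 T) x =
      ∫ x in (M.elem T).carrier, M.piecewise p x * w x := fun T => by
    have h5 := (h.isInterpolation T).proj.2 (p T) (hp T)
    rw [h.jet.nil] at h5
    have h6 : ∀ g : Pt d → ℝ, ∫ x in (M.elem T).carrier, M.piecewise p x * g x =
        ∫ x in (M.elem T).carrier, g x * peval (p T) x := fun g => by
      refine integral_congr_ae ?_
      filter_upwards [M.piecewise_ae_eq p T] with x hx
      rw [hx, mul_comm]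
    rw [h6, h6, h5]
  rw [Finset.sum_congr rfl fun T _ => h4 T, ← h2] at h1
  have h7 : ∀ T i, ∫ x in (M.elem T).carrier,
      (D [i] x - peval (q T i) x) * (D' [i] x - peval (q' T i) x) =
      (∫ x in (M.elem T).carrier, D [i] x * D' [i] x) -
        ∫ x in (M.elem T).carrier, peval (q T i) x * peval (q' T i) x := fun T i => by
    rw [integral_sub_mul (p := fun x => D' [i] x - peval (q' T i) x) (hDT T i) (memLp_peval T _)
      ((hDT' T i).sub (memLp_peval T _))]
    simp only [mul_comm (D [i] _), mul_comm (peval (q T i) _)]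
    rw [integral_sub_mul (hDT' T i) (memLp_peval T _) (hDT T i),
      integral_sub_mul (hDT' T i) (memLp_peval T _) (memLp_peval T _),
      ← ((h'.isInterpolation T).proj_grad i).2 (q T i) ((h.isInterpolation T).proj_grad i).1]
    have h8 := ((h.isInterpolation T).proj_grad i).2 (q' T i)
      ((h'.isInterpolation T).proj_grad i).1
    simp only [mul_comm (peval (q' T i) _)]
    rw [← h8]
    ring
  simp only [h7, integral_sub_mul (memLp_peval _ _) (memLp_peval _ _) (memLp_peval _ _),
    Finset.sum_sub_distrib]
  simp only [mul_comm (peval (M.weakGradient j wI _ _) _)]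
  linarith

end

/-! ### The energy estimate and the duality estimate -/

/-- The sum of the `L²(T)` norms of the components of the weak gradient. -/
def gradNorm (M : PolytopalMesh Ω) (j : Fin M.numElem → ℕ) (v : WeakFun d M.numElem)
    (T : Fin M.numElem) : ℝ :=
  ∑ i, nrm (M.elem T).vol (peval (M.weakGradient j v T i))

theorem gradNorm_nonneg (j : Fin M.numElem → ℕ) (v : WeakFun d M.numElem) (T : Fin M.numElem) :
    0 ≤ M.gradNorm j v T := Finset.sum_nonneg fun _ _ => nrm_nonneg

/-- `e T` bounds the interpolation errors on `T`, in the scaling of the gradient. -/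
structure ErrorBound (M : PolytopalMesh Ω) (j : Fin M.numElem → ℕ) (D : List (Fin d) → Pt d → ℝ)
    (wI : WeakFun d M.numElem) (q : Fin M.numElem → Fin d → Poly d)
    (τ : Fin M.numElem → Fin d → Pt d → Pt d → ℝ) (e : Fin M.numElem → ℝ) : Prop where
  nonneg : ∀ T, 0 ≤ e T
  proj_grad : ∀ T i, nrm (M.elem T).vol (fun x => D [i] x - peval (q T i) x) ≤ e T
  trace_grad : ∀ T, ∀ ν ∈ (M.elem T).normals, ∀ i, Real.sqrt (M.elem T).diam *
    nrm ((M.elem T).surf ν) (fun x => τ T i ν x - peval (q T i) x) ≤ e T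
  jump : ∀ T, ∀ ν ∈ (M.elem T).normals, nrm ((M.elem T).surf ν) (fun x => peval (wI.v0 T) x -
    peval (wI.vb ((M.elem T).facet ν)) x) ≤ Real.sqrt (M.elem T).diam * e T
  weakGradient : ∀ T i, nrm (M.elem T).vol
    (fun x => peval (M.weakGradient j wI T i) x - peval (q T i) x) ≤ e T

/-- The jumps `v₀ - v_b` are controlled by the weak gradient, with constant `c`. -/
def JumpBound (M : PolytopalMesh Ω) (j : Fin M.numElem → ℕ) (v : WeakFun d M.numElem) (c : ℝ) :
    Prop :=
  ∀ T, ∀ ν ∈ (M.elem T).normals, nrm ((M.elem T).surf ν) (fun x => peval (v.v0 T) x -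
    peval (v.vb ((M.elem T).facet ν)) x) ≤ Real.sqrt (M.elem T).diam * (c * M.gradNorm j v T)

section

variable {k J : ℕ} {j : Fin M.numElem → ℕ} {f : Pt d → ℝ} {c : ℝ} {uh : WeakFun d M.numElem}
  {m : ℕ} {w : Pt d → ℝ} {D : List (Fin d) → Pt d → ℝ}
  {wI : WeakFun d M.numElem} {q : Fin M.numElem → Fin d → Poly d}
  {t : Fin M.numElem → Pt d → Pt d → ℝ} {τ : Fin M.numElem → Fin d → Pt d → Pt d → ℝ}
  {e : Fin M.numElem → ℝ}

theorem IsInterpolant.consistency_le (h : M.IsInterpolant m k j w D wI q t τ)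
    (hJ : ∀ T, (M.elem T).normals.card ≤ J) (he : M.ErrorBound j D wI q τ e) (T : Fin M.numElem)
    {v : WeakFun d M.numElem} {B : ℝ} (hB0 : 0 ≤ B)
    (hB : ∀ ν ∈ (M.elem T).normals, nrm ((M.elem T).surf ν) (fun x => peval (v.v0 T) x -
      peval (v.vb ((M.elem T).facet ν)) x) ≤ Real.sqrt (M.elem T).diam * B) :
    |(M.elem T).consistency (q T) (τ T) (v.v0 T) v.vb| ≤ J * d * (e T * B) := by
  refine (ConvexPolytope.abs_consistency_le
    (fun i ν hν => ((h.isInterpolation T).trace_grad i).memLp hν) hB0 (he.trace_grad T) hB).trans ?_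
  rw [mul_assoc]
  have h0 := he.nonneg T
  exact mul_le_mul_of_nonneg_right (by exact_mod_cast hJ T) (by positivity)

/-- The interpolant is superclose to the discrete solution in the energy norm. -/
theorem IsInterpolant.sum_gradNorm_sq_le (h : M.IsInterpolant m k j w D wI q t τ)
    (hkj : ∀ T, k ≤ j T) (hf : f =ᵐ[volume.restrict Ω] fun x => -∑ i, D [i, i] x)
    (huh : M.IsWGSolution k j f uh) (hJ : ∀ T, (M.elem T).normals.card ≤ J)
    (he : M.ErrorBound j D wI q τ e) (hc : 0 ≤ c) (hjump : M.JumpBound j (wI.sub uh) c) :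
    ∑ T, M.gradNorm j (wI.sub uh) T ^ 2 ≤
      d * (1 + J * d * c) * ∑ T, e T * M.gradNorm j (wI.sub uh) T := by
  set v := wI.sub uh with hv
  set N := M.gradNorm j v with hN
  have hN0 : ∀ T, 0 ≤ N T := gradNorm_nonneg j v
  have h1 := h.error_eq hkj hf huh (h.memV0.sub huh.1)
  rw [← hv] at h1
  have h2 : ∀ T, N T ^ 2 ≤ d * ∑ i, ∫ x in (M.elem T).carrier,
      peval (M.weakGradient j v T i) x * peval (M.weakGradient j v T i) x := fun T => by
    have h3 := sq_sum_le_card_mul_sum_sq (s := Finset.univ)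
      (f := fun i => nrm (M.elem T).vol (peval (M.weakGradient j v T i)))
    simp only [Finset.card_univ, Fintype.card_fin, nrm_sq, sq (peval _ _)] at h3
    exact h3
  have h4 : ∀ T, ∑ i, ∫ x in (M.elem T).carrier, (peval (M.weakGradient j wI T i) x -
      peval (q T i) x) * peval (M.weakGradient j v T i) x ≤ e T * N T := fun T => by
    rw [hN, gradNorm, Finset.mul_sum]
    refine Finset.sum_le_sum fun i _ => (integral_mul_le
      ((memLp_peval T _).sub (memLp_peval T _)) (memLp_peval T _)).trans ?_
    exact mul_le_mul_of_nonneg_right (he.weakGradient T i) nrm_nonneg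
  have h5 : ∀ T, (M.elem T).consistency (q T) (τ T) (v.v0 T) v.vb ≤
      J * d * (e T * (c * N T)) := fun T =>
    (le_abs_self _).trans (h.consistency_le hJ he T (mul_nonneg hc (hN0 T)) (hjump T))
  calc ∑ T, N T ^ 2 ≤ d * ∑ T, ∑ i, ∫ x in (M.elem T).carrier,
        peval (M.weakGradient j v T i) x * peval (M.weakGradient j v T i) x := by
        rw [Finset.mul_sum]; exact Finset.sum_le_sum fun T _ => h2 T
    _ ≤ d * (∑ T, e T * N T + ∑ T, J * d * (e T * (c * N T))) := by
        rw [h1]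
        refine mul_le_mul_of_nonneg_left (add_le_add (Finset.sum_le_sum fun T _ => h4 T)
          (Finset.sum_le_sum fun T _ => h5 T)) (by positivity)
    _ = _ := by
        rw [← Finset.sum_add_distrib, Finset.mul_sum, Finset.mul_sum]
        exact Finset.sum_congr rfl fun T _ => by ring

/-- The duality argument. The square of the `L²` norm is the pairing of the dual equation with the
error; by the error equation it is a sum of products of interpolation errors of `w` or the energy
error with interpolation errors of `Φ`, and of consistency terms of the same kind. -/
theorem IsInterpolant.nrm_sq_le (hΩ : IsOpen Ω) (h : M.IsInterpolant m k j w D wI q t τ)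
    (hw : IsH10 Ω w fun i => D [i])
    (hkj : ∀ T, k ≤ j T) (hf : f =ᵐ[volume.restrict Ω] fun x => -∑ i, D [i, i] x)
    (huh : M.IsWGSolution k j f uh) (hJ : ∀ T, (M.elem T).normals.card ≤ J)
    (he : M.ErrorBound j D wI q τ e) (hc : 0 ≤ c) (hjump : M.JumpBound j (wI.sub uh) c)
    {m' : ℕ} {Φ : Pt d → ℝ}
    {D' : List (Fin d) → Pt d → ℝ} {ΦI : WeakFun d M.numElem}
    {q' : Fin M.numElem → Fin d → Poly d} {t' : Fin M.numElem → Pt d → Pt d → ℝ}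
    {τ' : Fin M.numElem → Fin d → Pt d → Pt d → ℝ} {e' : Fin M.numElem → ℝ}
    (h' : M.IsInterpolant m' k j Φ D' ΦI q' t' τ') (he' : M.ErrorBound j D' ΦI q' τ' e')
    (hΦ : IsPoissonSolution Ω (M.piecewise (wI.sub uh).v0) Φ) :
    nrm (volume.restrict Ω) (M.piecewise (wI.sub uh).v0) ^ 2 ≤
      ∑ T, ((2 * d + 2 * (J * d)) * e T + (1 + J * d * c) * M.gradNorm j (wI.sub uh) T) * e' T := by
  set v := wI.sub uh with hv
  set N := M.gradNorm j v with hN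
  have hN0 : ∀ T, 0 ≤ N T := gradNorm_nonneg j v
  have hvV : M.MemV0 k v := h.memV0.sub huh.1
  have hpw := M.memLp_piecewise v.v0
  have hD1 : ∀ T i, MemLp (D [i]) 2 (M.elem T).vol := fun T i =>
    (h.memLp (by have := h.two_le; simp; omega)).mono_measure (M.vol_le T)
  have hD1' : ∀ T i, MemLp (D' [i]) 2 (M.elem T).vol := fun T i =>
    (h'.memLp (by have := h'.two_le; simp; omega)).mono_measure (M.vol_le T)
  have e1 := h'.sum_integral_laplacian hkj (hΦ.ae_eq hΩ hpw h'.two_le h'.jet) hvV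
  have e2 := h.error_eq hkj hf huh h'.memV0
  have e3 := h.sum_integral_dual hΩ hw hkj h' hvV.1.1 hΦ
  rw [← hv] at e2
  have e0 : nrm (volume.restrict Ω) (M.piecewise v.v0) ^ 2 =
      ∑ T, ∫ x in (M.elem T).carrier, M.piecewise v.v0 x * peval (v.v0 T) x := by
    rw [M.nrm_sq_eq_sum hpw]
    refine Finset.sum_congr rfl fun T _ => ?_
    rw [nrm_sq]
    refine integral_congr_ae ?_
    filter_upwards [M.piecewise_ae_eq v.v0 T] with x hx
    rw [hx, sq]
  have e4 : ∀ T i, ∫ x in (M.elem T).carrier, (peval (M.weakGradient j ΦI T i) x -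
      peval (q' T i) x) * peval (M.weakGradient j v T i) x =
      (∫ x in (M.elem T).carrier, peval (M.weakGradient j v T i) x *
        peval (M.weakGradient j ΦI T i) x) -
      ∫ x in (M.elem T).carrier, peval (q' T i) x * peval (M.weakGradient j v T i) x :=
    fun T i => by
      rw [integral_sub_mul (memLp_peval T _) (memLp_peval T _) (memLp_peval T _)]
      simp only [mul_comm]
  have e5 : ∀ T i, ∫ x in (M.elem T).carrier, (peval (M.weakGradient j ΦI T i) x -
      peval (q' T i) x) * (peval (M.weakGradient j wI T i) x - peval (q T i) x) =
      (∫ x in (M.elem T).carrier, (peval (M.weakGradient j wI T i) x - peval (q T i) x) *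
        peval (M.weakGradient j ΦI T i) x) -
      ∫ x in (M.elem T).carrier, (peval (M.weakGradient j wI T i) x - peval (q T i) x) *
        peval (q' T i) x :=
    fun T i => by
      rw [integral_sub_mul (memLp_peval T _) (memLp_peval T _)
        (p := fun x => peval (M.weakGradient j wI T i) x - peval (q T i) x)
        ((memLp_peval T _).sub (memLp_peval T _))]
      simp only [mul_comm]
  have f1 := Finset.sum_congr (rfl : Finset.univ = Finset.univ) fun T _ =>
    Finset.sum_congr (rfl : Finset.univ = Finset.univ) fun i _ => e4 T i
  have f2 := Finset.sum_congr (rfl : Finset.univ = Finset.univ) fun T _ =>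
    Finset.sum_congr (rfl : Finset.univ = Finset.univ) fun i _ => e5 T i
  simp only [Finset.sum_sub_distrib] at f1 f2
  set s1 := fun T => ∑ i, ∫ x in (M.elem T).carrier, (peval (M.weakGradient j ΦI T i) x -
      peval (q' T i) x) * peval (M.weakGradient j v T i) x with hs1
  set s2 := fun T => ∑ i, ∫ x in (M.elem T).carrier, (peval (M.weakGradient j ΦI T i) x -
      peval (q' T i) x) * (peval (M.weakGradient j wI T i) x - peval (q T i) x) with hs2
  set s3 := fun T => ∑ i, ∫ x in (M.elem T).carrier,
      (D [i] x - peval (q T i) x) * (D' [i] x - peval (q' T i) x) with hs3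
  set l1 := fun T => (M.elem T).consistency (q T) (τ T) (ΦI.v0 T) ΦI.vb with hl1
  set l2 := fun T => (M.elem T).consistency (q' T) (τ' T) (wI.v0 T) wI.vb with hl2
  set l3 := fun T => (M.elem T).consistency (q' T) (τ' T) (v.v0 T) v.vb with hl3
  have key : nrm (volume.restrict Ω) (M.piecewise v.v0) ^ 2 =
      ∑ T, (-s1 T + s2 T + s3 T + l1 T + l2 T - l3 T) := by
    simp only [Finset.sum_add_distrib, Finset.sum_sub_distrib, Finset.sum_neg_distrib]
    linarith
  rw [key]
  refine Finset.sum_le_sum fun T _ => ?_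
  have he0 := he.nonneg T
  have he0' := he'.nonneg T
  have b1 : |s1 T| ≤ e' T * N T := by
    rw [hN, gradNorm, Finset.mul_sum]
    refine (Finset.abs_sum_le_sum_abs _ _).trans (Finset.sum_le_sum fun i _ =>
      (abs_integral_mul_le ((memLp_peval T _).sub (memLp_peval T _)) (memLp_peval T _)).trans ?_)
    exact mul_le_mul_of_nonneg_right (he'.weakGradient T i) nrm_nonneg
  have b2 : |s2 T| ≤ d * (e' T * e T) := by
    refine (Finset.abs_sum_le_sum_abs _ _).trans ((Finset.sum_le_card_nsmul _ _ _ fun i _ =>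
      (abs_integral_mul_le ((memLp_peval T _).sub (memLp_peval T _))
        ((memLp_peval T _).sub (memLp_peval T _))).trans (mul_le_mul (he'.weakGradient T i)
          (he.weakGradient T i) nrm_nonneg he0')).trans (le_of_eq ?_))
    simp
  have b3 : |s3 T| ≤ d * (e T * e' T) := by
    refine (Finset.abs_sum_le_sum_abs _ _).trans ((Finset.sum_le_card_nsmul _ _ _ fun i _ =>
      (abs_integral_mul_le ((hD1 T i).sub (memLp_peval T _))
        ((hD1' T i).sub (memLp_peval T _))).trans (mul_le_mul (he.proj_grad T i)
          (he'.proj_grad T i) nrm_nonneg he0)).trans (le_of_eq ?_))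
    simp
  have b4 : |l1 T| ≤ J * d * (e T * e' T) := h.consistency_le hJ he T he0' (he'.jump T)
  have b5 : |l2 T| ≤ J * d * (e' T * e T) := h'.consistency_le hJ he' T he0 (he.jump T)
  have b6 : |l3 T| ≤ J * d * (e' T * (c * N T)) :=
    h'.consistency_le hJ he' T (mul_nonneg hc (hN0 T)) (hjump T)
  calc -s1 T + s2 T + s3 T + l1 T + l2 T - l3 T
      ≤ |s1 T| + |s2 T| + |s3 T| + |l1 T| + |l2 T| + |l3 T| := by
        linarith [neg_abs_le (s1 T), le_abs_self (s2 T), le_abs_self (s3 T), le_abs_self (l1 T),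
          le_abs_self (l2 T), neg_abs_le (l3 T)]
    _ ≤ _ := by linarith

end

/-- Summation of the local bounds by the Cauchy–Schwarz inequality. -/
theorem sqrt_sum_sq_le (hΩ : IsOpen Ω) {m l r : ℕ} {u : Pt d → ℝ} {D : List (Fin d) → Pt d → ℝ}
    (hD : IsJetOn Ω m u D) (hl : l ≤ m) {C : ℝ} (hC : 0 ≤ C) :
    Real.sqrt (∑ T, (C * (M.elem T).diam ^ r * Real.sqrt ((M.elem T).jetSum D l)) ^ 2) ≤
      C * M.meshSize ^ r * sobolevSeminorm Ω l u := by
  have h0 : 0 ≤ sobolevSeminorm Ω l u := Real.sqrt_nonneg _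
  have h1 := M.meshSize_nonneg
  refine Real.sqrt_le_iff.2 ⟨by positivity, ?_⟩
  rw [mul_pow, ← sum_jetSum hΩ hD hl, Finset.mul_sum]
  refine Finset.sum_le_sum fun T _ => ?_
  rw [mul_pow, Real.sq_sqrt (ConvexPolytope.jetSum_nonneg _ _)]
  refine mul_le_mul_of_nonneg_right (pow_le_pow_left₀ ?_ ?_ 2) (ConvexPolytope.jetSum_nonneg _ _)
  · exact mul_nonneg hC (pow_nonneg (M.elem T).diam_nonneg r)
  · exact mul_le_mul_of_nonneg_left
      (pow_le_pow_left₀ (M.elem T).diam_nonneg (M.diam_le_meshSize T) r) hC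

theorem errorBound_of_interpolationBounds {j : Fin M.numElem → ℕ} {m : ℕ}
    {D : List (Fin d) → Pt d → ℝ} {wI : WeakFun d M.numElem} {q : Fin M.numElem → Fin d → Poly d}
    {τ : Fin M.numElem → Fin d → Pt d → Pt d → ℝ} {C : ℝ} (hC : 0 ≤ C)
    (h : ∀ T, (M.elem T).InterpolationBounds C m D (wI.v0 T) wI.vb (q T) (M.weakGradient j wI T)
      (τ T)) :
    M.ErrorBound j D wI q τ fun T =>
      C * (M.elem T).diam ^ (m + 1) * Real.sqrt ((M.elem T).jetSum D (m + 2)) :=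
  ⟨fun T => mul_nonneg (mul_nonneg hC (pow_nonneg (M.elem T).diam_nonneg _)) (Real.sqrt_nonneg _),
    fun T => (h T).proj_grad, fun T => (h T).trace_grad, fun T => (h T).jump,
    fun T => (h T).weakGradient⟩

theorem piecewise_sub (p q : Fin M.numElem → Poly d) (x : Pt d) :
    M.piecewise (fun T => p T - q T) x = M.piecewise p x - M.piecewise q x := by
  simp only [piecewise]
  rw [← Finset.sum_sub_distrib]
  refine Finset.sum_congr rfl fun T _ => ?_
  by_cases hx : x ∈ interior (M.elem T).carrier
  · simp only [Set.indicator_of_mem hx, peval_sub]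
  · simp only [Set.indicator_of_notMem hx, sub_zero]

theorem nrm_sub_piecewise_le {u : Pt d → ℝ} (hu : MemLp u 2 (volume.restrict Ω))
    {p : Fin M.numElem → Poly d} {e : Fin M.numElem → ℝ}
    (h : ∀ T, nrm (M.elem T).vol (fun x => u x - peval (p T) x) ≤ e T) :
    nrm (volume.restrict Ω) (fun x => u x - M.piecewise p x) ≤ Real.sqrt (∑ T, e T ^ 2) := by
  refine Real.le_sqrt_of_sq_le ?_
  have h1 : MemLp (fun x => u x - M.piecewise p x) 2 (volume.restrict Ω) :=
    hu.sub (M.memLp_piecewise p)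
  rw [M.nrm_sq_eq_sum h1]
  refine Finset.sum_le_sum fun T _ => pow_le_pow_left₀ nrm_nonneg (le_trans (le_of_eq ?_) (h T)) 2
  refine nrm_congr ?_
  filter_upwards [M.piecewise_ae_eq p T] with x hx
  rw [hx]

/-- Absorbing the energy estimate into the duality estimate. -/
theorem _root_.WG.sq_le_of_energy_of_duality {ι : Type*} {s : Finset ι} {a b n : ι → ℝ}
    {α β κ E : ℝ} (hα : 0 ≤ α) (hβ : 0 ≤ β) (hκ : 0 ≤ κ)
    (hen : ∑ i ∈ s, n i ^ 2 ≤ κ * ∑ i ∈ s, a i * n i)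
    (hdu : E ^ 2 ≤ ∑ i ∈ s, (α * a i + β * n i) * b i) :
    E ^ 2 ≤ (α + β * κ) * (Real.sqrt (∑ i ∈ s, a i ^ 2) * Real.sqrt (∑ i ∈ s, b i ^ 2)) := by
  set A := Real.sqrt (∑ i ∈ s, a i ^ 2)
  set B := Real.sqrt (∑ i ∈ s, b i ^ 2)
  set N := Real.sqrt (∑ i ∈ s, n i ^ 2) with hN
  have hA0 : 0 ≤ A := Real.sqrt_nonneg _
  have hB0 : 0 ≤ B := Real.sqrt_nonneg _
  have hN0 : 0 ≤ N := Real.sqrt_nonneg _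
  have hN2 : N ^ 2 = ∑ i ∈ s, n i ^ 2 := Real.sq_sqrt (Finset.sum_nonneg fun _ _ => sq_nonneg _)
  have h1 : N ^ 2 ≤ κ * (A * N) := by
    rw [hN2]
    exact hen.trans (mul_le_mul_of_nonneg_left (Real.sum_mul_le_sqrt_mul_sqrt s a n) hκ)
  have h2 : N ≤ κ * A := by
    rcases hN0.eq_or_lt with h | h
    · rw [← h]; positivity
    · refine le_of_mul_le_mul_right ?_ h
      linarith
  calc E ^ 2 ≤ α * ∑ i ∈ s, a i * b i + β * ∑ i ∈ s, n i * b i := by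
        refine hdu.trans (le_of_eq ?_)
        rw [Finset.mul_sum, Finset.mul_sum, ← Finset.sum_add_distrib]
        exact Finset.sum_congr rfl fun i _ => by ring
    _ ≤ α * (A * B) + β * (N * B) := add_le_add
        (mul_le_mul_of_nonneg_left (Real.sum_mul_le_sqrt_mul_sqrt s a b) hα)
        (mul_le_mul_of_nonneg_left (Real.sum_mul_le_sqrt_mul_sqrt s n b) hβ)
    _ ≤ α * (A * B) + β * (κ * A * B) := by gcongr
    _ = _ := by ring

end PolytopalMesh

end WG
end

theorem theorem5p1 (d : ℕ) (hd : 2 ≤ d) (k : ℕ) (hk : 1 ≤ k) (J : ℕ)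
    (ρ : ℝ) (hρ : 0 < ρ) (Creg : ℝ) :
    ∃ C : ℝ, 0 < C ∧
      ∀ (Ω : Set (WG.Pt d)), IsOpen Ω →
      ∀ (M : WG.PolytopalMesh Ω), M.ShapeRegular ρ →
      ∀ (j : Fin M.numElem → ℕ),
        (∀ T, (M.elem T).numFacets + k - 1 ≤ j T ∧ j T ≤ J) →
      ∀ (f u : WG.Pt d → ℝ), MemLp f 2 (volume.restrict Ω) →
        WG.IsPoissonSolution Ω f u → WG.MemSobolev Ω (k + 1) u →
      ∀ (uh : WG.WeakFun d M.numElem), M.IsWGSolution k j f uh →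
        WG.H2Regularity Ω (M.piecewise (fun T => M.Q0 k u T - uh.v0 T)) Creg →
        WG.l2Norm Ω (fun x => u x - M.piecewise uh.v0 x) ≤
          C * M.meshSize ^ (k + 1) * WG.sobolevSeminorm Ω (k + 1) u := by
  have hd0 : 0 < d := by omega
  obtain ⟨n, rfl⟩ : ∃ n, k = n + 1 := ⟨k - 1, by omega⟩
  obtain ⟨c₁, hc₁, H₁⟩ :=
    WG.ConvexPolytope.exists_interpolationBounds d n (n + 1) J le_rfl hρ
  obtain ⟨c₂, hc₂, H₂⟩ :=
    WG.ConvexPolytope.exists_interpolationBounds d 0 (n + 1) J (by omega) hρ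
  obtain ⟨c, hc, H₃⟩ := WG.ConvexPolytope.exists_jump_bound d hk J hρ
  -- the constants of the duality estimate and of the energy estimate
  set α : ℝ := 2 * d + 2 * (J * d) with hα
  set β : ℝ := 1 + J * d * c with hβ
  set κ : ℝ := d * (1 + J * d * c) with hκ
  have hα0 : 0 ≤ α := by positivity
  have hβ0 : 0 ≤ β := by positivity
  have hκ0 : 0 ≤ κ := by positivity
  set K : ℝ := α + β * κ with hK
  have hK0 : 0 ≤ K := by positivity
  refine ⟨c₁ + K * c₁ * c₂ * |Creg|, by positivity, ?_⟩
  intro Ω hΩ M hM j hj f u hf hu huk uh huh hreg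
  have hR := hM.regular hd0
  have hcard : ∀ T, 1 ≤ (M.elem T).normals.card := fun T =>
    Finset.card_pos.2 ((M.elem T).normals_nonempty hd0)
  have hcJ : ∀ T, (M.elem T).normals.card ≤ J := fun T => by
    have h := hj T
    simp only [WG.ConvexPolytope.numFacets] at h
    omega
  have hkj : ∀ T, n + 1 ≤ j T := fun T => by
    have h := hj T
    have h' := hcard T
    simp only [WG.ConvexPolytope.numFacets] at h
    omega
  -- the interpolant of `u`
  obtain ⟨D, hD⟩ := huk.exists_jet
  have hG : WG.HasWeakGrad Ω u fun i => D [i] :=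
    hD.nil ▸ hD.hasWeakGrad (I := []) (by simp)
  have hu0 := hu.1.isH10 hΩ hG
  obtain ⟨uI, q, t, τ, huI, huI0, hI⟩ := M.exists_interpolant (by omega) hΩ hD hu0 (n + 1) j
  have hU : M.IsInterpolant (n + 1 + 1) (n + 1) j u D uI q t τ := ⟨by omega, hD, huI, hI⟩
  have hfD := hu.ae_eq hΩ hf (by omega : 2 ≤ n + 1 + 1) hD
  have hB := fun T => H₁ (M.elem T) (hR T) (hcJ T) (j T) (hkj T) (hj T).2 D
    (hD.isJet (M.interior_subset T)) _ _ _ _ _ _ (hI T)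
  have he := WG.PolytopalMesh.errorBound_of_interpolationBounds hc₁.le hB
  -- the interpolant of the dual solution
  have hpw : M.piecewise (fun T => M.Q0 (n + 1) u T - uh.v0 T) =
      M.piecewise (uI.sub uh).v0 := by rw [WG.WeakFun.sub, huI0]
  rw [hpw] at hreg
  obtain ⟨R, hΩR⟩ := M.isCompact_closure.isBounded.exists_norm_le
  obtain ⟨Φ, hΦ⟩ := WG.exists_isPoissonSolution hΩ ⟨0, hd0⟩ (fun x hx => hΩR x (subset_closure hx))
    (M.memLp_piecewise (uI.sub uh).v0)
  obtain ⟨hΦ2, hΦreg⟩ := hreg Φ hΦ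
  obtain ⟨D', hD'⟩ := hΦ2.exists_jet
  have hG' : WG.HasWeakGrad Ω Φ fun i => D' [i] :=
    hD'.nil ▸ hD'.hasWeakGrad (I := []) (by simp)
  obtain ⟨ΦI, q', t', τ', hΦI, -, hI'⟩ :=
    M.exists_interpolant le_rfl hΩ hD' (hΦ.1.isH10 hΩ hG') (n + 1) j
  have hV : M.IsInterpolant 2 (n + 1) j Φ D' ΦI q' t' τ' := ⟨le_rfl, hD', hΦI, hI'⟩
  have hB' := fun T => H₂ (M.elem T) (hR T) (hcJ T) (j T) (hkj T) (hj T).2 D'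
    (hD'.isJet (M.interior_subset T)) _ _ _ _ _ _ (hI' T)
  have he' := WG.PolytopalMesh.errorBound_of_interpolationBounds hc₂.le hB'
  have hjump : M.JumpBound j (uI.sub uh) c := fun T ν hν => by
    have hv := huI.sub huh.1
    have h := H₃ (M.elem T) (hR T) (j T) (hj T).1 (hj T).2 _ (hv.1.1 T) _ (hv.1.2 T) _
      (WG.PolytopalMesh.isWeakGradient j (uI.sub uh) T) ν hν
    rw [mul_comm c, mul_assoc] at h
    exact h
  have hen := hU.sum_gradNorm_sq_le hkj hfD huh hcJ he hc.le hjump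
  have hdu := hU.nrm_sq_le hΩ hu0 hkj hfD huh hcJ he hc.le hjump hV he' hΦ
  have hE := WG.sq_le_of_energy_of_duality hα0 hβ0 hκ0 hen hdu
  have hA := M.sqrt_sum_sq_le (r := n + 1) hΩ hD le_rfl hc₁.le
  have hA' := M.sqrt_sum_sq_le (r := 0 + 1) hΩ hD' le_rfl hc₂.le
  have hP := M.sqrt_sum_sq_le (r := n + 2) hΩ hD le_rfl hc₁.le
  have hQ := WG.PolytopalMesh.nrm_sub_piecewise_le hG.memLp fun T => hD.nil ▸ (hB T).proj
  set E := WG.nrm (volume.restrict Ω) (M.piecewise (uI.sub uh).v0) with hEdef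
  have hE0 : 0 ≤ E := WG.nrm_nonneg
  set H := M.meshSize with hH
  have hH0 : 0 ≤ H := M.meshSize_nonneg
  set S := WG.sobolevSeminorm Ω (n + 1 + 1) u with hS
  have hS0 : 0 ≤ S := Real.sqrt_nonneg _
  have hS' : WG.sobolevSeminorm Ω 2 Φ ≤ |Creg| * E :=
    (WG.sobolevSeminorm_le_sobolevNorm Ω le_rfl Φ).trans
      (hΦreg.trans (mul_le_mul_of_nonneg_right (le_abs_self _) hE0))
  have hE1 : E ^ 2 ≤ K * ((c₁ * H ^ (n + 1) * S) * (c₂ * H ^ (0 + 1) * (|Creg| * E))) := by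
    refine hE.trans (mul_le_mul_of_nonneg_left (mul_le_mul hA (hA'.trans ?_)
      (Real.sqrt_nonneg _) (by positivity)) hK0)
    exact mul_le_mul_of_nonneg_left hS' (by positivity)
  have hE2 : E ≤ K * c₁ * c₂ * |Creg| * H ^ (n + 1 + 1) * S := by
    rcases hE0.eq_or_lt with h | h
    · rw [← h]; positivity
    · refine le_of_mul_le_mul_right ?_ h
      calc E * E = E ^ 2 := (sq E).symm
        _ ≤ _ := hE1
        _ = _ := by ring
  have hsplit : (fun x => u x - M.piecewise uh.v0 x) = fun x =>
      (u x - M.piecewise uI.v0 x) + M.piecewise (uI.sub uh).v0 x := by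
    funext x
    rw [WG.WeakFun.sub, WG.PolytopalMesh.piecewise_sub]
    ring
  change WG.nrm (volume.restrict Ω) (fun x => u x - M.piecewise uh.v0 x) ≤ _
  rw [hsplit]
  calc _ ≤ WG.nrm (volume.restrict Ω) (fun x => u x - M.piecewise uI.v0 x) + E :=
        WG.nrm_add_le (hG.memLp.sub (M.memLp_piecewise _)) (M.memLp_piecewise _)
    _ ≤ c₁ * H ^ (n + 2) * S + K * c₁ * c₂ * |Creg| * H ^ (n + 1 + 1) * S :=
        add_le_add (hQ.trans hP) hE2
    _ = _ := by ring
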